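/- **Setting.** Let $M$ be a smooth Hausdorff $n$-manifold, $n\ge 1$. A *scaled bounded geometry structure* on $M$ is a countable family $\{(U_\alpha,\phi_\alpha,\rho_\alpha)\}_{\alpha}$ with $U_\alpha\subset M$ open, $\phi_\alpha\colon U_\alpha\to(-2,2)^n$ a diffeomorphism and $\rho_\alpha=(\rho_{\alpha,1},\dots,\rho_{\alpha,n})\in(0,1]^n$, such that: for some $A\in\mathbb N$ any $A+1$ distinct $U_\alpha$ have empty intersection; the sets $\phi_\alpha^{-1}((-1,1)^n)$ cover $M$; the transition functions $\tau_{\beta\alpha}=\phi_\beta\circ\phi_\alpha^{-1}$ on $\phi_\alpha(U_\alpha\cap U_\beta)$ are bounded with all derivatives, uniformly in $\alpha,\beta$; and $|\partial^\gamma(\rho_{\alpha,i}\,\partial_i\tau_{\beta\alpha}^j)|\le C_\gamma\,\rho_{\beta,j}$ on $\phi_\alpha(U_\alpha\cap U_\beta)$ for all $\alpha,\beta,i,j,\gamma$. Fix such a structure. $\mathcal C^\infty_{\rm uni}(M)$ and $\mathcal W$ denote the smooth functions, resp. vector fields, on $M$ whose expressions, resp. coefficients, in the charts $\phi_\alpha$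 are bounded with all derivatives on $(-2,2)^n$, uniformly in $\alpha$. A *weight* is a positive $w\in\mathcal C^\infty(M)$ with $\frac{Ww}{w}\in\mathcal C^\infty_{\rm uni}(M)$ for all $W\in\mathcal W$. Let $U'_\alpha=\phi_\alpha^{-1}((-\frac32,\frac32)^n)$ and $w_\alpha=\sup_{U'_\alpha}w$. Fix a weight $\rho$ for which $\rho$ and $\max_i\rho_{\alpha,i}$ are comparable on $U'_\alpha$, uniformly in $\alpha$ (a *scaling weight*). *Symbols.* For $a\colon T^*M\to\mathbb C$ let $((\phi_\alpha)_*a)(x,\xi)=a\bigl(\sum_i\xi_i\frac{dx^i_\alpha}{\rho_{\alpha,i}}\bigr|_{\phi_\alpha^{-1}(x)}\bigr)$, where $x_\alpha^i=\phi_\alpha^i$. $S^m({}^{\mathcal V}T^*M)$ is the set of smooth $a$ with $|\partial_x^\beta\partial_\xi^\gamma(\phi_\alpha)_*a(x,\xi)|\le C_{\beta\gamma}\langle\xi\rangle^{m-|\gamma|}$ for all $x\in(-2,2)^n$, $\xi\in\mathbb R^n$, uniformly in $\alpha$; and $wS^m({}^{\mathcal V}T^*M)=\{wa\colon a\in S^m({}^{\mathcal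 V}T^*M)\}$. *Sobolev spaces.* Fix $\chi\in\mathcal C_c^\infty((-2,2)^n)$ with $\chi=1$ on $[-1,1]^n$ and put $S_\alpha(x)=(x^i/\rho_{\alpha,i})_i$. For $s\in\mathbb R$ and a weight $w$, $wH^s_{\mathcal V}(M)$ is the space of distributions $u$ on $M$ with $(S_\alpha)_*(\phi_\alpha)_*((\phi_\alpha^*\chi)u)\in H^s(\mathbb R^n)$ for all $\alpha$ and $$\|u\|^2_{wH_{\mathcal V}^s}=\sum_\alpha\bigl\|w_\alpha^{-1}(S_\alpha)_*(\phi_\alpha)_*((\phi_\alpha^*\chi)u)\bigr\|^2_{H^s(\mathbb R^n)}<\infty.$$ For $k\in\mathbb N_0$, $wH^{(s;k)}_{\mathcal V;\mathcal W}(M)$ is the space of $u$ with $W_1\cdots W_ju\in wH^s_{\mathcal V}(M)$ for all $0\le j\le k$ and $W_1,\dots,W_j\in\mathcal W$, with norm given by $\|u\|^2=\sum_{j\le k}\sum_{W_1,\dots,W_j\in\mathscr W}\|W_1\cdots W_ju\|^2_{wH^s_{\mathcal V}}$ for a fixed finite set $\mathscr W\subset\mathcal W$ spanning $\mathcal W$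 over $\mathcal C^\infty_{\rm uni}(M)$. *Quantization.* Fix $\psi\in\mathcal C_c^\infty((-\frac14,\frac14)^n)$ with $\psi=1$ near $0$, and $0\le\tilde\chi\in\mathcal C^\infty_c((-\frac54,\frac54)^n)$ with $\tilde\chi=1$ on $[-1,1]^n$; put $\chi_\alpha=\phi_\alpha^*\tilde\chi/\sum_\beta\phi_\beta^*\tilde\chi$. For $a\in wS^m({}^{\mathcal V}T^*M)$ and $u\in\mathcal C^\infty(M)$ set $(\mathrm{Op}_{\mathcal V}(a)u)(p)=\sum_{\alpha\colon p\in U_\alpha}\bigl(\mathrm{Op}_\alpha((\phi_\alpha)_*(\chi_\alpha a))(u\circ\phi_\alpha^{-1})\bigr)(\phi_\alpha(p))$, where $$(\mathrm{Op}_\alpha(b)v)(x)=(2\pi)^{-n}\int_{\mathbb R^n}\int_{\mathbb R^n}e^{i\sum_j(x^j-x'^j)\xi_j/\rho_{\alpha,j}}\,\psi(x-x')\,b(x,\xi)\,v(x')\,\frac{dx'}{\rho_{\alpha,1}\cdots\rho_{\alpha,n}}\,d\xi .$$ *$\mathcal V$-ps.d.o.s.* Fix a measure $\mu$ on $M$ which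 in the chart $\phi_\alpha$ is $d_\alpha(x)\frac{dx^1\cdots dx^n}{\rho_{\alpha,1}\cdots\rho_{\alpha,n}}$ with $d_\alpha$ uniformly (in $\alpha$) bounded with all derivatives and uniformly bounded below by a positive constant. For a weight $w$, $w\rho^\infty\Psi_{\mathcal V}^{-\infty}(M)$ is the space of linear operators $R$ on $\mathcal C_c^\infty(M)$ such that $R$ and its formal $L^2(M;\mu)$-adjoint are bounded as maps $w'\rho^{-N}H^{(-N;k)}_{\mathcal V;\mathcal W}(M)\to ww'\rho^NH^{(N;k)}_{\mathcal V;\mathcal W}(M)$ for all weights $w'$, all $N\in\mathbb R$ and all $k\in\mathbb N_0$. Finally, $w\Psi^m_{\mathcal V}(M)=\{\mathrm{Op}_{\mathcal V}(a)+R\colon a\in wS^m({}^{\mathcal V}T^*M),\ R\in w\rho^\infty\Psi_{\mathcal V}^{-\infty}(M)\}$, as operators on $\mathcal C_c^\infty(M)$. **Statement.** Let $w$ be a weight and $m\in\mathbb R$. 1. Let $A\in w\Psi^m_{\mathcal V}(M)$. For every weight $w'$ and every $s\in\mathbb R$, $A$ defines a bounded linear map $w'H^s_{\mathcal V}(M)\to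 ww'H^{s-m}_{\mathcal V}(M)$; that is, $A\colon\mathcal C_c^\infty(M)\to\mathcal C_c^\infty(M)$ has a unique bounded linear extension to a map between these spaces. For every $k\in\mathbb N_0$ this extension restricts to a bounded linear map $w'H^{(s;k)}_{\mathcal V;\mathcal W}(M)\to ww'H^{(s-m;k)}_{\mathcal V;\mathcal W}(M)$. 2. Let $a\in wS^m({}^{\mathcal V}T^*M)$. Then $\mathrm{Op}_{\mathcal V}(a)$ maps $\mathcal C^\infty(M)$ to itself and $\mathcal C_c^\infty(M)$ linearly to itself. For every weight $w'$ and every $s\in\mathbb R$, $\mathrm{Op}_{\mathcal V}(a)$ defines (in the same sense) a bounded linear map $w'H^s_{\mathcal V}(M)\to ww'H^{s-m}_{\mathcal V}(M)$, which on $\mathcal C^\infty(M)\cap w'H^s_{\mathcal V}(M)$ is given by the formula above, and for every $k\in\mathbb N_0$ it restricts to a bounded linear map $w'H^{(s;k)}_{\mathcal V;\mathcal W}(M)\to ww'H^{(s-m;k)}_{\mathcal V;\mathcal W}(M)$. -/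

import Mathlib

open Set Topology MeasureTheory Filter
open scoped Manifold ContDiff Distributions ENNReal NNReal

/-! Scaled bounded geometry structures, weights, symbols, weighted Sobolev spaces, quantizations and
pseudodifferential operators on manifolds of bounded geometry. -/

noncomputable section

namespace ScaledBG

/-- The Euclidean space `ℝⁿ`. -/
abbrev E (n : ℕ) : Type := EuclideanSpace ℝ (Fin n)

/-- The standard basis vectors of `ℝⁿ`. -/
def e {n : ℕ} (i : Fin n) : E n := EuclideanSpace.single i 1

/-- The open cube `(-r, r)ⁿ`. -/
def cube (n : ℕ) (r : ℝ) : Set (E n) := {x | ∀ i, |x i| < r}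

/-- The closed cube `[-r, r]ⁿ`. -/
def closedCube (n : ℕ) (r : ℝ) : Set (E n) := {x | ∀ i, |x i| ≤ r}

theorem isOpen_cube (n : ℕ) (r : ℝ) : IsOpen (cube n r) := by
  have h : cube n r = ⋂ i : Fin n, {x : E n | |x i| < r} := by
    ext x; simp [cube]
  rw [h]
  refine isOpen_iInter_of_finite fun i => isOpen_lt ?_ continuous_const
  fun_prop

/-- The coordinate domain `(-2, 2)ⁿ`, as an open set. -/
def box (n : ℕ) : TopologicalSpace.Opens (E n) := ⟨cube n 2, isOpen_cube n 2⟩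

/-- The Japanese bracket `⟨ξ⟩ = (1 + |ξ|²)^(1/2)`. -/
def bracket {n : ℕ} (ξ : E n) : ℝ := Real.sqrt (1 + ‖ξ‖ ^ 2)

section Structure

variable (n : ℕ) (M : Type*) [TopologicalSpace M] [ChartedSpace (E n) M] (ι : Type*)

/-- A scaled bounded geometry structure on the smooth `n`-manifold `M`, with index set `ι`. The sets
`U_α` are the sources of the charts `φ_α`. -/
structure SBGStructure where
  /-- the diffeomorphisms `φ_α : U_α → (-2, 2)ⁿ` -/
  chart : ι → OpenPartialHomeomorph M (E n)
  chart_mem : ∀ α, chart α ∈ IsManifold.maximalAtlas (𝓡 n) ∞ M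
  chart_target : ∀ α, (chart α).target = cube n 2
  /-- any `N + 1` pairwise distinct indices have `U_{α_1} ∩ ⋯ ∩ U_{α_{N + 1}} = ∅` -/
  finite_overlap : ∃ N : ℕ, ∀ s : Finset ι, s.card = N + 1 → ⋂ α ∈ s, (chart α).source = ∅
  /-- the sets `φ_α⁻¹((-1, 1)ⁿ)` cover `M` -/
  cover : ∀ p : M, ∃ α, p ∈ (chart α).source ∧ chart α p ∈ cube n 1
  /-- the transition functions `τ_{βα} = φ_β ∘ φ_α⁻¹` are uniformly bounded in `C^∞` -/
  transition_bdd : ∀ k : ℕ, ∃ C : ℝ, ∀ α β, ∀ x ∈ ((chart α).symm.trans (chart β)).source,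
    ‖iteratedFDeriv ℝ k (fun y => chart β ((chart α).symm y)) x‖ ≤ C
  /-- the scaling `ρ_{α, i}` -/
  scale : ι → Fin n → ℝ
  scale_pos : ∀ α i, 0 < scale α i
  scale_le_one : ∀ α i, scale α i ≤ 1
  /-- `|∂^γ (ρ_{α, i} ∂_i τ_{βα}^j)| ≤ C_γ ρ_{β, j}` -/
  scale_bdd : ∀ k : ℕ, ∃ C : ℝ, ∀ α β, ∀ i j, ∀ x ∈ ((chart α).symm.trans (chart β)).source,
    scale α i * ‖iteratedFDeriv ℝ k
      (fun y => fderiv ℝ (fun z => chart β ((chart α).symm z) j) y (e i)) x‖ ≤ C * scale β j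

/-- Vector fields on `M` (not assumed to be smooth). -/
abbrev VField : Type _ := (p : M) → TangentSpace (𝓡 n) p

/-- Complex functions on the cotangent bundle `T^*M`. -/
abbrev CotFun : Type _ := (p : M) → (TangentSpace (𝓡 n) p →L[ℝ] ℝ) → ℂ

/-- `C^∞(M)`, complex valued. -/
def Smooth : Submodule ℂ (M → ℂ) where
  carrier := {u | ContMDiff (𝓡 n) 𝓘(ℝ, ℂ) ∞ u}
  add_mem' hu hv := ContMDiff.add hu hv
  zero_mem' := contMDiff_const
  smul_mem' c _ hu := ContMDiff.comp (I' := 𝓘(ℝ, ℂ))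
    (g := fun z : ℂ => c * z) (contDiff_const.mul contDiff_id).contMDiff hu

/-- `C_c^∞(M)`, complex valued. -/
def SmoothC : Submodule ℂ (M → ℂ) where
  carrier := {u | u ∈ Smooth n M ∧ HasCompactSupport u}
  add_mem' hu hv := ⟨add_mem hu.1 hv.1, hu.2.add hv.2⟩
  zero_mem' := ⟨zero_mem _, HasCompactSupport.zero⟩
  smul_mem' c _ hu := ⟨Submodule.smul_mem _ c hu.1, hu.2.smul_left (f := fun _ => c)⟩

end Structure

namespace SBGStructure

variable {n : ℕ} {M : Type*} [TopologicalSpace M] [ChartedSpace (E n) M] {ι : Type*}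
variable [IsManifold (𝓡 n) ∞ M] (B : SBGStructure n M ι)

/-! ### Uniformly smooth functions and vector fields, weights -/

/-- A family of functions on `(-2, 2)ⁿ`, indexed by `α`, is smooth and uniformly bounded with all
derivatives. -/
def UnifSmoothFamily {F : Type*} [NormedAddCommGroup F] [NormedSpace ℝ F] (_B : SBGStructure n M ι)
    (f : ι → E n → F) : Prop :=
  (∀ α, ContDiffOn ℝ ∞ (f α) (cube n 2)) ∧
    ∀ k : ℕ, ∃ C : ℝ, ∀ α, ∀ x ∈ cube n 2, ‖iteratedFDeriv ℝ k (f α) x‖ ≤ C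

/-- The space `C^∞_uni(M)` of uniformly smooth functions (real valued). -/
def UnifSmooth (f : M → ℝ) : Prop :=
  ContMDiff (𝓡 n) 𝓘(ℝ, ℝ) ∞ f ∧ B.UnifSmoothFamily fun α x => f ((B.chart α).symm x)

/-- The coefficient vector of the push-forward `(φ_α)_* W`, as a function of `x ∈ (-2, 2)ⁿ`. -/
def locVF (W : VField n M) (α : ι) (x : E n) : E n :=
  (mfderiv (𝓡 n) 𝓘(ℝ, E n) (B.chart α) ((B.chart α).symm x) (W ((B.chart α).symm x)) : E n)

/-- The coefficient Lie algebra `𝒲 = C^∞_uni(M; TM)`. -/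
def MemW (W : VField n M) : Prop :=
  ContMDiff (𝓡 n) (𝓡 n).tangent ∞ (fun p => (⟨p, W p⟩ : TangentBundle (𝓡 n) M)) ∧
    B.UnifSmoothFamily (B.locVF W)

/-- The derivative `W f` of a real function along a vector field. -/
def vderiv (W : VField n M) (f : M → ℝ) (p : M) : ℝ :=
  (mfderiv (𝓡 n) 𝓘(ℝ, ℝ) f p (W p) : ℝ)

/-- Weights on `(M, 𝔅)`. -/
def IsWeight (w : M → ℝ) : Prop :=
  (∀ p, 0 < w p) ∧ ContMDiff (𝓡 n) 𝓘(ℝ, ℝ) ∞ w ∧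
    ∀ W : VField n M, B.MemW W → B.UnifSmooth fun p => vderiv W w p / w p

/-- The sets `U'_α = φ_α⁻¹((-3/2, 3/2)ⁿ)`. -/
def cell' (α : ι) : Set M := (B.chart α).symm '' cube n (3 / 2)

/-- The weight family `w_α = sup_{U'_α} w` associated with a weight `w`. -/
def weightFamily (w : M → ℝ) (α : ι) : ℝ := sSup (w '' B.cell' α)

/-- `ρ̄_α = max_i ρ_{α, i}`. -/
def scaleMax (α : ι) : ℝ := ⨆ i, B.scale α i

/-- `ρ_{α, 1} ⋯ ρ_{α, n}`. -/
def scaleProd (α : ι) : ℝ := ∏ i, B.scale α i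

/-- A scaling weight: a weight which is equivalent to the weight family `ρ̄`. -/
def IsScalingWeight (r : M → ℝ) : Prop :=
  B.IsWeight r ∧ ∃ C : ℝ, 0 < C ∧ ∀ α, ∀ p ∈ B.cell' α,
    r p ≤ C * B.scaleMax α ∧ B.scaleMax α ≤ C * r p

/-- Finitely many elements of `𝒲` which span `𝒲` over `C^∞_uni(M)`. -/
def IsSpanning {N : ℕ} (S : Fin N → VField n M) : Prop :=
  (∀ j, B.MemW (S j)) ∧ ∀ W : VField n M, B.MemW W →
    ∃ f : Fin N → M → ℝ, (∀ j, B.UnifSmooth (f j)) ∧ ∀ p, W p = ∑ j, f j p • S j p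

/-- A (smooth) uniformly positive `𝒱`-density `μ`: in the chart `φ_α` it equals
`d_α(x) |dx¹/ρ_{α, 1} ⋯ dxⁿ/ρ_{α, n}|` where the `d_α` are uniformly bounded in `C^∞` and bounded
from below by a positive constant. -/
def IsPosVDensity [MeasurableSpace M] (μ : Measure M) : Prop :=
  ∃ d : ι → E n → ℝ, B.UnifSmoothFamily d ∧
    (∃ ε : ℝ, 0 < ε ∧ ∀ α, ∀ x ∈ cube n 2, ε ≤ d α x) ∧
    ∀ α, (μ.restrict (B.chart α).source).map (B.chart α) =
      (volume.restrict (cube n 2)).withDensity fun x => ENNReal.ofReal (d α x / B.scaleProd α)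

/-! ### Symbols -/

/-- The covector `∑ ξ_i dx_α^i / ρ_{α, i}` at `p`, where `x_α^i = φ_α^i`. -/
def covector (α : ι) (p : M) (ξ : E n) : TangentSpace (𝓡 n) p →L[ℝ] ℝ :=
  ∑ i, (ξ i / B.scale α i) •
    ((EuclideanSpace.proj i : E n →L[ℝ] ℝ).comp
      (mfderiv (𝓡 n) 𝓘(ℝ, E n) (B.chart α) p : TangentSpace (𝓡 n) p →L[ℝ] E n))

/-- The expression `(φ_α)_* a` of `a : T^*M → ℂ` in the trivialization of the `𝒱`-cotangent bundle
over `U_α`. -/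
def locSymbol (a : CotFun n M) (α : ι) (x ξ : E n) : ℂ :=
  a ((B.chart α).symm x) (B.covector α ((B.chart α).symm x) ξ)

/-- The symbol class `S^m(^𝒱T^*M)`. -/
def IsSymbol (m : ℝ) (a : CotFun n M) : Prop :=
  (∀ α, ContDiffOn ℝ ∞ (fun z : E n × E n => B.locSymbol a α z.1 z.2) (cube n 2 ×ˢ univ)) ∧
    ∀ j k : ℕ, ∃ C : ℝ, ∀ α, ∀ x ∈ cube n 2, ∀ ξ : E n,
      ‖iteratedFDeriv ℝ j (fun y => iteratedFDeriv ℝ k (fun η => B.locSymbol a α y η) ξ) x‖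
        ≤ C * bracket ξ ^ (m - k)

/-- The weighted symbol class `w S^m(^𝒱T^*M)`. -/
def IsWSymbol (w : M → ℝ) (m : ℝ) (a : CotFun n M) : Prop :=
  ∃ b : CotFun n M, B.IsSymbol m b ∧ ∀ p η, a p η = (w p : ℂ) * b p η

/-! ### Distributions -/

/-- Families of distributions `u_α` on the coordinate domains `(-2, 2)ⁿ` of the charts. -/
abbrev LocalFamily (_B : SBGStructure n M ι) : Type _ := ι → 𝓓'(box n, ℂ)

/-- The space `𝒟'(M)` of distributions (generalized functions) on `M`: families of distributions
`u_α = (φ_α)_* u` in the charts with `u_α = τ_{βα}^* u_β` on `φ_α(U_α ∩ U_β)`, that is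
`u_α((g ∘ τ_{βα}) |det Dτ_{βα}|) = u_β(g)` for all test functions `g` with support in
`φ_β(U_α ∩ U_β)`. -/
def Distrib : Submodule ℂ B.LocalFamily where
  carrier := {u | ∀ α β, ∀ f g : 𝓓(box n, ℝ),
    tsupport g ⊆ ((B.chart β).symm.trans (B.chart α)).source →
    (∀ x ∈ ((B.chart α).symm.trans (B.chart β)).source, f x =
      |(fderiv ℝ (fun y => B.chart β ((B.chart α).symm y)) x).det| *
        g (B.chart β ((B.chart α).symm x))) →
    (∀ x ∉ ((B.chart α).symm.trans (B.chart β)).source, f x = 0) →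
    u α f = u β g}
  add_mem' {u v} hu hv α β f g h1 h2 h3 := by
    change u α f + v α f = u β g + v β g
    rw [hu α β f g h1 h2 h3, hv α β f g h1 h2 h3]
  zero_mem' _ _ _ _ _ _ _ := rfl
  smul_mem' c u hu α β f g h1 h2 h3 := by
    change c • u α f = c • u β g
    rw [hu α β f g h1 h2 h3]

/-- The distribution defined by a function `u` on `M`: `u_α(f) = ∫ f(x) u(φ_α⁻¹(x)) dx`. (This is
used for smooth functions only.) -/
def ofFun (u : M → ℂ) : B.LocalFamily := fun α =>
  (ContinuousLinearMap.toUniformConvergenceCLM _ _ _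
    (TestFunction.integralAgainstBilinCLM (𝕜 := ℝ) (ContinuousLinearMap.lsmul ℝ ℝ) volume
      fun x => u ((B.chart α).symm x)) : 𝓓'(box n, ℂ))

/-- Multiplication of test functions on `(-2, 2)ⁿ` by a smooth function on `(-2, 2)ⁿ`. -/
def mulTest (g : E n → ℝ) (hg : ContDiffOn ℝ ∞ g (cube n 2)) (f : 𝓓(box n, ℝ)) :
    𝓓(box n, ℝ) where
  toFun x := f x * g x
  contDiff' := by
    rw [contDiff_iff_contDiffAt]
    intro x
    by_cases hx : x ∈ tsupport f
    · exact f.contDiff.contDiffAt.mul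
        (hg.contDiffAt ((isOpen_cube n 2).mem_nhds (f.tsupport_subset hx)))
    · have h0 : (fun x => f x * g x) =ᶠ[𝓝 x] fun _ => 0 := by
        filter_upwards [(isClosed_tsupport f).isOpen_compl.mem_nhds hx] with y hy
        rw [image_eq_zero_of_notMem_tsupport hy, zero_mul]
      exact contDiffAt_const.congr_of_eventuallyEq h0
  hasCompactSupport' := f.hasCompactSupport.mul_right
  tsupport_subset' := (closure_mono (Function.support_mul_subset_left _ _)).trans f.tsupport_subset

theorem exists_cutoff (g : E n → ℝ) (hg : ContDiffOn ℝ ∞ g (cube n 2)) (K : Set (E n))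
    (hK : IsCompact K) (hK2 : K ⊆ cube n 2) :
    ∃ h : E n → ℝ, ContDiff ℝ ∞ h ∧ ∀ x ∈ K, h x = g x := by
  obtain ⟨θ, h0, h1, -⟩ := exists_contMDiffMap_zero_one_nhds_of_isClosed 𝓘(ℝ, E n) (n := (⊤ : ℕ∞))
    (s := (cube n 2)ᶜ) (t := K) (isOpen_cube n 2).isClosed_compl hK.isClosed
    (Set.disjoint_left.2 fun x hx hx' => hx (hK2 hx'))
  refine ⟨fun x => θ x * g x, ?_, fun x hx => ?_⟩
  · rw [contDiff_iff_contDiffAt]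
    intro x
    by_cases hx : x ∈ cube n 2
    · exact θ.contMDiff.contDiff.contDiffAt.mul (hg.contDiffAt ((isOpen_cube n 2).mem_nhds hx))
    · have h2 : (fun x => θ x * g x) =ᶠ[𝓝 x] fun _ => 0 := by
        filter_upwards [h0.filter_mono (nhds_le_nhdsSet hx)] with y hy
        rw [hy, zero_mul]
      exact contDiffAt_const.congr_of_eventuallyEq h2
  · have h2 : θ x = 1 := h1.self_of_nhdsSet x hx
    simp [h2]

/-- `mulTest` as a continuous linear map. -/
def mulCLM (g : E n → ℝ) (hg : ContDiffOn ℝ ∞ g (cube n 2)) : 𝓓(box n, ℝ) →L[ℝ] 𝓓(box n, ℝ) :=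
  TestFunction.limitCLM ℝ (mulTest g hg)
    (fun K hK => TestFunction.ofSupportedInCLM ℝ hK ∘L
      ContDiffMapSupportedIn.bilinLeftCLM (ContinuousLinearMap.mul ℝ ℝ)
        (exists_cutoff g hg K K.isCompact hK).choose_spec.1)
    (fun K hK f => by
      ext x
      have h := (exists_cutoff g hg K K.isCompact hK).choose_spec.2
      change f x * g x = f x * (exists_cutoff g hg K K.isCompact hK).choose x
      by_cases hx : x ∈ (K : Set (E n))
      · rw [h x hx]
      · have h2 : f x = 0 := f.zero_on_compl hx
        rw [h2, zero_mul, zero_mul])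

open Classical in
/-- The action of a smooth vector field `W` on distributions: `(W u)_α = ∑ W_α^i ∂_i u_α`, where
`W_α^i` are the coefficients of `(φ_α)_* W`. -/
def vfAct (W : VField n M) (u : B.LocalFamily) : B.LocalFamily := fun α =>
  if h : ∀ i, ContDiffOn ℝ ∞ (fun x => B.locVF W α x i) (cube n 2) then
    ∑ i, (mulCLM (fun x => B.locVF W α x i) (h i)).precompCompactConvergenceCLM ℂ
      (Distribution.lineDerivCLM (e i) (u α) : 𝓓'(box n, ℂ))
  else 0

variable (M) in
/-- The auxiliary objects which are fixed once and for all in the definitions of norms,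
quantizations and residual operators. -/
structure Choices [MeasurableSpace M] where
  /-- the cutoff in the definition of Sobolev norms -/
  chiH : E n → ℝ
  chiH_smooth : ContDiff ℝ ∞ chiH
  chiH_compact : HasCompactSupport chiH
  chiH_supp : tsupport chiH ⊆ cube n 2
  chiH_one : ∀ x ∈ closedCube n 1, chiH x = 1
  /-- the cutoff in the definition of quantizations -/
  chiQ : E n → ℝ
  chiQ_smooth : ContDiff ℝ ∞ chiQ
  chiQ_compact : HasCompactSupport chiQ
  chiQ_supp : tsupport chiQ ⊆ cube n (5 / 4)
  chiQ_one : ∀ x ∈ closedCube n 1, chiQ x = 1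
  chiQ_nonneg : ∀ x, 0 ≤ chiQ x
  /-- the cutoff near the diagonal in the definition of quantizations -/
  psi : E n → ℝ
  psi_smooth : ContDiff ℝ ∞ psi
  psi_compact : HasCompactSupport psi
  psi_supp : tsupport psi ⊆ cube n (1 / 4)
  psi_one : ∀ᶠ x in 𝓝 (0 : E n), psi x = 1
  /-- the scaling weight `ρ` -/
  rho : M → ℝ
  rho_scaling : B.IsScalingWeight rho
  /-- a uniformly positive `𝒱`-density -/
  mu : Measure M
  mu_pos : B.IsPosVDensity mu
  /-- the number of elements of a finite spanning set of `𝒲` -/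
  num : ℕ
  /-- a finite spanning set of `𝒲` -/
  span : Fin num → VField n M
  span_spanning : B.IsSpanning span

namespace Choices

variable {B} [MeasurableSpace M] (c : B.Choices)

/-! ### Sobolev spaces -/

/-- The test function `χ g` on `(-2, 2)ⁿ`. -/
def cutTest (g : E n → ℝ) (hg : ContDiff ℝ ∞ g) : 𝓓(box n, ℝ) where
  toFun x := c.chiH x * g x
  contDiff' := c.chiH_smooth.mul hg
  hasCompactSupport' := c.chiH_compact.mul_right
  tsupport_subset' := (closure_mono (Function.support_mul_subset_left _ _)).trans c.chiH_supp

/-- The phase `∑ x_i ξ_i / ρ_{α, i}`. -/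
def phase (B : SBGStructure n M ι) (α : ι) (ξ x : E n) : ℝ := ∑ i, x i * ξ i / B.scale α i

theorem contDiff_phase (α : ι) (ξ : E n) : ContDiff ℝ ∞ (phase B α ξ) := by
  unfold phase
  fun_prop

/-- The Fourier transform `ξ ↦ v(e^{-i x̃ ξ})` of the compactly supported distribution
`v = (S_α)_* (φ_α)_* (χ_α u)` on `ℝⁿ`, with `S_α(x) = x̃ = (x_i / ρ_{α, i})`. -/
def fourierLoc (u : B.LocalFamily) (α : ι) (ξ : E n) : ℂ :=
  ((B.scaleProd α)⁻¹ : ℂ) *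
    (u α (c.cutTest (fun x => Real.cos (phase B α ξ x)) (contDiff_phase α ξ).cos) -
      Complex.I * u α (c.cutTest (fun x => Real.sin (phase B α ξ x)) (contDiff_phase α ξ).sin))

/-- `⟨ξ⟩^s` times the Fourier transform of `(S_α)_* (φ_α)_* (χ_α u)`. -/
def weightedFourier (s : ℝ) (u : B.LocalFamily) (α : ι) (ξ : E n) : ℂ :=
  ((bracket ξ ^ s : ℝ) : ℂ) * c.fourierLoc u α ξ

/-- The norm `(∑_α ‖w_α⁻¹ (S_α)_* (φ_α)_* (χ_α u)‖²_{H^s(ℝⁿ)})^(1/2)` of `w H_𝒱^s(M)`, as an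
extended real number. -/
def sobNorm (w : M → ℝ) (s : ℝ) (u : B.LocalFamily) : ℝ≥0∞ :=
  (∑' α, (ENNReal.ofReal (B.weightFamily w α)⁻¹ *
    eLpNorm (c.weightedFourier s u α) 2 volume) ^ 2) ^ (1 / 2 : ℝ)

theorem weightedFourier_add (s : ℝ) (u v : B.LocalFamily) (α : ι) :
    c.weightedFourier s (u + v) α = c.weightedFourier s u α + c.weightedFourier s v α := by
  funext ξ
  change (_ : ℂ) * (_ * ((u α _ + v α _) - Complex.I * (u α _ + v α _))) =
    _ * (_ * (u α _ - Complex.I * u α _)) + _ * (_ * (v α _ - Complex.I * v α _))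
  ring

theorem weightedFourier_smul (s : ℝ) (z : ℂ) (u : B.LocalFamily) (α : ι) :
    c.weightedFourier s (z • u) α = z • c.weightedFourier s u α := by
  funext ξ
  change (_ : ℂ) * (_ * (z * u α _ - Complex.I * (z * u α _))) =
    z * (_ * (_ * (u α _ - Complex.I * u α _)))
  ring

theorem weightedFourier_zero (s : ℝ) (α : ι) : c.weightedFourier s 0 α = 0 := by
  have h := c.weightedFourier_smul s (0 : ℂ) (0 : B.LocalFamily) α
  rwa [zero_smul ℂ (0 : B.LocalFamily), zero_smul] at h

theorem sobNorm_lt_top_iff (w : M → ℝ) (s : ℝ) (u : B.LocalFamily) :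
    c.sobNorm w s u < ⊤ ↔ ∑' α, (ENNReal.ofReal (B.weightFamily w α)⁻¹ *
      eLpNorm (c.weightedFourier s u α) 2 volume) ^ 2 < ⊤ := by
  unfold sobNorm
  rw [ENNReal.rpow_lt_top_iff_of_pos (by norm_num)]

/-- The weighted `𝒱`-Sobolev space `w H_𝒱^s(M)`. -/
def H (w : M → ℝ) (s : ℝ) : Submodule ℂ B.LocalFamily where
  carrier := {u | u ∈ B.Distrib ∧ (∀ α, MemLp (c.weightedFourier s u α) 2 volume) ∧
    c.sobNorm w s u < ⊤}
  add_mem' {u v} hu hv := by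
    refine ⟨add_mem hu.1 hv.1, fun α => ?_, ?_⟩
    · rw [weightedFourier_add]
      exact (hu.2.1 α).add (hv.2.1 α)
    · have h1 := (c.sobNorm_lt_top_iff w s u).1 hu.2.2
      have h2 := (c.sobNorm_lt_top_iff w s v).1 hv.2.2
      rw [sobNorm_lt_top_iff]
      refine lt_of_le_of_lt (b := ∑' α, 2 * ((ENNReal.ofReal (B.weightFamily w α)⁻¹ *
        eLpNorm (c.weightedFourier s u α) 2 volume) ^ 2 + (ENNReal.ofReal (B.weightFamily w α)⁻¹ *
        eLpNorm (c.weightedFourier s v α) 2 volume) ^ 2)) (ENNReal.tsum_le_tsum fun α => ?_) ?_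
      · rw [weightedFourier_add]
        have h3 := eLpNorm_add_le (hu.2.1 α).1 (hv.2.1 α).1 (one_le_two : (1 : ℝ≥0∞) ≤ 2)
        calc _ ≤ (ENNReal.ofReal (B.weightFamily w α)⁻¹ *
              eLpNorm (c.weightedFourier s u α) 2 volume + ENNReal.ofReal (B.weightFamily w α)⁻¹ *
              eLpNorm (c.weightedFourier s v α) 2 volume) ^ 2 := by
                rw [← mul_add]; gcongr
          _ ≤ _ := by
                have h4 := ENNReal.rpow_add_le_mul_rpow_add_rpow
                  (ENNReal.ofReal (B.weightFamily w α)⁻¹ *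
                    eLpNorm (c.weightedFourier s u α) 2 volume)
                  (ENNReal.ofReal (B.weightFamily w α)⁻¹ *
                    eLpNorm (c.weightedFourier s v α) 2 volume) (one_le_two : (1 : ℝ) ≤ 2)
                have h5 : (2 : ℝ) - 1 = 1 := by norm_num
                simpa only [h5, ENNReal.rpow_one, ENNReal.rpow_two] using h4
      · rw [ENNReal.tsum_mul_left, ENNReal.tsum_add]
        exact ENNReal.mul_lt_top (by norm_num) (ENNReal.add_lt_top.2 ⟨h1, h2⟩)
  zero_mem' := by
    refine ⟨zero_mem _, fun α => ?_, ?_⟩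
    · rw [weightedFourier_zero]; exact MemLp.zero
    · rw [sobNorm_lt_top_iff]; simp [weightedFourier_zero]
  smul_mem' z u hu := by
    refine ⟨Submodule.smul_mem _ z hu.1, fun α => ?_, ?_⟩
    · rw [weightedFourier_smul]
      exact (hu.2.1 α).const_smul z
    · have h1 := (c.sobNorm_lt_top_iff w s u).1 hu.2.2
      rw [sobNorm_lt_top_iff]
      simp only [weightedFourier_smul, eLpNorm_const_smul, mul_left_comm _ ‖z‖ₑ, mul_pow _ _ 2]
      rw [ENNReal.tsum_mul_left]
      exact ENNReal.mul_lt_top (ENNReal.pow_lt_top enorm_lt_top)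
        (by simpa only [mul_pow] using h1)

/-- The mixed space `w H_{𝒱;𝒲}^{(s;k)}(M)`: all `u` with `W_1 ⋯ W_j u ∈ w H_𝒱^s(M)` for all `j ≤ k`
and `W_1, …, W_j ∈ 𝒲`. -/
def MemMixed (w : M → ℝ) (s : ℝ) (k : ℕ) (u : B.LocalFamily) : Prop :=
  ∀ l : List (VField n M), l.length ≤ k → (∀ W ∈ l, B.MemW W) → l.foldr B.vfAct u ∈ c.H w s

/-- The norm of `w H_{𝒱;𝒲}^{(s;k)}(M)` defined by the fixed finite spanning set of `𝒲`. -/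
def mixedNorm (w : M → ℝ) (s : ℝ) (k : ℕ) (u : B.LocalFamily) : ℝ≥0∞ :=
  (∑ j ∈ Finset.range (k + 1), ∑ f : Fin j → Fin c.num,
    c.sobNorm w s ((List.ofFn fun i => c.span (f i)).foldr B.vfAct u) ^ 2) ^ (1 / 2 : ℝ)

/-! ### Quantizations -/

/-- The local quantization `(Op_α(a) u)(x)` of `a = a(x, ξ)`. -/
def opLocal (α : ι) (a : E n → E n → ℂ) (u : E n → ℂ) (x : E n) : ℂ :=
  (((2 * Real.pi) ^ n : ℝ) : ℂ)⁻¹ * ∫ ξ : E n, ∫ y : E n,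
    Complex.exp (Complex.I * (phase B α ξ (x - y) : ℂ)) * (c.psi (x - y) : ℂ) * a x ξ * u y *
      ((B.scaleProd α)⁻¹ : ℂ)

open Classical in
/-- The function `φ_α^* χ`, extended by `0`. -/
def cutQ (α : ι) (p : M) : ℝ := if p ∈ (B.chart α).source then c.chiQ (B.chart α p) else 0

/-- The partition of unity `χ_α = φ_α^* χ / ∑_β φ_β^* χ`. -/
def pou (α : ι) (p : M) : ℝ := c.cutQ α p / ∑ᶠ β, c.cutQ β p

open Classical in
/-- The `𝒱`-quantization `(Op_𝒱(a) u)(p) = ∑_α (Op_α((φ_α)_* (χ_α a)) ((φ_α)_* u))(φ_α(p))`, where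
the term with index `α` vanishes for `p ∉ U_α`. -/
def OpV (a : CotFun n M) (u : M → ℂ) (p : M) : ℂ :=
  ∑ᶠ α, if p ∈ (B.chart α).source then
    c.opLocal α (fun x ξ => (c.pou α ((B.chart α).symm x) : ℂ) * B.locSymbol a α x ξ)
      (fun y => u ((B.chart α).symm y)) (B.chart α p)
    else 0

/-! ### Residual operators and pseudodifferential operators -/

/-- The operator `R` on `C_c^∞(M)` is bounded as a map
`w' ρ^{-N} H_{𝒱;𝒲}^{(-N;k)}(M) → w w' ρ^N H_{𝒱;𝒲}^{(N;k)}(M)` for all weights `w'`, all `N ∈ ℝ` and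
all `k`. -/
def ResidualBound (w : M → ℝ) (R : SmoothC n M → M → ℂ) : Prop :=
  ∀ w' : M → ℝ, B.IsWeight w' → ∀ (N : ℝ) (k : ℕ), ∃ C : ℝ≥0, ∀ u : SmoothC n M,
    c.MemMixed (fun p => w p * w' p * c.rho p ^ N) N k (B.ofFun (R u)) ∧
    c.mixedNorm (fun p => w p * w' p * c.rho p ^ N) N k (B.ofFun (R u)) ≤
      C * c.mixedNorm (fun p => w' p * c.rho p ^ (-N)) (-N) k (B.ofFun u)

/-- The residual operators `w ρ^∞ Ψ_𝒱^{-∞}(M)`: linear operators on `C_c^∞(M)` which, together with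
their formal `L²(M; μ)`-adjoints, have the mapping properties of `ResidualBound`. -/
def IsResidual (w : M → ℝ) (R : SmoothC n M →ₗ[ℂ] SmoothC n M) : Prop :=
  c.ResidualBound w (fun u => R u) ∧
    ∃ R' : SmoothC n M →ₗ[ℂ] Smooth n M,
      (∀ u v : SmoothC n M,
        ∫ p, (R u : M → ℂ) p * starRingEnd ℂ ((v : M → ℂ) p) ∂c.mu =
          ∫ p, (u : M → ℂ) p * starRingEnd ℂ ((R' v : M → ℂ) p) ∂c.mu) ∧
      c.ResidualBound w (fun u => R' u)

/-- The space `w Ψ_𝒱^m(M)` of weighted `𝒱`-pseudodifferential operators, acting on `C_c^∞(M)`. -/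
def Psi (w : M → ℝ) (m : ℝ) : Set (SmoothC n M →ₗ[ℂ] SmoothC n M) :=
  {A | ∃ a : CotFun n M, B.IsWSymbol w m a ∧
    ∃ R : SmoothC n M →ₗ[ℂ] SmoothC n M, c.IsResidual w R ∧
      ∀ (u : SmoothC n M) (p : M), (A u : M → ℂ) p = c.OpV a u p + (R u : M → ℂ) p}

/-! ### Boundedness -/

/-- The linear map `T : w₁ H_𝒱^{s₁}(M) → w₂ H_𝒱^{s₂}(M)` is bounded and extends the operator `A` on
`C_c^∞(M)`. -/
def IsBddExt {w₁ w₂ : M → ℝ} {s₁ s₂ : ℝ} (A : SmoothC n M →ₗ[ℂ] SmoothC n M)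
    (T : c.H w₁ s₁ →ₗ[ℂ] c.H w₂ s₂) : Prop :=
  (∀ u : SmoothC n M, ∃ v : c.H w₁ s₁,
    (v : B.LocalFamily) = B.ofFun u ∧ (T v : B.LocalFamily) = B.ofFun (A u)) ∧
  ∃ C : ℝ≥0, ∀ v : c.H w₁ s₁, c.sobNorm w₂ s₂ (T v) ≤ C * c.sobNorm w₁ s₁ v

/-- The map `T` restricts to a bounded map `w₁ H_{𝒱;𝒲}^{(s₁;k)}(M) → w₂ H_{𝒱;𝒲}^{(s₂;k)}(M)`. -/
def MapsMixed {w₁ w₂ : M → ℝ} {s₁ s₂ : ℝ} (T : c.H w₁ s₁ →ₗ[ℂ] c.H w₂ s₂) (k : ℕ) : Prop :=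
  ∃ C : ℝ≥0, ∀ v : c.H w₁ s₁, c.MemMixed w₁ s₁ k v →
    c.MemMixed w₂ s₂ k (T v) ∧ c.mixedNorm w₂ s₂ k (T v) ≤ C * c.mixedNorm w₁ s₁ k v

end Choices

end SBGStructure
end ScaledBG
end

noncomputable section

namespace ScaledBG

open scoped SchwartzMap FourierTransform LineDeriv

/-! ### Uniformly bounded families of smooth functions -/

section UnifBdd

variable {I : Type*} {V W F F' G : Type*} [NormedAddCommGroup V] [NormedSpace ℝ V]
  [NormedAddCommGroup W] [NormedSpace ℝ W] [NormedAddCommGroup F] [NormedSpace ℝ F]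
  [NormedAddCommGroup F'] [NormedSpace ℝ F'] [NormedAddCommGroup G] [NormedSpace ℝ G]

/-- The functions `f i` are smooth on `D i`, and bounded with all derivatives uniformly in `i`. -/
def UnifBdd (D : I → Set V) (f : I → V → F) : Prop :=
  (∀ i, ContDiffOn ℝ ∞ (f i) (D i)) ∧
    ∀ k : ℕ, ∃ C : ℝ, ∀ i, ∀ x ∈ D i, ‖iteratedFDeriv ℝ k (f i) x‖ ≤ C

namespace UnifBdd

variable {D : I → Set V} {f : I → V → F}

theorem exists_bound (hf : UnifBdd D f) (k : ℕ) :
    ∃ C : ℝ, 0 < C ∧ ∀ i, ∀ x ∈ D i, ∀ j ≤ k, ‖iteratedFDeriv ℝ j (f i) x‖ ≤ C := by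
  choose C hC using hf.2
  refine ⟨1 + ∑ j ∈ Finset.range (k + 1), |C j|, by positivity, fun i x hx j hj => ?_⟩
  have h1 : |C j| ≤ ∑ j ∈ Finset.range (k + 1), |C j| :=
    Finset.single_le_sum (f := fun j => |C j|) (fun _ _ => abs_nonneg _)
      (Finset.mem_range.2 (by omega))
  linarith [hC j i x hx, le_abs_self (C j)]

theorem exists_norm_le (hf : UnifBdd D f) : ∃ C : ℝ, 0 < C ∧ ∀ i, ∀ x ∈ D i, ‖f i x‖ ≤ C := by
  obtain ⟨C, h0, hC⟩ := hf.exists_bound 0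
  exact ⟨C, h0, fun i x hx => by simpa using hC i x hx 0 le_rfl⟩

theorem of_within (hD : ∀ i, IsOpen (D i)) (hf : ∀ i, ContDiffOn ℝ ∞ (f i) (D i))
    (h : ∀ k : ℕ, ∃ C : ℝ, ∀ i, ∀ x ∈ D i, ‖iteratedFDerivWithin ℝ k (f i) (D i) x‖ ≤ C) :
    UnifBdd D f := by
  refine ⟨hf, fun k => ?_⟩
  obtain ⟨C, hC⟩ := h k
  refine ⟨C, fun i x hx => ?_⟩
  rw [← iteratedFDerivWithin_of_isOpen k (hD i) hx]
  exact hC i x hx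

theorem mono {D' : I → Set V} (hf : UnifBdd D f) (h : ∀ i, D' i ⊆ D i) : UnifBdd D' f :=
  ⟨fun i => (hf.1 i).mono (h i), fun k => (hf.2 k).imp fun _ hC i x hx => hC i x (h i hx)⟩

theorem reindex {J : Type*} (hf : UnifBdd D f) (e : J → I) :
    UnifBdd (fun j => D (e j)) (fun j => f (e j)) :=
  ⟨fun j => hf.1 (e j), fun k => (hf.2 k).imp fun _ hC j => hC (e j)⟩

theorem congr {g : I → V → F} (hf : UnifBdd D f) (hD : ∀ i, IsOpen (D i))
    (h : ∀ i, EqOn (g i) (f i) (D i)) : UnifBdd D g := by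
  refine ⟨fun i => (hf.1 i).congr (h i), fun k => (hf.2 k).imp fun _ hC i x hx => ?_⟩
  have : g i =ᶠ[𝓝 x] f i := by
    filter_upwards [(hD i).mem_nhds hx] with y hy using h i hy
  rw [(this.iteratedFDeriv ℝ k).eq_of_nhds]
  exact hC i x hx

theorem const {c : I → F} {C : ℝ} (hc : ∀ i, ‖c i‖ ≤ C) : UnifBdd D fun i _ => c i := by
  refine ⟨fun i => contDiffOn_const, fun k => ⟨max C 0, fun i x _ => ?_⟩⟩
  rcases k with _ | k
  · simpa using Or.inl (hc i)
  · rw [iteratedFDeriv_const_of_ne (by omega)]; simp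

theorem bilin (B : F →L[ℝ] F' →L[ℝ] G) {g : I → V → F'} (hD : ∀ i, IsOpen (D i))
    (hf : UnifBdd D f) (hg : UnifBdd D g) : UnifBdd D fun i x => B (f i x) (g i x) := by
  have hsm : ∀ i, ContDiffOn ℝ ∞ (fun x => B (f i x) (g i x)) (D i) := fun i =>
    (B.contDiff.comp_contDiffOn (hf.1 i)).clm_apply (hg.1 i)
  refine of_within hD hsm fun k => ?_
  obtain ⟨A, hA0, hA⟩ := hf.exists_bound k
  obtain ⟨A', hA0', hA'⟩ := hg.exists_bound k
  refine ⟨‖B‖ * ∑ i ∈ Finset.range (k + 1), (k.choose i) * A * A', fun i x hx => ?_⟩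
  refine (B.norm_iteratedFDerivWithin_le_of_bilinear (hf.1 i) (hg.1 i) (hD i).uniqueDiffOn hx
    (n := k) (by exact_mod_cast le_top)).trans ?_
  gcongr with j hj
  · rw [iteratedFDerivWithin_of_isOpen j (hD i) hx]
    exact hA i x hx j (by have := Finset.mem_range.1 hj; omega)
  · rw [iteratedFDerivWithin_of_isOpen _ (hD i) hx]
    exact hA' i x hx _ (by omega)

theorem smul {g : I → V → ℝ} (hD : ∀ i, IsOpen (D i)) (hg : UnifBdd D g) (hf : UnifBdd D f) :
    UnifBdd D fun i x => g i x • f i x :=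
  bilin (ContinuousLinearMap.lsmul ℝ ℝ) hD hg hf

theorem mul {f g : I → V → ℝ} (hD : ∀ i, IsOpen (D i)) (hf : UnifBdd D f) (hg : UnifBdd D g) :
    UnifBdd D fun i x => f i x * g i x :=
  bilin (ContinuousLinearMap.mul ℝ ℝ) hD hf hg

theorem clm_apply {A : I → V → (F →L[ℝ] G)} (hD : ∀ i, IsOpen (D i)) (hA : UnifBdd D A)
    (hf : UnifBdd D f) : UnifBdd D fun i x => A i x (f i x) :=
  bilin (ContinuousLinearMap.id ℝ (F →L[ℝ] G)) hD hA hf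

theorem clm (L : F →L[ℝ] G) (hD : ∀ i, IsOpen (D i)) (hf : UnifBdd D f) :
    UnifBdd D fun i x => L (f i x) :=
  clm_apply (A := fun _ _ => L) hD (const fun _ => le_rfl) hf

theorem add {g : I → V → F} (hD : ∀ i, IsOpen (D i)) (hf : UnifBdd D f) (hg : UnifBdd D g) :
    UnifBdd D fun i x => f i x + g i x := by
  refine ⟨fun i => (hf.1 i).add (hg.1 i), fun k => ?_⟩
  obtain ⟨A, hA⟩ := hf.2 k
  obtain ⟨A', hA'⟩ := hg.2 k
  refine ⟨A + A', fun i x hx => ?_⟩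
  have h1 : ContDiffAt ℝ k (f i) x :=
    ((hf.1 i).contDiffAt ((hD i).mem_nhds hx)).of_le (by exact_mod_cast le_top)
  have h2 : ContDiffAt ℝ k (g i) x :=
    ((hg.1 i).contDiffAt ((hD i).mem_nhds hx)).of_le (by exact_mod_cast le_top)
  change ‖iteratedFDeriv ℝ k (f i + g i) x‖ ≤ _
  rw [iteratedFDeriv_add_apply h1 h2]
  exact (norm_add_le _ _).trans (add_le_add (hA i x hx) (hA' i x hx))

theorem sum {J : Type*} (s : Finset J) {g : J → I → V → F} (hD : ∀ i, IsOpen (D i))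
    (hg : ∀ j ∈ s, UnifBdd D (g j)) : UnifBdd D fun i x => ∑ j ∈ s, g j i x := by
  classical
  induction s using Finset.induction_on with
  | empty => simpa using const (D := D) (c := fun _ => (0 : F)) (C := 0) (by simp)
  | insert a s ha ih =>
    simp only [Finset.sum_insert ha]
    exact add hD (hg a (by simp)) (ih fun j hj => hg j (by simp [hj]))

theorem fderiv (hD : ∀ i, IsOpen (D i)) (hf : UnifBdd D f) :
    UnifBdd D fun i x => fderiv ℝ (f i) x := by
  refine ⟨fun i => (hf.1 i).fderiv_of_isOpen (hD i) (by simp), fun k => ?_⟩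
  obtain ⟨C, hC⟩ := hf.2 (k + 1)
  exact ⟨C, fun i x hx => by rw [norm_iteratedFDeriv_fderiv]; exact hC i x hx⟩

theorem fderiv_apply (hD : ∀ i, IsOpen (D i)) (hf : UnifBdd D f) (v : V) :
    UnifBdd D fun i x => _root_.fderiv ℝ (f i) x v :=
  clm_apply hD (hf.fderiv hD) (f := fun _ _ => v) (const fun _ => le_rfl)

theorem comp' {D' : I → Set W} {g : I → W → F} {h : I → V → W} (hD : ∀ i, IsOpen (D i))
    (hD' : ∀ i, IsOpen (D' i)) (hg : ∀ i, ContDiffOn ℝ ∞ (g i) (D' i)) (hh : UnifBdd D h)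
    (hm : ∀ i, MapsTo (h i) (D i) (D' i))
    (hb : ∀ k : ℕ, ∃ C : ℝ, ∀ i, ∀ x ∈ D i, ‖iteratedFDeriv ℝ k (g i) (h i x)‖ ≤ C) :
    UnifBdd D fun i x => g i (h i x) := by
  refine of_within hD (fun i => (hg i).comp (hh.1 i) (hm i)) fun k => ?_
  choose C hC using hb
  obtain ⟨A, hA0, hA⟩ := hh.exists_bound k
  refine ⟨k.factorial * (∑ j ∈ Finset.range (k + 1), |C j|) * (max 1 A) ^ k, fun i x hx => ?_⟩
  refine norm_iteratedFDerivWithin_comp_le (hg i) (hh.1 i) (n := k) (by exact_mod_cast le_top)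
    (hD' i).uniqueDiffOn (hD i).uniqueDiffOn (hm i) hx (fun j hj => ?_) (fun j hj1 hj => ?_)
  · rw [iteratedFDerivWithin_of_isOpen j (hD' i) (hm i hx)]
    have h1 : |C j| ≤ ∑ j ∈ Finset.range (k + 1), |C j| :=
      Finset.single_le_sum (f := fun j => |C j|) (fun _ _ => abs_nonneg _)
        (Finset.mem_range.2 (by omega))
    linarith [hC j i x hx, le_abs_self (C j)]
  · rw [iteratedFDerivWithin_of_isOpen j (hD i) hx]
    refine (hA i x hx j hj).trans ((le_max_right 1 A).trans ?_)
    exact le_self_pow₀ (le_max_left 1 A) (by omega)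

theorem comp {D' : I → Set W} {g : I → W → F} {h : I → V → W} (hD : ∀ i, IsOpen (D i))
    (hD' : ∀ i, IsOpen (D' i)) (hg : UnifBdd D' g) (hh : UnifBdd D h)
    (hm : ∀ i, MapsTo (h i) (D i) (D' i)) : UnifBdd D fun i x => g i (h i x) :=
  comp' hD hD' hg.1 hh hm fun k => (hg.2 k).imp fun _ hC i x hx => hC i _ (hm i hx)

theorem comp_isCompact {U K : Set F} {g : F → G} (hD : ∀ i, IsOpen (D i)) (hU : IsOpen U)
    (hg : ContDiffOn ℝ ∞ g U) (hK : IsCompact K) (hKU : K ⊆ U) (hf : UnifBdd D f)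
    (hm : ∀ i, MapsTo (f i) (D i) K) : UnifBdd D fun i x => g (f i x) := by
  refine comp' (D' := fun _ => U) hD (fun _ => hU) (fun _ => hg) hf
    (fun i => (hm i).mono_right hKU) fun k => ?_
  have hc : ContinuousOn (iteratedFDeriv ℝ k g) U :=
    (hg.continuousOn_iteratedFDerivWithin (m := k) (by exact_mod_cast le_top)
      hU.uniqueDiffOn).congr fun x hx => (iteratedFDerivWithin_of_isOpen k hU hx).symm
  obtain ⟨C, hC⟩ := hK.exists_bound_of_continuousOn (hc.mono hKU)
  exact ⟨C, fun i x hx => hC _ (hm i hx)⟩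

theorem comp_contDiff [ProperSpace F] {g : F → G} (hD : ∀ i, IsOpen (D i)) (hg : ContDiff ℝ ∞ g)
    (hf : UnifBdd D f) : UnifBdd D fun i x => g (f i x) := by
  obtain ⟨C, -, hC⟩ := hf.exists_norm_le
  exact comp_isCompact hD isOpen_univ hg.contDiffOn (isCompact_closedBall 0 C) (subset_univ _) hf
    fun i x hx => by simpa using hC i x hx

theorem inv {f : I → V → ℝ} {ε : ℝ} (hε : 0 < ε) (hD : ∀ i, IsOpen (D i)) (hf : UnifBdd D f)
    (h : ∀ i, ∀ x ∈ D i, ε ≤ f i x) : UnifBdd D fun i x => (f i x)⁻¹ := by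
  obtain ⟨C, -, hC⟩ := hf.exists_norm_le
  exact comp_isCompact (U := {x : ℝ | x ≠ 0}) (K := Icc ε C) hD isOpen_ne
    (fun x hx => (contDiffAt_inv ℝ hx).contDiffWithinAt) isCompact_Icc
    (fun x hx => (hε.trans_le hx.1).ne') hf
    fun i x hx => ⟨h i x hx, (le_abs_self _).trans (hC i x hx)⟩

theorem abs {f : I → V → ℝ} {ε : ℝ} (hε : 0 < ε) (hD : ∀ i, IsOpen (D i)) (hf : UnifBdd D f)
    (h : ∀ i, ∀ x ∈ D i, ε ≤ |f i x|) : UnifBdd D fun i x => |f i x| := by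
  obtain ⟨C, -, hC⟩ := hf.exists_norm_le
  refine comp_isCompact (U := {x : ℝ | x ≠ 0}) (K := {x | ε ≤ |x|} ∩ Metric.closedBall 0 C) hD
    isOpen_ne (fun x hx => (contDiffAt_abs hx).contDiffWithinAt)
    ((isCompact_closedBall 0 C).inter_left (isClosed_le continuous_const continuous_abs))
    (fun x hx h0 => ?_) hf fun i x hx => ⟨h i x hx, by simpa using hC i x hx⟩
  have := hx.1
  simp only [h0, mem_ofPred_eq, abs_zero] at this
  linarith

theorem smul_cutoff {D' : I → Set V} {g : I → V → ℝ} (hD : ∀ i, IsOpen (D i))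
    (hD' : ∀ i, IsOpen (D' i)) (hg : UnifBdd D' g) (hs : ∀ i, D' i ∩ tsupport (g i) ⊆ D i)
    (hf : UnifBdd D f) : UnifBdd D' fun i x => g i x • f i x := by
  have h1 : UnifBdd (fun i => D i ∩ D' i) fun i x => g i x • f i x :=
    smul (fun i => (hD i).inter (hD' i)) (hg.mono fun i => inter_subset_right)
      (hf.mono fun i => inter_subset_left)
  have h2 : ∀ i, ∀ x ∈ D' i, x ∉ D i → (fun x => g i x • f i x) =ᶠ[𝓝 x] fun _ => 0 := by
    intro i x hx' hx
    have hx2 : x ∉ tsupport (g i) := fun h => hx (hs i ⟨hx', h⟩)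
    filter_upwards [(isClosed_tsupport (g i)).isOpen_compl.mem_nhds hx2] with y hy
    rw [image_eq_zero_of_notMem_tsupport hy, zero_smul]
  refine ⟨fun i x hx' => ?_, fun k => ?_⟩
  · by_cases hx : x ∈ D i
    · exact ((h1.1 i).contDiffAt (((hD i).inter (hD' i)).mem_nhds ⟨hx, hx'⟩)).contDiffWithinAt
    · exact (contDiffAt_const.congr_of_eventuallyEq (h2 i x hx' hx)).contDiffWithinAt
  · obtain ⟨C, hC⟩ := h1.2 k
    refine ⟨max C 0, fun i x hx' => ?_⟩
    by_cases hx : x ∈ D i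
    · exact (hC i x ⟨hx, hx'⟩).trans (le_max_left _ _)
    · rw [((h2 i x hx' hx).iteratedFDeriv ℝ k).eq_of_nhds]
      simp only [iteratedFDeriv_fun_zero, Pi.zero_apply, norm_zero]
      exact le_max_right _ _

theorem of_contDiff_hasCompactSupport {g : V → F} (hg : ContDiff ℝ ∞ g)
    (hc : HasCompactSupport g) : UnifBdd (fun _ : I => (univ : Set V)) fun _ => g := by
  refine ⟨fun _ => hg.contDiffOn, fun k => ?_⟩
  obtain ⟨C, hC⟩ := (hc.iteratedFDeriv (𝕜 := ℝ) k).exists_bound_of_continuous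
    (hg.continuous_iteratedFDeriv (m := k) (by exact_mod_cast le_top))
  exact ⟨C, fun _ x _ => hC x⟩

theorem contDiff (hf : UnifBdd (fun _ => univ) f) (i : I) : ContDiff ℝ ∞ (f i) :=
  contDiffOn_univ.1 (hf.1 i)

variable {n : ℕ}

theorem apply {f : I → V → E n} (hD : ∀ i, IsOpen (D i)) (hf : UnifBdd D f) (j : Fin n) :
    UnifBdd D fun i x => f i x j :=
  clm (EuclideanSpace.proj j : E n →L[ℝ] ℝ) hD hf

end UnifBdd

theorem contDiff_det {n : ℕ} : ContDiff ℝ ∞ fun A : E n →L[ℝ] E n => A.det := by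
  have h : ∀ A : E n →L[ℝ] E n, A.det = Matrix.det (Matrix.of fun i j => A (e j) i) := by
    intro A
    rw [ContinuousLinearMap.det, ← LinearMap.det_toMatrix (EuclideanSpace.basisFun (Fin n) ℝ).toBasis]
    congr 1
  simp_rw [h, Matrix.det_apply]
  refine ContDiff.sum fun σ _ => ContDiff.const_smul _ (contDiff_prod fun i _ => ?_)
  simp only [Matrix.of_apply]
  exact ((EuclideanSpace.proj (σ i) : E n →L[ℝ] ℝ).comp
    (ContinuousLinearMap.apply ℝ (E n) (e i))).contDiff

end UnifBdd

/-! ### Weighted `L²` norms on the Fourier side -/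

section Weights

variable {n : ℕ}

theorem one_le_bracket (ξ : E n) : 1 ≤ bracket ξ := by
  rw [bracket, Real.one_le_sqrt]; nlinarith [sq_nonneg ‖ξ‖]

theorem bracket_pos (ξ : E n) : 0 < bracket ξ := one_pos.trans_le (one_le_bracket ξ)

theorem bracket_sq (ξ : E n) : bracket ξ ^ 2 = 1 + ‖ξ‖ ^ 2 := by
  rw [bracket, Real.sq_sqrt (by positivity)]

theorem bracket_neg (ξ : E n) : bracket (-ξ) = bracket ξ := by simp [bracket]

theorem bracket_rpow (ξ : E n) (s : ℝ) : bracket ξ ^ s = (1 + ‖ξ‖ ^ 2) ^ (s / 2) := by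
  rw [bracket, Real.sqrt_eq_rpow, ← Real.rpow_mul (by positivity)]; congr 1; ring

theorem continuous_bracket : Continuous (bracket : E n → ℝ) := by
  unfold bracket; fun_prop

theorem norm_le_bracket (ξ : E n) : ‖ξ‖ ≤ bracket ξ :=
  Real.le_sqrt_of_sq_le (by linarith)

/-- The dilation `ξ ↦ 2πρξ`. -/
def scl (ρ : Fin n → ℝ) : E n →L[ℝ] E n :=
  LinearMap.toContinuousLinearMap
    { toFun := fun ξ => WithLp.toLp 2 fun i => 2 * Real.pi * ρ i * ξ i
      map_add' := fun x y => by ext i; simp [mul_add]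
      map_smul' := fun c x => by ext i; simp; ring }

@[simp] theorem scl_apply (ρ : Fin n → ℝ) (ξ : E n) (i : Fin n) :
    scl ρ ξ i = 2 * Real.pi * ρ i * ξ i := rfl

/-- The weight `⟨2πρξ⟩^s ⟨2πξ⟩^k`. -/
def wt (ρ : Fin n → ℝ) (s k : ℝ) (ξ : E n) : ℝ :=
  bracket (scl ρ ξ) ^ s * bracket (scl 1 ξ) ^ k

variable {ρ : Fin n → ℝ} {s k : ℝ}

theorem wt_pos (ξ : E n) : 0 < wt ρ s k ξ :=
  mul_pos (Real.rpow_pos_of_pos (bracket_pos _) _) (Real.rpow_pos_of_pos (bracket_pos _) _)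

theorem wt_neg (ξ : E n) : wt ρ s k (-ξ) = wt ρ s k ξ := by
  simp [wt, bracket_neg]

theorem wt_zero_zero : wt ρ 0 0 = fun _ => 1 := by ext; simp [wt]

theorem wt_mul (s' k' : ℝ) (ξ : E n) :
    wt ρ s k ξ * wt ρ s' k' ξ = wt ρ (s + s') (k + k') ξ := by
  simp only [wt, Real.rpow_add (bracket_pos _)]; ring

theorem wt_inv (ξ : E n) : (wt ρ s k ξ)⁻¹ = wt ρ (-s) (-k) ξ := by
  simp only [wt, Real.rpow_neg (bracket_pos _).le, mul_inv]

theorem wt_le_wt {s' k' : ℝ} (hs : s ≤ s') (hk : k ≤ k') (ξ : E n) :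
    wt ρ s k ξ ≤ wt ρ s' k' ξ := by
  unfold wt
  have := Real.rpow_le_rpow_of_exponent_le (one_le_bracket (scl ρ ξ)) hs
  have := Real.rpow_le_rpow_of_exponent_le (one_le_bracket (scl 1 ξ)) hk
  have := Real.rpow_pos_of_pos (bracket_pos (scl ρ ξ)) s
  have := Real.rpow_pos_of_pos (bracket_pos (scl 1 ξ)) k
  exact mul_le_mul ‹_› ‹_› (by positivity) (by linarith)

theorem hasTemperateGrowth_bracket_rpow (s : ℝ) :
    Function.HasTemperateGrowth fun ξ : E n => bracket ξ ^ s := by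
  simp_rw [bracket_rpow]
  exact Function.hasTemperateGrowth_one_add_norm_sq_rpow (E n) (s / 2)

theorem hasTemperateGrowth_wt : Function.HasTemperateGrowth (wt ρ s k) :=
  ((hasTemperateGrowth_bracket_rpow s).comp (scl ρ).hasTemperateGrowth).mul
    ((hasTemperateGrowth_bracket_rpow k).comp (scl 1).hasTemperateGrowth)

theorem continuous_wt : Continuous (wt ρ s k) :=
  (hasTemperateGrowth_wt (ρ := ρ) (s := s) (k := k)).1.continuous

theorem norm_scl_le (h0 : ∀ i, 0 ≤ ρ i) (h1 : ∀ i, ρ i ≤ 1) (ξ : E n) :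
    ‖scl ρ ξ‖ ≤ 2 * Real.pi * ‖ξ‖ := by
  have hpi := Real.pi_pos
  refine le_of_sq_le_sq ?_ (by positivity)
  rw [mul_pow, EuclideanSpace.norm_sq_eq, EuclideanSpace.norm_sq_eq, Finset.mul_sum]
  refine Finset.sum_le_sum fun i _ => ?_
  rw [scl_apply, norm_mul, mul_pow, Real.norm_eq_abs, abs_of_nonneg (by have := h0 i; positivity)]
  have h2 := h1 i
  have h3 := h0 i
  have h4 : 2 * Real.pi * ρ i ≤ 2 * Real.pi := by nlinarith
  gcongr

/-- Peetre's inequality. -/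
theorem bracket_add_le (a b : E n) : bracket (a + b) ≤ 2 * bracket a * bracket b := by
  refine le_of_sq_le_sq ?_ (by have := bracket_pos a; have := bracket_pos b; positivity)
  rw [mul_pow, mul_pow, bracket_sq, bracket_sq, bracket_sq]
  have := norm_add_le a b
  have h0 : 0 ≤ ‖a + b‖ := norm_nonneg _
  nlinarith [sq_nonneg (‖a‖ - ‖b‖), sq_nonneg (‖a‖ * ‖b‖), norm_nonneg a, norm_nonneg b]

theorem bracket_scl_le (h0 : ∀ i, 0 ≤ ρ i) (h1 : ∀ i, ρ i ≤ 1) (ξ : E n) :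
    bracket (scl ρ ξ) ≤ 2 * Real.pi * bracket ξ := by
  have hpi := Real.pi_gt_three
  refine le_of_sq_le_sq ?_ (by have := bracket_pos ξ; positivity)
  rw [mul_pow, bracket_sq, bracket_sq]
  have h := norm_scl_le h0 h1 ξ
  have h2 : ‖scl ρ ξ‖ ^ 2 ≤ (2 * Real.pi * ‖ξ‖) ^ 2 := by gcongr
  nlinarith [sq_nonneg ‖ξ‖]

theorem bracket_scl_rpow_le (h0 : ∀ i, 0 ≤ ρ i) (h1 : ∀ i, ρ i ≤ 1) (s : ℝ) (ξ η : E n) :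
    bracket (scl ρ ξ) ^ s ≤
      (4 * Real.pi) ^ |s| * bracket (scl ρ η) ^ s * bracket (ξ - η) ^ |s| := by
  have key : ∀ a b : E n, bracket (scl ρ a) ≤ 4 * Real.pi * bracket (scl ρ b) * bracket (a - b) := by
    intro a b
    have h := bracket_add_le (scl ρ b) (scl ρ (a - b))
    rw [← map_add, add_sub_cancel] at h
    have h2 := bracket_scl_le h0 h1 (a - b)
    have h3 := bracket_pos (scl ρ b)
    calc _ ≤ _ := h
      _ ≤ 2 * bracket (scl ρ b) * (2 * Real.pi * bracket (a - b)) := by gcongr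
      _ = _ := by ring
  have hb := bracket_pos (ξ - η)
  have hx := bracket_pos (scl ρ ξ)
  have hy := bracket_pos (scl ρ η)
  have hpi := Real.pi_pos
  have hb' := bracket_pos (η - ξ)
  rcases le_total 0 s with hs | hs
  · rw [abs_of_nonneg hs, ← Real.mul_rpow (by positivity) (by positivity),
      ← Real.mul_rpow (by positivity) (by positivity)]
    exact Real.rpow_le_rpow hx.le (key ξ η) hs
  · have h := Real.rpow_le_rpow_of_nonpos hy (key η ξ) hs
    rw [Real.mul_rpow (by positivity) (by positivity),
      Real.mul_rpow (by positivity) (by positivity), ← neg_sub ξ η, bracket_neg] at h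
    rw [abs_of_nonpos hs, Real.rpow_neg (by positivity), Real.rpow_neg hb.le]
    have h4 : 0 < (4 * Real.pi) ^ s := by positivity
    have h5 : 0 < bracket (ξ - η) ^ s := by positivity
    rw [mul_comm, ← mul_assoc, ← mul_inv, ← div_eq_inv_mul, le_div_iff₀ (by positivity)]
    linarith

theorem wt_le_mul (h0 : ∀ i, 0 ≤ ρ i) (h1 : ∀ i, ρ i ≤ 1) (s k : ℝ) (ξ η : E n) :
    wt ρ s k ξ ≤ (4 * Real.pi) ^ (|s| + |k|) * wt ρ s k η * bracket (ξ - η) ^ (|s| + |k|) := by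
  have e1 := bracket_scl_rpow_le h0 h1 s ξ η
  have e2 := bracket_scl_rpow_le (ρ := (1 : Fin n → ℝ)) (by simp) (by simp) k ξ η
  have hpi := Real.pi_pos
  have := bracket_pos (ξ - η)
  have := bracket_pos (scl ρ ξ)
  have := bracket_pos (scl ρ η)
  have := bracket_pos (scl 1 η)
  have := bracket_pos (scl 1 ξ)
  rw [Real.rpow_add (by positivity), Real.rpow_add (by positivity)]
  calc wt ρ s k ξ ≤ _ := mul_le_mul e1 e2 (by positivity) (by positivity)
    _ = _ := by unfold wt; ring

/-- The squared weighted `L²` norm. -/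
def qn (φ : E n → ℝ) (F : E n → ℂ) : ℝ≥0∞ := ∫⁻ ξ, ENNReal.ofReal (φ ξ ^ 2) * ‖F ξ‖ₑ ^ 2

theorem enorm_add_sq_le (a b : ℂ) : ‖a + b‖ₑ ^ 2 ≤ 2 * ‖a‖ₑ ^ 2 + 2 * ‖b‖ₑ ^ 2 := by
  have h : ‖a + b‖ ^ 2 ≤ 2 * ‖a‖ ^ 2 + 2 * ‖b‖ ^ 2 := by
    have := norm_add_le a b
    nlinarith [norm_nonneg (a + b), sq_nonneg (‖a‖ - ‖b‖)]
  simp only [← ofReal_norm, ← ENNReal.ofReal_pow (norm_nonneg _)]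
  rw [show (2 : ℝ≥0∞) = ENNReal.ofReal 2 by simp, ← ENNReal.ofReal_mul (by norm_num),
    ← ENNReal.ofReal_mul (by norm_num), ← ENNReal.ofReal_add (by positivity) (by positivity)]
  exact ENNReal.ofReal_le_ofReal h

theorem qn_add_le {φ : E n → ℝ} (hφ : Measurable φ) {F G : E n → ℂ} (hF : AEMeasurable F) :
    qn φ (fun ξ => F ξ + G ξ) ≤ 2 * qn φ F + 2 * qn φ G := by
  unfold qn
  rw [← lintegral_const_mul' _ _ (by simp), ← lintegral_const_mul' _ _ (by simp),
    ← lintegral_add_left' (by fun_prop)]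
  refine lintegral_mono fun ξ => ?_
  calc _ ≤ ENNReal.ofReal (φ ξ ^ 2) * (2 * ‖F ξ‖ₑ ^ 2 + 2 * ‖G ξ‖ₑ ^ 2) := by
        gcongr; exact enorm_add_sq_le _ _
    _ = _ := by ring

theorem qn_congr {φ : E n → ℝ} {F G : E n → ℂ} (h : ∀ ξ, ‖F ξ‖ = ‖G ξ‖) : qn φ F = qn φ G := by
  unfold qn
  refine lintegral_congr fun ξ => ?_
  rw [← ofReal_norm, h, ofReal_norm]

theorem qn_mono {φ φ' : E n → ℝ} {F G : E n → ℂ} {C : ℝ}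
    (h : ∀ ξ, |φ ξ| * ‖F ξ‖ ≤ C * (|φ' ξ| * ‖G ξ‖)) :
    qn φ F ≤ ENNReal.ofReal (C ^ 2) * qn φ' G := by
  unfold qn
  rw [← lintegral_const_mul' _ _ (by simp)]
  refine lintegral_mono fun ξ => ?_
  simp only [← ofReal_norm, ← ENNReal.ofReal_pow (norm_nonneg _)]
  rw [← ENNReal.ofReal_mul (by positivity), ← ENNReal.ofReal_mul (by positivity),
    ← ENNReal.ofReal_mul (by positivity)]
  refine ENNReal.ofReal_le_ofReal ?_
  have := pow_le_pow_left₀ (by positivity) (h ξ) 2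
  simpa only [mul_pow, sq_abs, mul_assoc] using this

theorem qn_mono_weight {φ φ' : E n → ℝ} {F : E n → ℂ} (h : ∀ ξ, |φ ξ| ≤ |φ' ξ|) :
    qn φ F ≤ qn φ' F := by
  have := qn_mono (F := F) (G := F) (φ := φ) (φ' := φ') (C := 1)
    fun ξ => by rw [one_mul]; exact mul_le_mul_of_nonneg_right (h ξ) (norm_nonneg _)
  simpa using this

theorem qn_const_mul {φ : E n → ℝ} {F : E n → ℂ} (c : ℂ) :
    qn φ (fun ξ => c * F ξ) = ‖c‖ₑ ^ 2 * qn φ F := by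
  unfold qn
  rw [← lintegral_const_mul' _ _ (by simp)]
  refine lintegral_congr fun ξ => ?_
  rw [enorm_mul]; ring

theorem qn_sum_le {J : Type*} (S : Finset J) {φ : E n → ℝ} (hφ : Measurable φ)
    {F : J → E n → ℂ} (hF : ∀ j ∈ S, AEMeasurable (F j)) :
    qn φ (fun ξ => ∑ j ∈ S, F j ξ) ≤ S.card * ∑ j ∈ S, qn φ (F j) := by
  unfold qn
  rw [← lintegral_finsetSum' _ (fun j hj => by have := hF j hj; fun_prop),
    ← lintegral_const_mul' _ _ (by simp)]
  refine lintegral_mono fun ξ => ?_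
  rw [← Finset.mul_sum, mul_left_comm]
  gcongr
  have h : ‖∑ j ∈ S, F j ξ‖ ^ 2 ≤ S.card * ∑ j ∈ S, ‖F j ξ‖ ^ 2 :=
    (pow_le_pow_left₀ (norm_nonneg _) (norm_sum_le _ _) 2).trans (sq_sum_le_card_mul_sum_sq)
  simp only [← ofReal_norm, ← ENNReal.ofReal_pow (norm_nonneg _)]
  rw [← ENNReal.ofReal_sum_of_nonneg (fun _ _ => by positivity), ← ENNReal.ofReal_natCast,
    ← ENNReal.ofReal_mul (by positivity)]
  exact ENNReal.ofReal_le_ofReal h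

theorem qn_comp_neg {φ : E n → ℝ} (hφ : ∀ ξ, φ (-ξ) = φ ξ) (F : E n → ℂ) :
    qn φ (fun ξ => F (-ξ)) = qn φ F := by
  unfold qn
  rw [← lintegral_neg_eq_self (fun ξ => ENNReal.ofReal (φ ξ ^ 2) * ‖F ξ‖ₑ ^ 2)]
  simp only [hφ]

/-- The Cauchy–Schwarz inequality for weighted `L²` norms. -/
theorem enorm_integral_mul_le {φ : E n → ℝ} (hφ : Measurable φ) (h0 : ∀ ξ, 0 < φ ξ)
    {F G : E n → ℂ} (hF : AEMeasurable F) (hG : AEMeasurable G) :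
    ‖∫ ξ, F ξ * G ξ‖ₑ ^ 2 ≤ qn (fun ξ => (φ ξ)⁻¹) F * qn φ G := by
  have hconj : (2 : ℝ).HolderConjugate 2 := Real.HolderConjugate.two_two
  have h1 : ‖∫ ξ, F ξ * G ξ‖ₑ ≤
      ∫⁻ ξ, ((fun ξ => ENNReal.ofReal ((φ ξ)⁻¹) * ‖F ξ‖ₑ) * fun ξ => ENNReal.ofReal (φ ξ) * ‖G ξ‖ₑ) ξ := by
    refine (enorm_integral_le_lintegral_enorm _).trans (lintegral_mono fun ξ => ?_)
    rw [Pi.mul_apply, enorm_mul, mul_mul_mul_comm, ← ENNReal.ofReal_mul (by have := h0 ξ; positivity),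
      inv_mul_cancel₀ (h0 ξ).ne']
    simp
  have h2 := h1.trans (ENNReal.lintegral_mul_le_Lp_mul_Lq volume hconj (by fun_prop) (by fun_prop))
  calc _ ≤ _ := pow_le_pow_left' h2 2
    _ = _ := by
      rw [mul_pow]
      simp only [← ENNReal.rpow_natCast, ← ENNReal.rpow_mul]
      norm_num
      unfold qn
      congr 1 <;>
      · refine lintegral_congr fun ξ => ?_
        rw [mul_pow, ← ENNReal.ofReal_pow (by have := h0 ξ; positivity)]
        try rw [inv_pow]

theorem lintegral_enorm_sq_eq (f : 𝓢(E n, ℂ)) :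
    ∫⁻ x, ‖f x‖ₑ ^ 2 = ENNReal.ofReal (∫ x, ‖f x‖ ^ 2) := by
  rw [ofReal_integral_eq_lintegral_ofReal]
  · refine lintegral_congr fun x => ?_
    rw [← ofReal_norm, ENNReal.ofReal_pow (norm_nonneg _)]
  · exact (f.memLp 2).integrable_norm_pow (by norm_num)
  · exact Eventually.of_forall fun x => by positivity

/-- Plancherel's theorem. -/
theorem lintegral_enorm_fourier_sq (f : 𝓢(E n, ℂ)) :
    ∫⁻ x, ‖(𝓕 f) x‖ₑ ^ 2 = ∫⁻ x, ‖f x‖ₑ ^ 2 := by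
  rw [lintegral_enorm_sq_eq, lintegral_enorm_sq_eq, SchwartzMap.integral_norm_sq_fourier]

theorem smulLeft_apply {g : E n → ℝ} (hg : g.HasTemperateGrowth) (f : 𝓢(E n, ℂ)) (x : E n) :
    SchwartzMap.smulLeftCLM ℂ g f x = (g x : ℂ) * f x := by
  rw [SchwartzMap.smulLeftCLM_apply_apply hg]; simp

theorem qn_wt_lt_top (f : 𝓢(E n, ℂ)) : qn (wt ρ s k) f < ⊤ := by
  have h : qn (wt ρ s k) f = ∫⁻ x, ‖SchwartzMap.smulLeftCLM ℂ (wt ρ s k) f x‖ₑ ^ 2 := by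
    unfold qn
    refine lintegral_congr fun ξ => ?_
    rw [smulLeft_apply hasTemperateGrowth_wt, enorm_mul, mul_pow, ← ofReal_norm (wt ρ s k ξ : ℂ),
      Complex.norm_real, Real.norm_eq_abs, ← ENNReal.ofReal_pow (abs_nonneg _), sq_abs]
  rw [h, lintegral_enorm_sq_eq]
  exact ENNReal.ofReal_lt_top

theorem fourier_lineDeriv_apply (f : 𝓢(E n, ℂ)) (m ξ : E n) :
    (𝓕 (∂_{m} f)) ξ = 2 * Real.pi * Complex.I * ((inner ℝ ξ m : ℝ) : ℂ) * (𝓕 f) ξ := by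
  rw [SchwartzMap.fourier_lineDerivOp_eq, smul_apply, smulLeft_apply (by fun_prop)]
  simp [mul_assoc]

theorem wt_succ_sq (ρ : Fin n → ℝ) (s k : ℝ) (ξ : E n) :
    wt ρ (s + 1) k ξ ^ 2 =
      wt ρ s k ξ ^ 2 + ∑ i, (wt ρ s k ξ * (2 * Real.pi * ρ i * ξ i)) ^ 2 := by
  have h : wt ρ (s + 1) k ξ = wt ρ s k ξ * bracket (scl ρ ξ) := by
    rw [wt, wt, Real.rpow_add (bracket_pos _), Real.rpow_one]; ring
  rw [h, mul_pow, bracket_sq, EuclideanSpace.norm_sq_eq, mul_add, mul_one, Finset.mul_sum]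
  congr 1
  refine Finset.sum_congr rfl fun i _ => ?_
  rw [scl_apply, Real.norm_eq_abs, sq_abs]; ring

theorem wt_succ_right_sq (ρ : Fin n → ℝ) (s k : ℝ) (ξ : E n) :
    wt ρ s (k + 1) ξ ^ 2 =
      wt ρ s k ξ ^ 2 + ∑ i, (wt ρ s k ξ * (2 * Real.pi * ξ i)) ^ 2 := by
  have h : wt ρ s (k + 1) ξ = wt ρ s k ξ * bracket (scl 1 ξ) := by
    rw [wt, wt, Real.rpow_add (bracket_pos (scl 1 ξ)), Real.rpow_one]; ring
  rw [h, mul_pow, bracket_sq, EuclideanSpace.norm_sq_eq, mul_add, mul_one, Finset.mul_sum]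
  congr 1
  refine Finset.sum_congr rfl fun i _ => ?_
  rw [scl_apply, Real.norm_eq_abs, sq_abs]; simp; ring

theorem qn_eq_add_sum {φ φ₁ : E n → ℝ} {v : Fin n → E n → ℝ} (h1 : Measurable φ₁)
    (hv : ∀ i, Measurable (v i)) {F : E n → ℂ} (hF : AEMeasurable F)
    (h : ∀ ξ, φ ξ ^ 2 = φ₁ ξ ^ 2 + ∑ i, (φ₁ ξ * v i ξ) ^ 2) :
    qn φ F = qn φ₁ F + ∑ i, qn φ₁ fun ξ => (v i ξ : ℂ) * F ξ := by
  unfold qn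
  rw [← lintegral_finsetSum' _ (fun i _ => by have := hv i; fun_prop),
    ← lintegral_add_left' (by fun_prop)]
  refine lintegral_congr fun ξ => ?_
  rw [h, ENNReal.ofReal_add (by positivity) (by positivity), add_mul,
    ENNReal.ofReal_sum_of_nonneg (fun _ _ => by positivity), Finset.sum_mul]
  congr 1
  refine Finset.sum_congr rfl fun i _ => ?_
  rw [mul_pow, ENNReal.ofReal_mul (by positivity), enorm_mul, mul_pow, mul_assoc,
    ← ofReal_norm (v i ξ : ℂ), Complex.norm_real, Real.norm_eq_abs,
    ← ENNReal.ofReal_pow (abs_nonneg _), sq_abs]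

/-- The squared norm of a function in the Sobolev space with weight `⟨2πρξ⟩^s ⟨2πξ⟩^k`. -/
def sn (ρ : Fin n → ℝ) (s k : ℝ) (f : E n → ℂ) : ℝ≥0∞ := qn (wt ρ s k) (𝓕 f)

theorem sn_coe (f : 𝓢(E n, ℂ)) : sn ρ s k f = qn (wt ρ s k) (𝓕 f : 𝓢(E n, ℂ)) := rfl

theorem sn_lt_top (f : 𝓢(E n, ℂ)) : sn ρ s k f < ⊤ := qn_wt_lt_top (𝓕 f)

theorem sn_zero_zero (f : 𝓢(E n, ℂ)) : sn ρ 0 0 f = ∫⁻ x, ‖f x‖ₑ ^ 2 := by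
  rw [← lintegral_enorm_fourier_sq, sn_coe, qn, wt_zero_zero]
  simp

theorem sn_add_le (f g : 𝓢(E n, ℂ)) :
    sn ρ s k (fun x => f x + g x) ≤ 2 * sn ρ s k f + 2 * sn ρ s k g := by
  have h : (fun x => f x + g x) = ⇑(f + g) := rfl
  rw [h, sn_coe, sn_coe, sn_coe, FourierTransform.fourier_add]
  exact qn_add_le continuous_wt.measurable (𝓕 f).continuous.aemeasurable

theorem sn_succ (ρ : Fin n → ℝ) (s k : ℝ) (f : 𝓢(E n, ℂ)) :
    sn ρ (s + 1) k f = sn ρ s k f +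
      ∑ i, sn ρ s k (ρ i • ∂_{(e i : E n)} f : 𝓢(E n, ℂ)) := by
  simp only [sn_coe]
  rw [qn_eq_add_sum (φ₁ := wt ρ s k) (v := fun i ξ => 2 * Real.pi * ρ i * ξ i)
    continuous_wt.measurable (fun i => by fun_prop) (𝓕 f).continuous.aemeasurable (wt_succ_sq ρ s k)]
  congr 1
  refine Finset.sum_congr rfl fun i _ => qn_congr fun ξ => ?_
  have h : (𝓕 (ρ i • ∂_{(e i : E n)} f) : 𝓢(E n, ℂ)) = ρ i • 𝓕 (∂_{(e i : E n)} f) :=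
    FourierTransform.fourier_smul _ _
  rw [h, smul_apply, fourier_lineDeriv_apply]
  simp [e, EuclideanSpace.inner_single_right]; ring

theorem sn_succ_right (ρ : Fin n → ℝ) (s k : ℝ) (f : 𝓢(E n, ℂ)) :
    sn ρ s (k + 1) f = sn ρ s k f + ∑ i, sn ρ s k (∂_{(e i : E n)} f : 𝓢(E n, ℂ)) := by
  simp only [sn_coe]
  rw [qn_eq_add_sum (φ₁ := wt ρ s k) (v := fun i ξ => 2 * Real.pi * ξ i)
    continuous_wt.measurable (fun i => by fun_prop) (𝓕 f).continuous.aemeasurable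
    (wt_succ_right_sq ρ s k)]
  congr 1
  refine Finset.sum_congr rfl fun i _ => qn_congr fun ξ => ?_
  rw [fourier_lineDeriv_apply]
  simp [e, EuclideanSpace.inner_single_right]

theorem sn_sum_le {J : Type*} (S : Finset J) (f : J → 𝓢(E n, ℂ)) :
    sn ρ s k (fun x => ∑ j ∈ S, f j x) ≤ S.card * ∑ j ∈ S, sn ρ s k (f j) := by
  have h : (fun x => ∑ j ∈ S, f j x) = ⇑(∑ j ∈ S, f j) := by ext x; simp
  have h2 : ∀ ξ, (𝓕 (∑ j ∈ S, f j) : 𝓢(E n, ℂ)) ξ = ∑ j ∈ S, (𝓕 (f j) : 𝓢(E n, ℂ)) ξ := by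
    intro ξ
    have := map_sum (FourierTransform.fourierCLM ℂ 𝓢(E n, ℂ)) f S
    simp only [FourierTransform.fourierCLM_apply] at this
    rw [this]; simp
  rw [h, sn_coe, qn_congr fun ξ => by rw [h2]]
  exact qn_sum_le S continuous_wt.measurable fun j _ => (𝓕 (f j)).continuous.aemeasurable

theorem enorm_integral_mul_le_sn (f g : 𝓢(E n, ℂ)) :
    ‖∫ x, f x * g x‖ₑ ^ 2 ≤ sn ρ (-s) (-k) f * sn ρ s k g := by
  have h : ∫ x, f x * g x = ∫ ξ, (𝓕 f) ξ * (𝓕⁻ g) ξ := by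
    have := SchwartzMap.integral_fourier_mul_eq f (𝓕⁻ g)
    rw [this]; simp
  have h2 : sn ρ s k g = qn (wt ρ s k) (𝓕⁻ g : 𝓢(E n, ℂ)) := by
    rw [sn_coe, ← qn_comp_neg wt_neg]
    refine qn_congr fun ξ => ?_
    rw [SchwartzMap.fourierInv_coe, Real.fourierInv_eq_fourier_neg]; rfl
  rw [h, h2, sn_coe]
  refine (enorm_integral_mul_le (φ := wt ρ s k) continuous_wt.measurable (fun ξ => wt_pos ξ)
    (𝓕 f).continuous.aemeasurable (𝓕⁻ g).continuous.aemeasurable).trans_eq ?_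
  simp_rw [wt_inv]

theorem sn_le_of_duality (g : 𝓢(E n, ℂ)) {A : ℝ≥0∞}
    (h : ∀ f : 𝓢(E n, ℂ), ‖∫ x, g x * f x‖ₑ ^ 2 ≤ A * sn ρ s k f) :
    sn ρ (-s) (-k) g ≤ A := by
  let H : 𝓢(E n, ℂ) := SchwartzMap.smulLeftCLM ℂ (wt ρ (-s + -s) (-k + -k))
    (SchwartzMap.postcompCLM (𝕜 := ℝ) (Complex.conjCLE : ℂ →L[ℝ] ℂ) (𝓕 g))
  have hH : ∀ ξ, H ξ = (wt ρ (-s) (-k) ξ : ℂ) ^ 2 * starRingEnd ℂ ((𝓕 g) ξ) := by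
    intro ξ
    rw [smulLeft_apply hasTemperateGrowth_wt, ← wt_mul, SchwartzMap.postcompCLM_apply]
    push_cast; rw [sq]; rfl
  have h1 : ∫ x, g x * (𝓕 H) x = ((∫ ξ, wt ρ (-s) (-k) ξ ^ 2 * ‖(𝓕 g) ξ‖ ^ 2 : ℝ) : ℂ) := by
    rw [← SchwartzMap.integral_fourier_mul_eq, ← integral_complex_ofReal]
    refine integral_congr_ae (Eventually.of_forall fun ξ => ?_)
    simp only [hH]
    rw [mul_left_comm, Complex.mul_conj, Complex.normSq_eq_norm_sq]
    push_cast; ring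
  have hint : sn ρ (-s) (-k) g =
      ENNReal.ofReal (∫ ξ, wt ρ (-s) (-k) ξ ^ 2 * ‖(𝓕 g) ξ‖ ^ 2) := by
    have hm : MemLp (fun ξ => SchwartzMap.smulLeftCLM ℂ (wt ρ (-s) (-k)) (𝓕 g) ξ) 2 :=
      SchwartzMap.memLp (SchwartzMap.smulLeftCLM ℂ (wt ρ (-s) (-k)) (𝓕 g)) 2 volume
    have hi := hm.integrable_norm_pow (p := 2) (by norm_num)
    have he : ∀ ξ, ‖SchwartzMap.smulLeftCLM ℂ (wt ρ (-s) (-k)) (𝓕 g) ξ‖ ^ 2 =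
        wt ρ (-s) (-k) ξ ^ 2 * ‖(𝓕 g) ξ‖ ^ 2 := fun ξ => by
      rw [smulLeft_apply hasTemperateGrowth_wt, norm_mul, Complex.norm_real, mul_pow,
        Real.norm_eq_abs, sq_abs]
    simp only [he] at hi
    rw [ofReal_integral_eq_lintegral_ofReal hi (Eventually.of_forall fun ξ => by positivity), sn_coe,
      qn]
    refine lintegral_congr fun ξ => ?_
    rw [ENNReal.ofReal_mul (by positivity), ENNReal.ofReal_pow (norm_nonneg _), ofReal_norm]
  have h2 : sn ρ s k (𝓕 H : 𝓢(E n, ℂ)) = sn ρ (-s) (-k) g := by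
    have h3 : (𝓕 (𝓕 H) : 𝓢(E n, ℂ)) = fun ξ => H (-ξ) := by
      have h4 : ∀ ξ, (𝓕 (𝓕 H) : 𝓢(E n, ℂ)) ξ = (𝓕⁻ (𝓕 H)) (-ξ) := fun ξ => by
        rw [SchwartzMap.fourierInv_coe, Real.fourierInv_eq_fourier_neg, neg_neg]; rfl
      funext ξ; rw [h4]; simp
    rw [sn_coe, h3, qn_comp_neg wt_neg, sn_coe, qn, qn]
    refine lintegral_congr fun ξ => ?_
    rw [hH, enorm_mul, mul_pow, ← ofReal_norm ((wt ρ (-s) (-k) ξ : ℂ) ^ 2), norm_pow,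
      Complex.norm_real, Real.norm_eq_abs, sq_abs, ← ENNReal.ofReal_pow (by positivity), ← mul_assoc,
      ← ENNReal.ofReal_mul (by positivity), ← wt_inv]
    congr 2
    · have := (wt_pos (ρ := ρ) (s := s) (k := k) ξ).ne'
      field_simp
    · rw [← ofReal_norm, RCLike.norm_conj, ofReal_norm]
  have h3 := h (𝓕 H)
  rw [h1, h2] at h3
  have h4 : ‖((∫ ξ, wt ρ (-s) (-k) ξ ^ 2 * ‖(𝓕 g) ξ‖ ^ 2 : ℝ) : ℂ)‖ₑ = sn ρ (-s) (-k) g := by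
    rw [hint, ← ofReal_norm, Complex.norm_real, Real.norm_of_nonneg]
    exact integral_nonneg fun ξ => by positivity
  rw [h4, sq] at h3
  rcases eq_or_ne (sn ρ (-s) (-k) g) 0 with h0 | h0
  · simp [h0]
  · exact (ENNReal.mul_le_mul_iff_left h0 (sn_lt_top g).ne).1 h3

end Weights

section Interpolation

/-- The normalization constant in the interpolation of weights. -/
def interpConst (θ : ℝ) : ℝ≥0∞ := ∫⁻ t in Ioi (0 : ℝ), ENNReal.ofReal (t ^ (-θ) / (1 + t))

theorem interpConst_lt_top {θ : ℝ} (h0 : 0 < θ) (h1 : θ < 1) : interpConst θ < ⊤ := by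
  have hu : Ioi (0 : ℝ) = Ioc 0 1 ∪ Ioi 1 := (Ioc_union_Ioi_eq_Ioi zero_le_one).symm
  unfold interpConst
  rw [hu]
  refine (lintegral_union_le _ _ _).trans_lt (ENNReal.add_lt_top.2 ⟨?_, ?_⟩)
  · have h : IntegrableOn (fun t : ℝ => t ^ (-θ)) (Ioc 0 1) :=
      (intervalIntegrable_iff_integrableOn_Ioc_of_le zero_le_one).1
        (intervalIntegral.intervalIntegrable_rpow' (by linarith))
    refine lt_of_le_of_lt (setLIntegral_mono' measurableSet_Ioc fun t ht => ?_) h.lintegral_lt_top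
    refine ENNReal.ofReal_le_ofReal (div_le_self (Real.rpow_nonneg ht.1.le _) (by linarith [ht.1]))
  · have h : IntegrableOn (fun t : ℝ => t ^ (-θ - 1)) (Ioi 1) :=
      integrableOn_Ioi_rpow_of_lt (by linarith) one_pos
    refine lt_of_le_of_lt (setLIntegral_mono' measurableSet_Ioi fun t ht => ?_) h.lintegral_lt_top
    have ht0 : 0 < t := one_pos.trans ht
    rw [Real.rpow_sub_one ht0.ne']
    exact ENNReal.ofReal_le_ofReal (div_le_div_of_nonneg_left (Real.rpow_nonneg ht0.le _) ht0
      (by linarith))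

theorem interpConst_ne_zero {θ : ℝ} (h0 : 0 < θ) : interpConst θ ≠ 0 := by
  have h : (1 / 2 : ℝ≥0∞) ≤ interpConst θ := by
    calc (1 / 2 : ℝ≥0∞) = ∫⁻ _ in Ioc (0 : ℝ) 1, ENNReal.ofReal (1 / 2) := by
          simp
      _ ≤ ∫⁻ t in Ioc (0 : ℝ) 1, ENNReal.ofReal (t ^ (-θ) / (1 + t)) := by
          refine setLIntegral_mono' measurableSet_Ioc fun t ht => ENNReal.ofReal_le_ofReal ?_
          have h3 : 1 ≤ t ^ (-θ) := Real.one_le_rpow_of_pos_of_le_one_of_nonpos ht.1 ht.2 (by linarith)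
          exact div_le_div₀ (by linarith) h3 (by linarith [ht.1]) (by linarith [ht.2])
      _ ≤ _ := lintegral_mono_set Ioc_subset_Ioi_self
  intro h2
  rw [h2] at h
  simp at h

theorem lintegral_interp {θ b : ℝ} (hb : 0 < b) :
    ∫⁻ t in Ioi (0 : ℝ), ENNReal.ofReal (t ^ (-θ - 1) * (t * b / (1 + t * b))) =
      ENNReal.ofReal (b ^ θ) * interpConst θ := by
  let g : ℝ → ℝ≥0∞ := (Ioi 0).indicator fun t => ENNReal.ofReal (t ^ (-θ) / (1 + t))
  have hg : Measurable g := by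
    refine Measurable.indicator ?_ measurableSet_Ioi
    fun_prop
  have h1 : ∫⁻ t, g (b * t) = ENNReal.ofReal b⁻¹ * interpConst θ := by
    rw [← lintegral_map hg (by fun_prop : Measurable fun t => b * t),
      Real.map_volume_mul_left hb.ne', lintegral_smul_measure, abs_of_pos (inv_pos.2 hb)]
    rw [lintegral_indicator measurableSet_Ioi]
    rfl
  have h2 : ∫⁻ t in Ioi (0 : ℝ), ENNReal.ofReal (t ^ (-θ - 1) * (t * b / (1 + t * b))) =
      ∫⁻ t, ENNReal.ofReal (b ^ (θ + 1)) * g (b * t) := by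
    rw [← lintegral_indicator measurableSet_Ioi]
    refine lintegral_congr fun t => ?_
    by_cases ht : 0 < t
    · have hbt : 0 < b * t := mul_pos hb ht
      rw [indicator_of_mem (show t ∈ Ioi 0 from ht)]
      simp only [g]
      rw [indicator_of_mem (show b * t ∈ Ioi 0 from hbt), ← ENNReal.ofReal_mul (by positivity)]
      congr 1
      rw [Real.mul_rpow hb.le ht.le, Real.rpow_sub_one ht.ne', Real.rpow_add_one hb.ne',
        Real.rpow_neg hb.le]
      have : 0 < b ^ θ := by positivity
      field_simp
    · have hbt : ¬ 0 < b * t := fun h => ht (pos_of_mul_pos_right h hb.le)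
      simp only [g]
      rw [indicator_of_notMem (show t ∉ Ioi 0 from ht),
        indicator_of_notMem (show b * t ∉ Ioi 0 from hbt), mul_zero]
  rw [h2, lintegral_const_mul' _ _ (by simp), h1, ← mul_assoc, ← ENNReal.ofReal_mul (by positivity),
    Real.rpow_add_one hb.ne']
  congr 2
  field_simp

variable {n : ℕ}

/-- The weights in the `K`-functional between the orders `j` and `j + 1`. -/
def interpWt (ρ : Fin n → ℝ) (j k t : ℝ) (ξ : E n) : ℝ :=
  wt ρ j k ξ * √(t * bracket (scl ρ ξ) ^ 2 / (1 + t * bracket (scl ρ ξ) ^ 2))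

theorem interpWt_sq {ρ : Fin n → ℝ} {j k t : ℝ} (ht : 0 < t) (ξ : E n) :
    interpWt ρ j k t ξ ^ 2 =
      wt ρ j k ξ ^ 2 * (t * bracket (scl ρ ξ) ^ 2 / (1 + t * bracket (scl ρ ξ) ^ 2)) := by
  rw [interpWt, mul_pow, Real.sq_sqrt (by positivity)]

theorem continuous_interpWt {ρ : Fin n → ℝ} {j k : ℝ} {t : ℝ} (ht : 0 < t) :
    Continuous (interpWt ρ j k t) := by
  unfold interpWt
  have h1 : Continuous fun ξ : E n => bracket (scl ρ ξ) := continuous_bracket.comp (scl ρ).continuous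
  refine continuous_wt.mul (Real.continuous_sqrt.comp ?_)
  refine Continuous.div (by fun_prop) (by fun_prop) fun ξ => ?_
  have := bracket_pos (scl ρ ξ)
  positivity


theorem qn_interp {ρ : Fin n → ℝ} {j k θ : ℝ} {F : E n → ℂ} (hF : Measurable F) :
    ∫⁻ t in Ioi (0 : ℝ), ENNReal.ofReal (t ^ (-θ - 1)) * qn (interpWt ρ j k t) F =
      qn (wt ρ (j + θ) k) F * interpConst θ := by
  have hb : Continuous fun ξ : E n => bracket (scl ρ ξ) := continuous_bracket.comp (scl ρ).continuous
  have hw : Continuous (wt ρ j k) := continuous_wt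
  have h1 : ∀ t ∈ Ioi (0 : ℝ), ENNReal.ofReal (t ^ (-θ - 1)) * qn (interpWt ρ j k t) F =
      ∫⁻ ξ, ENNReal.ofReal (wt ρ j k ξ ^ 2) * ‖F ξ‖ₑ ^ 2 * ENNReal.ofReal
        (t ^ (-θ - 1) * (t * bracket (scl ρ ξ) ^ 2 / (1 + t * bracket (scl ρ ξ) ^ 2))) := by
    intro t ht
    have ht : 0 < t := ht
    rw [qn, ← lintegral_const_mul' _ _ (by simp)]
    refine lintegral_congr fun ξ => ?_
    rw [interpWt_sq ht, ENNReal.ofReal_mul (by positivity), ENNReal.ofReal_mul (by positivity)]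
    ring
  rw [setLIntegral_congr_fun measurableSet_Ioi h1, lintegral_lintegral_swap]
  · rw [qn, ← lintegral_mul_const _ (by have := (continuous_wt (ρ := ρ) (s := j + θ) (k := k)); fun_prop)]
    refine lintegral_congr fun ξ => ?_
    have hbp : 0 < bracket (scl ρ ξ) := bracket_pos _
    rw [lintegral_const_mul _ (by fun_prop), lintegral_interp (by positivity), ← mul_assoc]
    congr 1
    rw [mul_right_comm, ← ENNReal.ofReal_mul (by positivity)]
    congr 2
    simp only [wt]
    rw [Real.rpow_add hbp, ← Real.rpow_natCast (bracket (scl ρ ξ)) 2, ← Real.rpow_mul hbp.le,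
      mul_comm ((2 : ℕ) : ℝ) θ, Real.rpow_mul hbp.le, Real.rpow_natCast]
    ring
  · refine Measurable.aemeasurable ?_
    have h3 : Measurable fun p : ℝ × E n => bracket (scl ρ p.2) := hb.measurable.comp measurable_snd
    have h4 : Measurable fun p : ℝ × E n => wt ρ j k p.2 := hw.measurable.comp measurable_snd
    have h5 : Measurable fun p : ℝ × E n => F p.2 := hF.comp measurable_snd
    simp only [Function.uncurry_def]
    fun_prop

theorem hasTemperateGrowth_resolvent (ρ : Fin n → ℝ) {t : ℝ} (ht : 0 < t) :
    Function.HasTemperateGrowth fun ξ : E n => (1 + t * bracket (scl ρ ξ) ^ 2)⁻¹ := by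
  let c := √(t / (1 + t))
  have h := ((Function.HasTemperateGrowth.const (E := E n) (1 + t)⁻¹)).mul
    ((hasTemperateGrowth_bracket_rpow (n := n) (-2)).comp (c • scl ρ : E n →L[ℝ] E n).hasTemperateGrowth)
  refine (congrArg Function.HasTemperateGrowth (funext fun ξ => ?_)).mpr h
  have hc : c ^ 2 = t / (1 + t) := Real.sq_sqrt (by positivity)
  simp only [Pi.mul_apply, Function.comp, smul_apply]
  rw [show (-2 : ℝ) = -((2 : ℕ) : ℝ) by norm_num, Real.rpow_neg (bracket_pos _).le, Real.rpow_natCast,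
    bracket_sq, bracket_sq, norm_smul, mul_pow, Real.norm_eq_abs, sq_abs, hc, ← mul_inv]
  congr 1
  field_simp
  ring

/-- Interpolation between the orders `j` and `j + 1`. -/
theorem sn_interp {ρ ρ' : Fin n → ℝ} {j k θ : ℝ} (h0 : 0 < θ) (h1 : θ < 1) {C : ℝ≥0∞} (hC : C ≠ ⊤)
    {T : 𝓢(E n, ℂ) → 𝓢(E n, ℂ)} (hT : ∀ f g, T (f + g) = T f + T g)
    (hj : ∀ f, sn ρ' j k (T f) ≤ C * sn ρ j k f)
    (hj1 : ∀ f, sn ρ' (j + 1) k (T f) ≤ C * sn ρ (j + 1) k f) (f : 𝓢(E n, ℂ)) :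
    sn ρ' (j + θ) k (T f) ≤ 2 * C * sn ρ (j + θ) k f := by
  have key : ∀ t : ℝ, 0 < t → qn (interpWt ρ' j k t) (𝓕 (T f) : 𝓢(E n, ℂ)) ≤
      2 * C * qn (interpWt ρ j k t) (𝓕 f : 𝓢(E n, ℂ)) := by
    intro t ht
    let m : E n → ℝ := fun ξ => (1 + t * bracket (scl ρ ξ) ^ 2)⁻¹
    have hm : m.HasTemperateGrowth := hasTemperateGrowth_resolvent ρ ht
    let f₁ : 𝓢(E n, ℂ) := 𝓕⁻ (SchwartzMap.smulLeftCLM ℂ m (𝓕 f))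
    let f₀ : 𝓢(E n, ℂ) := f - f₁
    have hf1 : ∀ ξ, (𝓕 f₁) ξ = (m ξ : ℂ) * (𝓕 f) ξ := fun ξ => by
      simp only [f₁, FourierTransform.fourier_fourierInv_eq]
      exact smulLeft_apply hm _ _
    have hf0 : ∀ ξ, (𝓕 f₀) ξ = ((1 - m ξ : ℝ) : ℂ) * (𝓕 f) ξ := fun ξ => by
      have : (𝓕 f₀ : 𝓢(E n, ℂ)) = 𝓕 f - 𝓕 f₁ := by
        simpa only [FourierTransform.fourierCLM_apply] using
          map_sub (FourierTransform.fourierCLM ℂ 𝓢(E n, ℂ)) f f₁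
      rw [this, sub_apply, hf1]; push_cast; ring
    have hTf : T f = T f₀ + T f₁ := by rw [← hT]; simp [f₀]
    have hadd : ⇑(𝓕 (T f) : 𝓢(E n, ℂ)) =
        fun ξ => (𝓕 (T f₀) : 𝓢(E n, ℂ)) ξ + (𝓕 (T f₁) : 𝓢(E n, ℂ)) ξ := by
      rw [hTf, FourierTransform.fourier_add]; rfl
    have e0 : qn (interpWt ρ' j k t) (𝓕 (T f₀) : 𝓢(E n, ℂ)) ≤ C * sn ρ j k f₀ := by
      refine le_trans ?_ (hj f₀)
      refine qn_mono_weight fun ξ => ?_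
      have hb := bracket_pos (scl ρ' ξ)
      rw [interpWt, abs_mul]
      refine mul_le_of_le_one_right (abs_nonneg _) ?_
      rw [abs_of_nonneg (Real.sqrt_nonneg _), Real.sqrt_le_iff, one_pow, div_le_one (by positivity)]
      exact ⟨zero_le_one, by linarith⟩
    have e1 : qn (interpWt ρ' j k t) (𝓕 (T f₁) : 𝓢(E n, ℂ)) ≤
        C * (ENNReal.ofReal t * sn ρ (j + 1) k f₁) := by
      rw [mul_left_comm]
      refine le_trans ?_ (mul_le_mul_right (hj1 f₁) _)
      have h3 := qn_mono (φ := interpWt ρ' j k t) (φ' := wt ρ' (j + 1) k)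
        (F := (𝓕 (T f₁) : 𝓢(E n, ℂ))) (G := (𝓕 (T f₁) : 𝓢(E n, ℂ))) (C := √t) fun ξ => ?_
      · rwa [Real.sq_sqrt ht.le] at h3
      have hb := bracket_pos (scl ρ' ξ)
      rw [← mul_assoc]
      refine mul_le_mul_of_nonneg_right ?_ (norm_nonneg _)
      have h4 : wt ρ' (j + 1) k ξ = wt ρ' j k ξ * bracket (scl ρ' ξ) := by
        rw [wt, wt, Real.rpow_add_one hb.ne']; ring
      rw [abs_of_pos (wt_pos ξ), h4, interpWt, abs_of_nonneg (by have := wt_pos (ρ := ρ') (s := j) (k := k) ξ; positivity)]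
      have h5 : √(t * bracket (scl ρ' ξ) ^ 2 / (1 + t * bracket (scl ρ' ξ) ^ 2)) ≤
          √t * bracket (scl ρ' ξ) := by
        rw [Real.sqrt_le_left (by positivity), mul_pow, Real.sq_sqrt ht.le]
        exact div_le_self (by positivity) (by nlinarith [sq_nonneg (bracket (scl ρ' ξ))])
      have := wt_pos (ρ := ρ') (s := j) (k := k) ξ
      calc _ ≤ wt ρ' j k ξ * (√t * bracket (scl ρ' ξ)) := by gcongr
        _ = _ := by ring
    have e2 : sn ρ j k f₀ + ENNReal.ofReal t * sn ρ (j + 1) k f₁ =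
        qn (interpWt ρ j k t) (𝓕 f : 𝓢(E n, ℂ)) := by
      have c1 := (continuous_wt (ρ := ρ) (s := j) (k := k)).measurable
      have c2 := (𝓕 f₀).continuous.measurable
      rw [sn_coe, sn_coe, qn, qn, qn, ← lintegral_const_mul' _ _ (by simp), ← lintegral_add_left (by fun_prop)]
      refine lintegral_congr fun ξ => ?_
      have hb := bracket_pos (scl ρ ξ)
      have h4 : wt ρ (j + 1) k ξ = wt ρ j k ξ * bracket (scl ρ ξ) := by
        rw [wt, wt, Real.rpow_add_one hb.ne']; ring
      rw [hf0, hf1, interpWt_sq ht, h4]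
      simp only [← ofReal_norm, ← ENNReal.ofReal_pow (norm_nonneg _)]
      simp only [norm_mul, Complex.norm_real, Real.norm_eq_abs, mul_pow, sq_abs]
      rw [← ENNReal.ofReal_mul (by positivity), ← ENNReal.ofReal_mul (by positivity),
        ← ENNReal.ofReal_mul (by positivity), ← ENNReal.ofReal_mul (by positivity),
        ← ENNReal.ofReal_add (by positivity) (by positivity)]
      congr 1
      simp only [m]
      field_simp
      ring
    calc _ ≤ 2 * (C * sn ρ j k f₀) + 2 * (C * (ENNReal.ofReal t * sn ρ (j + 1) k f₁)) := by
          rw [hadd]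
          refine (qn_add_le (continuous_interpWt ht).measurable
            (𝓕 (T f₀)).continuous.aemeasurable).trans ?_
          gcongr
      _ = _ := by rw [← e2]; ring
  have hc0 := interpConst_ne_zero h0
  have hc1 := (interpConst_lt_top h0 h1).ne
  refine (ENNReal.mul_le_mul_iff_left hc0 hc1).1 ?_
  rw [sn_coe, sn_coe, mul_assoc, ← qn_interp (𝓕 (T f)).continuous.measurable,
    ← qn_interp (𝓕 f).continuous.measurable]
  rw [← lintegral_const_mul' _ _ (ENNReal.mul_ne_top (by simp) hC)]
  refine setLIntegral_mono' measurableSet_Ioi fun t ht => ?_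
  rw [mul_left_comm]
  gcongr
  exact key t ht

end Interpolation

section Schur

variable {n : ℕ}

/-- Schur's test (Young's inequality) for convolution kernels. -/
theorem lintegral_conv_sq_le {κ g : E n → ℝ≥0∞} (hκ : Measurable κ) (hg : Measurable g) :
    ∫⁻ τ, (∫⁻ ζ, κ (τ - ζ) * g ζ) ^ 2 ≤ (∫⁻ ζ, κ ζ) ^ 2 * ∫⁻ ζ, g ζ ^ 2 := by
  have hconj : (2 : ℝ).HolderConjugate 2 := Real.HolderConjugate.two_two
  have h1 : ∀ τ, (∫⁻ ζ, κ (τ - ζ) * g ζ) ^ 2 ≤ (∫⁻ ζ, κ ζ) * ∫⁻ ζ, κ (τ - ζ) * g ζ ^ 2 := by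
    intro τ
    have h2 := ENNReal.lintegral_mul_le_Lp_mul_Lq (volume : Measure (E n)) hconj
      (f := fun ζ => κ (τ - ζ) ^ (1 / 2 : ℝ)) (g := fun ζ => κ (τ - ζ) ^ (1 / 2 : ℝ) * g ζ)
      (by fun_prop) (by fun_prop)
    have h3 : ∀ x : ℝ≥0∞, x ^ (1 / 2 : ℝ) * x ^ (1 / 2 : ℝ) = x := fun x => by
      rw [← ENNReal.rpow_add_of_nonneg _ _ (by norm_num) (by norm_num)]; norm_num
    simp only [Pi.mul_apply, ← mul_assoc, h3, ENNReal.rpow_two, mul_pow] at h2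
    have h4 : ∀ x : ℝ≥0∞, (x ^ (1 / 2 : ℝ)) ^ 2 = x := fun x => by rw [sq, h3]
    simp only [h4] at h2
    rw [lintegral_sub_left_eq_self κ τ] at h2
    calc _ ≤ _ := pow_le_pow_left' h2 2
      _ = _ := by rw [mul_pow, h4, h4]
  calc _ ≤ ∫⁻ τ, (∫⁻ ζ, κ ζ) * ∫⁻ ζ, κ (τ - ζ) * g ζ ^ 2 := lintegral_mono h1
    _ = (∫⁻ ζ, κ ζ) * ∫⁻ τ, ∫⁻ ζ, κ (τ - ζ) * g ζ ^ 2 := by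
      rw [lintegral_const_mul]
      exact Measurable.lintegral_prod_right' (f := fun p : E n × E n => κ (p.1 - p.2) * g p.2 ^ 2)
        (by fun_prop)
    _ = (∫⁻ ζ, κ ζ) * ∫⁻ ζ, ∫⁻ τ, κ (τ - ζ) * g ζ ^ 2 := by
      rw [lintegral_lintegral_swap]
      exact Measurable.aemeasurable (by fun_prop)
    _ = _ := by
      have h5 : ∀ ζ, ∫⁻ τ, κ (τ - ζ) * g ζ ^ 2 = (∫⁻ ζ, κ ζ) * g ζ ^ 2 := fun ζ => by
        rw [lintegral_mul_const _ (by fun_prop), lintegral_sub_right_eq_self κ ζ]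
      simp_rw [h5]
      rw [lintegral_const_mul _ (by fun_prop), sq, mul_assoc]

theorem lintegral_bracket_lt_top :
    ∫⁻ ξ : E n, ENNReal.ofReal (bracket ξ ^ (-((n : ℝ) + 1))) < ⊤ := by
  have h : Integrable (fun ξ : E n => (1 + ‖ξ‖ ^ 2) ^ (-((n : ℝ) + 1) / 2)) :=
    integrable_rpow_neg_one_add_norm_sq (by simp)
  simp_rw [bracket_rpow]
  exact h.lintegral_lt_top

theorem continuous_bracket_rpow (s : ℝ) : Continuous fun ξ : E n => bracket ξ ^ s :=
  (hasTemperateGrowth_bracket_rpow s).1.continuous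

/-- An operator whose kernel on the Fourier side decays off the diagonal has order `m`. -/
theorem qn_le_of_kernel (s m k : ℝ) : ∃ C : ℝ, 0 < C ∧ ∀ ρ : Fin n → ℝ, (∀ i, 0 ≤ ρ i) →
    (∀ i, ρ i ≤ 1) → ∀ A : ℝ, 0 ≤ A → ∀ V W : E n → ℂ, Measurable V → (∀ τ, ‖W τ‖ₑ ≤
      ∫⁻ ζ, ENNReal.ofReal (A * bracket (τ - ζ) ^ (-(|s - m| + |k| + (n + 1))) * wt ρ m 0 ζ) *
        ‖V ζ‖ₑ) → qn (wt ρ (s - m) k) W ≤ ENNReal.ofReal (C * A ^ 2) * qn (wt ρ s k) V := by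
  set c := (∫⁻ ξ : E n, ENNReal.ofReal (bracket ξ ^ (-((n : ℝ) + 1)))) with hc
  have hctop : c < ⊤ := lintegral_bracket_lt_top
  set L := |s - m| + |k| with hL
  have hpi := Real.pi_pos
  refine ⟨((4 * Real.pi) ^ L) ^ 2 * (c.toReal ^ 2 + 1), by positivity, ?_⟩
  intro ρ h0 h1 A hA V W hV hW
  have hbr : Measurable fun ξ : E n => ENNReal.ofReal (bracket ξ ^ (-((n : ℝ) + 1))) :=
    (continuous_bracket_rpow _).measurable.ennreal_ofReal
  have hwt : Measurable (wt ρ s k) := continuous_wt.measurable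
  have h2 : ∀ τ, ENNReal.ofReal (wt ρ (s - m) k τ ^ 2) * ‖W τ‖ₑ ^ 2 ≤
      ENNReal.ofReal ((A * (4 * Real.pi) ^ L) ^ 2) * (∫⁻ ζ, ENNReal.ofReal (bracket (τ - ζ) ^ (-((n : ℝ) + 1))) *
        (ENNReal.ofReal (wt ρ s k ζ) * ‖V ζ‖ₑ)) ^ 2 := by
    intro τ
    have hp := wt_pos (ρ := ρ) (s := s - m) (k := k) τ
    rw [ENNReal.ofReal_pow hp.le, ← mul_pow, ENNReal.ofReal_pow (by positivity), ← mul_pow,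
      ← lintegral_const_mul' _ _ (by simp)]
    refine pow_le_pow_left' ((mul_le_mul_right (hW τ) _).trans ?_) 2
    rw [← lintegral_const_mul' _ _ (by simp)]
    refine lintegral_mono fun ζ => ?_
    have hb := bracket_pos (τ - ζ)
    have hwm := wt_pos (ρ := ρ) (s := m) (k := 0) ζ
    have hws := wt_pos (ρ := ρ) (s := s) (k := k) ζ
    rw [← mul_assoc, ← mul_assoc, ← mul_assoc, ← ENNReal.ofReal_mul hp.le,
      ← ENNReal.ofReal_mul (by positivity), ← ENNReal.ofReal_mul (by positivity)]
    refine mul_le_mul_left (ENNReal.ofReal_le_ofReal ?_) _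
    have h3 := wt_le_mul h0 h1 (s - m) k τ ζ
    rw [← hL] at h3
    have h4 : wt ρ s k ζ = wt ρ (s - m) k ζ * wt ρ m 0 ζ := by rw [wt_mul]; simp
    rw [h4, neg_add, Real.rpow_add hb, Real.rpow_neg hb.le]
    calc _ ≤ ((4 * Real.pi) ^ L * wt ρ (s - m) k ζ * bracket (τ - ζ) ^ L) *
          (A * ((bracket (τ - ζ) ^ L)⁻¹ * bracket (τ - ζ) ^ (-((n : ℝ) + 1))) * wt ρ m 0 ζ) := by
          gcongr
      _ = _ := by
          have : bracket (τ - ζ) ^ L ≠ 0 := by positivity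
          field_simp
  calc _ ≤ _ := lintegral_mono h2
    _ = ENNReal.ofReal ((A * (4 * Real.pi) ^ L) ^ 2) * _ := lintegral_const_mul' _ _ (by simp)
    _ ≤ ENNReal.ofReal ((A * (4 * Real.pi) ^ L) ^ 2) * (c ^ 2 * ∫⁻ ζ, (ENNReal.ofReal (wt ρ s k ζ) * ‖V ζ‖ₑ) ^ 2) := by
      gcongr
      exact lintegral_conv_sq_le hbr (by fun_prop)
    _ ≤ _ := by
      have h5 : ∫⁻ ζ, (ENNReal.ofReal (wt ρ s k ζ) * ‖V ζ‖ₑ) ^ 2 = qn (wt ρ s k) V := by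
        unfold qn
        refine lintegral_congr fun ζ => ?_
        rw [mul_pow, ENNReal.ofReal_pow (wt_pos ζ).le]
      rw [h5, ← mul_assoc]
      refine mul_le_mul_left ?_ _
      have h6 : c ^ 2 = ENNReal.ofReal (c.toReal ^ 2) := by
        rw [ENNReal.ofReal_pow (by positivity), ENNReal.ofReal_toReal hctop.ne]
      rw [h6, ← ENNReal.ofReal_mul (by positivity)]
      refine ENNReal.ofReal_le_ofReal ?_
      nlinarith [sq_nonneg (A * (4 * Real.pi) ^ L)]

end Schur

theorem isClosed_closedCube (n : ℕ) (r : ℝ) : IsClosed (closedCube n r) := by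
  have h : closedCube n r = ⋂ i : Fin n, {x : E n | |x i| ≤ r} := by
    ext x; simp [closedCube]
  rw [h]
  exact isClosed_iInter fun i => isClosed_le (by fun_prop) continuous_const

theorem isCompact_closedCube (n : ℕ) (r : ℝ) : IsCompact (closedCube n r) := by
  refine Metric.isCompact_of_isClosed_isBounded (isClosed_closedCube n r) ?_
  rw [isBounded_iff_forall_norm_le]
  refine ⟨√(n * r ^ 2), fun x hx => ?_⟩
  refine Real.le_sqrt_of_sq_le ?_
  rw [EuclideanSpace.norm_sq_eq]
  calc ∑ i, ‖x i‖ ^ 2 ≤ ∑ _i : Fin n, r ^ 2 := Finset.sum_le_sum fun i _ =>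
        pow_le_pow_left₀ (norm_nonneg _) (by simpa using hx i) 2
    _ = n * r ^ 2 := by simp

theorem closedCube_subset_cube {n : ℕ} {r r' : ℝ} (h : r < r') : closedCube n r ⊆ cube n r' :=
  fun _ hx i => (hx i).trans_lt h

theorem cube_subset_closedCube {n : ℕ} {r : ℝ} : cube n r ⊆ closedCube n r :=
  fun _ hx i => (hx i).le

theorem cube_mono {n : ℕ} {r r' : ℝ} (h : r ≤ r') : cube n r ⊆ cube n r' :=
  fun _ hx i => (hx i).trans_le h

theorem closedCube_mono {n : ℕ} {r r' : ℝ} (h : r ≤ r') : closedCube n r ⊆ closedCube n r' :=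
  fun _ hx i => (hx i).trans h

theorem abs_apply_le_norm {n : ℕ} (x : E n) (i : Fin n) : |x i| ≤ ‖x‖ := by
  simpa using PiLp.norm_apply_le x i

theorem mem_closedCube_of_norm_sub_le {n : ℕ} {r ε : ℝ} {x y : E n} (hx : x ∈ closedCube n r)
    (h : ‖y - x‖ ≤ ε) : y ∈ closedCube n (r + ε) := fun i => by
  have h1 := abs_apply_le_norm (y - x) i
  rw [PiLp.sub_apply] at h1
  have h2 := abs_sub_abs_le_abs_sub (y i) (x i)
  linarith [hx i]

theorem convex_cube (n : ℕ) (r : ℝ) : Convex ℝ (cube n r) := by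
  have h : cube n r = ⋂ i : Fin n, (EuclideanSpace.proj i : E n →L[ℝ] ℝ) ⁻¹' Ioo (-r) r := by
    ext x; simp [cube, abs_lt]
  rw [h]
  exact convex_iInter fun i => (convex_Ioo _ _).linear_preimage (EuclideanSpace.proj i : E n →L[ℝ] ℝ).toLinearMap

namespace SBGStructure

variable {n : ℕ} {M : Type*} [TopologicalSpace M] [ChartedSpace (E n) M] {ι : Type*}
  (B : SBGStructure n M ι)

/-- The domain `φ_α(U_α ∩ U_β)` of the transition function. -/
def dom (α β : ι) : Set (E n) := ((B.chart α).symm.trans (B.chart β)).source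

/-- The transition function `φ_β ∘ φ_α⁻¹`. -/
def tr (α β : ι) (x : E n) : E n := B.chart β ((B.chart α).symm x)

variable {B} {α β γ : ι} {x : E n}

theorem isOpen_dom : IsOpen (B.dom α β) := ((B.chart α).symm.trans (B.chart β)).open_source

theorem mem_dom : x ∈ B.dom α β ↔ x ∈ cube n 2 ∧ (B.chart α).symm x ∈ (B.chart β).source := by
  simp [dom, B.chart_target]

theorem mem_cube_of_mem_source {p : M} (hp : p ∈ (B.chart α).source) : B.chart α p ∈ cube n 2 := by
  rw [← B.chart_target α]; exact (B.chart α).map_source hp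

theorem symm_mem_source (hx : x ∈ cube n 2) : (B.chart α).symm x ∈ (B.chart α).source :=
  (B.chart α).map_target (by rwa [B.chart_target])

theorem chart_symm (hx : x ∈ cube n 2) : B.chart α ((B.chart α).symm x) = x :=
  (B.chart α).right_inv (by rwa [B.chart_target])

theorem symm_chart {p : M} (hp : p ∈ (B.chart α).source) : (B.chart α).symm (B.chart α p) = p :=
  (B.chart α).left_inv hp

theorem chart_mem_dom {p : M} (h1 : p ∈ (B.chart α).source) (h2 : p ∈ (B.chart β).source) :
    B.chart α p ∈ B.dom α β :=
  mem_dom.2 ⟨mem_cube_of_mem_source h1, by rwa [symm_chart h1]⟩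

theorem symm_tr (hx : x ∈ B.dom α β) : (B.chart β).symm (B.tr α β x) = (B.chart α).symm x :=
  symm_chart (mem_dom.1 hx).2

theorem tr_mem_dom (hx : x ∈ B.dom α β) : B.tr α β x ∈ B.dom β α :=
  mem_dom.2 ⟨mem_cube_of_mem_source (mem_dom.1 hx).2, by
    rw [symm_tr hx]; exact symm_mem_source (mem_dom.1 hx).1⟩

theorem tr_tr (hx : x ∈ B.dom α β) : B.tr β α (B.tr α β x) = x := by
  rw [tr, symm_tr hx, chart_symm (mem_dom.1 hx).1]

theorem image_tr : B.tr α β '' B.dom α β = B.dom β α := by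
  ext y
  constructor
  · rintro ⟨x, hx, rfl⟩; exact tr_mem_dom hx
  · intro hy; exact ⟨_, tr_mem_dom hy, tr_tr hy⟩

theorem injOn_tr : InjOn (B.tr α β) (B.dom α β) := fun x hx y hy h => by
  rw [← tr_tr hx, h, tr_tr hy]

theorem dom_subset_cube : B.dom α β ⊆ cube n 2 := fun _ hx => (mem_dom.1 hx).1

theorem contDiffOn_tr : ContDiffOn ℝ ∞ (B.tr α β) (B.dom α β) := by
  have h := ((contDiffGroupoid ∞ (𝓡 n)).compatible_of_mem_maximalAtlas (B.chart_mem α)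
    (B.chart_mem β))
  exact contMDiffOn_iff_contDiffOn.1 (contMDiffOn_of_mem_contDiffGroupoid h)

theorem unifBdd_tr : UnifBdd (fun p : ι × ι => B.dom p.1 p.2) (fun p => B.tr p.1 p.2) :=
  ⟨fun _ => contDiffOn_tr, fun k => by
    obtain ⟨C, hC⟩ := B.transition_bdd k
    exact ⟨C, fun p x hx => hC p.1 p.2 x hx⟩⟩

theorem unifBdd_tr_apply (j : Fin n) :
    UnifBdd (fun p : ι × ι => B.dom p.1 p.2) (fun p x => B.tr p.1 p.2 x j) :=
  unifBdd_tr.apply (fun _ => isOpen_dom) j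

theorem unifBdd_tr_deriv (i j : Fin n) : UnifBdd (fun p : ι × ι => B.dom p.1 p.2)
    (fun p x => fderiv ℝ (fun y => B.tr p.1 p.2 y j) x (e i)) :=
  (unifBdd_tr_apply j).fderiv_apply (fun _ => isOpen_dom) (e i)

theorem unifBdd_tr_deriv_scale (i j : Fin n) : UnifBdd (fun p : ι × ι => B.dom p.1 p.2)
    (fun p x => B.scale p.1 i / B.scale p.2 j * fderiv ℝ (fun y => B.tr p.1 p.2 y j) x (e i)) := by
  have h0 := unifBdd_tr_deriv (B := B) i j
  refine ⟨fun p => contDiffOn_const.mul (h0.1 p), fun k => ?_⟩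
  obtain ⟨C, hC⟩ := B.scale_bdd k
  refine ⟨C, fun p x hx => ?_⟩
  have h1 : ContDiffAt ℝ k (fun x => fderiv ℝ (fun y => B.tr p.1 p.2 y j) x (e i)) x :=
    ((h0.1 p).contDiffAt (isOpen_dom.mem_nhds hx)).of_le (by exact_mod_cast le_top)
  have h2 := iteratedFDeriv_const_smul_apply (a := B.scale p.1 i / B.scale p.2 j) h1
  change ‖iteratedFDeriv ℝ k ((B.scale p.1 i / B.scale p.2 j) •
    fun x => fderiv ℝ (fun y => B.tr p.1 p.2 y j) x (e i)) x‖ ≤ C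
  have h3 := B.scale_pos p.1 i
  have h4 := B.scale_pos p.2 j
  rw [h2, norm_smul, Real.norm_of_nonneg (by positivity), div_mul_eq_mul_div, div_le_iff₀ h4]
  exact hC p.1 p.2 i j x hx

theorem hasFDerivAt_tr (hx : x ∈ B.dom α β) :
    HasFDerivAt (B.tr α β) (fderiv ℝ (B.tr α β) x) x :=
  ((contDiffOn_tr.contDiffAt (isOpen_dom.mem_nhds hx)).differentiableAt (by simp)).hasFDerivAt

theorem det_tr_mul (hx : x ∈ B.dom α β) :
    (fderiv ℝ (B.tr β α) (B.tr α β x)).det * (fderiv ℝ (B.tr α β) x).det = 1 := by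
  have h := (hasFDerivAt_tr (tr_mem_dom hx)).comp x (hasFDerivAt_tr hx)
  have h2 : HasFDerivAt (B.tr β α ∘ B.tr α β) (ContinuousLinearMap.id ℝ (E n)) x := by
    refine (hasFDerivAt_id x).congr_of_eventuallyEq ?_
    filter_upwards [isOpen_dom.mem_nhds hx] with y hy using tr_tr hy
  have h3 := h.unique h2
  have h4 := congrArg ContinuousLinearMap.det h3
  simpa only [ContinuousLinearMap.det, ContinuousLinearMap.toLinearMap_comp, LinearMap.det_comp,
    ContinuousLinearMap.coe_id, LinearMap.det_id] using h4

theorem unifBdd_det : UnifBdd (fun p : ι × ι => B.dom p.1 p.2)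
    (fun p x => (fderiv ℝ (B.tr p.1 p.2) x).det) :=
  UnifBdd.comp_contDiff (fun _ => isOpen_dom) contDiff_det (unifBdd_tr.fderiv fun _ => isOpen_dom)

variable (B) in
theorem exists_det_ge : ∃ ε : ℝ, 0 < ε ∧ ∀ α β, ∀ x ∈ B.dom α β,
    ε ≤ |(fderiv ℝ (B.tr α β) x).det| := by
  obtain ⟨C, hC0, hC⟩ := (unifBdd_det (B := B)).exists_norm_le
  refine ⟨C⁻¹, by positivity, fun α β x hx => ?_⟩
  have h1 := hC (β, α) _ (tr_mem_dom hx)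
  have h2 := congrArg abs (det_tr_mul hx)
  rw [abs_mul, abs_one] at h2
  rw [inv_le_iff_one_le_mul₀ hC0, ← h2, mul_comm]
  exact mul_le_mul_of_nonneg_left h1 (abs_nonneg _)

theorem unifBdd_abs_det : UnifBdd (fun p : ι × ι => B.dom p.1 p.2)
    (fun p x => |(fderiv ℝ (B.tr p.1 p.2) x).det|) := by
  obtain ⟨ε, hε, h⟩ := B.exists_det_ge
  exact unifBdd_det.abs hε (fun _ => isOpen_dom) fun p x hx => h p.1 p.2 x hx

/-! ### Cells -/

variable (B) in
/-- The compact set `φ_α⁻¹([-r, r]ⁿ)`. -/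
def cell (r : ℝ) (α : ι) : Set M := (B.chart α).symm '' closedCube n r

theorem cell_mono {r r' : ℝ} (h : r ≤ r') : B.cell r α ⊆ B.cell r' α :=
  image_mono (closedCube_mono h)

theorem isCompact_cell {r : ℝ} (hr : r < 2) : IsCompact (B.cell r α) :=
  (isCompact_closedCube n r).image_of_continuousOn ((B.chart α).continuousOn_symm.mono (by
    rw [B.chart_target]; exact closedCube_subset_cube hr))

theorem mem_cell {r : ℝ} (hr : r < 2) {p : M} :
    p ∈ B.cell r α ↔ p ∈ (B.chart α).source ∧ B.chart α p ∈ closedCube n r := by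
  constructor
  · rintro ⟨x, hx, rfl⟩
    have hx2 := closedCube_subset_cube hr hx
    exact ⟨symm_mem_source hx2, by rwa [chart_symm hx2]⟩
  · rintro ⟨h1, h2⟩
    exact ⟨_, h2, symm_chart h1⟩

variable (B) in
/-- The compact set `φ_α(φ_α⁻¹([-r, r]ⁿ) ∩ φ_β⁻¹([-r, r]ⁿ))`. -/
def overlap (r : ℝ) (α β : ι) : Set (E n) := B.chart α '' (B.cell r α ∩ B.cell r β)

theorem mem_overlap {r : ℝ} (hr : r < 2) :
    x ∈ B.overlap r α β ↔ x ∈ closedCube n r ∧ x ∈ B.dom α β ∧ B.tr α β x ∈ closedCube n r := by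
  constructor
  · rintro ⟨p, ⟨h1, h2⟩, rfl⟩
    rw [mem_cell hr] at h1 h2
    refine ⟨h1.2, chart_mem_dom h1.1 h2.1, ?_⟩
    rw [tr, symm_chart h1.1]; exact h2.2
  · rintro ⟨h1, h2, h3⟩
    have h4 := mem_dom.1 h2
    refine ⟨(B.chart α).symm x, ⟨⟨x, h1, rfl⟩, ?_⟩, chart_symm h4.1⟩
    exact (mem_cell hr).2 ⟨h4.2, h3⟩

variable [T2Space M]

theorem isCompact_overlap {r : ℝ} (hr : r < 2) : IsCompact (B.overlap r α β) := by
  refine ((isCompact_cell hr).inter (isCompact_cell hr)).image_of_continuousOn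
    ((B.chart α).continuousOn.mono fun p hp => ((mem_cell hr).1 hp.1).1)

variable (B) in
/-- Short segments starting in a cell of a chart do not leave this chart. -/
theorem exists_lift {r : ℝ} (hr : r < 2) : ∃ δ : ℝ, 0 < δ ∧ ∀ α β, ∀ x ∈ B.dom β α,
    B.tr β α x ∈ closedCube n r → ∀ y ∈ cube n 2, ‖y - x‖ ≤ δ →
      y ∈ B.dom β α ∧ B.tr β α y ∈ closedCube n ((r + 2) / 2) := by
  obtain ⟨L, hL0, hL⟩ := ((unifBdd_tr (B := B)).fderiv fun _ => isOpen_dom).exists_norm_le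
  refine ⟨(2 - r) / 2 / L, by have : 0 < 2 - r := by linarith
                              positivity, ?_⟩
  intro α β x hx hxr y hy hxy
  have hr' : (r + 2) / 2 < 2 := by linarith
  have hx2 := dom_subset_cube hx
  let l : ℝ → E n := fun t => AffineMap.lineMap x y t
  have hl : Continuous l := AffineMap.lineMap_continuous
  have hlmem : ∀ t ∈ Icc (0 : ℝ) 1, l t ∈ cube n 2 := fun t ht =>
    (convex_cube n 2).segment_subset hx2 hy (by
      rw [segment_eq_image_lineMap]; exact ⟨t, ht, rfl⟩)
  have hlsub : ∀ s t, l s - l t = (s - t) • (y - x) := fun s t => by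
    simp only [l, AffineMap.lineMap_apply, vsub_eq_sub, vadd_eq_add]; module
  have hlip : L * ‖y - x‖ ≤ (2 - r) / 2 := by
    calc L * ‖y - x‖ ≤ L * ((2 - r) / 2 / L) := by gcongr
      _ = _ := by field_simp
  let K := B.cell ((r + 2) / 2) α
  have hK : IsClosed K := (isCompact_cell hr').isClosed
  let T : Set ℝ := {t | t ∈ Icc (0 : ℝ) 1 ∧ (B.chart β).symm (l t) ∈ K}
  have hcont : ContinuousOn (fun t => (B.chart β).symm (l t)) (Icc 0 1) :=
    (B.chart β).continuousOn_symm.comp hl.continuousOn fun t ht => by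
      rw [B.chart_target]; exact hlmem t ht
  have hT : IsClosed T := hcont.preimage_isClosed_of_isClosed isClosed_Icc hK
  have hTd : ∀ t ∈ T, l t ∈ B.dom β α := fun t ht =>
    mem_dom.2 ⟨hlmem t ht.1, ((mem_cell hr').1 ht.2).1⟩
  have hTc : ContinuousOn (fun t => ‖B.tr β α (l t) - B.tr β α x‖ - L * t * ‖y - x‖) T := by
    refine ContinuousOn.sub (ContinuousOn.norm (ContinuousOn.sub ?_ continuousOn_const))
      (by fun_prop)
    exact contDiffOn_tr.continuousOn.comp hl.continuousOn hTd
  let S : Set ℝ := {t | t ∈ T ∧ ‖B.tr β α (l t) - B.tr β α x‖ ≤ L * t * ‖y - x‖}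
  have hS : IsClosed (S ∩ Icc 0 1) := by
    have h1 : S ∩ Icc 0 1 = T ∩ (fun t => ‖B.tr β α (l t) - B.tr β α x‖ - L * t * ‖y - x‖) ⁻¹' Iic 0 := by
      ext t
      simp only [S, mem_inter_iff, mem_ofPred_eq, mem_preimage, mem_Iic, sub_nonpos]
      exact ⟨fun h => h.1, fun h => ⟨h, h.1.1⟩⟩
    rw [h1]
    exact hTc.preimage_isClosed_of_isClosed hT isClosed_Iic
  have hl0 : l 0 = x := AffineMap.lineMap_apply_zero x y
  have hl1 : l 1 = y := AffineMap.lineMap_apply_one x y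
  have h0 : (0 : ℝ) ∈ S := by
    refine ⟨⟨by simp, ?_⟩, by simp [hl0]⟩
    rw [hl0]
    exact cell_mono (by linarith) ((mem_cell hr).2 ⟨(mem_dom.1 hx).2, hxr⟩)
  have hsub : Icc (0 : ℝ) 1 ⊆ S := by
    refine hS.Icc_subset_of_forall_exists_gt h0 ?_
    rintro t ⟨htS, ht⟩ u hu
    have htd := hTd t htS.1
    obtain ⟨ε, hε, hball⟩ := Metric.isOpen_iff.1 (isOpen_dom (B := B) (α := β) (β := α)) _ htd
    have hev : ∀ᶠ v in 𝓝[>] t, l v ∈ Metric.ball (l t) ε :=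
      (hl.continuousAt.tendsto.mono_left nhdsWithin_le_nhds) (Metric.ball_mem_nhds _ hε)
    have hev2 : ∀ᶠ v in 𝓝[>] t, v ∈ Ioc t (min u 1) :=
      Ioc_mem_nhdsGT (lt_min hu ht.2)
    obtain ⟨v, hv1, hv2⟩ := (hev.and hev2).exists
    have hv01 : v ∈ Icc (0 : ℝ) 1 := ⟨ht.1.trans hv2.1.le, hv2.2.trans (min_le_right _ _)⟩
    have hvd := hball hv1
    have hd : ‖B.tr β α (l v) - B.tr β α (l t)‖ ≤ L * ‖l v - l t‖ :=
      (convex_ball (l t) ε).norm_image_sub_le_of_norm_fderiv_le (f := B.tr β α) (C := L)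
        (fun z hz => (hasFDerivAt_tr (hball hz)).differentiableAt)
        (fun z hz => hL (β, α) z (hball hz)) (Metric.mem_ball_self hε) hv1
    have hle : ‖B.tr β α (l v) - B.tr β α x‖ ≤ L * v * ‖y - x‖ := by
      have h3 := norm_sub_le_norm_sub_add_norm_sub (B.tr β α (l v)) (B.tr β α (l t)) (B.tr β α x)
      rw [hlsub, norm_smul, Real.norm_of_nonneg (by linarith [hv2.1])] at hd
      have h4 := htS.2
      nlinarith
    refine ⟨v, ⟨⟨hv01, (mem_cell hr').2 ⟨(mem_dom.1 hvd).2, ?_⟩⟩, hle⟩, hv2.1,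
      hv2.2.trans (min_le_left _ _)⟩
    have h5 : ‖B.tr β α (l v) - B.tr β α x‖ ≤ (2 - r) / 2 := by
      refine hle.trans (le_trans ?_ hlip)
      have := norm_nonneg (y - x)
      have := hv01.2
      have : L * v ≤ L * 1 := by gcongr
      nlinarith
    have h6 := mem_closedCube_of_norm_sub_le hxr h5
    rwa [show r + (2 - r) / 2 = (r + 2) / 2 by ring] at h6
  have h1 := (hsub (right_mem_Icc.2 zero_le_one)).1
  rw [← hl1]
  exact ⟨hTd 1 h1, ((mem_cell hr').1 h1.2).2⟩

variable (B) in
/-- Cells meet a uniformly bounded number of other cells. -/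
theorem exists_card_le {r : ℝ} (hr : r < 2) : ∃ J : ℕ, ∀ α : ι, ∀ s : Finset ι,
    (∀ β ∈ s, (B.cell r α ∩ B.cell r β).Nonempty) → s.card ≤ J := by
  classical
  obtain ⟨δ, hδ, hlift⟩ := B.exists_lift hr
  obtain ⟨N, hN⟩ := B.finite_overlap
  obtain ⟨t, -, ht⟩ := (isCompact_closedCube n r).elim_finite_subcover_image (b := univ)
    (c := fun c => Metric.ball c (δ / 2)) (fun _ _ => Metric.isOpen_ball)
    (fun x _ => mem_iUnion₂.2 ⟨x, mem_univ x, Metric.mem_ball_self (by positivity)⟩)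
  obtain ⟨htf, ht⟩ := ht
  refine ⟨htf.toFinset.card * N, fun α s hs => ?_⟩
  by_contra! hcard
  have : Nonempty M := by
    obtain ⟨β, hβ⟩ := Finset.card_pos.1 ((Nat.zero_le _).trans_lt hcard)
    exact ⟨(hs β hβ).some⟩
  choose! p hp using hs
  have hx : ∀ β ∈ s, B.chart α (p β) ∈ closedCube n r := fun β hβ => ((mem_cell hr).1 (hp β hβ).1).2
  have hc : ∀ β ∈ s, ∃ c ∈ htf.toFinset, B.chart α (p β) ∈ Metric.ball c (δ / 2) := fun β hβ => by
    obtain ⟨c, hc, h⟩ := mem_iUnion₂.1 (ht (hx β hβ))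
    exact ⟨c, by simpa using hc, h⟩
  choose! c hc1 hc2 using hc
  obtain ⟨c₀, -, hc₀⟩ := Finset.exists_lt_card_fiber_of_mul_lt_card_of_maps_to hc1 hcard
  obtain ⟨s', hs', hs'card⟩ := Finset.exists_subset_card_eq (Nat.succ_le_of_lt hc₀)
  have hne : s'.Nonempty := Finset.card_pos.1 (by omega)
  obtain ⟨β₀, hβ₀⟩ := hne
  have hmem : ∀ β ∈ s', β ∈ s ∧ c β = c₀ := fun β hβ => by simpa using hs' hβ
  have hempty := hN s' hs'card
  have : p β₀ ∈ ⋂ β ∈ s', (B.chart β).source := by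
    refine mem_iInter₂.2 fun β hβ => ?_
    have h1 := (mem_cell hr).1 (hp β (hmem β hβ).1).1
    have h2 := (mem_cell hr).1 (hp β (hmem β hβ).1).2
    have h0 := (mem_cell hr).1 (hp β₀ (hmem β₀ hβ₀).1).1
    have hd := chart_mem_dom h1.1 h2.1
    have h3 : B.tr α β (B.chart α (p β)) ∈ closedCube n r := by
      rw [tr, symm_chart h1.1]; exact h2.2
    have h4 : ‖B.chart α (p β₀) - B.chart α (p β)‖ ≤ δ := by
      have e1 := hc2 β (hmem β hβ).1
      have e0 := hc2 β₀ (hmem β₀ hβ₀).1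
      rw [(hmem β hβ).2, Metric.mem_ball] at e1
      rw [(hmem β₀ hβ₀).2, Metric.mem_ball] at e0
      rw [← dist_eq_norm]
      have := dist_triangle_right (B.chart α (p β₀)) (B.chart α (p β)) c₀
      linarith
    have h5 := (hlift β α _ hd h3 _ (mem_cube_of_mem_source h0.1) h4).1
    have h6 := (mem_dom.1 h5).2
    rwa [symm_chart h0.1] at h6
  rw [hempty] at this
  exact this

end SBGStructure

theorem UnifBdd.indicator {I V F : Type*} [NormedAddCommGroup V] [NormedSpace ℝ V]
    [NormedAddCommGroup F] [NormedSpace ℝ F] {D K : I → Set V} {f : I → V → F}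
    (hf : UnifBdd D f) (hD : ∀ i, IsOpen (D i)) (hK : ∀ i, IsClosed (K i)) (hKD : ∀ i, K i ⊆ D i)
    (h0 : ∀ i, ∀ x ∈ D i, x ∉ K i → f i x = 0) :
    UnifBdd (fun _ => univ) fun i => (D i).indicator (f i) := by
  classical
  have h2 : ∀ i x, x ∉ D i → (D i).indicator (f i) =ᶠ[𝓝 x] fun _ => 0 := by
    intro i x hx
    filter_upwards [(hK i).isOpen_compl.mem_nhds fun h => hx (hKD i h)] with y hy
    by_cases hyD : y ∈ D i
    · rw [indicator_of_mem hyD, h0 i y hyD hy]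
    · rw [indicator_of_notMem hyD]
  have h3 : ∀ i x, x ∈ D i → (D i).indicator (f i) =ᶠ[𝓝 x] f i := by
    intro i x hx
    filter_upwards [(hD i).mem_nhds hx] with y hy using indicator_of_mem hy _
  refine ⟨fun i x _ => ?_, fun k => ?_⟩
  · by_cases hx : x ∈ D i
    · exact (((hf.1 i).contDiffAt ((hD i).mem_nhds hx)).congr_of_eventuallyEq
        (h3 i x hx)).contDiffWithinAt
    · exact (contDiffAt_const.congr_of_eventuallyEq (h2 i x hx)).contDiffWithinAt
  · obtain ⟨C, hC⟩ := hf.2 k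
    refine ⟨max C 0, fun i x _ => ?_⟩
    by_cases hx : x ∈ D i
    · rw [((h3 i x hx).iteratedFDeriv ℝ k).eq_of_nhds]
      exact (hC i x hx).trans (le_max_left _ _)
    · rw [((h2 i x hx).iteratedFDeriv ℝ k).eq_of_nhds]
      simp only [iteratedFDeriv_fun_zero, Pi.zero_apply, norm_zero]
      exact le_max_right _ _

theorem contDiff_of_contDiffAt_tsupport {V F : Type*} [NormedAddCommGroup V] [NormedSpace ℝ V]
    [NormedAddCommGroup F] [NormedSpace ℝ F] {f : V → F}
    (h : ∀ x ∈ tsupport f, ContDiffAt ℝ ∞ f x) : ContDiff ℝ ∞ f :=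
  contDiff_iff_contDiffAt.2 fun x => by
    by_cases hx : x ∈ tsupport f
    · exact h x hx
    · exact contDiffAt_const.congr_of_eventuallyEq (notMem_tsupport_iff_eventuallyEq.1 hx)

theorem lintegral_eq_setLIntegral {n : ℕ} {s : Set (E n)} (hs : MeasurableSet s) {f : E n → ℝ≥0∞}
    (h : ∀ x ∉ s, f x = 0) : ∫⁻ x, f x = ∫⁻ x in s, f x := by
  rw [← lintegral_indicator hs, indicator_eq_self.2 fun x hx => by_contra fun hxs => hx (h x hxs)]

namespace SBGStructure

variable {n : ℕ} {M : Type*} [TopologicalSpace M] [ChartedSpace (E n) M] {ι : Type*}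
  {B : SBGStructure n M ι} {G : ι × ι → E n → ℝ}

variable (B) in
/-- A uniformly smooth family of functions with compact supports in the domains of the transition
functions. -/
structure Adm (G : ι × ι → E n → ℝ) : Prop where
  unif : UnifBdd (fun _ => univ) G
  compact : ∀ p, HasCompactSupport (G p)
  sub : ∀ p, tsupport (G p) ⊆ B.dom p.1 p.2

variable (B) in
/-- The operator `f ↦ G (f ∘ τ)` from functions on the chart `p.2` to functions on the chart
`p.1`. -/
def trOp (G : ι × ι → E n → ℝ) (p : ι × ι) (f : E n → ℂ) (x : E n) : ℂ :=
  (G p x : ℂ) * f (B.tr p.1 p.2 x)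

theorem Adm.contDiff_trOp (hG : B.Adm G) (p : ι × ι) {f : E n → ℂ}
    (hf : ContDiffOn ℝ ∞ f (B.dom p.2 p.1)) : ContDiff ℝ ∞ (B.trOp G p f) := by
  refine contDiff_of_contDiffAt_tsupport fun x hx => ?_
  have hx2 : x ∈ B.dom p.1 p.2 :=
    hG.sub p (closure_mono (fun y hy => by
      simp only [trOp, Function.mem_support] at hy ⊢
      intro h; simp [h] at hy) hx)
  refine ContDiffAt.mul (Complex.ofRealCLM.contDiff.contDiffAt.comp x (hG.unif.contDiff p).contDiffAt)
    (ContDiffAt.comp x (hf.contDiffAt (isOpen_dom.mem_nhds (tr_mem_dom hx2)))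
      (contDiffOn_tr.contDiffAt (isOpen_dom.mem_nhds hx2)))

theorem Adm.hasCompactSupport_trOp (hG : B.Adm G) (p : ι × ι) (f : E n → ℂ) :
    HasCompactSupport (B.trOp G p f) :=
  (hG.compact p).mono' (subset_trans (fun y hy => by
      simp only [trOp, Function.mem_support] at hy ⊢
      intro h; simp [h] at hy) subset_closure)

/-- The operator `trOp` on Schwartz functions. -/
def Adm.trS (hG : B.Adm G) (p : ι × ι) (f : 𝓢(E n, ℂ)) : 𝓢(E n, ℂ) :=
  (hG.hasCompactSupport_trOp p f).toSchwartzMap (hG.contDiff_trOp p (f.smooth ⊤).contDiffOn)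

theorem Adm.trS_apply (hG : B.Adm G) (p : ι × ι) (f : 𝓢(E n, ℂ)) (x : E n) :
    hG.trS p f x = (G p x : ℂ) * f (B.tr p.1 p.2 x) := rfl

theorem Adm.mul_dom (hG : B.Adm G) {h : ι × ι → E n → ℝ}
    (hh : UnifBdd (fun p : ι × ι => B.dom p.1 p.2) h) : B.Adm fun p x => G p x * h p x :=
  ⟨UnifBdd.smul_cutoff (fun _ => isOpen_dom) (fun _ => isOpen_univ) hG.unif
    (fun p => inter_subset_right.trans (hG.sub p)) hh, fun p => (hG.compact p).mul_right,
    fun p => tsupport_mul_subset_left.trans (hG.sub p)⟩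

theorem Adm.fderiv_apply (hG : B.Adm G) (v : E n) : B.Adm fun p x => fderiv ℝ (G p) x v :=
  ⟨hG.unif.fderiv_apply (fun _ => isOpen_univ) v, fun p => (hG.compact p).fderiv_apply ℝ v,
    fun p => (tsupport_fderiv_apply_subset ℝ v).trans (hG.sub p)⟩

/-- The transpose of an admissible family. -/
def adj (B : SBGStructure n M ι) (G : ι × ι → E n → ℝ) (p : ι × ι) : E n → ℝ :=
  (B.dom p.1 p.2).indicator fun x =>
    G p.swap (B.tr p.1 p.2 x) * |(fderiv ℝ (B.tr p.1 p.2) x).det|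

theorem Adm.adj (hG : B.Adm G) : B.Adm (B.adj G) := by
  classical
  let K : ι × ι → Set (E n) := fun p => B.tr p.2 p.1 '' tsupport (G p.swap)
  have hK : ∀ p, IsCompact (K p) := fun p => (hG.compact p.swap).isCompact.image_of_continuousOn
    (contDiffOn_tr.continuousOn.mono (hG.sub p.swap))
  have hKD : ∀ p, K p ⊆ B.dom p.1 p.2 := by
    rintro p _ ⟨x, hx, rfl⟩
    exact tr_mem_dom (hG.sub p.swap hx)
  have h0 : ∀ p : ι × ι, ∀ x ∈ B.dom p.1 p.2, x ∉ K p →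
      G p.swap (B.tr p.1 p.2 x) * |(fderiv ℝ (B.tr p.1 p.2) x).det| = 0 := by
    intro p x hx hxK
    rw [image_eq_zero_of_notMem_tsupport (f := G p.swap) fun h => hxK ⟨_, h, tr_tr hx⟩, zero_mul]
  have h1 : UnifBdd (fun p : ι × ι => B.dom p.1 p.2) fun p x =>
      G p.swap (B.tr p.1 p.2 x) * |(fderiv ℝ (B.tr p.1 p.2) x).det| :=
    UnifBdd.mul (fun _ => isOpen_dom) (UnifBdd.comp (fun _ => isOpen_dom) (fun _ => isOpen_univ)
      (hG.unif.reindex Prod.swap) unifBdd_tr fun _ _ _ => mem_univ _) unifBdd_abs_det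
  have hs : ∀ p, tsupport (B.adj G p) ⊆ K p := fun p => by
    refine closure_minimal (fun x hx => ?_) (hK p).isClosed
    by_contra hxK
    rw [Function.mem_support] at hx
    refine hx (indicator_apply_eq_zero.2 fun hxD => h0 p x hxD hxK)
  exact ⟨h1.indicator (fun _ => isOpen_dom) (fun p => (hK p).isClosed) hKD h0,
    fun p => (hK p).of_isClosed_subset (isClosed_tsupport _) (hs p), fun p => (hs p).trans (hKD p)⟩

theorem setIntegral_tr {F : Type*} [NormedAddCommGroup F] [NormedSpace ℝ F] (α β : ι) (g : E n → F) :
    ∫ x in B.dom β α, g x = ∫ x in B.dom α β, |(fderiv ℝ (B.tr α β) x).det| • g (B.tr α β x) := by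
  rw [← image_tr (α := α)]
  exact integral_image_eq_integral_abs_det_fderiv_smul volume isOpen_dom.measurableSet
    (fun x hx => (hasFDerivAt_tr hx).hasFDerivWithinAt) injOn_tr g

theorem setLIntegral_tr (α β : ι) (g : E n → ℝ≥0∞) :
    ∫⁻ x in B.dom β α, g x =
      ∫⁻ x in B.dom α β, ENNReal.ofReal |(fderiv ℝ (B.tr α β) x).det| * g (B.tr α β x) := by
  rw [← image_tr (α := α)]
  exact lintegral_image_eq_lintegral_abs_det_fderiv_mul volume isOpen_dom.measurableSet
    (fun x hx => (hasFDerivAt_tr hx).hasFDerivWithinAt) injOn_tr g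

theorem Adm.integral_trOp_mul (hG : B.Adm G) (p : ι × ι) (f h : E n → ℂ) :
    ∫ x, B.trOp G p f x * h x = ∫ y, f y * B.trOp (B.adj G) p.swap h y := by
  obtain ⟨α, β⟩ := p
  simp only [trOp, Prod.swap_prod_mk]
  have e1 : ∫ x, (G (α, β) x : ℂ) * f (B.tr α β x) * h x =
      ∫ x in B.dom α β, (G (α, β) x : ℂ) * f (B.tr α β x) * h x := by
    rw [setIntegral_eq_integral_of_forall_compl_eq_zero]
    intro x hx
    rw [image_eq_zero_of_notMem_tsupport (f := G (α, β)) fun h => hx (hG.sub (α, β) h)]; simp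
  have e2 : ∫ y, f y * ((B.adj G (β, α) y : ℂ) * h (B.tr β α y)) =
      ∫ y in B.dom β α, f y * ((B.adj G (β, α) y : ℂ) * h (B.tr β α y)) := by
    rw [setIntegral_eq_integral_of_forall_compl_eq_zero]
    intro x hx
    simp [SBGStructure.adj, indicator_of_notMem hx]
  rw [e1, e2, setIntegral_tr β α]
  refine setIntegral_congr_fun isOpen_dom.measurableSet fun x hx => ?_
  simp only [SBGStructure.adj, Prod.swap_prod_mk, indicator_of_mem hx, tr_tr hx, Complex.real_smul]
  push_cast; ring

variable (B) in
/-- Admissible families define uniformly bounded operators of order `(s, k)`. -/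
def Bound (s k : ℝ) : Prop := ∀ G : ι × ι → E n → ℝ, ∀ hG : B.Adm G, ∃ C : ℝ≥0∞, C ≠ ⊤ ∧
  ∀ (p : ι × ι) (f : 𝓢(E n, ℂ)),
    sn (B.scale p.1) s k (hG.trS p f) ≤ C * sn (B.scale p.2) s k f

variable (B) in
theorem bound_zero_zero : B.Bound 0 0 := by
  intro G hG
  obtain ⟨C, hC0, hC⟩ := hG.unif.exists_norm_le
  obtain ⟨ε, hε, hdet⟩ := B.exists_det_ge
  refine ⟨ENNReal.ofReal (C ^ 2 / ε), ENNReal.ofReal_ne_top, ?_⟩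
  rintro ⟨α, β⟩ f
  rw [sn_zero_zero, sn_zero_zero]
  calc ∫⁻ x, ‖hG.trS (α, β) f x‖ₑ ^ 2 = ∫⁻ x in B.dom α β, ‖hG.trS (α, β) f x‖ₑ ^ 2 := by
        refine lintegral_eq_setLIntegral isOpen_dom.measurableSet fun x hx => ?_
        rw [Adm.trS_apply, image_eq_zero_of_notMem_tsupport (f := G (α, β)) fun h => hx (hG.sub (α, β) h)]
        simp
    _ ≤ ∫⁻ x in B.dom α β, ENNReal.ofReal (C ^ 2 / ε) *
          (ENNReal.ofReal |(fderiv ℝ (B.tr α β) x).det| * ‖f (B.tr α β x)‖ₑ ^ 2) := by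
        refine setLIntegral_mono' isOpen_dom.measurableSet fun x hx => ?_
        rw [Adm.trS_apply, enorm_mul, mul_pow, ← mul_assoc]
        gcongr
        rw [← ofReal_norm, ← ENNReal.ofReal_pow (norm_nonneg _),
          ← ENNReal.ofReal_mul (by positivity), Complex.norm_real]
        refine ENNReal.ofReal_le_ofReal ?_
        have h1 := hC (α, β) x (mem_univ x)
        have h2 := hdet α β x hx
        calc ‖G (α, β) x‖ ^ 2 ≤ C ^ 2 := by gcongr
          _ = C ^ 2 / ε * ε := by field_simp
          _ ≤ _ := by gcongr
    _ = ENNReal.ofReal (C ^ 2 / ε) * ∫⁻ x in B.dom β α, ‖f x‖ₑ ^ 2 := by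
        rw [lintegral_const_mul' _ _ ENNReal.ofReal_ne_top, setLIntegral_tr α β]
    _ ≤ _ := mul_le_mul_right (setLIntegral_le_lintegral _ _) _

theorem Bound.neg {s k : ℝ} (h : B.Bound s k) : B.Bound (-s) (-k) := by
  intro G hG
  obtain ⟨C, hC, hb⟩ := h _ hG.adj
  refine ⟨C, hC, fun p f => sn_le_of_duality _ fun g => ?_⟩
  have h1 : ∫ x, hG.trS p f x * g x = ∫ x, f x * hG.adj.trS p.swap g x :=
    hG.integral_trOp_mul p f g
  rw [h1]
  refine (enorm_integral_mul_le_sn (ρ := B.scale p.2) (s := s) (k := k) f (hG.adj.trS p.swap g)).trans ?_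
  calc _ ≤ sn (B.scale p.2) (-s) (-k) f * (C * sn (B.scale p.1) s k g) := by
        gcongr
        exact hb p.swap g
    _ = _ := by ring

/-- Derivatives of `trOp` are sums of such operators, applied to derivatives. -/
theorem Adm.exists_deriv (hG : B.Adm G) {a : ι → Fin n → ℝ} (ha0 : ∀ α i, 0 < a α i)
    (ha1 : ∀ α i, a α i ≤ 1) (htr : ∀ i j, UnifBdd (fun p : ι × ι => B.dom p.1 p.2)
      fun p x => a p.1 i / a p.2 j * fderiv ℝ (fun y => B.tr p.1 p.2 y j) x (e i)) (i : Fin n) :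
    ∃ G₀ : ι × ι → E n → ℝ, ∃ G₁ : Fin n → ι × ι → E n → ℝ, ∃ h₀ : B.Adm G₀,
      ∃ h₁ : ∀ j, B.Adm (G₁ j), ∀ (p : ι × ι) (f : 𝓢(E n, ℂ)),
        a p.1 i • ∂_{(e i : E n)} (hG.trS p f) = h₀.trS p f +
          ∑ j, (h₁ j).trS p (a p.2 j • ∂_{(e j : E n)} f) := by
  have h0 := (hG.fderiv_apply (e i)).mul_dom (h := fun p _ => a p.1 i)
    (UnifBdd.const (C := 1) fun p => by
      rw [Real.norm_of_nonneg (ha0 _ _).le]; exact ha1 _ _)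
  refine ⟨_, fun j p x => G p x *
    (a p.1 i / a p.2 j * fderiv ℝ (fun y => B.tr p.1 p.2 y j) x (e i)), h0,
    fun j => hG.mul_dom (htr i j), fun p f => ?_⟩
  ext x
  rw [smul_apply, add_apply, sum_apply, SchwartzMap.lineDerivOp_apply_eq_fderiv]
  simp only [Adm.trS_apply]
  by_cases hx : x ∈ B.dom p.1 p.2
  · have e1 : HasFDerivAt (fun x => ((G p x : ℝ) : ℂ)) (Complex.ofRealCLM ∘L fderiv ℝ (G p) x) x :=
      Complex.ofRealCLM.hasFDerivAt.comp x
        ((hG.unif.contDiff p).differentiable (by simp) x).hasFDerivAt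
    have e2 := (f.differentiable (B.tr p.1 p.2 x)).hasFDerivAt.comp x (hasFDerivAt_tr hx)
    have e3 : HasFDerivAt (hG.trS p f) _ x := e1.mul e2
    rw [e3.fderiv]
    have e4 : ∀ j, fderiv ℝ (fun y => B.tr p.1 p.2 y j) x (e i) =
        fderiv ℝ (B.tr p.1 p.2) x (e i) j := fun j => by
      have := ((EuclideanSpace.proj j : E n →L[ℝ] ℝ).hasFDerivAt.comp x (hasFDerivAt_tr hx)).fderiv
      change fderiv ℝ (⇑(EuclideanSpace.proj j : E n →L[ℝ] ℝ) ∘ B.tr p.1 p.2) x (e i) = _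
      rw [this]; rfl
    have e5 : fderiv ℝ f (B.tr p.1 p.2 x) (fderiv ℝ (B.tr p.1 p.2) x (e i)) =
        ∑ j, (fderiv ℝ (B.tr p.1 p.2) x (e i) j : ℂ) *
          fderiv ℝ f (B.tr p.1 p.2 x) (e j) := by
      have : fderiv ℝ (B.tr p.1 p.2) x (e i) =
          ∑ j, fderiv ℝ (B.tr p.1 p.2) x (e i) j • (e j : E n) := by
        ext l; simp [e, Pi.single_apply]
      conv_lhs => rw [this]
      simp [map_sum]
    simp only [add_apply, smul_apply, ContinuousLinearMap.comp_apply, e4, e5,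
      SchwartzMap.lineDerivOp_apply_eq_fderiv, Complex.real_smul, smul_eq_mul,
      Complex.ofRealCLM_apply]
    rw [mul_add, add_comm, Finset.mul_sum, Finset.mul_sum]
    congr 1
    · push_cast; ring
    · refine Finset.sum_congr rfl fun j _ => ?_
      have : (a p.2 j : ℂ) ≠ 0 := by exact_mod_cast (ha0 p.2 j).ne'
      push_cast
      field_simp
  · have hx0 : x ∉ tsupport (G p) := fun h => hx (hG.sub p h)
    have hx1 : fderiv ℝ (hG.trS p f) x = 0 := by
      have : (hG.trS p f : E n → ℂ) =ᶠ[𝓝 x] fun _ => 0 := by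
        filter_upwards [(isClosed_tsupport (G p)).isOpen_compl.mem_nhds hx0] with y hy
        rw [Adm.trS_apply, image_eq_zero_of_notMem_tsupport hy]; simp
      rw [this.fderiv_eq]; simp
    have hx2 : fderiv ℝ (G p) x (e i) = 0 :=
      image_eq_zero_of_notMem_tsupport (f := fun x => fderiv ℝ (G p) x (e i))
        fun h => hx0 (tsupport_fderiv_apply_subset ℝ _ h)
    simp [hx1, hx2, image_eq_zero_of_notMem_tsupport hx0]

theorem Bound.step {s k : ℝ} (h : B.Bound s k) {a : ι → Fin n → ℝ} (ha0 : ∀ α i, 0 < a α i)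
    (ha1 : ∀ α i, a α i ≤ 1) (htr : ∀ i j, UnifBdd (fun p : ι × ι => B.dom p.1 p.2)
      fun p x => a p.1 i / a p.2 j * fderiv ℝ (fun y => B.tr p.1 p.2 y j) x (e i))
    (hG : B.Adm G) : ∃ C : ℝ≥0∞, C ≠ ⊤ ∧ ∀ (p : ι × ι) (f : 𝓢(E n, ℂ)),
      sn (B.scale p.1) s k (hG.trS p f) +
        ∑ i, sn (B.scale p.1) s k (a p.1 i • ∂_{(e i : E n)} (hG.trS p f) : 𝓢(E n, ℂ)) ≤
      C * (sn (B.scale p.2) s k f +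
        ∑ i, sn (B.scale p.2) s k (a p.2 i • ∂_{(e i : E n)} f : 𝓢(E n, ℂ))) := by
  choose G₀ G₁ h₀ h₁ hd using hG.exists_deriv ha0 ha1 htr
  obtain ⟨C, hC, hCb⟩ := h G hG
  choose C₀ hC₀ hb₀ using fun i => h _ (h₀ i)
  choose C₁ hC₁ hb₁ using fun i j => h _ (h₁ i j)
  refine ⟨C + ∑ i, (2 * C₀ i + 2 * (n * ∑ j, C₁ i j)), ?_, fun p f => ?_⟩
  · refine ENNReal.add_ne_top.2 ⟨hC, ENNReal.sum_ne_top.2 fun i _ => ENNReal.add_ne_top.2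
      ⟨ENNReal.mul_ne_top (by simp) (hC₀ i), ENNReal.mul_ne_top (by simp)
        (ENNReal.mul_ne_top (by simp) (ENNReal.sum_ne_top.2 fun j _ => hC₁ i j))⟩⟩
  set S := sn (B.scale p.2) s k f with hS
  set S' : Fin n → ℝ≥0∞ := fun i => sn (B.scale p.2) s k (a p.2 i • ∂_{(e i : E n)} f : 𝓢(E n, ℂ))
    with hS'
  rw [add_mul, Finset.sum_mul]
  refine add_le_add ((hCb p f).trans (by gcongr; exact le_self_add))
    (Finset.sum_le_sum fun i _ => ?_)
  rw [hd i p f]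
  refine (sn_add_le _ _).trans ?_
  rw [add_mul, mul_assoc, mul_assoc]
  gcongr 2 * ?_ + 2 * ?_
  · exact (hb₀ i p f).trans (by gcongr; exact le_self_add)
  · have h3 : (⇑(∑ j, (h₁ i j).trS p (a p.2 j • ∂_{(e j : E n)} f)) : E n → ℂ) =
        fun x => ∑ j, (h₁ i j).trS p (a p.2 j • ∂_{(e j : E n)} f) x := by
      ext x; rw [sum_apply]
    rw [h3]
    refine (sn_sum_le Finset.univ _).trans ?_
    rw [Finset.card_univ, Fintype.card_fin, mul_assoc, Finset.sum_mul]
    gcongr with j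
    refine (hb₁ i j p _).trans ?_
    gcongr
    exact (Finset.single_le_sum (f := S') (fun _ _ => zero_le) (Finset.mem_univ j)).trans
      le_add_self

theorem Bound.succ {s k : ℝ} (h : B.Bound s k) : B.Bound (s + 1) k := fun G hG => by
  simp only [sn_succ]
  exact h.step B.scale_pos B.scale_le_one unifBdd_tr_deriv_scale hG

theorem Bound.succ_right {s k : ℝ} (h : B.Bound s k) : B.Bound s (k + 1) := fun G hG => by
  simp only [sn_succ_right]
  simpa using h.step (a := fun _ _ => 1) (fun _ _ => one_pos) (fun _ _ => le_rfl)
    (fun i j => by simpa using unifBdd_tr_deriv (B := B) i j) hG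

theorem Adm.trS_add (hG : B.Adm G) (p : ι × ι) (f g : 𝓢(E n, ℂ)) :
    hG.trS p (f + g) = hG.trS p f + hG.trS p g := by
  ext x
  simp only [Adm.trS_apply, add_apply, mul_add]

variable (B) in
theorem bound_of_nonneg {s : ℝ} (hs : 0 ≤ s) : B.Bound s 0 := by
  have hN : ∀ j : ℕ, B.Bound j 0 := fun j => by
    induction j with
    | zero => simpa using B.bound_zero_zero
    | succ j ih => rw [Nat.cast_succ]; exact ih.succ
  rcases eq_or_lt_of_le (Nat.floor_le hs) with h | h
  · rw [← h]; exact hN _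
  · intro G hG
    obtain ⟨C, hC, hb⟩ := hN ⌊s⌋₊ G hG
    obtain ⟨C', hC', hb'⟩ := (hN ⌊s⌋₊).succ G hG
    have hs1 := Nat.lt_floor_add_one s
    refine ⟨2 * (C + C'), ENNReal.mul_ne_top (by simp) (ENNReal.add_ne_top.2 ⟨hC, hC'⟩),
      fun p f => ?_⟩
    have := sn_interp (θ := s - ⌊s⌋₊) (by linarith) (by linarith) (ENNReal.add_ne_top.2 ⟨hC, hC'⟩)
      (T := hG.trS p) (hG.trS_add p)
      (fun f => (hb p f).trans (by gcongr; exact le_self_add))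
      (fun f => (hb' p f).trans (by gcongr; exact le_add_self)) f
    simpa using this

variable (B) in
theorem bound (s : ℝ) (k : ℕ) : B.Bound s k := by
  induction k with
  | zero =>
    rw [Nat.cast_zero]
    rcases le_total 0 s with hs | hs
    · exact B.bound_of_nonneg hs
    · simpa using (B.bound_of_nonneg (neg_nonneg.2 hs)).neg
  | succ k ih => rw [Nat.cast_succ]; exact ih.succ_right

end SBGStructure

/-! ### Local pseudodifferential operators -/

section LocalOp

variable {n : ℕ}

/-- A symbol of order `m` supported over `K`, with bounds for its derivatives along the base. -/
structure SymBd (K : Set (E n)) (m : ℝ) (A : ℕ → ℝ) (b : E n → E n → ℂ) : Prop where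
  smooth : ContDiff ℝ ∞ (fun z : E n × E n => b z.1 z.2)
  supp : ∀ x ∉ K, ∀ ξ, b x ξ = 0
  bound : ∀ j x ξ, ‖iteratedFDeriv ℝ j (fun y => b y ξ) x‖ ≤ A j * bracket ξ ^ m

variable {K : Set (E n)} {m : ℝ} {A : ℕ → ℝ} {b : E n → E n → ℂ}

theorem SymBd.nonneg (hb : SymBd K m A b) (j : ℕ) : 0 ≤ A j := by
  have h := (norm_nonneg _).trans (hb.bound j 0 0)
  exact nonneg_of_mul_nonneg_left h (Real.rpow_pos_of_pos (bracket_pos _) _)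

theorem SymBd.norm_le (hb : SymBd K m A b) (x ξ : E n) : ‖b x ξ‖ ≤ A 0 * bracket ξ ^ m := by
  simpa using hb.bound 0 x ξ

theorem SymBd.contDiff (hb : SymBd K m A b) (ξ : E n) : ContDiff ℝ ∞ fun y => b y ξ :=
  hb.smooth.comp (contDiff_id.prodMk contDiff_const)

theorem SymBd.tsupport_subset (hK : IsCompact K) (hb : SymBd K m A b) (ξ : E n) :
    tsupport (fun y => b y ξ) ⊆ K :=
  closure_minimal (fun x hx => by_contra fun h => hx (hb.supp x h ξ)) hK.isClosed

theorem SymBd.integral_le (hK : IsCompact K) (hb : SymBd K m A b) (j : ℕ) (ξ : E n) :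
    Integrable (fun v => ‖iteratedFDeriv ℝ j (fun y => b y ξ) v‖) ∧
    ∫ v, ‖iteratedFDeriv ℝ j (fun y => b y ξ) v‖ ≤ A j * bracket ξ ^ m * volume.real K := by
  have hcs : HasCompactSupport fun y => b y ξ :=
    hK.of_isClosed_subset (isClosed_tsupport _) (hb.tsupport_subset hK ξ)
  have hc : Continuous (iteratedFDeriv ℝ j fun y => b y ξ) :=
    (hb.contDiff ξ).continuous_iteratedFDeriv (m := j) (by exact_mod_cast le_top)
  refine ⟨(hc.integrable_of_hasCompactSupport (hcs.iteratedFDeriv j)).norm, ?_⟩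
  rw [← setIntegral_eq_integral_of_forall_compl_eq_zero (s := K)]
  · refine (le_abs_self _).trans ?_
    exact norm_setIntegral_le_of_norm_le_const
      (f := fun v => ‖iteratedFDeriv ℝ j (fun y => b y ξ) v‖) hK.measure_lt_top
      fun x _ => by rw [norm_norm]; exact hb.bound j x ξ
  · intro x hx
    rw [norm_eq_zero]
    by_contra h
    exact hx (hb.tsupport_subset hK ξ (support_iteratedFDeriv_subset (𝕜 := ℝ) j h))

theorem bracket_pow_le (θ : E n) (N : ℕ) : bracket θ ^ N ≤ 2 ^ N * (1 + ‖θ‖ ^ N) := by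
  have h1 : bracket θ ≤ 1 + ‖θ‖ := by
    refine le_of_sq_le_sq ?_ (by positivity)
    rw [bracket_sq]; nlinarith [norm_nonneg θ]
  calc bracket θ ^ N ≤ (1 + ‖θ‖) ^ N := pow_le_pow_left₀ (bracket_pos _).le h1 N
    _ ≤ 2 ^ (N - 1) * (1 ^ N + ‖θ‖ ^ N) := add_pow_le zero_le_one (norm_nonneg _) N
    _ ≤ _ := by rw [one_pow]; gcongr <;> simp

/-- The Fourier transform of a symbol along the base decays rapidly. -/
theorem SymBd.norm_fourier_le (hK : IsCompact K) (hb : SymBd K m A b) (N : ℕ) (θ ξ : E n) :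
    ‖𝓕 (fun y => b y ξ) θ‖ ≤ 2 ^ N * volume.real K * (A 0 + 2 ^ N * ∑ j ∈ Finset.range (N + 1), A j) *
      bracket θ ^ (-(N : ℝ)) * bracket ξ ^ m := by
  set f : E n → ℂ := fun y => b y ξ with hf
  have hr : 0 < bracket ξ ^ m := Real.rpow_pos_of_pos (bracket_pos _) _
  have hcs : HasCompactSupport f :=
    hK.of_isClosed_subset (isClosed_tsupport _) (hb.tsupport_subset hK ξ)
  have hint : ∀ k j : ℕ, (k : ℕ∞) ≤ (0 : ℕ∞) → (j : ℕ∞) ≤ (⊤ : ℕ∞) →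
      Integrable fun v => ‖v‖ ^ k * ‖iteratedFDeriv ℝ j f v‖ := fun k j hk _ => by
    have : k = 0 := by simpa using hk
    subst this
    simpa using (hb.integral_le hK j ξ).1
  have h1 : ∀ j : ℕ, ‖θ‖ ^ j * ‖𝓕 f θ‖ ≤ 2 ^ j * ∑ l ∈ Finset.range (j + 1),
      A l * bracket ξ ^ m * volume.real K := fun j => by
    have h := Real.pow_mul_norm_iteratedFDeriv_fourier_le (K := 0) (N := ⊤) (hb.contDiff ξ) hint
      (k := 0) (n := j) le_rfl le_top θ
    rw [norm_iteratedFDeriv_zero, Finset.sum_product] at h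
    simp only [zero_add, Finset.range_one, Finset.sum_singleton, pow_zero, one_mul, Nat.cast_zero,
      mul_zero] at h
    refine h.trans ?_
    gcongr with l hl
    exact (hb.integral_le hK l ξ).2
  have h2 : bracket θ ^ N * ‖𝓕 f θ‖ ≤ 2 ^ N * volume.real K *
      (A 0 + 2 ^ N * ∑ j ∈ Finset.range (N + 1), A j) * bracket ξ ^ m := by
    calc bracket θ ^ N * ‖𝓕 f θ‖ ≤ 2 ^ N * (1 + ‖θ‖ ^ N) * ‖𝓕 f θ‖ := by
          gcongr; exact bracket_pow_le θ N
      _ = 2 ^ N * (‖θ‖ ^ 0 * ‖𝓕 f θ‖ + ‖θ‖ ^ N * ‖𝓕 f θ‖) := by ring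
      _ ≤ 2 ^ N * (2 ^ 0 * ∑ l ∈ Finset.range (0 + 1), A l * bracket ξ ^ m * volume.real K +
          2 ^ N * ∑ l ∈ Finset.range (N + 1), A l * bracket ξ ^ m * volume.real K) := by
          exact mul_le_mul_of_nonneg_left (add_le_add (h1 0) (h1 N)) (by positivity)
      _ = _ := by
          rw [← Finset.sum_mul, ← Finset.sum_mul, ← Finset.sum_mul, ← Finset.sum_mul]
          simp; ring
  have hbp : 0 < bracket θ ^ N := pow_pos (bracket_pos _) _
  rw [Real.rpow_neg (bracket_pos _).le, Real.rpow_natCast]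
  calc ‖𝓕 f θ‖ = (bracket θ ^ N * ‖𝓕 f θ‖) * (bracket θ ^ N)⁻¹ := by field_simp
    _ ≤ _ := by
      rw [mul_right_comm _ _ (bracket ξ ^ m)]
      gcongr

theorem lintegral_temperate_mul_lt_top {g : E n → ℝ} (hg : g.HasTemperateGrowth) (f : 𝓢(E n, ℂ)) :
    ∫⁻ x, ENNReal.ofReal |g x| * ‖f x‖ₑ < ⊤ := by
  have h := (SchwartzMap.smulLeftCLM ℂ g f).integrable (μ := volume)
  refine lt_of_eq_of_lt (lintegral_congr fun x => ?_) h.2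
  rw [smulLeft_apply hg, enorm_mul, ← ofReal_norm (g x : ℂ), Complex.norm_real, Real.norm_eq_abs]

theorem exists_lintegral_bracket_mul_le (m : ℝ) (g : 𝓢(E n, ℂ)) : ∃ C : ℝ, 0 ≤ C ∧
    ∀ ρ : Fin n → ℝ, (∀ i, 0 ≤ ρ i) → (∀ i, ρ i ≤ 1) → ∀ ζ : E n,
      ∫⁻ η, ENNReal.ofReal (bracket (scl ρ η) ^ m) * ‖g (ζ - η)‖ₑ ≤
        ENNReal.ofReal (C * wt ρ m 0 ζ) := by
  have hpi := Real.pi_pos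
  set I := ∫⁻ x, ENNReal.ofReal |bracket x ^ (|m|)| * ‖g x‖ₑ with hI
  have hI2 : I < ⊤ := lintegral_temperate_mul_lt_top (hasTemperateGrowth_bracket_rpow _) g
  refine ⟨(4 * Real.pi) ^ |m| * I.toReal, by positivity, fun ρ h0 h1 ζ => ?_⟩
  have hw : wt ρ m 0 ζ = bracket (scl ρ ζ) ^ m := by simp [wt]
  have hp : 0 < bracket (scl ρ ζ) ^ m := Real.rpow_pos_of_pos (bracket_pos _) _
  calc _ ≤ ∫⁻ η, ENNReal.ofReal ((4 * Real.pi) ^ |m| * bracket (scl ρ ζ) ^ m) *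
        (ENNReal.ofReal |bracket (ζ - η) ^ (|m|)| * ‖g (ζ - η)‖ₑ) := by
        refine lintegral_mono fun η => ?_
        rw [← mul_assoc, ← ENNReal.ofReal_mul (by positivity)]
        gcongr
        refine (bracket_scl_rpow_le h0 h1 m η ζ).trans ?_
        rw [← bracket_neg (η - ζ), neg_sub]
        gcongr
        exact le_abs_self _
    _ = ENNReal.ofReal ((4 * Real.pi) ^ |m| * bracket (scl ρ ζ) ^ m) * I := by
        rw [lintegral_const_mul' _ _ ENNReal.ofReal_ne_top,
          lintegral_sub_left_eq_self (fun x => ENNReal.ofReal |bracket x ^ (|m|)| * ‖g x‖ₑ) ζ]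
    _ = _ := by
        rw [← ENNReal.ofReal_toReal hI2.ne, ← ENNReal.ofReal_mul (by positivity), hw]
        congr 1
        rw [ENNReal.toReal_ofReal (by positivity)]; ring

/-- The exponential `e^{2πi⟨x, ζ⟩}`. -/
def ex (x ζ : E n) : ℂ := Complex.exp ((2 * Real.pi * inner ℝ x ζ : ℝ) * Complex.I)

theorem norm_ex (x ζ : E n) : ‖ex x ζ‖ = 1 := Complex.norm_exp_ofReal_mul_I _

theorem ex_add_left (x y ζ : E n) : ex (x + y) ζ = ex x ζ * ex y ζ := by
  simp only [ex, ← Complex.exp_add, inner_add_left]; congr 1; push_cast; ring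

theorem ex_add_right (x ζ η : E n) : ex x (ζ + η) = ex x ζ * ex x η := by
  simp only [ex, ← Complex.exp_add, inner_add_right]; congr 1; push_cast; ring

theorem ex_neg_right (x y : E n) : ex x (-y) = ex (-x) y := by simp [ex]

theorem contDiff_ex : ContDiff ℝ ∞ fun p : E n × E n => ex p.1 p.2 := by
  unfold ex
  exact Complex.contDiff_exp.comp ((Complex.ofRealCLM.contDiff.comp
    (contDiff_const.mul (contDiff_fst.inner ℝ contDiff_snd))).mul contDiff_const)

theorem fourier_eq_ex (f : E n → ℂ) (w : E n) : 𝓕 f w = ∫ v, ex v (-w) * f v := by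
  rw [Real.fourier_eq']
  simp only [ex, smul_eq_mul, inner_neg_right]
  congr 1; ext v; congr 3; push_cast; ring_nf

theorem fourierInv_eq_ex (f : E n → ℂ) (w : E n) : 𝓕⁻ f w = ∫ v, ex v w * f v := by
  rw [Real.fourierInv_eq']
  simp only [ex, smul_eq_mul]

theorem integral_cutoff_eq {ψ : 𝓢(E n, ℂ)} (hψ : HasCompactSupport ψ) (v : 𝓢(E n, ℂ)) (x η : E n) :
    ∫ y, ex (x - y) η * ψ (x - y) * v y = ∫ ζ, (𝓕 ψ) (ζ - η) * (𝓕 v) ζ * ex x ζ := by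
  have hc : HasCompactSupport fun y => ex (x - y) η * ψ (x - y) :=
    (hψ.comp_homeomorph (Homeomorph.subLeft x)).mul_left
  have hd : ContDiff ℝ ∞ fun y => ex (x - y) η * ψ (x - y) :=
    (contDiff_ex.comp ((contDiff_const.sub contDiff_id).prodMk contDiff_const)).mul
      ((ψ.smooth ⊤).comp (contDiff_const.sub contDiff_id))
  let g : 𝓢(E n, ℂ) := hc.toSchwartzMap hd
  have hg : ∀ ζ, (𝓕⁻ g) ζ = ex x ζ * (𝓕 ψ) (ζ - η) := fun ζ => by
    rw [SchwartzMap.fourierInv_coe, fourierInv_eq_ex, SchwartzMap.fourier_coe, fourier_eq_ex,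
      ← integral_const_mul, ← integral_sub_left_eq_self _ volume x]
    refine integral_congr_ae (Eventually.of_forall fun z => ?_)
    change ex (x - z) ζ * (ex (x - (x - z)) η * ψ (x - (x - z))) = _
    rw [sub_sub_cancel, sub_eq_add_neg x z, ex_add_left, neg_sub]
    have : ex z (η - ζ) = ex z η * ex (-z) ζ := by
      rw [sub_eq_add_neg, ex_add_right, ex_neg_right]
    simp only [this]
    ring
  have h1 := SchwartzMap.integral_fourier_mul_eq (𝓕⁻ g) v
  rw [FourierTransform.fourier_fourierInv_eq] at h1
  calc _ = ∫ y, g y * v y := rfl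
    _ = _ := h1
    _ = _ := integral_congr_ae (Eventually.of_forall fun ζ => by
      simp only [hg]; ring)

/-- The operator with symbol `b(x, 2πρη)`, cut off near the diagonal. -/
def locOp (ρ : Fin n → ℝ) (b : E n → E n → ℂ) (ψ v : E n → ℂ) (x : E n) : ℂ :=
  ∫ η, b x (scl ρ η) * ∫ y, ex (x - y) η * ψ (x - y) * v y

/-- The integrand in the expression of `locOp` on the Fourier side. -/
def locKer (ρ : Fin n → ℝ) (b : E n → E n → ℂ) (ψ v : 𝓢(E n, ℂ)) (x : E n) (p : E n × E n) : ℂ :=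
  b x (scl ρ p.1) * ((𝓕 ψ) (p.2 - p.1) * (𝓕 v) p.2 * ex x p.2)

variable {ρ : Fin n → ℝ} {ψ v : 𝓢(E n, ℂ)}

theorem SymBd.continuous_locKer (hb : SymBd K m A b) :
    Continuous fun q : E n × E n × E n => locKer ρ b ψ v q.1 q.2 := by
  have h1 : Continuous fun q : E n × E n × E n => b q.1 (scl ρ q.2.1) :=
    hb.smooth.continuous.comp (g := fun z : E n × E n => b z.1 z.2)
      (f := fun q : E n × E n × E n => (q.1, scl ρ q.2.1)) (by fun_prop)
  have h2 : Continuous fun q : E n × E n × E n => ex q.1 q.2.2 :=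
    contDiff_ex.continuous.comp (g := fun z : E n × E n => ex z.1 z.2)
      (f := fun q : E n × E n × E n => (q.1, q.2.2)) (by fun_prop)
  have h3 := (𝓕 ψ).continuous
  have h4 := (𝓕 v).continuous
  exact h1.mul (((h3.comp (by fun_prop)).mul (h4.comp (by fun_prop))).mul h2)

theorem exists_integrable_dominating (m : ℝ) (ψ v : 𝓢(E n, ℂ)) (h0 : ∀ i, 0 ≤ ρ i)
    (h1 : ∀ i, ρ i ≤ 1) : Integrable (fun p : E n × E n =>
      bracket (scl ρ p.1) ^ m * (‖(𝓕 ψ) (p.2 - p.1)‖ * ‖(𝓕 v) p.2‖)) (volume.prod volume) := by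
  have hc1 : Continuous fun p : E n × E n => bracket (scl ρ p.1) ^ m :=
    (continuous_bracket_rpow m).comp (by fun_prop)
  have hc2 := (𝓕 ψ).continuous
  have hc3 := (𝓕 v).continuous
  refine ⟨(by fun_prop : Continuous _).aestronglyMeasurable, ?_⟩
  obtain ⟨C, hC0, hC⟩ := exists_lintegral_bracket_mul_le m (𝓕 ψ)
  have he : ∀ p : E n × E n, ‖bracket (scl ρ p.1) ^ m * (‖(𝓕 ψ) (p.2 - p.1)‖ * ‖(𝓕 v) p.2‖)‖ₑ =
      ENNReal.ofReal (bracket (scl ρ p.1) ^ m) * ‖(𝓕 ψ) (p.2 - p.1)‖ₑ * ‖(𝓕 v) p.2‖ₑ := fun p => by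
    rw [enorm_mul, enorm_mul, enorm_norm, enorm_norm, Real.enorm_of_nonneg
      (Real.rpow_nonneg (bracket_pos _).le _), mul_assoc]
  rw [HasFiniteIntegral]
  simp only [he]
  have hm : Measurable fun p : E n × E n =>
      ENNReal.ofReal (bracket (scl ρ p.1) ^ m) * ‖(𝓕 ψ) (p.2 - p.1)‖ₑ * ‖(𝓕 v) p.2‖ₑ :=
    (hc1.measurable.ennreal_ofReal.mul
      (hc2.comp (continuous_snd.sub continuous_fst)).measurable.enorm).mul
      (hc3.comp continuous_snd).measurable.enorm
  rw [lintegral_prod_symm' _ hm]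
  calc _ = ∫⁻ ζ, (∫⁻ η, ENNReal.ofReal (bracket (scl ρ η) ^ m) * ‖(𝓕 ψ) (ζ - η)‖ₑ) * ‖(𝓕 v) ζ‖ₑ := by
        exact lintegral_congr fun ζ => lintegral_mul_const' ‖(𝓕 v) ζ‖ₑ
          (fun η => ENNReal.ofReal (bracket (scl ρ η) ^ m) * ‖(𝓕 ψ) (ζ - η)‖ₑ) enorm_ne_top
    _ ≤ ∫⁻ ζ, ENNReal.ofReal C * (ENNReal.ofReal |wt ρ m 0 ζ| * ‖(𝓕 v) ζ‖ₑ) := by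
        refine lintegral_mono fun ζ => ?_
        rw [← mul_assoc, ← ENNReal.ofReal_mul hC0, abs_of_pos (wt_pos ζ)]
        gcongr
        exact hC ρ h0 h1 ζ
    _ < ⊤ := by
        rw [lintegral_const_mul' _ _ ENNReal.ofReal_ne_top]
        exact ENNReal.mul_lt_top ENNReal.ofReal_lt_top
          (lintegral_temperate_mul_lt_top hasTemperateGrowth_wt (𝓕 v))

theorem SymBd.norm_locKer_le (hb : SymBd K m A b) (x : E n) (p : E n × E n) :
    ‖locKer ρ b ψ v x p‖ ≤ A 0 * (bracket (scl ρ p.1) ^ m * (‖(𝓕 ψ) (p.2 - p.1)‖ * ‖(𝓕 v) p.2‖)) := by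
  rw [locKer, norm_mul, norm_mul, norm_mul, norm_ex, mul_one]
  exact (mul_le_mul_of_nonneg_right (hb.norm_le _ _) (by positivity)).trans_eq (mul_assoc _ _ _)

theorem SymBd.integrable_locKer (hb : SymBd K m A b) (h0 : ∀ i, 0 ≤ ρ i) (h1 : ∀ i, ρ i ≤ 1)
    (x : E n) : Integrable (locKer ρ b ψ v x) (volume.prod volume) :=
  ((exists_integrable_dominating m ψ v h0 h1).const_mul (A 0)).mono'
    (hb.continuous_locKer.comp (Continuous.prodMk_right x)).aestronglyMeasurable
    (Eventually.of_forall (hb.norm_locKer_le x))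

theorem SymBd.locOp_eq (hb : SymBd K m A b) (h0 : ∀ i, 0 ≤ ρ i) (h1 : ∀ i, ρ i ≤ 1)
    (hψ : HasCompactSupport ψ) (x : E n) :
    locOp ρ b ψ v x = ∫ p, locKer ρ b ψ v x p ∂(volume.prod volume) := by
  rw [integral_prod _ (hb.integrable_locKer h0 h1 x), locOp]
  refine integral_congr_ae (Eventually.of_forall fun η => ?_)
  simp only [integral_cutoff_eq hψ v x η, locKer, integral_const_mul]

theorem SymBd.continuous_locOp (hb : SymBd K m A b) (h0 : ∀ i, 0 ≤ ρ i) (h1 : ∀ i, ρ i ≤ 1)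
    (hψ : HasCompactSupport ψ) : Continuous (locOp ρ b ψ v) := by
  rw [show locOp ρ b ψ v = fun x => ∫ p, locKer ρ b ψ v x p ∂(volume.prod volume) from
    funext fun x => hb.locOp_eq h0 h1 hψ x]
  refine continuous_of_dominated (fun x => (hb.integrable_locKer h0 h1 x).1)
    (fun x => Eventually.of_forall (hb.norm_locKer_le x))
    ((exists_integrable_dominating m ψ v h0 h1).const_mul (A 0)) (Eventually.of_forall fun p => ?_)
  exact hb.continuous_locKer.comp (g := fun q : E n × E n × E n => locKer ρ b ψ v q.1 q.2)
    (f := fun x => (x, p)) (by fun_prop)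

theorem SymBd.locOp_eq_zero (hb : SymBd K m A b) {v : E n → ℂ} {ψ : E n → ℂ} {x : E n} (hx : x ∉ K) :
    locOp ρ b ψ v x = 0 := by
  simp [locOp, hb.supp x hx]

theorem SymBd.hasCompactSupport_locOp (hK : IsCompact K) (hb : SymBd K m A b) {v : E n → ℂ}
    {ψ : E n → ℂ} : HasCompactSupport (locOp ρ b ψ v) :=
  HasCompactSupport.intro hK fun _ hx => hb.locOp_eq_zero hx

theorem SymBd.fourier_locOp (hK : IsCompact K) (hb : SymBd K m A b) (h0 : ∀ i, 0 ≤ ρ i)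
    (h1 : ∀ i, ρ i ≤ 1) (hψ : HasCompactSupport ψ) (τ : E n) :
    𝓕 (locOp ρ b ψ v) τ = ∫ p : E n × E n, 𝓕 (fun y => b y (scl ρ p.1)) (τ - p.2) *
      ((𝓕 ψ) (p.2 - p.1) * (𝓕 v) p.2) ∂(volume.prod volume) := by
  have hc2 : Continuous fun x : E n => ex x (-τ) :=
    contDiff_ex.continuous.comp (g := fun z : E n × E n => ex z.1 z.2)
      (f := fun x : E n => (x, -τ)) (by fun_prop)
  have hint : Integrable (fun q : E n × E n × E n => ex q.1 (-τ) * locKer ρ b ψ v q.1 q.2)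
      (volume.prod (volume.prod volume)) := by
    have hA : Integrable (K.indicator fun _ : E n => A 0) :=
      (integrable_indicator_iff hK.measurableSet).2
        (integrableOn_const (μ := volume) (C := A 0) hK.measure_lt_top.ne)
    refine (hA.mul_prod (exists_integrable_dominating (ρ := ρ) m ψ v h0 h1)).mono' ?_
      (Eventually.of_forall fun q => ?_)
    · exact ((hc2.comp continuous_fst).mul
        (hb.continuous_locKer (ρ := ρ) (ψ := ψ) (v := v))).aestronglyMeasurable
    · rw [norm_mul, norm_ex, one_mul]
      by_cases hq : q.1 ∈ K
      · rw [indicator_of_mem hq]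
        exact hb.norm_locKer_le q.1 q.2
      · rw [indicator_of_notMem hq, locKer, hb.supp _ hq]; simp
  rw [fourier_eq_ex]
  calc _ = ∫ x, ∫ p, ex x (-τ) * locKer ρ b ψ v x p ∂(volume.prod volume) := by
        refine integral_congr_ae (Eventually.of_forall fun x => ?_)
        simp only [hb.locOp_eq h0 h1 hψ x, integral_const_mul]
    _ = ∫ p, (∫ x, ex x (-τ) * locKer ρ b ψ v x p) ∂(volume.prod volume) :=
        integral_integral_swap hint
    _ = _ := by
        refine integral_congr_ae (Eventually.of_forall fun p => ?_)
        have h := fourier_eq_ex (fun y => b y (scl ρ p.1)) (τ - p.2)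
        beta_reduce
        rw [h, ← integral_mul_const]
        refine integral_congr_ae (Eventually.of_forall fun x => ?_)
        simp only [locKer]
        rw [neg_sub, sub_eq_add_neg p.2 τ, ex_add_right]
        ring

theorem SymBd.enorm_fourier_locOp_le (hK : IsCompact K) (m : ℝ) (A : ℕ → ℝ)
    (hψ : HasCompactSupport ψ) (N : ℕ) : ∃ C : ℝ, 0 ≤ C ∧ ∀ b : E n → E n → ℂ, SymBd K m A b →
    ∀ ρ : Fin n → ℝ, (∀ i, 0 ≤ ρ i) → (∀ i, ρ i ≤ 1) → ∀ (v : 𝓢(E n, ℂ)) (τ : E n),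
      ‖𝓕 (locOp ρ b ψ v) τ‖ₑ ≤
        ∫⁻ ζ, ENNReal.ofReal (C * bracket (τ - ζ) ^ (-(N : ℝ)) * wt ρ m 0 ζ) * ‖(𝓕 v) ζ‖ₑ := by
  obtain ⟨C, hC0, hC⟩ := exists_lintegral_bracket_mul_le m (𝓕 ψ)
  set C' := 2 ^ N * volume.real K * (A 0 + 2 ^ N * ∑ j ∈ Finset.range (N + 1), A j) with hC'
  by_cases hex : ∃ b : E n → E n → ℂ, SymBd K m A b
  swap
  · exact ⟨0, le_rfl, fun b hb => absurd ⟨b, hb⟩ hex⟩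
  obtain ⟨b₀, hb₀⟩ := hex
  have hC'0 : 0 ≤ C' := by
    have := hb₀.nonneg 0
    have : 0 ≤ ∑ j ∈ Finset.range (N + 1), A j := Finset.sum_nonneg fun j _ => hb₀.nonneg j
    positivity
  refine ⟨C' * C, by positivity, fun b hb ρ h0 h1 v τ => ?_⟩
  have hc1 : Continuous fun p : E n × E n => bracket (scl ρ p.1) ^ m :=
    (continuous_bracket_rpow m).comp (by fun_prop)
  have hc4 : Continuous fun p : E n × E n => bracket (τ - p.2) ^ (-(N : ℝ)) :=
    (continuous_bracket_rpow _).comp (by fun_prop)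
  have hc2 := (𝓕 ψ).continuous
  have hc3 := (𝓕 v).continuous
  rw [hb.fourier_locOp hK h0 h1 hψ]
  refine (enorm_integral_le_lintegral_enorm _).trans ?_
  calc _ ≤ ∫⁻ p : E n × E n, ENNReal.ofReal (C' * bracket (τ - p.2) ^ (-(N : ℝ))) *
        ‖(𝓕 v) p.2‖ₑ * (ENNReal.ofReal (bracket (scl ρ p.1) ^ m) * ‖(𝓕 ψ) (p.2 - p.1)‖ₑ)
          ∂(volume.prod volume) := by
        refine lintegral_mono fun p => ?_
        have h := hb.norm_fourier_le hK N (τ - p.2) (scl ρ p.1)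
        have hp : 0 < bracket (τ - p.2) ^ (-(N : ℝ)) := Real.rpow_pos_of_pos (bracket_pos _) _
        rw [enorm_mul, enorm_mul, ← ofReal_norm (𝓕 (fun y => b y (scl ρ p.1)) (τ - p.2))]
        calc _ ≤ ENNReal.ofReal (C' * bracket (τ - p.2) ^ (-(N : ℝ)) * bracket (scl ρ p.1) ^ m) *
              (‖(𝓕 ψ) (p.2 - p.1)‖ₑ * ‖(𝓕 v) p.2‖ₑ) := by gcongr
          _ = _ := by rw [ENNReal.ofReal_mul (by positivity)]; ring
    _ = ∫⁻ ζ, ENNReal.ofReal (C' * bracket (τ - ζ) ^ (-(N : ℝ))) * ‖(𝓕 v) ζ‖ₑ *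
          ∫⁻ η, (ENNReal.ofReal (bracket (scl ρ η) ^ m) * ‖(𝓕 ψ) (ζ - η)‖ₑ) := by
        have hm : Measurable fun p : E n × E n => ENNReal.ofReal
            (C' * bracket (τ - p.2) ^ (-(N : ℝ))) * ‖(𝓕 v) p.2‖ₑ *
            (ENNReal.ofReal (bracket (scl ρ p.1) ^ m) * ‖(𝓕 ψ) (p.2 - p.1)‖ₑ) :=
          ((continuous_const.mul hc4).measurable.ennreal_ofReal.mul
            (hc3.comp continuous_snd).measurable.enorm).mul (hc1.measurable.ennreal_ofReal.mul
            (hc2.comp (continuous_snd.sub continuous_fst)).measurable.enorm)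
        rw [lintegral_prod_symm' _ hm]
        exact lintegral_congr fun ζ => lintegral_const_mul'
          (ENNReal.ofReal (C' * bracket (τ - ζ) ^ (-(N : ℝ))) * ‖(𝓕 v) ζ‖ₑ)
          (fun η => ENNReal.ofReal (bracket (scl ρ η) ^ m) * ‖(𝓕 ψ) (ζ - η)‖ₑ)
          (ENNReal.mul_ne_top ENNReal.ofReal_ne_top enorm_ne_top)
    _ ≤ _ := by
        refine lintegral_mono fun ζ => ?_
        have hp : 0 < bracket (τ - ζ) ^ (-(N : ℝ)) := Real.rpow_pos_of_pos (bracket_pos _) _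
        calc _ ≤ ENNReal.ofReal (C' * bracket (τ - ζ) ^ (-(N : ℝ))) * ‖(𝓕 v) ζ‖ₑ *
              ENNReal.ofReal (C * wt ρ m 0 ζ) := by gcongr; exact hC ρ h0 h1 ζ
          _ = _ := by
            rw [mul_right_comm, ← ENNReal.ofReal_mul (by positivity)]
            congr 2; ring

theorem SymBd.exists_sn_locOp_le (hK : IsCompact K) (m : ℝ) (A : ℕ → ℝ) (hψ : HasCompactSupport ψ)
    (s k : ℝ) : ∃ C : ℝ≥0∞, C ≠ ⊤ ∧ ∀ b : E n → E n → ℂ, SymBd K m A b →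
    ∀ ρ : Fin n → ℝ, (∀ i, 0 ≤ ρ i) → (∀ i, ρ i ≤ 1) → ∀ v : 𝓢(E n, ℂ),
      sn ρ (s - m) k (locOp ρ b ψ v) ≤ C * sn ρ s k v := by
  obtain ⟨C₁, hC₁, h₁⟩ := qn_le_of_kernel (n := n) s m k
  obtain ⟨C₂, hC₂, h₂⟩ := SymBd.enorm_fourier_locOp_le hK m A hψ ⌈|s - m| + |k| + (n + 1)⌉₊
  refine ⟨ENNReal.ofReal (C₁ * C₂ ^ 2), ENNReal.ofReal_ne_top, fun b hb ρ h0 h1' v => ?_⟩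
  refine h₁ ρ h0 h1' C₂ hC₂ _ _ (𝓕 v).continuous.measurable fun τ => ?_
  refine (h₂ b hb ρ h0 h1' v τ).trans (lintegral_mono fun ζ => ?_)
  have := wt_pos (ρ := ρ) (s := m) (k := 0) ζ
  refine mul_le_mul_left (ENNReal.ofReal_le_ofReal ?_) _
  gcongr
  · exact one_le_bracket _
  · exact Nat.le_ceil _

theorem SymBd.contDiff_locOp (hK : IsCompact K) (hb : SymBd K m A b) (h0 : ∀ i, 0 ≤ ρ i)
    (h1 : ∀ i, ρ i ≤ 1) (hψ : HasCompactSupport ψ) : ContDiff ℝ ∞ (locOp ρ b ψ v) := by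
  set u := locOp ρ b ψ v with hu
  have hcont : Continuous u := hb.continuous_locOp h0 h1 hψ
  have hint : Integrable u := hcont.integrable_of_hasCompactSupport (hb.hasCompactSupport_locOp hK)
  have hWc : Continuous (𝓕 u) :=
    VectorFourier.fourierIntegral_continuous Real.continuous_fourierChar continuous_inner hint
  have hdec : ∀ N : ℕ, ∃ C : ℝ, ∀ τ, ‖𝓕 u τ‖ ≤ C * bracket τ ^ (-(N : ℝ)) := by
    intro N
    obtain ⟨C, hC0, hC⟩ := SymBd.enorm_fourier_locOp_le hK m A hψ N
    have hfin : ∫⁻ ζ, ENNReal.ofReal |bracket ζ ^ (N : ℝ) * wt ρ m 0 ζ| * ‖(𝓕 v) ζ‖ₑ < ⊤ :=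
      lintegral_temperate_mul_lt_top
      ((hasTemperateGrowth_bracket_rpow (n := n) N).mul (hasTemperateGrowth_wt (ρ := ρ) (s := m) (k := 0)))
      (𝓕 v)
    set I := ∫⁻ ζ, ENNReal.ofReal |bracket ζ ^ (N : ℝ) * wt ρ m 0 ζ| * ‖(𝓕 v) ζ‖ₑ with hI
    refine ⟨C * 2 ^ N * I.toReal, fun τ => ?_⟩
    have hp : 0 < bracket τ ^ (-(N : ℝ)) := Real.rpow_pos_of_pos (bracket_pos _) _
    rw [← ENNReal.ofReal_le_ofReal_iff (by positivity), ofReal_norm]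
    refine (hC b hb ρ h0 h1 v τ).trans ?_
    rw [mul_right_comm, ENNReal.ofReal_mul (by positivity), ENNReal.ofReal_toReal hfin.ne, hI,
      ← lintegral_const_mul' _ _ ENNReal.ofReal_ne_top]
    refine lintegral_mono fun ζ => ?_
    have hw := wt_pos (ρ := ρ) (s := m) (k := 0) ζ
    have hbz := bracket_pos ζ
    have hbt := bracket_pos τ
    have hbtz := bracket_pos (τ - ζ)
    rw [← mul_assoc, ← ENNReal.ofReal_mul (by positivity)]
    refine mul_le_mul_left (ENNReal.ofReal_le_ofReal ?_) _
    rw [abs_of_pos (by positivity), Real.rpow_neg hbt.le, Real.rpow_neg hbtz.le, Real.rpow_natCast,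
      Real.rpow_natCast, Real.rpow_natCast]
    have h3 : bracket τ ^ N ≤ (2 * bracket (τ - ζ) * bracket ζ) ^ N := by
      refine pow_le_pow_left₀ hbt.le ?_ N
      simpa using bracket_add_le (τ - ζ) ζ
    have h4 : (bracket (τ - ζ) ^ N)⁻¹ ≤ 2 ^ N * (bracket τ ^ N)⁻¹ * bracket ζ ^ N := by
      rw [inv_le_iff_one_le_mul₀ (by positivity)]
      calc (1 : ℝ) = bracket τ ^ N * (bracket τ ^ N)⁻¹ := by field_simp
        _ ≤ (2 * bracket (τ - ζ) * bracket ζ) ^ N * (bracket τ ^ N)⁻¹ := by gcongr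
        _ = _ := by rw [mul_pow, mul_pow]; ring
    calc _ ≤ C * (2 ^ N * (bracket τ ^ N)⁻¹ * bracket ζ ^ N) * wt ρ m 0 ζ := by gcongr
      _ = _ := by ring
  have hintN : ∀ k : ℕ, Integrable fun τ => ‖τ‖ ^ k * ‖𝓕 u τ‖ := by
    intro k
    obtain ⟨C, hC⟩ := hdec (k + (n + 1))
    have hbi : Integrable fun τ : E n => C * bracket τ ^ (-((n : ℝ) + 1)) := by
      refine Integrable.const_mul ⟨(continuous_bracket_rpow _).aestronglyMeasurable, ?_⟩ C
      refine lt_of_eq_of_lt (lintegral_congr fun τ => ?_) (lintegral_bracket_lt_top (n := n))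
      rw [Real.enorm_of_nonneg (Real.rpow_nonneg (bracket_pos _).le _)]
    refine hbi.mono' (by fun_prop) (Eventually.of_forall fun τ => ?_)
    have hbt := bracket_pos τ
    rw [Real.norm_of_nonneg (by positivity)]
    calc ‖τ‖ ^ k * ‖𝓕 u τ‖ ≤ bracket τ ^ k * (C * bracket τ ^ (-((k + (n + 1) : ℕ) : ℝ))) := by
          gcongr
          · exact norm_le_bracket τ
          · exact hC τ
      _ = _ := by
          rw [mul_left_comm, ← Real.rpow_natCast, ← Real.rpow_add hbt]
          congr 2; push_cast; ring
  have hinv : u = fun x => 𝓕 (𝓕 u) (-x) := by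
    have h := hcont.fourierInv_fourier_eq hint 
      ((integrable_norm_iff hWc.aestronglyMeasurable).1 (by simpa using hintN 0))
    conv_lhs => rw [← h]
    funext x
    rw [Real.fourierInv_eq_fourier_neg]
  rw [hinv]
  exact (Real.contDiff_fourier (N := ⊤) fun k _ => hintN k).comp contDiff_neg

end LocalOp

/-! ### Compactly supported distributions -/

section Dist

variable {n : ℕ}

/-- Complex valued test functions on `(-2, 2)ⁿ`. -/
structure IsTest (f : E n → ℂ) : Prop where
  smooth : ContDiff ℝ ∞ f
  compact : HasCompactSupport f
  sub : tsupport f ⊆ cube n 2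

/-- The composition of a complex valued test function with a real linear functional. -/
def IsTest.clm {f : E n → ℂ} (hf : IsTest f) (L : ℂ →L[ℝ] ℝ) : 𝓓(box n, ℝ) where
  toFun x := L (f x)
  contDiff' := L.contDiff.comp hf.smooth
  hasCompactSupport' := hf.compact.comp_left (map_zero L)
  tsupport_subset' := (tsupport_comp_subset (map_zero L) f).trans hf.sub

open Classical in
/-- The complex linear extension of a distribution, evaluated at a complex valued function. -/
def cev (v : 𝓓'(box n, ℂ)) (f : E n → ℂ) : ℂ :=
  if hf : IsTest f then v (hf.clm Complex.reCLM) + Complex.I * v (hf.clm Complex.imCLM) else 0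

variable {v : 𝓓'(box n, ℂ)} {f g : E n → ℂ}

theorem cev_eq (hf : IsTest f) :
    cev v f = v (hf.clm Complex.reCLM) + Complex.I * v (hf.clm Complex.imCLM) := dif_pos hf

theorem IsTest.ofReal (f : 𝓓(box n, ℝ)) : IsTest fun x => (f x : ℂ) :=
  ⟨Complex.ofRealCLM.contDiff.comp f.contDiff, f.hasCompactSupport.comp_left Complex.ofReal_zero,
    (tsupport_comp_subset Complex.ofReal_zero f).trans f.tsupport_subset⟩

theorem cev_ofReal (f : 𝓓(box n, ℝ)) : cev v (fun x => (f x : ℂ)) = v f := by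
  rw [cev_eq (IsTest.ofReal f)]
  have h1 : (IsTest.ofReal f).clm Complex.reCLM = f := by ext x; rfl
  have h2 : (IsTest.ofReal f).clm Complex.imCLM = 0 := by ext x; rfl
  rw [h1, h2, map_zero, mul_zero, add_zero]

theorem IsTest.add (hf : IsTest f) (hg : IsTest g) : IsTest fun x => f x + g x :=
  ⟨hf.smooth.add hg.smooth, hf.compact.add hg.compact,
    (tsupport_add f g).trans (union_subset hf.sub hg.sub)⟩

theorem IsTest.mul_left (hf : IsTest f) (hg : ContDiff ℝ ∞ g) : IsTest fun x => g x * f x :=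
  ⟨hg.mul hf.smooth, hf.compact.mul_left, tsupport_mul_subset_right.trans hf.sub⟩

theorem IsTest.mul_right (hf : IsTest f) (hg : ContDiff ℝ ∞ g) : IsTest fun x => f x * g x :=
  ⟨hf.smooth.mul hg, hf.compact.mul_right, tsupport_mul_subset_left.trans hf.sub⟩

theorem cev_add (hf : IsTest f) (hg : IsTest g) : cev v (fun x => f x + g x) = cev v f + cev v g := by
  rw [cev_eq hf, cev_eq hg, cev_eq (hf.add hg)]
  have h : ∀ L : ℂ →L[ℝ] ℝ, (hf.add hg).clm L = hf.clm L + hg.clm L := fun L => by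
    ext x; exact map_add L _ _
  rw [h, h, map_add, map_add]; ring

theorem cev_const_mul (c : ℂ) (hf : IsTest f) : cev v (fun x => c * f x) = c * cev v f := by
  have hcf : IsTest fun x => c * f x := hf.mul_left contDiff_const
  rw [cev_eq hf, cev_eq hcf]
  have h1 : hcf.clm Complex.reCLM = c.re • hf.clm Complex.reCLM - c.im • hf.clm Complex.imCLM := by
    ext x; exact Complex.mul_re _ _
  have h2 : hcf.clm Complex.imCLM = c.re • hf.clm Complex.imCLM + c.im • hf.clm Complex.reCLM := by
    ext x; exact Complex.mul_im _ _
  rw [h1, h2, map_sub, map_add, map_smul, map_smul, map_smul, map_smul]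
  simp only [Complex.real_smul]
  conv_rhs => rw [← Complex.re_add_im c]
  linear_combination (c.im * v (hf.clm Complex.imCLM) : ℂ) * Complex.I_sq.symm

theorem isTest_zero : IsTest fun _ : E n => (0 : ℂ) :=
  ⟨contDiff_const, HasCompactSupport.zero, by simp [tsupport]⟩

theorem cev_zero : cev v (fun _ : E n => (0 : ℂ)) = 0 := by
  have := cev_const_mul (v := v) 0 isTest_zero
  simpa using this

theorem IsTest.sum {J : Type*} (s : Finset J) {f : J → E n → ℂ} (hf : ∀ j ∈ s, IsTest (f j)) :
    IsTest fun x => ∑ j ∈ s, f j x := by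
  classical
  induction s using Finset.induction_on with
  | empty => simpa using isTest_zero
  | insert a s ha ih =>
    simp only [Finset.sum_insert ha]
    exact (hf a (by simp)).add (ih fun j hj => hf j (by simp [hj]))

theorem cev_sum {J : Type*} (s : Finset J) {f : J → E n → ℂ} (hf : ∀ j ∈ s, IsTest (f j)) :
    cev v (fun x => ∑ j ∈ s, f j x) = ∑ j ∈ s, cev v (f j) := by
  classical
  induction s using Finset.induction_on with
  | empty => simpa using cev_zero
  | insert a s ha ih =>
    simp only [Finset.sum_insert ha]
    rw [cev_add (hf a (by simp)) (IsTest.sum s fun j hj => hf j (by simp [hj])),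
      ih fun j hj => hf j (by simp [hj])]

theorem exists_cev_bound (v : 𝓓'(box n, ℂ)) {K : Set (E n)} (hK : IsCompact K) (hK2 : K ⊆ cube n 2) :
    ∃ (C : ℝ) (N : ℕ), 0 ≤ C ∧ ∀ f : E n → ℂ, ContDiff ℝ ∞ f → tsupport f ⊆ K → ∀ A : ℝ,
      (∀ i ≤ N, ∀ x, ‖iteratedFDeriv ℝ i f x‖ ≤ A) → ‖cev v f‖ ≤ C * A := by
  let K' : TopologicalSpace.Compacts (E n) := ⟨K, hK⟩
  let L : 𝓓_{K'}(E n, ℝ) →ₗ[ℝ] ℂ :=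
    { toFun := fun f => v (TestFunction.ofSupportedInCLM ℝ (n := ⊤) (Ω := box n) hK2 f)
      map_add' := fun f g => by rw [map_add, map_add]
      map_smul' := fun c f => by rw [map_smul, map_smul]; rfl }
  have hL : Continuous L := by
    have h1 : Continuous (fun f => v f) := v.continuous
    exact h1.comp (TestFunction.ofSupportedInCLM ℝ (n := ⊤) (Ω := box n) (K := K') hK2).continuous
  obtain ⟨s, C, hC0, hC⟩ := Seminorm.bound_of_continuous
    (ContDiffMapSupportedIn.withSeminorms ℝ (E n) ℝ ⊤ K') ((normSeminorm ℝ ℂ).comp L)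
    (by exact continuous_norm.comp hL)
  refine ⟨2 * C, s.sup id, by positivity, fun f hf hfK A hA => ?_⟩
  have hA0 : 0 ≤ A := (norm_nonneg _).trans (hA 0 (Nat.zero_le _) 0)
  have hft : IsTest f := ⟨hf, hK.of_isClosed_subset (isClosed_tsupport _) hfK, hfK.trans hK2⟩
  have key : ∀ P : ℂ →L[ℝ] ℝ, ‖P‖ ≤ 1 → ‖v (hft.clm P)‖ ≤ C * A := by
    intro P hP
    let f' : 𝓓_{K'}(E n, ℝ) := ContDiffMapSupportedIn.of_support_subset (f := fun x => P (f x))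
      (P.contDiff.comp hf) (subset_closure.trans ((tsupport_comp_subset (map_zero P) f).trans hfK))
    have h1 : v (hft.clm P) = L f' := by
      change _ = v _
      congr 1
    rw [h1]
    refine (hC f').trans ?_
    rw [smul_apply, NNReal.smul_def, smul_eq_mul]
    gcongr
    refine Seminorm.finset_sup_apply_le hA0 fun i hi => ?_
    rw [ContDiffMapSupportedIn.seminorm_top_le_iff ℝ hA0]
    intro x _
    have h2 : iteratedFDeriv ℝ i (P ∘ f) x = P.compContinuousMultilinearMap (iteratedFDeriv ℝ i f x) :=
      P.iteratedFDeriv_comp_left (n := i) (hf.contDiffAt.of_le (by exact_mod_cast le_top)) le_rfl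
    change ‖iteratedFDeriv ℝ i (P ∘ f) x‖ ≤ A
    rw [h2]
    refine (ContinuousLinearMap.norm_compContinuousMultilinearMap_le _ _).trans ?_
    calc _ ≤ 1 * A := by
          gcongr
          exact hA i (Finset.le_sup (f := id) hi) x
      _ = A := one_mul A
  rw [cev_eq hft]
  have h1 := key Complex.reCLM Complex.reCLM_norm.le
  have h2 := key Complex.imCLM Complex.imCLM_norm.le
  refine (norm_add_le _ _).trans ?_
  rw [norm_mul, Complex.norm_I, one_mul]
  linarith


theorem exists_norm_le_wt (g : 𝓢(E n, ℂ)) (N : ℝ) : ∃ A : ℝ, 0 ≤ A ∧ ∀ x,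
    ‖g x‖ ≤ A * wt 1 0 (-N) x := by
  refine ⟨SchwartzMap.seminorm ℝ 0 0 (SchwartzMap.smulLeftCLM ℂ (wt (n := n) 1 0 N) g),
    apply_nonneg _ _, fun x => ?_⟩
  have h := SchwartzMap.norm_le_seminorm ℝ (SchwartzMap.smulLeftCLM ℂ (wt (n := n) 1 0 N) g) x
  have hp : 0 < wt 1 0 N x := wt_pos x
  rw [smulLeft_apply hasTemperateGrowth_wt, norm_mul, Complex.norm_real,
    Real.norm_of_nonneg hp.le] at h
  have h2 := wt_inv (ρ := 1) (s := 0) (k := N) x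
  rw [neg_zero] at h2
  rw [← h2, ← div_eq_mul_inv, le_div_iff₀ hp, mul_comm]
  exact h

theorem exists_norm_le_bracket_rpow (g : 𝓢(E n, ℂ)) (N : ℝ) : ∃ A : ℝ, 0 ≤ A ∧ ∀ x,
    ‖g x‖ ≤ A * bracket x ^ (-N) := by
  refine ⟨SchwartzMap.seminorm ℝ 0 0 (SchwartzMap.smulLeftCLM ℂ (fun ξ : E n => bracket ξ ^ N) g),
    apply_nonneg _ _, fun x => ?_⟩
  have h := SchwartzMap.norm_le_seminorm ℝ
    (SchwartzMap.smulLeftCLM ℂ (fun ξ : E n => bracket ξ ^ N) g) x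
  have hp : 0 < bracket x ^ N := Real.rpow_pos_of_pos (bracket_pos _) _
  rw [smulLeft_apply (hasTemperateGrowth_bracket_rpow N), norm_mul, Complex.norm_real,
    Real.norm_of_nonneg hp.le] at h
  rw [Real.rpow_neg (bracket_pos _).le, ← div_eq_mul_inv, le_div_iff₀ hp, mul_comm]
  exact h

theorem bracket_le_bracket_scl_one (ζ : E n) : bracket ζ ≤ bracket (scl 1 ζ) := by
  refine le_of_sq_le_sq ?_ (bracket_pos _).le
  rw [bracket_sq, bracket_sq, EuclideanSpace.norm_sq_eq, EuclideanSpace.norm_sq_eq]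
  gcongr 1 + ∑ i, ?_ ^ 2 with i
  rw [scl_apply, norm_mul]
  have : (1 : ℝ) ≤ ‖2 * Real.pi * (1 : Fin n → ℝ) i‖ := by
    rw [Real.norm_of_nonneg (by simp; positivity)]
    simp; linarith [Real.pi_gt_three]
  exact le_mul_of_one_le_left (norm_nonneg _) this

theorem wt_zero_left (ρ : Fin n → ℝ) (k : ℝ) : wt ρ 0 k = fun ξ => bracket (scl 1 ξ) ^ k := by
  ext; simp [wt]

theorem exists_integral_bracket_mul_le (N : ℕ) : ∃ C : ℝ, 0 ≤ C ∧ ∀ g : 𝓢(E n, ℂ),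
    ENNReal.ofReal (∫ ζ, bracket ζ ^ N * ‖g ζ‖) ^ 2 ≤
      ENNReal.ofReal C * qn (wt 1 0 ((N : ℝ) + (n + 1))) g := by
  set k : ℝ := (N : ℝ) + (n + 1) with hk
  set D := qn (wt (n := n) 1 0 k)⁻¹ (fun ζ : E n => ((bracket ζ ^ N : ℝ) : ℂ)) with hD
  have hDtop : D < ⊤ := by
    refine lt_of_le_of_lt (lintegral_mono fun ζ => ?_) (lintegral_bracket_lt_top (n := n))
    have hb := bracket_pos ζ
    have h1 := one_le_bracket ζ
    rw [← ofReal_norm, Complex.norm_real, Real.norm_of_nonneg (by positivity),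
      ← ENNReal.ofReal_pow (by positivity), ← ENNReal.ofReal_mul (by positivity)]
    refine ENNReal.ofReal_le_ofReal ?_
    have h2 : bracket ζ ^ k ≤ wt 1 0 k ζ := by
      rw [wt_zero_left]
      exact Real.rpow_le_rpow hb.le (bracket_le_bracket_scl_one ζ) (by positivity)
    have h3 : 0 < bracket ζ ^ k := Real.rpow_pos_of_pos hb _
    have h6 : 0 < wt 1 0 k ζ := wt_pos ζ
    have h7 : bracket ζ ^ N = bracket ζ ^ (N : ℝ) := (Real.rpow_natCast _ _).symm
    rw [Pi.inv_apply]
    calc (wt 1 0 k ζ)⁻¹ ^ 2 * (bracket ζ ^ N) ^ 2 ≤ (bracket ζ ^ k)⁻¹ ^ 2 * (bracket ζ ^ N) ^ 2 := by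
          gcongr
      _ = (bracket ζ ^ (-((n : ℝ) + 1))) ^ 2 := by
          rw [← mul_pow, h7, ← Real.rpow_neg hb.le, ← Real.rpow_add hb]
          congr 2; rw [hk]; ring
      _ ≤ bracket ζ ^ (-((n : ℝ) + 1)) := by
          have h4 : bracket ζ ^ (-((n : ℝ) + 1)) ≤ 1 :=
            Real.rpow_le_one_of_one_le_of_nonpos h1 (by linarith [(n.cast_nonneg : (0 : ℝ) ≤ n)])
          have h5 : 0 < bracket ζ ^ (-((n : ℝ) + 1)) := Real.rpow_pos_of_pos hb _
          nlinarith
  refine ⟨D.toReal, ENNReal.toReal_nonneg, fun g => ?_⟩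
  have hc1 : Continuous fun ζ : E n => ((bracket ζ ^ N : ℝ) : ℂ) := by
    have := continuous_bracket (n := n)
    fun_prop
  have hc2 : Continuous fun ζ => ((‖g ζ‖ : ℝ) : ℂ) := by
    have := g.continuous
    fun_prop
  have h := enorm_integral_mul_le (φ := wt 1 0 k) continuous_wt.measurable (fun ξ => wt_pos ξ)
    hc1.aemeasurable hc2.aemeasurable
  have h1 : ∫ ζ, ((bracket ζ ^ N : ℝ) : ℂ) * ((‖g ζ‖ : ℝ) : ℂ) =
      ((∫ ζ, bracket ζ ^ N * ‖g ζ‖ : ℝ) : ℂ) := by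
    rw [← integral_complex_ofReal]
    simp
  rw [h1, ← ofReal_norm, Complex.norm_real, Real.norm_of_nonneg (integral_nonneg fun ζ => by
    have := bracket_pos ζ; positivity)] at h
  rw [ENNReal.ofReal_toReal hDtop.ne]
  refine h.trans_eq ?_
  congr 1
  exact qn_congr fun ξ => by simp

theorem exists_iteratedFDeriv_fourier_le (N : ℕ) : ∃ C : ℝ, 0 ≤ C ∧ ∀ g : 𝓢(E n, ℂ), ∀ i ≤ N, ∀ x,
    ‖iteratedFDeriv ℝ i (𝓕 g : 𝓢(E n, ℂ)) x‖ ≤ C * ∫ ζ, bracket ζ ^ N * ‖g ζ‖ := by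
  refine ⟨(2 * Real.pi) ^ N * (N + 1), by positivity, fun g i hi x => ?_⟩
  have hint : ∀ p : ℕ, Integrable fun ζ => ‖ζ‖ ^ p * ‖iteratedFDeriv ℝ 0 g ζ‖ := fun p =>
    g.integrable_pow_mul_iteratedFDeriv volume p 0
  have h := Real.pow_mul_norm_iteratedFDeriv_fourier_le (K := ⊤) (N := 0) (f := (g : E n → ℂ))
    (g.smooth 0) (fun p q _ hq => by
      have : q = 0 := by simpa using hq
      subst this; exact hint p) (k := i) (n := 0) le_top le_rfl x
  rw [Finset.sum_product] at h
  simp only [zero_add, Finset.range_one, Finset.sum_singleton, pow_zero, one_mul, mul_one,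
    norm_iteratedFDeriv_zero] at h
  have hI : Integrable fun ζ => bracket ζ ^ N * ‖g ζ‖ := by
    have := ((SchwartzMap.smulLeftCLM ℂ (fun ξ : E n => bracket ξ ^ (N : ℝ)) g).integrable
      (μ := volume)).norm
    refine this.congr (Eventually.of_forall fun ζ => ?_)
    simp only
    rw [smulLeft_apply (hasTemperateGrowth_bracket_rpow _), norm_mul, Complex.norm_real,
      Real.rpow_natCast, Real.norm_of_nonneg (pow_nonneg (bracket_pos ζ).le _)]
  refine h.trans ?_
  rw [mul_assoc]
  have h2pi : (1 : ℝ) ≤ 2 * Real.pi := by linarith [Real.pi_gt_three]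
  refine mul_le_mul (pow_le_pow_right₀ h2pi hi) ?_ (by positivity) (by positivity)
  calc _ ≤ ∑ _p ∈ Finset.range (i + 1), ∫ ζ, bracket ζ ^ N * ‖g ζ‖ := by
        refine Finset.sum_le_sum fun p hp => integral_mono_of_nonneg
          (Eventually.of_forall fun ζ => by positivity) hI (Eventually.of_forall fun ζ => ?_)
        have hp' : p ≤ N := by have := Finset.mem_range.1 hp; omega
        simp only
        gcongr
        exact (pow_le_pow_left₀ (norm_nonneg _) (norm_le_bracket ζ) p).trans
          (pow_le_pow_right₀ (one_le_bracket ζ) hp')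
    _ ≤ _ := by
        rw [Finset.sum_const, Finset.card_range, nsmul_eq_mul]
        have : 0 ≤ ∫ ζ, bracket ζ ^ N * ‖g ζ‖ := integral_nonneg fun ζ => by
          have := bracket_pos ζ; positivity
        gcongr
        push_cast
        gcongr

variable {h : E n → ℝ}

theorem exists_cev_fourier_le (v : 𝓓'(box n, ℂ)) (hh : IsTest fun x => (h x : ℂ)) :
    ∃ C k : ℝ, 0 ≤ C ∧ ∀ g : 𝓢(E n, ℂ),
      ‖cev v (fun x => (h x : ℂ) * (𝓕 g) x)‖ₑ ^ 2 ≤ ENNReal.ofReal C * qn (wt 1 0 k) g := by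
  obtain ⟨C₁, N, hC₁, hv⟩ := exists_cev_bound v hh.compact.isCompact hh.sub
  obtain ⟨C₂, hC₂, h₂⟩ := exists_iteratedFDeriv_fourier_le (n := n) N
  obtain ⟨C₃, hC₃, h₃⟩ := exists_integral_bracket_mul_le (n := n) N
  obtain ⟨C₄, hC₄, h₄⟩ := (UnifBdd.of_contDiff_hasCompactSupport (I := Unit) hh.smooth
    hh.compact).exists_bound N
  refine ⟨(C₁ * (2 ^ N * C₄ * C₂)) ^ 2 * C₃, (N : ℝ) + (n + 1), by positivity, fun g => ?_⟩
  set I := ∫ ζ, bracket ζ ^ N * ‖g ζ‖ with hI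
  have hI0 : 0 ≤ I := integral_nonneg fun ζ => by
    have := bracket_pos ζ; positivity
  have h5 := hv (fun x => (h x : ℂ) * (𝓕 g : 𝓢(E n, ℂ)) x)
    (hh.smooth.mul ((𝓕 g : 𝓢(E n, ℂ)).smooth ⊤))
    tsupport_mul_subset_left (2 ^ N * C₄ * C₂ * I) (fun i hi x => by
      refine (norm_iteratedFDeriv_mul_le (N := ∞) hh.smooth
        ((𝓕 g : 𝓢(E n, ℂ)).smooth ⊤) x (n := i)
        (by exact_mod_cast le_top)).trans ?_
      calc _ ≤ ∑ j ∈ Finset.range (i + 1), (i.choose j : ℝ) * C₄ * (C₂ * I) := by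
            gcongr with j hj
            · exact h₄ () x (mem_univ _) j (by have := Finset.mem_range.1 hj; omega)
            · exact h₂ g _ (by omega) x
        _ = 2 ^ i * (C₄ * (C₂ * I)) := by
            simp_rw [mul_assoc]
            rw [← Finset.sum_mul]
            congr 1
            exact_mod_cast Nat.sum_range_choose i
        _ ≤ 2 ^ N * (C₄ * (C₂ * I)) := by gcongr; norm_num
        _ = _ := by ring)
  have h6 : ‖cev v (fun x => (h x : ℂ) * (𝓕 g) x)‖ₑ ≤
      ENNReal.ofReal (C₁ * (2 ^ N * C₄ * C₂)) * ENNReal.ofReal I := by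
    rw [← ofReal_norm, ← ENNReal.ofReal_mul (by positivity)]
    exact ENNReal.ofReal_le_ofReal (h5.trans_eq (by ring))
  calc _ ≤ (ENNReal.ofReal (C₁ * (2 ^ N * C₄ * C₂)) * ENNReal.ofReal I) ^ 2 := by gcongr
    _ = ENNReal.ofReal ((C₁ * (2 ^ N * C₄ * C₂)) ^ 2) * ENNReal.ofReal I ^ 2 := by
        rw [mul_pow, ENNReal.ofReal_pow (by positivity)]
    _ ≤ ENNReal.ofReal ((C₁ * (2 ^ N * C₄ * C₂)) ^ 2) * (ENNReal.ofReal C₃ * _) := by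
        gcongr
        exact h₃ g
    _ = _ := by rw [← mul_assoc, ← ENNReal.ofReal_mul (by positivity)]

theorem exists_one_on {K : Set (E n)} (hK : IsCompact K) : ∃ κ : 𝓢(E n, ℂ),
    HasCompactSupport κ ∧ ∀ x ∈ K, κ x = 1 := by
  obtain ⟨R, hR0, hR⟩ := hK.isBounded.subset_closedBall_lt 0 0
  let f : ContDiffBump (0 : E n) := ⟨R, R + 1, hR0, by linarith⟩
  have hc : HasCompactSupport fun x => (f x : ℂ) := f.hasCompactSupport.comp_left Complex.ofReal_zero
  refine ⟨hc.toSchwartzMap (Complex.ofRealCLM.contDiff.comp f.contDiff), hc, fun x hx => ?_⟩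
  change (f x : ℂ) = 1
  rw [f.one_of_mem_closedBall (hR hx), Complex.ofReal_one]

theorem lintegral_enorm_mul_sq_le {φ : E n → ℝ} (hφ : Measurable φ) (h0 : ∀ ξ, 0 < φ ξ)
    {F G : E n → ℂ} (hF : AEMeasurable F) (hG : AEMeasurable G) :
    (∫⁻ ξ, ‖F ξ‖ₑ * ‖G ξ‖ₑ) ^ 2 ≤ qn (fun ξ => (φ ξ)⁻¹) F * qn φ G := by
  have hconj : (2 : ℝ).HolderConjugate 2 := Real.HolderConjugate.two_two
  have h1 : ∫⁻ ξ, ‖F ξ‖ₑ * ‖G ξ‖ₑ ≤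
      ∫⁻ ξ, ((fun ξ => ENNReal.ofReal ((φ ξ)⁻¹) * ‖F ξ‖ₑ) * fun ξ => ENNReal.ofReal (φ ξ) * ‖G ξ‖ₑ) ξ := by
    refine lintegral_mono fun ξ => ?_
    rw [Pi.mul_apply, mul_mul_mul_comm, ← ENNReal.ofReal_mul (by have := h0 ξ; positivity),
      inv_mul_cancel₀ (h0 ξ).ne']
    simp
  have h2 := h1.trans (ENNReal.lintegral_mul_le_Lp_mul_Lq volume hconj (by fun_prop) (by fun_prop))
  calc _ ≤ _ := pow_le_pow_left' h2 2
    _ = _ := by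
      rw [mul_pow]
      simp only [← ENNReal.rpow_natCast, ← ENNReal.rpow_mul]
      norm_num
      unfold qn
      congr 1 <;>
      · refine lintegral_congr fun ξ => ?_
        rw [mul_pow, ← ENNReal.ofReal_pow (by have := h0 ξ; positivity)]
        try rw [inv_pow]

theorem lintegral_enorm_sq_Lp (Φ : Lp ℂ 2 (volume : Measure (E n))) : ∫⁻ ζ, ‖Φ ζ‖ₑ ^ 2 = ‖Φ‖ₑ ^ 2 := by
  rw [Lp.enorm_def, eLpNorm_eq_lintegral_rpow_enorm_toReal (by norm_num) (by norm_num)]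
  simp only [ENNReal.toReal_ofNat, ENNReal.rpow_ofNat]
  rw [← ENNReal.rpow_natCast, ← ENNReal.rpow_mul]
  norm_num

/-- Linear functionals on Schwartz functions which are bounded with respect to a weighted `L²` norm
are represented by functions. -/
theorem exists_qn_density {ρ : Fin n → ℝ} {s k : ℝ} (Λ₀ : 𝓢(E n, ℂ) →ₗ[ℂ] ℂ) {A : ℝ≥0∞} (hA : A ≠ ⊤)
    (hC : ∀ g, ‖Λ₀ g‖ₑ ^ 2 ≤ A * qn (wt ρ (-s) (-k)) g) :
    ∃ F : E n → ℂ, StronglyMeasurable F ∧ qn (wt ρ s k) F ≤ A ∧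
      ∀ g : 𝓢(E n, ℂ), Λ₀ g = ∫ ζ, F ζ * g ζ := by
  let D : 𝓢(E n, ℂ) → 𝓢(E n, ℂ) := fun G => SchwartzMap.smulLeftCLM ℂ (wt (n := n) ρ s k) G
  have hD : ∀ G ζ, D G ζ = (wt ρ s k ζ : ℂ) * G ζ := fun G ζ =>
    smulLeft_apply hasTemperateGrowth_wt G ζ
  have hDadd : ∀ G G', D (G + G') = D G + D G' := fun G G' => map_add _ _ _
  have hDsmul : ∀ (c : ℂ) G, D (c • G) = c • D G := fun c G => by
    ext ζ
    simp only [hD, smul_apply, smul_eq_mul]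
    ring
  let Λ : 𝓢(E n, ℂ) →ₗ[ℂ] ℂ :=
    { toFun := fun G => Λ₀ (D G)
      map_add' := fun G G' => by rw [hDadd, map_add]
      map_smul' := fun c G => by rw [hDsmul, map_smul, RingHom.id_apply] }
  let e : 𝓢(E n, ℂ) →ₗ[ℂ] Lp ℂ 2 (volume : Measure (E n)) :=
    (SchwartzMap.toLpCLM ℂ ℂ 2 volume).toLinearMap
  have hde : DenseRange e := SchwartzMap.denseRange_toLpCLM (F := ℂ) (by norm_num)
  have hwt : ∀ ζ, wt ρ (-s) (-k) ζ * wt ρ s k ζ = 1 := fun ζ => by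
    rw [wt_mul]; simp [wt_zero_zero]
  have hqn : ∀ G : 𝓢(E n, ℂ), qn (wt ρ (-s) (-k)) (D G) = ‖e G‖ₑ ^ 2 := fun G => by
    rw [← lintegral_enorm_sq_Lp]
    refine lintegral_congr_ae ?_
    filter_upwards [SchwartzMap.coeFn_toLp G 2 volume] with ζ hζ
    change _ = ‖SchwartzMap.toLp G 2 volume ζ‖ₑ ^ 2
    rw [hζ, hD, enorm_mul, mul_pow, ← ofReal_norm (wt ρ s k ζ : ℂ), Complex.norm_real,
      Real.norm_of_nonneg (wt_pos _).le, ← ENNReal.ofReal_pow (wt_pos _).le, ← mul_assoc,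
      ← ENNReal.ofReal_mul (by positivity), ← mul_pow, hwt]
    simp
  have hbd : ∀ G, ‖Λ G‖ ≤ √A.toReal * ‖e G‖ := fun G => by
    have h1 := hC (D G)
    rw [hqn] at h1
    refine le_of_sq_le_sq ?_ (by positivity)
    rw [mul_pow, Real.sq_sqrt ENNReal.toReal_nonneg, ← ENNReal.ofReal_le_ofReal_iff (by positivity),
      ENNReal.ofReal_mul ENNReal.toReal_nonneg, ENNReal.ofReal_pow (norm_nonneg _),
      ENNReal.ofReal_pow (norm_nonneg _), ofReal_norm, ofReal_norm, ENNReal.ofReal_toReal hA]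
    exact h1
  let Φ := (InnerProductSpace.toDual ℂ (Lp ℂ 2 (volume : Measure (E n)))).symm (Λ.extendOfNorm e)
  have hΦ : ‖Φ‖ₑ ^ 2 ≤ A := by
    have h1 : ‖Φ‖ ≤ √A.toReal := by
      rw [LinearIsometryEquiv.norm_map]
      exact LinearMap.opNorm_extendOfNorm_le hde (Real.sqrt_nonneg _) hbd
    rw [← ofReal_norm, ← ENNReal.ofReal_pow (norm_nonneg _), ← ENNReal.ofReal_toReal hA]
    refine ENNReal.ofReal_le_ofReal ?_
    calc ‖Φ‖ ^ 2 ≤ √A.toReal ^ 2 := by gcongr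
      _ = _ := Real.sq_sqrt ENNReal.toReal_nonneg
  refine ⟨fun ζ => starRingEnd ℂ (Φ ζ) * (wt ρ (-s) (-k) ζ : ℂ), ?_, ?_, fun g => ?_⟩
  · exact (RCLike.continuous_conj.comp_stronglyMeasurable (Lp.stronglyMeasurable Φ)).mul
      (Complex.continuous_ofReal.comp continuous_wt).stronglyMeasurable
  · refine le_trans (le_of_eq ?_) hΦ
    rw [← lintegral_enorm_sq_Lp]
    refine lintegral_congr fun ζ => ?_
    rw [enorm_mul, mul_pow, ← ofReal_norm (wt ρ (-s) (-k) ζ : ℂ), Complex.norm_real,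
      Real.norm_of_nonneg (wt_pos _).le, ← ENNReal.ofReal_pow (wt_pos _).le, mul_comm (_ ^ 2 : ℝ≥0∞),
      ← mul_assoc, ← ENNReal.ofReal_mul (by positivity), ← mul_pow, mul_comm (wt ρ s k ζ), hwt]
    simp
  · let G : 𝓢(E n, ℂ) := SchwartzMap.smulLeftCLM ℂ (wt (n := n) ρ (-s) (-k)) g
    have hG : ∀ ζ, G ζ = (wt ρ (-s) (-k) ζ : ℂ) * g ζ := fun ζ =>
      smulLeft_apply hasTemperateGrowth_wt g ζ
    have hDG : D G = g := by
      ext ζ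
      rw [hD, hG, ← mul_assoc, ← Complex.ofReal_mul, mul_comm (wt ρ s k ζ), hwt, Complex.ofReal_one,
        one_mul]
    have h1 : Λ G = inner ℂ Φ (e G) := by
      rw [InnerProductSpace.toDual_symm_apply, LinearMap.extendOfNorm_eq hde ⟨_, hbd⟩]
    have h2 : Λ G = Λ₀ g := by
      change Λ₀ (D G) = _
      rw [hDG]
    rw [← h2, h1, L2.inner_def]
    refine integral_congr_ae ?_
    filter_upwards [SchwartzMap.coeFn_toLp G 2 volume] with ζ hζ
    change inner ℂ (Φ ζ) (SchwartzMap.toLp G 2 volume ζ) = _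
    rw [hζ, hG, RCLike.inner_apply]
    ring

theorem qn_le_of_duality {ρ : Fin n → ℝ} {s k : ℝ} {F : E n → ℂ} {A : ℝ≥0∞}
    (hFg : ∀ g : 𝓢(E n, ℂ), Integrable fun ζ => F ζ * g ζ)
    (h : ∀ g : 𝓢(E n, ℂ), ‖∫ ζ, F ζ * g ζ‖ₑ ^ 2 ≤ A * qn (wt ρ (-s) (-k)) g) :
    qn (wt ρ s k) F ≤ A := by
  by_cases hA : A = ⊤
  · rw [hA]; exact le_top
  let Λ : 𝓢(E n, ℂ) →ₗ[ℂ] ℂ :=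
    { toFun := fun g => ∫ ζ, F ζ * g ζ
      map_add' := fun g g' => by
        rw [← integral_add (hFg g) (hFg g')]
        simp only [add_apply, mul_add]
      map_smul' := fun c g => by
        rw [RingHom.id_apply, smul_eq_mul, ← integral_const_mul]
        simp only [smul_apply, smul_eq_mul, mul_left_comm] }
  obtain ⟨F', hF'm, hF', hΛ⟩ := exists_qn_density (ρ := ρ) (s := s) (k := k) Λ hA h
  have hwm : Measurable (wt ρ (-s) (-k)) := continuous_wt.measurable
  have hF'g : ∀ g : 𝓢(E n, ℂ), Integrable fun ζ => F' ζ * g ζ := fun g => by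
    refine ⟨hF'm.aestronglyMeasurable.mul g.continuous.aestronglyMeasurable, ?_⟩
    rw [hasFiniteIntegral_iff_enorm]
    simp only [enorm_mul]
    have h1 := lintegral_enorm_mul_sq_le hwm (fun ξ => wt_pos ξ) hF'm.measurable.aemeasurable
      g.continuous.aemeasurable
    simp only [wt_inv, neg_neg] at h1
    exact (ENNReal.pow_lt_top_iff (n := 2)).1 (h1.trans_lt (ENNReal.mul_lt_top
      (hF'.trans_lt (lt_top_iff_ne_top.2 hA)) (qn_wt_lt_top g))) |>.resolve_right (by norm_num)
  have hli : ∀ {F : E n → ℂ}, (∀ g : 𝓢(E n, ℂ), Integrable fun ζ => F ζ * g ζ) → LocallyIntegrable F := by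
    intro F hF
    rw [locallyIntegrable_iff]
    intro K hK
    obtain ⟨κ, hκ, hκ1⟩ := exists_one_on hK
    refine ((hF κ).integrableOn (s := K)).congr_fun (fun x hx => ?_) hK.measurableSet
    simp only
    rw [hκ1 x hx, mul_one]
  have hae : F =ᵐ[volume] F' := by
    refine ae_eq_of_integral_contDiff_smul_eq (hli hFg) (hli hF'g) fun g hg hgc => ?_
    have hc : HasCompactSupport fun x => (g x : ℂ) := hgc.comp_left Complex.ofReal_zero
    have h1 := hΛ (hc.toSchwartzMap (Complex.ofRealCLM.contDiff.comp hg))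
    have h2 : ∀ F : E n → ℂ, ∫ x, g x • F x = ∫ x, F x * (g x : ℂ) := fun F => by
      simp only [Complex.real_smul, mul_comm]
    rw [h2, h2]
    exact h1
  refine le_trans (le_of_eq (lintegral_congr_ae ?_)) hF'
  filter_upwards [hae] with ζ hζ
  rw [hζ]

theorem exists_density (v : 𝓓'(box n, ℂ)) (hh : IsTest fun x => (h x : ℂ)) :
    ∃ (k : ℝ) (F : E n → ℂ), StronglyMeasurable F ∧ qn (wt 1 0 (-k)) F < ⊤ ∧
      ∀ g : 𝓢(E n, ℂ), cev v (fun x => (h x : ℂ) * (𝓕 g : 𝓢(E n, ℂ)) x) = ∫ ζ, F ζ * g ζ := by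
  obtain ⟨C, k, hC0, hC⟩ := exists_cev_fourier_le v hh
  have htest : ∀ g : 𝓢(E n, ℂ), IsTest fun x => (h x : ℂ) * (𝓕 g : 𝓢(E n, ℂ)) x := fun g =>
    hh.mul_right ((𝓕 g : 𝓢(E n, ℂ)).smooth ⊤)
  let Λ : 𝓢(E n, ℂ) →ₗ[ℂ] ℂ :=
    { toFun := fun G => cev v fun x => (h x : ℂ) * (𝓕 G : 𝓢(E n, ℂ)) x
      map_add' := fun G G' => by
        rw [← cev_add (htest _) (htest _), FourierTransform.fourier_add]
        simp only [add_apply, mul_add]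
      map_smul' := fun c G => by
        rw [FourierTransform.fourier_smul, RingHom.id_apply, smul_eq_mul,
          ← cev_const_mul c (htest _)]
        simp only [smul_apply, smul_eq_mul, mul_left_comm] }
  obtain ⟨F, hFm, hF, hΛ⟩ := exists_qn_density (ρ := 1) (s := 0) (k := -k) Λ
    (A := ENNReal.ofReal C) ENNReal.ofReal_ne_top (fun g => by rw [neg_zero, neg_neg]; exact hC g)
  exact ⟨k, F, hFm, hF.trans_lt ENNReal.ofReal_lt_top, hΛ⟩

/-- The Fourier transform of the compactly supported distribution `h v`. -/
def flc (v : 𝓓'(box n, ℂ)) (h : E n → ℝ) (ζ : E n) : ℂ := cev v fun x => (h x : ℂ) * ex x (-ζ)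

theorem contDiff_ex_left (ζ : E n) : ContDiff ℝ ∞ fun x => ex x ζ :=
  contDiff_ex.comp (contDiff_id.prodMk contDiff_const)

theorem isTest_mul_ex (hh : IsTest fun x => (h x : ℂ)) (ζ : E n) :
    IsTest fun x => (h x : ℂ) * ex x ζ := hh.mul_right (contDiff_ex_left ζ)

theorem qn_wt_lt_top_of_norm_le {G : E n → ℂ} {A k : ℝ} (hG : ∀ ζ, ‖G ζ‖ ≤ A * wt 1 0 (-(k + (n + 1))) ζ) :
    qn (wt 1 0 k) G < ⊤ := by
  have h0 := ENNReal.mul_lt_top (a := ENNReal.ofReal (A ^ 2)) ENNReal.ofReal_lt_top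
    (lintegral_bracket_lt_top (n := n))
  rw [← lintegral_const_mul' _ _ ENNReal.ofReal_ne_top] at h0
  refine lt_of_le_of_lt (lintegral_mono fun ζ => ?_) h0
  have hb := bracket_pos ζ
  have hw : 0 < wt 1 0 k ζ := wt_pos ζ
  rw [← ofReal_norm, ← ENNReal.ofReal_pow (by positivity), ← ENNReal.ofReal_mul (by positivity),
    ← ENNReal.ofReal_mul (by positivity)]
  refine ENNReal.ofReal_le_ofReal ?_
  have h1 : wt 1 0 k ζ * ‖G ζ‖ ≤ A * bracket (scl 1 ζ) ^ (-((n : ℝ) + 1)) := by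
    calc _ ≤ wt 1 0 k ζ * (A * wt 1 0 (-(k + (n + 1))) ζ) := by gcongr; exact hG ζ
      _ = A * (wt 1 0 k ζ * wt 1 0 (-(k + (n + 1))) ζ) := by ring
      _ = _ := by rw [wt_mul, add_zero, wt_zero_left]; congr 2; ring
  have h3 : bracket (scl 1 ζ) ^ (-((n : ℝ) + 1)) ≤ bracket ζ ^ (-((n : ℝ) + 1)) :=
    Real.rpow_le_rpow_of_nonpos hb (bracket_le_bracket_scl_one ζ)
      (by linarith [(n.cast_nonneg : (0 : ℝ) ≤ n)])
  have h4 : bracket ζ ^ (-((n : ℝ) + 1)) ≤ 1 :=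
    Real.rpow_le_one_of_one_le_of_nonpos (one_le_bracket ζ) (by linarith [(n.cast_nonneg : (0 : ℝ) ≤ n)])
  have h5 : 0 < bracket (scl 1 ζ) ^ (-((n : ℝ) + 1)) := Real.rpow_pos_of_pos (bracket_pos _) _
  calc _ = (wt 1 0 k ζ * ‖G ζ‖) ^ 2 := by ring
    _ ≤ (A * bracket (scl 1 ζ) ^ (-((n : ℝ) + 1))) ^ 2 := by gcongr
    _ = A ^ 2 * (bracket (scl 1 ζ) ^ (-((n : ℝ) + 1))) ^ 2 := by ring
    _ ≤ _ := by
      gcongr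
      nlinarith

/-- The translate of an inverse Fourier transform, as the inverse Fourier transform of a modulated
function. -/
theorem fourierInv_sub {κ : 𝓢(E n, ℂ)} (ζ ζ₀ : E n) :
    (𝓕⁻ κ : 𝓢(E n, ℂ)) (ζ - ζ₀) = ∫ v, ex v ζ * (κ v * ex v (-ζ₀)) := by
  rw [SchwartzMap.fourierInv_coe, fourierInv_eq_ex]
  refine integral_congr_ae (Eventually.of_forall fun v => ?_)
  simp only [sub_eq_add_neg, ex_add_right]
  ring

/-- Multiplication of a Schwartz function by a compactly supported one. -/
def cutS {κ : 𝓢(E n, ℂ)} (hκ : HasCompactSupport κ) {f : E n → ℂ} (hf : ContDiff ℝ ∞ f) : 𝓢(E n, ℂ) :=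
  HasCompactSupport.toSchwartzMap (f := fun x => κ x * f x) hκ.mul_right ((κ.smooth ⊤).mul hf)

theorem cutS_apply {κ : 𝓢(E n, ℂ)} (hκ : HasCompactSupport κ) {f : E n → ℂ} (hf : ContDiff ℝ ∞ f)
    (x : E n) : cutS hκ hf x = κ x * f x := rfl

theorem integral_mul_fourierInv_sub {κ : 𝓢(E n, ℂ)} (hκ : HasCompactSupport κ) (g : 𝓢(E n, ℂ))
    (ζ : E n) : ∫ ζ₀, (𝓕⁻ κ : 𝓢(E n, ℂ)) (ζ - ζ₀) * g ζ₀ =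
      (𝓕⁻ (cutS hκ ((𝓕 g).smooth ⊤)) : 𝓢(E n, ℂ)) ζ := by
  have h1 := SchwartzMap.integral_fourier_mul_eq (cutS hκ (contDiff_ex_left ζ)) g
  rw [SchwartzMap.fourierInv_coe (cutS hκ _), fourierInv_eq_ex]
  have h2 : ∀ ζ₀, (𝓕 (cutS hκ (contDiff_ex_left ζ))) ζ₀ = (𝓕⁻ κ : 𝓢(E n, ℂ)) (ζ - ζ₀) := fun ζ₀ => by
    rw [fourierInv_sub, SchwartzMap.fourier_coe, fourier_eq_ex]
    refine integral_congr_ae (Eventually.of_forall fun v => ?_)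
    simp only [cutS_apply]
    ring
  simp only [h2] at h1
  rw [h1]
  refine integral_congr_ae (Eventually.of_forall fun v => ?_)
  simp only [cutS_apply]
  ring

theorem exists_flc (v : 𝓓'(box n, ℂ)) (hh : IsTest fun x => (h x : ℂ)) :
    Measurable (flc v h) ∧ (∃ k : ℝ, ∀ ρ : Fin n → ℝ, (∀ i, 0 ≤ ρ i) → (∀ i, ρ i ≤ 1) →
      qn (wt ρ 0 (-k)) (flc v h) < ⊤) ∧
    ∀ g : 𝓢(E n, ℂ), Integrable (fun ζ => flc v h ζ * g ζ) ∧
      ∫ ζ, flc v h ζ * g ζ = cev v fun x => (h x : ℂ) * (𝓕 g) x := by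
  obtain ⟨k, F, hFm, hF, hFg⟩ := exists_density v hh
  obtain ⟨κ, hκ, hκ1⟩ := exists_one_on hh.compact.isCompact
  have hmul : ∀ f : E n → ℂ, (fun x => (h x : ℂ) * (κ x * f x)) = fun x => (h x : ℂ) * f x := by
    intro f
    ext x
    by_cases hx : x ∈ tsupport fun x => (h x : ℂ)
    · rw [hκ1 x hx, one_mul]
    · have h0 : (h x : ℂ) = 0 := image_eq_zero_of_notMem_tsupport (f := fun x => (h x : ℂ)) hx
      rw [h0, zero_mul, zero_mul]
  have heq : ∀ ζ₀, flc v h ζ₀ = ∫ ζ, F ζ * (𝓕⁻ κ : 𝓢(E n, ℂ)) (ζ - ζ₀) := fun ζ₀ => by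
    have h1 := hFg (𝓕⁻ (cutS hκ (contDiff_ex_left (-ζ₀))))
    rw [FourierTransform.fourier_fourierInv_eq] at h1
    simp only [cutS_apply] at h1
    rw [flc, ← hmul, h1]
    refine integral_congr_ae (Eventually.of_forall fun ζ => ?_)
    simp only
    rw [fourierInv_sub, SchwartzMap.fourierInv_coe, fourierInv_eq_ex]
    rfl
  have hKc : Continuous (𝓕⁻ κ : 𝓢(E n, ℂ)) := (𝓕⁻ κ : 𝓢(E n, ℂ)).continuous
  have hsm : StronglyMeasurable fun p : E n × E n => F p.2 * (𝓕⁻ κ : 𝓢(E n, ℂ)) (p.2 - p.1) :=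
    (hFm.comp_measurable measurable_snd).mul
      ((hKc.comp (continuous_snd.sub continuous_fst)).stronglyMeasurable)
  have hmeas : Measurable (flc v h) := by
    rw [show flc v h = fun ζ₀ => ∫ ζ, F ζ * (𝓕⁻ κ : 𝓢(E n, ℂ)) (ζ - ζ₀) from funext heq]
    exact (StronglyMeasurable.integral_prod_right' hsm).measurable
  refine ⟨hmeas, ⟨k, fun ρ h0 h1 => ?_⟩, fun g => ?_⟩
  · obtain ⟨C, hC0, hC⟩ := qn_le_of_kernel (n := n) 0 0 (-k)
    obtain ⟨A, hA0, hA⟩ := exists_norm_le_bracket_rpow (𝓕⁻ κ : 𝓢(E n, ℂ)) (|(0 : ℝ) - 0| + |-k| + (n + 1))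
    have h2 := hC ρ h0 h1 A hA0 F (flc v h) hFm.measurable fun τ => by
      rw [heq]
      refine (enorm_integral_le_lintegral_enorm _).trans (lintegral_mono fun ζ => ?_)
      rw [enorm_mul, mul_comm]
      gcongr
      rw [← ofReal_norm]
      refine ENNReal.ofReal_le_ofReal ((hA _).trans_eq ?_)
      rw [wt_zero_zero, mul_one, ← bracket_neg, neg_sub]
    have h3 : ∀ ρ : Fin n → ℝ, wt ρ 0 (-k) = wt 1 0 (-k) := fun ρ => by
      rw [wt_zero_left, wt_zero_left]
    rw [sub_zero] at h2
    refine h2.trans_lt (ENNReal.mul_lt_top ENNReal.ofReal_lt_top ?_)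
    rw [h3]; exact hF
  · have hwm : Measurable (wt (n := n) 1 0 k) := continuous_wt.measurable
    have hint : Integrable (fun p : E n × E n => F p.2 * (𝓕⁻ κ : 𝓢(E n, ℂ)) (p.2 - p.1) * g p.1)
        (volume.prod volume) := by
      refine ⟨(hsm.mul (g.continuous.comp continuous_fst).stronglyMeasurable).aestronglyMeasurable, ?_⟩
      obtain ⟨A, hA0, hA⟩ := exists_norm_le_wt g (k + (n + 1))
      obtain ⟨C, hC0, hC⟩ := exists_lintegral_bracket_mul_le (-(k + (n + 1))) (𝓕⁻ κ)
      have hsw : AEMeasurable (fun p : E n × E n => ‖F p.2 * (𝓕⁻ κ : 𝓢(E n, ℂ)) (p.2 - p.1) * g p.1‖ₑ)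
          (volume.prod volume) :=
        (hsm.mul (g.continuous.comp continuous_fst).stronglyMeasurable).measurable.enorm.aemeasurable
      rw [hasFiniteIntegral_iff_enorm, lintegral_prod_symm _ hsw]
      have h2 : ∀ ζ, ∫⁻ ζ₀, ‖F ζ * (𝓕⁻ κ : 𝓢(E n, ℂ)) (ζ - ζ₀) * g ζ₀‖ₑ ≤
          ‖F ζ‖ₑ * ‖((A * (C * wt 1 0 (-(k + (n + 1))) ζ) : ℝ) : ℂ)‖ₑ := fun ζ => by
        have hw : 0 < wt 1 0 (-(k + (n + 1))) ζ := wt_pos ζ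
        rw [← ofReal_norm ((A * (C * wt 1 0 (-(k + (n + 1))) ζ) : ℝ) : ℂ),
          Complex.norm_real, Real.norm_of_nonneg (by positivity), ENNReal.ofReal_mul hA0]
        calc _ ≤ ∫⁻ ζ₀, ‖F ζ‖ₑ * ENNReal.ofReal A * (ENNReal.ofReal (bracket (scl 1 ζ₀) ^ (-(k + (n + 1)))) *
              ‖(𝓕⁻ κ : 𝓢(E n, ℂ)) (ζ - ζ₀)‖ₑ) := by
              refine lintegral_mono fun ζ₀ => ?_
              rw [enorm_mul, enorm_mul]
              have h3 : ‖g ζ₀‖ₑ ≤ ENNReal.ofReal A * ENNReal.ofReal (bracket (scl 1 ζ₀) ^ (-(k + (n + 1)))) := by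
                rw [← ofReal_norm, ← ENNReal.ofReal_mul hA0]
                have h4 := hA ζ₀
                rw [wt_zero_left] at h4
                exact ENNReal.ofReal_le_ofReal h4
              calc _ ≤ ‖F ζ‖ₑ * ‖(𝓕⁻ κ : 𝓢(E n, ℂ)) (ζ - ζ₀)‖ₑ * (ENNReal.ofReal A *
                    ENNReal.ofReal (bracket (scl 1 ζ₀) ^ (-(k + (n + 1))))) := by gcongr
                _ = _ := by ring
          _ ≤ _ := by
              rw [lintegral_const_mul' _ _ (ENNReal.mul_ne_top enorm_ne_top ENNReal.ofReal_ne_top),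
                mul_assoc]
              gcongr
              refine (hC 1 (fun _ => zero_le_one) (fun _ => le_rfl) ζ).trans_eq ?_
              rw [wt_zero_left]
              simp [wt]
      refine (lintegral_mono h2).trans_lt ?_
      have h3 := lintegral_enorm_mul_sq_le hwm (fun ξ => wt_pos ξ) hFm.measurable.aemeasurable
        (G := fun ζ => ((A * (C * wt 1 0 (-(k + (n + 1))) ζ) : ℝ) : ℂ))
        (by have := continuous_wt (n := n) (ρ := 1) (s := 0) (k := -(k + (n + 1))); fun_prop)
      have h4 : qn (wt 1 0 k) (fun ζ : E n => ((A * (C * wt 1 0 (-(k + (n + 1))) ζ) : ℝ) : ℂ)) < ⊤ :=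
        qn_wt_lt_top_of_norm_le (A := A * C) fun ζ => by
          have hw : 0 < wt 1 0 (-(k + (n + 1))) ζ := wt_pos ζ
          rw [Complex.norm_real, Real.norm_of_nonneg (by positivity), mul_assoc]
      have h5 : qn (fun ξ => (wt 1 0 k ξ)⁻¹) F < ⊤ := by
        simpa only [wt_inv, neg_zero] using hF
      exact (ENNReal.pow_lt_top_iff (n := 2)).1 (h3.trans_lt (ENNReal.mul_lt_top h5 h4)) |>.resolve_right (by norm_num)
    have h1 : ∀ ζ₀, flc v h ζ₀ * g ζ₀ = ∫ ζ, F ζ * (𝓕⁻ κ : 𝓢(E n, ℂ)) (ζ - ζ₀) * g ζ₀ := fun ζ₀ => by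
      rw [heq, integral_mul_const]
    refine ⟨?_, ?_⟩
    · simp only [h1]
      exact hint.integral_prod_left
    · simp only [h1]
      rw [integral_integral_swap hint]
      have h2 := hFg (𝓕⁻ (cutS hκ ((𝓕 g).smooth ⊤)))
      rw [FourierTransform.fourier_fourierInv_eq] at h2
      simp only [cutS_apply] at h2
      rw [← hmul, h2]
      refine integral_congr_ae (Eventually.of_forall fun ζ => ?_)
      simp only
      rw [← integral_mul_fourierInv_sub, ← integral_const_mul]
      refine integral_congr_ae (Eventually.of_forall fun ζ₀ => ?_)
      simp only
      ring

end Dist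

/-! ### Coordinate vector fields -/

theorem exists_coloring {ι : Type*} [Countable ι] (R : ι → ι → Prop) (hR : ∀ α β, R α β → R β α)
    (J : ℕ) (hJ : ∀ α, ∀ s : Finset ι, (∀ β ∈ s, R α β) → s.card ≤ J) :
    ∃ col : ι → Fin (J + 1), ∀ α β, R α β → α ≠ β → col α ≠ col β := by
  classical
  obtain ⟨e, he⟩ := Countable.exists_injective_nat ι
  have wf : WellFounded fun β α : ι => e β < e α := (measure e).wf
  let F : (α : ι) → ((β : ι) → e β < e α → ℕ) → ℕ := fun α rec =>
    sInf {m | ∀ β (h : e β < e α), R α β → rec β h ≠ m}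
  let c : ι → ℕ := wf.fix F
  have hc : ∀ α, c α = sInf {m | ∀ β, e β < e α → R α β → c β ≠ m} := fun α => wf.fix_eq F α
  have hne : ∀ α, ∃ m ≤ J, ∀ β, e β < e α → R α β → c β ≠ m := by
    intro α
    by_contra! hcon
    choose b hb1 hb2 hb3 using hcon
    let g : Fin (J + 1) → ι := fun m => b m (Nat.lt_succ_iff.1 m.2)
    have hg : Function.Injective g := fun m m' h => by
      have h1 := hb3 m (Nat.lt_succ_iff.1 m.2)
      have h2 := hb3 m' (Nat.lt_succ_iff.1 m'.2)
      have : b m (Nat.lt_succ_iff.1 m.2) = b m' (Nat.lt_succ_iff.1 m'.2) := h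
      rw [this, h2] at h1
      exact Fin.ext h1.symm
    have := hJ α (Finset.univ.image g) (fun β hβ => by
      obtain ⟨m, -, rfl⟩ := Finset.mem_image.1 hβ
      exact hb2 m _)
    rw [Finset.card_image_of_injective _ hg, Finset.card_fin] at this
    omega
  have hmem : ∀ α β, e β < e α → R α β → c β ≠ c α := fun α => by
    obtain ⟨m, -, hm⟩ := hne α
    rw [hc α]
    exact Nat.sInf_mem (s := {m | ∀ β, e β < e α → R α β → c β ≠ m}) ⟨m, hm⟩
  have hle : ∀ α, c α < J + 1 := fun α => by
    obtain ⟨m, hm, hm'⟩ := hne α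
    rw [hc α, Nat.lt_succ_iff]
    exact (Nat.sInf_le (s := {m | ∀ β, e β < e α → R α β → c β ≠ m}) hm').trans hm
  refine ⟨fun α => ⟨c α, hle α⟩, fun α β hab hne' h => ?_⟩
  have h' : c α = c β := congrArg Fin.val h
  rcases lt_trichotomy (e α) (e β) with h1 | h1 | h1
  · exact hmem β α h1 (hR _ _ hab) h'
  · exact hne' (he h1)
  · exact hmem α β h1 hab h'.symm

namespace SBGStructure

variable {n : ℕ} {M : Type*} [TopologicalSpace M] [ChartedSpace (E n) M] {ι : Type*}
variable [IsManifold (𝓡 n) ∞ M] {B : SBGStructure n M ι} {α β γ : ι} {x : E n} {p : M}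

theorem contMDiffAt_chart (hp : p ∈ (B.chart α).source) :
    ContMDiffAt (𝓡 n) 𝓘(ℝ, E n) ∞ (B.chart α) p :=
  (contMDiffOn_of_mem_maximalAtlas (B.chart_mem α)).contMDiffAt ((B.chart α).open_source.mem_nhds hp)

theorem contMDiffAt_chart_symm (hx : x ∈ cube n 2) :
    ContMDiffAt 𝓘(ℝ, E n) (𝓡 n) ∞ (B.chart α).symm x :=
  (contMDiffOn_symm_of_mem_maximalAtlas (B.chart_mem α)).contMDiffAt
    ((B.chart α).open_target.mem_nhds (by rwa [B.chart_target]))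

theorem mfderiv_chart (hγ : p ∈ (B.chart γ).source) (hα : p ∈ (B.chart α).source) :
    (mfderiv (𝓡 n) 𝓘(ℝ, E n) (B.chart α) p : TangentSpace (𝓡 n) p →L[ℝ] E n) =
      (fderiv ℝ (B.tr γ α) (B.chart γ p)).comp (mfderiv (𝓡 n) 𝓘(ℝ, E n) (B.chart γ) p) := by
  have h1 : B.chart α =ᶠ[𝓝 p] B.tr γ α ∘ B.chart γ := by
    filter_upwards [(B.chart γ).open_source.mem_nhds hγ] with q hq
    simp [tr, symm_chart hq]
  rw [h1.mfderiv_eq, mfderiv_comp (I' := 𝓘(ℝ, E n)) p ?_ ((contMDiffAt_chart hγ).mdifferentiableAt (by simp)),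
    mfderiv_eq_fderiv]
  · rfl
  · exact (hasFDerivAt_tr (chart_mem_dom hγ hα)).differentiableAt.mdifferentiableAt

theorem isInvertible_mfderiv_chart (hp : p ∈ (B.chart α).source) :
    (mfderiv (𝓡 n) 𝓘(ℝ, E n) (B.chart α) p).IsInvertible := by
  have h : OpenPartialHomeomorph.MDifferentiable (𝓡 n) 𝓘(ℝ, E n) (B.chart α) :=
    ⟨(contMDiffOn_of_mem_maximalAtlas (B.chart_mem α)).mdifferentiableOn (by simp),
      (contMDiffOn_symm_of_mem_maximalAtlas (B.chart_mem α)).mdifferentiableOn (by simp)⟩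
  exact ⟨h.mfderiv hp, rfl⟩

/-- The vector field with coefficients `X` in the chart `φ_γ`. -/
def chartVF (B : SBGStructure n M ι) (γ : ι) (X : E n → E n) : VField n M :=
  VectorField.mpullback (𝓡 n) 𝓘(ℝ, E n) (B.chart γ) X

theorem contMDiffAt_chartVF {X : E n → E n} (hX : ContDiff ℝ ∞ X) (hp : p ∈ (B.chart γ).source) :
    ContMDiffAt (𝓡 n) (𝓡 n).tangent ∞
      (fun q => (⟨q, B.chartVF γ X q⟩ : TangentBundle (𝓡 n) M)) p := by
  have : IsManifold (𝓡 n) 1 M := IsManifold.of_le (n := ∞) (by exact_mod_cast le_top)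
  exact ContMDiffAt.mpullback_vectorField_preimage (n := ∞)
    (contMDiffAt_vectorSpace_iff_contDiffAt.2 hX.contDiffAt) (contMDiffAt_chart hp)
    (isInvertible_mfderiv_chart hp) (by simp)

theorem locVF_chartVF (X : E n → E n) (hx : x ∈ B.dom α γ) :
    B.locVF (B.chartVF γ X) α x = fderiv ℝ (B.tr γ α) (B.tr α γ x) (X (B.tr α γ x)) := by
  have h1 := (mem_dom.1 hx).1
  have h2 := (mem_dom.1 hx).2
  unfold locVF
  rw [mfderiv_chart h2 (symm_mem_source h1)]
  change fderiv ℝ (B.tr γ α) (B.tr α γ x) ((mfderiv (𝓡 n) 𝓘(ℝ, E n) (B.chart γ) ((B.chart α).symm x))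
    ((mfderiv (𝓡 n) 𝓘(ℝ, E n) (B.chart γ) ((B.chart α).symm x)).inverse (X (B.tr α γ x)))) = _
  congr 1
  obtain ⟨L, hL⟩ := isInvertible_mfderiv_chart (B := B) (α := γ) h2
  rw [← hL, ContinuousLinearMap.inverse_equiv]
  exact L.apply_symm_apply _

theorem isOpen_image_cube {r : ℝ} (hr : r ≤ 2) : IsOpen ((B.chart α).symm '' cube n r) :=
  (B.chart α).symm.isOpen_image_of_subset_source (isOpen_cube n r)
    (by simpa [B.chart_target] using cube_mono hr)

theorem mem_image_cube {r : ℝ} (hr : r ≤ 2) :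
    p ∈ (B.chart α).symm '' cube n r ↔ p ∈ (B.chart α).source ∧ B.chart α p ∈ cube n r := by
  constructor
  · rintro ⟨x, hx, rfl⟩
    exact ⟨symm_mem_source (cube_mono hr hx), by rwa [chart_symm (cube_mono hr hx)]⟩
  · rintro ⟨h1, h2⟩
    exact ⟨_, h2, symm_chart h1⟩

variable [T2Space M]

theorem isClosed_cell {r : ℝ} (hr : r < 2) : IsClosed (B.cell r α) := (isCompact_cell hr).isClosed

variable (B) in
theorem finite_cells {r : ℝ} (hr : r < 2) (α : ι) :
    {β | (B.cell r α ∩ B.cell r β).Nonempty}.Finite := by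
  obtain ⟨J, hJ⟩ := B.exists_card_le hr
  by_contra hinf
  obtain ⟨s, hs, hcard⟩ := Set.Infinite.exists_subset_card_eq hinf (J + 1)
  have := hJ α s hs
  omega

variable (B) in
/-- Every point has a neighbourhood which is disjoint from all cells which do not contain the point. -/
theorem eventually_mem_cell {r : ℝ} (hr1 : 1 ≤ r) (hr : r < 2) (p : M) :
    ∀ᶠ q in 𝓝 p, ∀ β, q ∈ B.cell r β → p ∈ B.cell r β := by
  obtain ⟨α, hα, hα1⟩ := B.cover p
  have h1 : (B.chart α).symm '' cube n 1 ∈ 𝓝 p :=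
    (isOpen_image_cube (by norm_num)).mem_nhds ((mem_image_cube (by norm_num)).2 ⟨hα, hα1⟩)
  have h2 : ∀ β ∈ {β | (B.cell r α ∩ B.cell r β).Nonempty}, ∀ᶠ q in 𝓝 p,
      q ∈ B.cell r β → p ∈ B.cell r β := by
    intro β _
    by_cases hp : p ∈ B.cell r β
    · exact Eventually.of_forall fun _ _ => hp
    · filter_upwards [(isClosed_cell hr).isOpen_compl.mem_nhds hp] with q hq h
      exact absurd h hq
  filter_upwards [h1, (B.finite_cells hr α).eventually_all.2 h2] with q hq1 hq2 β hβ
  refine hq2 β ⟨q, ?_, hβ⟩ hβ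
  rw [mem_cell hr]
  rw [mem_image_cube (by norm_num)] at hq1
  exact ⟨hq1.1, closedCube_mono hr1 (cube_subset_closedCube hq1.2)⟩

theorem exists_coordinate_fields [Countable ι] (B : SBGStructure n M ι) {r : ℝ} (hr1 : 1 ≤ r) (hr : r < 2) :
    ∃ (N : ℕ) (V : Fin N → Fin n → VField n M) (col : ι → Fin N), (∀ c i, B.MemW (V c i)) ∧
      ∀ α i, ∀ x ∈ closedCube n r, B.locVF (V (col α) i) α x = e i := by
  classical
  set r₁ := (r + 2) / 2 with hr₁
  set r₂ := (r₁ + 2) / 2 with hr₂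
  have h12 : r₁ < r₂ := by linarith
  have h1' : r < r₁ := by linarith
  have h2' : r₂ < 2 := by linarith
  obtain ⟨J, hJ⟩ := B.exists_card_le h2'
  obtain ⟨col, hcol⟩ := exists_coloring (fun α β => (B.cell r₂ α ∩ B.cell r₂ β).Nonempty)
    (fun α β h => by rwa [inter_comm]) J hJ
  obtain ⟨χ, hχ, hχc, hχs, hχ1⟩ : ∃ χ : E n → ℝ, ContDiff ℝ ∞ χ ∧ HasCompactSupport χ ∧
      (∀ x ∉ closedCube n r₁, χ x = 0) ∧ ∀ x ∈ closedCube n r, χ x = 1 := by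
    obtain ⟨θ, h0, h1, -⟩ := exists_contMDiffMap_zero_one_nhds_of_isClosed 𝓘(ℝ, E n) (n := (⊤ : ℕ∞))
      (s := (cube n r₁)ᶜ) (t := closedCube n r) (isOpen_cube n r₁).isClosed_compl
      (isClosed_closedCube n r) (Set.disjoint_left.2 fun x hx hx' => hx (closedCube_subset_cube h1' hx'))
    have hz : ∀ x ∉ closedCube n r₁, θ x = 0 := fun x hx =>
      h0.self_of_nhdsSet x fun hx' => hx (cube_subset_closedCube hx')
    exact ⟨θ, θ.contMDiff.contDiff, HasCompactSupport.intro (isCompact_closedCube n r₁) hz, hz,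
      fun x hx => h1.self_of_nhdsSet x hx⟩
  let X : Fin n → E n → E n := fun i x => χ x • e i
  have hX : ∀ i, ContDiff ℝ ∞ (X i) := fun i => hχ.smul contDiff_const
  let V : Fin (J + 1) → Fin n → VField n M := fun c i p =>
    if h : ∃ γ, col γ = c ∧ p ∈ B.cell r₂ γ then B.chartVF h.choose (X i) p else 0
  have hV1 : ∀ γ i p, p ∈ B.cell r₂ γ → V (col γ) i p = B.chartVF γ (X i) p := by
    intro γ i p hp
    have h : ∃ γ', col γ' = col γ ∧ p ∈ B.cell r₂ γ' := ⟨γ, rfl, hp⟩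
    have hV : V (col γ) i p = B.chartVF h.choose (X i) p := dif_pos h
    have h3 : h.choose = γ := by
      by_contra hne
      exact hcol _ _ ⟨p, h.choose_spec.2, hp⟩ hne h.choose_spec.1
    rw [hV, h3]
  have hV0 : ∀ c i p, (∀ γ, col γ = c → p ∉ B.cell r₁ γ) → V c i p = 0 := by
    intro c i p hp
    by_cases h : ∃ γ, col γ = c ∧ p ∈ B.cell r₂ γ
    · obtain ⟨γ, rfl, hγ⟩ := h
      rw [hV1 γ i p hγ]
      have h1 := hp γ rfl
      have hγ' := (mem_cell h2').1 hγ
      rw [mem_cell (h12.trans h2')] at h1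
      have h4 : X i (B.chart γ p) = 0 := by
        change χ _ • _ = _
        rw [hχs _ fun h => h1 ⟨hγ'.1, h⟩, zero_smul]
      change (mfderiv (𝓡 n) 𝓘(ℝ, E n) (B.chart γ) p).inverse (X i (B.chart γ p)) = 0
      rw [h4]
      exact map_zero _
    · exact dif_neg h
  have hloc : ∀ c i p, (∃ γ, p ∈ (B.chart γ).source ∧
      ∀ᶠ q in 𝓝 p, V c i q = B.chartVF γ (X i) q) ∨ ∀ᶠ q in 𝓝 p, V c i q = 0 := by
    intro c i p
    by_cases h : ∃ γ, col γ = c ∧ p ∈ B.cell r₁ γ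
    · obtain ⟨γ, rfl, hγ⟩ := h
      have hγ' := (mem_cell (h12.trans h2')).1 hγ
      refine Or.inl ⟨γ, hγ'.1, ?_⟩
      filter_upwards [(isOpen_image_cube (B := B) (α := γ) h2'.le).mem_nhds
        ((mem_image_cube h2'.le).2 ⟨hγ'.1, closedCube_subset_cube h12 hγ'.2⟩)] with q hq
      refine hV1 γ i q ?_
      rw [mem_image_cube h2'.le] at hq
      exact (mem_cell h2').2 ⟨hq.1, cube_subset_closedCube hq.2⟩
    · push Not at h
      right
      filter_upwards [B.eventually_mem_cell (hr1.trans h1'.le) (h12.trans h2') p] with q hq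
      exact hV0 c i q fun γ hγ hq' => h γ hγ (hq γ hq')
  have hlocVF : ∀ c i α, ∀ x ∈ cube n 2, (∃ γ, x ∈ B.dom α γ ∧ B.locVF (V c i) α =ᶠ[𝓝 x]
      fun y => fderiv ℝ (B.tr γ α) (B.tr α γ y) (X i (B.tr α γ y))) ∨
      B.locVF (V c i) α =ᶠ[𝓝 x] fun _ => 0 := by
    intro c i α x hx
    have hcont : Tendsto (B.chart α).symm (𝓝 x) (𝓝 ((B.chart α).symm x)) :=
      (contMDiffAt_chart_symm hx).continuousAt
    rcases hloc c i ((B.chart α).symm x) with ⟨γ, hγ, h⟩ | h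
    · refine Or.inl ⟨γ, mem_dom.2 ⟨hx, hγ⟩, ?_⟩
      filter_upwards [hcont.eventually h, isOpen_dom.mem_nhds (mem_dom.2 ⟨hx, hγ⟩)] with y hy hy2
      rw [← locVF_chartVF (X i) hy2]
      unfold locVF
      rw [hy]
    · right
      filter_upwards [hcont.eventually h] with y hy
      unfold locVF
      rw [hy]
      exact map_zero _
  have hUB : ∀ i, UnifBdd (fun p : ι × ι => B.dom p.1 p.2)
      fun p y => fderiv ℝ (B.tr p.2 p.1) (B.tr p.1 p.2 y) (X i (B.tr p.1 p.2 y)) := by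
    intro i
    have h1 : UnifBdd (fun p : ι × ι => B.dom p.1 p.2)
        fun p y => fderiv ℝ (B.tr p.2 p.1) (B.tr p.1 p.2 y) :=
      ((unifBdd_tr (B := B)).fderiv (fun _ => isOpen_dom)).reindex Prod.swap |>.comp
        (fun _ => isOpen_dom) (fun _ => isOpen_dom) unifBdd_tr (fun p x hx => tr_mem_dom hx)
    exact h1.clm_apply (fun _ => isOpen_dom)
      (unifBdd_tr.comp_contDiff (fun _ => isOpen_dom) (hX i))
  refine ⟨J + 1, V, col, fun c i => ⟨fun p => ?_, fun α x hx => ?_, fun k => ?_⟩, fun α i x hx => ?_⟩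
  · rcases hloc c i p with ⟨γ, hγ, h⟩ | h
    · refine (contMDiffAt_chartVF (hX i) hγ).congr_of_eventuallyEq ?_
      filter_upwards [h] with q hq
      rw [hq]
    · have h0 : ContMDiffAt (𝓡 n) (𝓡 n).tangent ∞
          (fun q => (⟨q, 0⟩ : TangentBundle (𝓡 n) M)) p :=
        (Bundle.contMDiff_zeroSection ℝ (TangentSpace (𝓡 n) : M → Type _)).contMDiffAt
      refine h0.congr_of_eventuallyEq ?_
      filter_upwards [h] with q hq
      rw [hq]
  · refine ContDiffAt.contDiffWithinAt ?_
    rcases hlocVF c i α x hx with ⟨γ, hγ, h⟩ | h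
    · exact (((hUB i).1 (α, γ)).contDiffAt (isOpen_dom.mem_nhds hγ)).congr_of_eventuallyEq h
    · exact contDiffAt_const.congr_of_eventuallyEq h
  · obtain ⟨C, hC⟩ := (hUB i).2 k
    refine ⟨max C 0, fun α x hx => ?_⟩
    rcases hlocVF c i α x hx with ⟨γ, hγ, h⟩ | h
    · rw [(h.iteratedFDeriv ℝ k).eq_of_nhds]
      exact (hC (α, γ) x hγ).trans (le_max_left _ _)
    · rw [(h.iteratedFDeriv ℝ k).eq_of_nhds]
      simp [iteratedFDeriv_fun_zero]
  · have hx2 : x ∈ cube n 2 := closedCube_subset_cube hr hx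
    have hs := symm_mem_source (B := B) (α := α) hx2
    have hd : x ∈ B.dom α α := mem_dom.2 ⟨hx2, hs⟩
    have h1 : B.locVF (V (col α) i) α x = B.locVF (B.chartVF α (X i)) α x := by
      unfold locVF
      rw [hV1 α i _ ((mem_cell h2').2 ⟨hs, by
        rw [chart_symm hx2]; exact closedCube_mono (h1'.trans h12).le hx⟩)]
    have h2 : B.tr α α x = x := chart_symm hx2
    have h3 : fderiv ℝ (B.tr α α) x = ContinuousLinearMap.id ℝ _ := by
      have : B.tr α α =ᶠ[𝓝 x] id := by
        filter_upwards [(isOpen_cube n 2).mem_nhds hx2] with y hy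
        exact chart_symm hy
      rw [this.fderiv_eq, fderiv_id]
    rw [h1, locVF_chartVF _ hd, h2, h3]
    change χ x • e i = e i
    rw [hχ1 x hx, one_smul]

end SBGStructure

/-! ### Weights -/

theorem UnifBdd.of_fderiv {I V F : Type*} [NormedAddCommGroup V] [NormedSpace ℝ V]
    [NormedAddCommGroup F] [NormedSpace ℝ F] {D : I → Set V} {f : I → V → F} {C : ℝ}
    (hf : ∀ i, ContDiffOn ℝ ∞ (f i) (D i)) (hC : ∀ i, ∀ x ∈ D i, ‖f i x‖ ≤ C)
    (hd : UnifBdd D fun i x => _root_.fderiv ℝ (f i) x) : UnifBdd D f := by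
  refine ⟨hf, fun k => ?_⟩
  cases k with
  | zero => exact ⟨C, fun i x hx => by simpa using hC i x hx⟩
  | succ k =>
    obtain ⟨C', hC'⟩ := hd.2 k
    refine ⟨C', fun i x hx => ?_⟩
    rw [← norm_iteratedFDeriv_fderiv]
    exact hC' i x hx

theorem e_apply {n : ℕ} (i j : Fin n) : (e i : E n) j = if j = i then 1 else 0 := by
  simp [e, Pi.single_apply]

theorem sum_apply' {n : ℕ} {J : Type*} (s : Finset J) (f : J → E n) (j : Fin n) :
    (∑ i ∈ s, f i) j = ∑ i ∈ s, f i j := map_sum (EuclideanSpace.proj j : E n →L[ℝ] ℝ) f s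

theorem sum_smul_e_apply {n : ℕ} (c : Fin n → ℝ) (j : Fin n) : (∑ i, c i • (e i : E n)) j = c j := by
  simp [sum_apply', e_apply]

theorem clm_eq_sum {n : ℕ} {F : Type*} [NormedAddCommGroup F] [NormedSpace ℝ F] (A : E n →L[ℝ] F) :
    A = ∑ i, (EuclideanSpace.proj i : E n →L[ℝ] ℝ).smulRight (A (e i)) := by
  ext x
  have hx : x = ∑ i, x i • (e i : E n) := by
    ext j
    rw [sum_smul_e_apply]
  conv_lhs => rw [hx]
  simp [map_sum]

theorem UnifBdd.fderiv_of_apply {n : ℕ} {I F : Type*} [NormedAddCommGroup F] [NormedSpace ℝ F]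
    {D : I → Set (E n)} {A : I → E n → E n →L[ℝ] F} (hD : ∀ i, IsOpen (D i))
    (h : ∀ j, UnifBdd D fun i x => A i x (e j)) : UnifBdd D A := by
  have h1 : UnifBdd D fun i x => ∑ j, (EuclideanSpace.proj j : E n →L[ℝ] ℝ).smulRight (A i x (e j)) :=
    UnifBdd.sum Finset.univ hD fun j _ =>
      (h j).clm (ContinuousLinearMap.smulRightL ℝ (E n) F (EuclideanSpace.proj j : E n →L[ℝ] ℝ)) hD
  exact h1.congr hD fun i x _ => clm_eq_sum _

theorem det_scl {n : ℕ} (ρ : Fin n → ℝ) : (scl ρ).det = (2 * Real.pi) ^ n * ∏ i, ρ i := by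
  have h : LinearMap.toMatrix (EuclideanSpace.basisFun (Fin n) ℝ).toBasis
      (EuclideanSpace.basisFun (Fin n) ℝ).toBasis (scl ρ : E n →ₗ[ℝ] E n) =
      Matrix.diagonal fun i => 2 * Real.pi * ρ i := by
    ext i j
    rw [LinearMap.toMatrix_apply, Matrix.diagonal_apply]
    simp [scl_apply]
  change LinearMap.det (scl ρ : E n →ₗ[ℝ] E n) = _
  rw [← LinearMap.det_toMatrix (EuclideanSpace.basisFun (Fin n) ℝ).toBasis, h, Matrix.det_diagonal,
    Finset.prod_mul_distrib]
  simp

namespace SBGStructure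

variable {n : ℕ} {M : Type*} [TopologicalSpace M] [ChartedSpace (E n) M] {ι : Type*}
variable [IsManifold (𝓡 n) ∞ M] {B : SBGStructure n M ι} {α β γ : ι} {x : E n} {p : M}

theorem scaleProd_pos : 0 < B.scaleProd α := Finset.prod_pos fun i _ => B.scale_pos α i

variable (B) in
theorem exists_scaleProd_le : ∃ C : ℝ, 0 < C ∧ ∀ α β, (B.dom α β).Nonempty →
    B.scaleProd α ≤ C * B.scaleProd β := by
  let T : ι × ι → E n → E n →L[ℝ] E n := fun p x => ∑ i, ∑ j,
    (B.scale p.1 i / B.scale p.2 j * fderiv ℝ (fun y => B.tr p.1 p.2 y j) x (e i)) •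
      (EuclideanSpace.proj i : E n →L[ℝ] ℝ).smulRight (e j : E n)
  have hT : UnifBdd (fun p : ι × ι => B.dom p.1 p.2) T :=
    UnifBdd.sum _ (fun _ => isOpen_dom) fun i _ => UnifBdd.sum _ (fun _ => isOpen_dom) fun j _ =>
      (unifBdd_tr_deriv_scale i j).clm ((ContinuousLinearMap.id ℝ ℝ).smulRight
        ((EuclideanSpace.proj i : E n →L[ℝ] ℝ).smulRight (e j : E n))) (fun _ => isOpen_dom)
  have hdet := UnifBdd.comp_contDiff (fun _ => isOpen_dom) contDiff_det hT
  obtain ⟨C, hC0, hC⟩ := hdet.exists_norm_le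
  obtain ⟨ε, hε, hε'⟩ := B.exists_det_ge
  refine ⟨C / ε, by positivity, fun α β ⟨x, hx⟩ => ?_⟩
  have hcomp : (scl (B.scale β)).comp (T (α, β) x) =
      (fderiv ℝ (B.tr α β) x).comp (scl (B.scale α)) := by
    have hj : ∀ (j : Fin n) (v : E n), fderiv ℝ (B.tr α β) x v j =
        fderiv ℝ (fun y => B.tr α β y j) x v := fun j v => by
      have h1 := ((EuclideanSpace.proj j : E n →L[ℝ] ℝ).hasFDerivAt.comp x (hasFDerivAt_tr hx)).fderiv
      have h2 : (fun y => B.tr α β y j) = (EuclideanSpace.proj j : E n →L[ℝ] ℝ) ∘ B.tr α β := rfl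
      rw [h2, h1]; rfl
    ext v l
    have hv : scl (B.scale α) v = ∑ i, (2 * Real.pi * B.scale α i * v i) • (e i : E n) := by
      ext j
      rw [sum_smul_e_apply, scl_apply]
    simp only [ContinuousLinearMap.comp_apply]
    rw [hv, map_sum, scl_apply]
    simp only [T, sum_apply, sum_apply', map_smul, smul_apply, PiLp.smul_apply,
      ContinuousLinearMap.smulRight_apply, smul_eq_mul, hj, Finset.mul_sum, EuclideanSpace.coe_proj,
      e_apply]
    refine Finset.sum_congr rfl fun i _ => ?_
    rw [Finset.sum_eq_single l]
    · have := B.scale_pos β l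
      rw [if_pos rfl]
      field_simp
    · intro j _ hj
      rw [if_neg hj.symm]; simp
    · simp
  have h1 := congrArg ContinuousLinearMap.det hcomp
  simp only [ContinuousLinearMap.det, ContinuousLinearMap.toLinearMap_comp, LinearMap.det_comp] at h1
  change (scl (B.scale β)).det * (T (α, β) x).det =
    (fderiv ℝ (B.tr α β) x).det * (scl (B.scale α)).det at h1
  rw [det_scl, det_scl] at h1
  have h2 : B.scaleProd β * (T (α, β) x).det = (fderiv ℝ (B.tr α β) x).det * B.scaleProd α := by
    have : (0 : ℝ) < (2 * Real.pi) ^ n := by positivity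
    refine mul_left_cancel₀ this.ne' ?_
    unfold scaleProd
    linarith
  have h3 := congrArg abs h2
  rw [abs_mul, abs_mul, abs_of_pos scaleProd_pos, abs_of_pos (scaleProd_pos (α := α))] at h3
  have h4 : |(T (α, β) x).det| ≤ C := hC (α, β) x hx
  have h5 := hε' α β x hx
  rw [div_mul_eq_mul_div, le_div_iff₀ hε]
  have hβ : 0 < B.scaleProd β := scaleProd_pos
  have hα : 0 < B.scaleProd α := scaleProd_pos
  calc _ = ε * B.scaleProd α := mul_comm _ _
    _ ≤ |(fderiv ℝ (B.tr α β) x).det| * B.scaleProd α := by gcongr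
    _ = B.scaleProd β * |(T (α, β) x).det| := h3.symm
    _ ≤ B.scaleProd β * C := by gcongr
    _ = _ := mul_comm _ _

theorem contDiffAt_symm {F : Type*} [NormedAddCommGroup F] [NormedSpace ℝ F] {f : M → F}
    (hx : x ∈ cube n 2) (hf : ContMDiffAt (𝓡 n) 𝓘(ℝ, F) ∞ f ((B.chart α).symm x)) :
    ContDiffAt ℝ ∞ (fun y => f ((B.chart α).symm y)) x :=
  contMDiffAt_iff_contDiffAt.1 (ContMDiffAt.comp (I' := 𝓡 n) x hf (contMDiffAt_chart_symm hx))

theorem vderiv_symm {f : M → ℝ} (W : VField n M) (hx : x ∈ cube n 2)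
    (hf : ContMDiffAt (𝓡 n) 𝓘(ℝ, ℝ) ∞ f ((B.chart α).symm x)) :
    vderiv W f ((B.chart α).symm x) = fderiv ℝ (fun y => f ((B.chart α).symm y)) x (B.locVF W α x) := by
  have hp := symm_mem_source (B := B) (α := α) hx
  have h1 : f =ᶠ[𝓝 ((B.chart α).symm x)] (fun y => f ((B.chart α).symm y)) ∘ B.chart α := by
    filter_upwards [(B.chart α).open_source.mem_nhds hp] with q hq
    simp [symm_chart hq]
  unfold vderiv locVF
  rw [h1.mfderiv_eq, mfderiv_comp (I' := 𝓘(ℝ, E n)) _ ?_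
    ((contMDiffAt_chart hp).mdifferentiableAt (by simp)), mfderiv_eq_fderiv, chart_symm hx]
  · rfl
  · rw [chart_symm hx]
    exact ((contDiffAt_symm hx hf).differentiableAt (by simp)).mdifferentiableAt

theorem IsWeight.mul {w w' : M → ℝ} (hw : B.IsWeight w) (hw' : B.IsWeight w') :
    B.IsWeight fun p => w p * w' p := by
  refine ⟨fun p => mul_pos (hw.1 p) (hw'.1 p), hw.2.1.mul hw'.2.1, fun W hW => ?_⟩
  have h1 := hw.2.2 W hW
  have h2 := hw'.2.2 W hW
  have heq : (fun p => vderiv W (fun p => w p * w' p) p / (w p * w' p)) =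
      fun p => vderiv W w p / w p + vderiv W w' p / w' p := by
    ext p
    obtain ⟨α, hα, -⟩ := B.cover p
    have hx := mem_cube_of_mem_source hα
    have hp := symm_chart hα
    have hc : ∀ f : M → ℝ, ContMDiff (𝓡 n) 𝓘(ℝ, ℝ) ∞ f → vderiv W f p =
        fderiv ℝ (fun y => f ((B.chart α).symm y)) (B.chart α p) (B.locVF W α (B.chart α p)) :=
      fun f hf => by
        have := vderiv_symm (B := B) (α := α) W hx hf.contMDiffAt
        rwa [hp] at this
    have hd : ∀ f : M → ℝ, ContMDiff (𝓡 n) 𝓘(ℝ, ℝ) ∞ f →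
        DifferentiableAt ℝ (fun y => f ((B.chart α).symm y)) (B.chart α p) := fun f hf =>
      (contDiffAt_symm hx hf.contMDiffAt).differentiableAt (by simp)
    rw [hc _ hw.2.1, hc _ hw'.2.1, hc (fun p => w p * w' p) (hw.2.1.mul hw'.2.1), fderiv_fun_mul (hd _ hw.2.1) (hd _ hw'.2.1)]
    have h3 := (hw.1 p).ne'
    have h4 := (hw'.1 p).ne'
    simp only [add_apply, smul_apply, smul_eq_mul, hp]
    field_simp
    ring
  rw [heq]
  have hU : ∀ {f : M → ℝ}, B.UnifSmooth f → UnifBdd (fun _ : ι => cube n 2)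
      fun α x => f ((B.chart α).symm x) := fun h => h.2
  exact ⟨h1.1.add h2.1, (hU h1).add (fun _ => isOpen_cube n 2) (hU h2)⟩

/-- The weight family `w_α`, bounds on the cells. -/
structure WtBd (B : SBGStructure n M ι) (w : M → ℝ) (r C : ℝ) : Prop where
  pos : ∀ α, 0 < B.weightFamily w α
  le : ∀ α, ∀ x ∈ cube n r, w ((B.chart α).symm x) ≤ C * B.weightFamily w α
  ge : ∀ α, ∀ x ∈ cube n r, B.weightFamily w α ≤ C * w ((B.chart α).symm x)

variable [T2Space M] [Countable ι]

theorem IsWeight.unifBdd_fderiv_log {w : M → ℝ} (hw : B.IsWeight w) {r : ℝ} (hr1 : 1 ≤ r) (hr : r < 2) :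
    UnifBdd (fun _ : ι => cube n r)
      fun α x => fderiv ℝ (fun y => Real.log (w ((B.chart α).symm y))) x := by
  obtain ⟨N, V, col, hV, hcol⟩ := B.exists_coordinate_fields hr1 hr
  refine UnifBdd.fderiv_of_apply (fun _ => isOpen_cube n r) fun i => ?_
  have h1 : ∀ c, UnifBdd (fun _ : ι => cube n 2)
      fun α x => vderiv (V c i) w ((B.chart α).symm x) / w ((B.chart α).symm x) :=
    fun c => (hw.2.2 _ (hV c i)).2
  have h2 : UnifBdd (fun _ : ι => cube n r)
      fun α x => vderiv (V (col α) i) w ((B.chart α).symm x) / w ((B.chart α).symm x) := by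
    refine ⟨fun α => ((h1 (col α)).1 α).mono (cube_mono hr.le), fun k => ?_⟩
    choose C hC using fun c => (h1 c).2 k
    refine ⟨∑ c, |C c|, fun α x hx => (hC (col α) α x (cube_mono hr.le hx)).trans ?_⟩
    exact (le_abs_self _).trans (Finset.single_le_sum (f := fun c => |C c|)
      (fun c _ => abs_nonneg _) (Finset.mem_univ _))
  refine h2.congr (fun _ => isOpen_cube n r) fun α x hx => ?_
  have hx2 := cube_mono hr.le hx
  have hd := (contDiffAt_symm (B := B) (α := α) hx2 hw.2.1.contMDiffAt).differentiableAt (by simp)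
  simp only
  rw [vderiv_symm _ hx2 hw.2.1.contMDiffAt, hcol α i x (cube_subset_closedCube hx),
    fderiv.log hd (hw.1 _).ne', smul_apply, smul_eq_mul, div_eq_inv_mul]

theorem exists_norm_sub_le (n : ℕ) (r : ℝ) : ∃ R : ℝ, 0 < R ∧ ∀ x ∈ cube n r, ∀ y ∈ cube n r,
    ‖x - y‖ ≤ R := by
  obtain ⟨R, hR⟩ := (isCompact_closedCube n r).isBounded.subset_closedBall 0
  refine ⟨max (R + R) 1, by positivity, fun x hx y hy => (norm_sub_le _ _).trans ((add_le_add ?_ ?_).trans (le_max_left _ _))⟩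
  · simpa using hR (cube_subset_closedCube hx)
  · simpa using hR (cube_subset_closedCube hy)

theorem IsWeight.exists_wtBd {w : M → ℝ} (hw : B.IsWeight w) {r : ℝ} (hr1 : 3 / 2 ≤ r) (hr : r < 2) :
    ∃ C : ℝ, 0 < C ∧ B.WtBd w r C := by
  obtain ⟨L, hL0, hL⟩ := (hw.unifBdd_fderiv_log (by linarith) hr).exists_norm_le
  obtain ⟨R, hR0, hR⟩ := exists_norm_sub_le n r
  have h1 : ∀ α, ∀ x ∈ cube n r, ∀ y ∈ cube n r,
      w ((B.chart α).symm x) ≤ Real.exp (L * R) * w ((B.chart α).symm y) := by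
    intro α x hx y hy
    have h2 := (convex_cube n r).norm_image_sub_le_of_norm_fderiv_le
      (f := fun y => Real.log (w ((B.chart α).symm y))) (C := L) (fun z hz =>
        ((contDiffAt_symm (cube_mono hr.le hz) hw.2.1.contMDiffAt).differentiableAt (by simp)).log
          (hw.1 _).ne') (fun z hz => hL α z hz) hy hx
    have h3 : Real.log (w ((B.chart α).symm x)) ≤ L * R + Real.log (w ((B.chart α).symm y)) := by
      have := hR x hx y hy
      have := (le_abs_self _).trans h2
      nlinarith
    rw [← Real.exp_log (hw.1 ((B.chart α).symm x)), ← Real.exp_log (hw.1 ((B.chart α).symm y)),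
      ← Real.exp_add]
    exact Real.exp_le_exp.2 h3
  have h0 : (0 : E n) ∈ cube n (3 / 2) := fun i => by simp
  have hbdd : ∀ α, ∀ x ∈ cube n r, ∀ v ∈ w '' B.cell' α,
      v ≤ Real.exp (L * R) * w ((B.chart α).symm x) := by
    rintro α x hx _ ⟨_, ⟨y, hy, rfl⟩, rfl⟩
    exact h1 α y (cube_mono hr1 hy) x hx
  have hmem : ∀ α, w ((B.chart α).symm 0) ∈ w '' B.cell' α := fun α =>
    mem_image_of_mem w (mem_image_of_mem _ h0)
  have hle : ∀ α, w ((B.chart α).symm 0) ≤ B.weightFamily w α := fun α =>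
    le_csSup ⟨_, hbdd α 0 (cube_mono hr1 h0)⟩ (hmem α)
  exact ⟨Real.exp (L * R), Real.exp_pos _, fun α => (hw.1 _).trans_le (hle α),
    fun α x hx => (h1 α x hx 0 (cube_mono hr1 h0)).trans (by gcongr; exact hle α),
    fun α x hx => csSup_le ⟨_, hmem α⟩ (hbdd α x hx)⟩

theorem IsWeight.unifBdd_div {w : M → ℝ} (hw : B.IsWeight w) {r : ℝ} (hr1 : 3 / 2 ≤ r) (hr : r < 2) :
    UnifBdd (fun _ : ι => cube n r) fun α x => w ((B.chart α).symm x) / B.weightFamily w α := by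
  obtain ⟨C, hC0, hC⟩ := hw.exists_wtBd hr1 hr
  have h1 : UnifBdd (fun _ : ι => cube n r)
      fun α x => Real.log (w ((B.chart α).symm x)) - Real.log (B.weightFamily w α) := by
    refine UnifBdd.of_fderiv (C := |Real.log C|) (fun α x hx => ?_) (fun α x hx => ?_) ?_
    · exact (((contDiffAt_symm (cube_mono hr.le hx) hw.2.1.contMDiffAt).log (hw.1 _).ne').sub
        contDiffAt_const).contDiffWithinAt
    · have hp := hC.pos α
      have hwx := hw.1 ((B.chart α).symm x)
      have h2 := Real.log_le_log hwx (hC.le α x hx)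
      have h3 := Real.log_le_log hp (hC.ge α x hx)
      rw [Real.log_mul hC0.ne' hp.ne'] at h2
      rw [Real.log_mul hC0.ne' hwx.ne'] at h3
      have h4 := le_abs_self (Real.log C)
      rw [Real.norm_eq_abs, abs_le]
      constructor <;> linarith
    · refine (hw.unifBdd_fderiv_log (by linarith) hr).congr (fun _ => isOpen_cube n r) fun α x _ => ?_
      simp only
      rw [fderiv_sub_const]
  refine (h1.comp_contDiff (fun _ => isOpen_cube n r) Real.contDiff_exp).congr
    (fun _ => isOpen_cube n r) fun α x _ => ?_
  simp only
  rw [Real.exp_sub, Real.exp_log (hw.1 _), Real.exp_log (hC.pos α)]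

theorem IsWeight.exists_weightFamily_le {w : M → ℝ} (hw : B.IsWeight w) {r : ℝ} (hr : r < 2) :
    ∃ C : ℝ, 0 < C ∧ ∀ α β, (B.cell r α ∩ B.cell r β).Nonempty →
      B.weightFamily w α ≤ C * B.weightFamily w β := by
  have hr1 : 3 / 2 ≤ max (3 / 2) ((r + 2) / 2) := le_max_left _ _
  have hr2 : max (3 / 2) ((r + 2) / 2) < 2 := max_lt (by norm_num) (by linarith)
  have hr3 : r < max (3 / 2) ((r + 2) / 2) := lt_max_of_lt_right (by linarith)
  obtain ⟨C, hC0, hC⟩ := hw.exists_wtBd hr1 hr2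
  refine ⟨C * C, by positivity, fun α β ⟨p, hα, hβ⟩ => ?_⟩
  rw [mem_cell hr] at hα hβ
  have h1 := hC.ge α _ (closedCube_subset_cube hr3 hα.2)
  have h2 := hC.le β _ (closedCube_subset_cube hr3 hβ.2)
  rw [symm_chart hα.1] at h1
  rw [symm_chart hβ.1] at h2
  calc _ ≤ C * w p := h1
    _ ≤ C * (C * B.weightFamily w β) := by gcongr
    _ = _ := by ring

theorem IsWeight.weightFamily_pos {w : M → ℝ} (hw : B.IsWeight w) : 0 < B.weightFamily w α := by
  obtain ⟨C, -, hC⟩ := hw.exists_wtBd le_rfl (by norm_num)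
  exact hC.pos α

end SBGStructure

/-! ### Localization of distributions -/

theorem enorm_sum_sq_le {J : Type*} (S : Finset J) (a : J → ℂ) :
    ‖∑ j ∈ S, a j‖ₑ ^ 2 ≤ S.card * ∑ j ∈ S, ‖a j‖ₑ ^ 2 := by
  have h : ‖∑ j ∈ S, a j‖ ^ 2 ≤ S.card * ∑ j ∈ S, ‖a j‖ ^ 2 :=
    (pow_le_pow_left₀ (norm_nonneg _) (norm_sum_le _ _) 2).trans (sq_sum_le_card_mul_sum_sq)
  simp only [← ofReal_norm, ← ENNReal.ofReal_pow (norm_nonneg _)]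
  rw [← ENNReal.ofReal_sum_of_nonneg (fun _ _ => by positivity), ← ENNReal.ofReal_natCast,
    ← ENNReal.ofReal_mul (by positivity)]
  exact ENNReal.ofReal_le_ofReal h

/-- A uniformly smooth family of functions with supports in the cube `[-r, r]ⁿ`. -/
structure IsCut {n : ℕ} {ι : Type*} (r : ℝ) (h : ι → E n → ℝ) : Prop where
  unif : UnifBdd (fun _ => univ) h
  supp : ∀ α, ∀ x ∉ closedCube n r, h α x = 0

namespace IsCut

variable {n : ℕ} {ι : Type*} {r : ℝ} {h : ι → E n → ℝ}

theorem tsupport_subset (hh : IsCut r h) (α : ι) : tsupport (h α) ⊆ closedCube n r :=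
  closure_minimal (fun x hx => by_contra fun hx' => hx (hh.supp α x hx')) (isClosed_closedCube n r)

theorem isTest (hh : IsCut r h) (hr : r < 2) (α : ι) : IsTest fun x => (h α x : ℂ) :=
  ⟨Complex.ofRealCLM.contDiff.comp (hh.unif.contDiff α), HasCompactSupport.intro
    (isCompact_closedCube n r) fun x hx => by rw [hh.supp α x hx, Complex.ofReal_zero],
    (tsupport_comp_subset Complex.ofReal_zero _).trans
      ((hh.tsupport_subset α).trans (closedCube_subset_cube hr))⟩

theorem mono (hh : IsCut r h) {r' : ℝ} (hr : r ≤ r') : IsCut r' h :=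
  ⟨hh.unif, fun α x hx => hh.supp α x fun hx' => hx (closedCube_mono hr hx')⟩

theorem mul_cube (hh : IsCut r h) {r' : ℝ} (hr : r < r') {f : ι → E n → ℝ}
    (hf : UnifBdd (fun _ => cube n r') f) : IsCut r fun α x => h α x * f α x :=
  ⟨UnifBdd.smul_cutoff (fun _ => isOpen_cube n r') (fun _ => isOpen_univ) hh.unif
    (fun α => inter_subset_right.trans ((hh.tsupport_subset α).trans (closedCube_subset_cube hr))) hf,
    fun α x hx => by rw [hh.supp α x hx, zero_mul]⟩

theorem fderiv_apply (hh : IsCut r h) (v : E n) : IsCut r fun α x => fderiv ℝ (h α) x v :=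
  ⟨hh.unif.fderiv_apply (fun _ => isOpen_univ) v, fun α x hx => by
    have : x ∉ tsupport fun x => fderiv ℝ (h α) x v := fun hx' =>
      hx (hh.tsupport_subset α (tsupport_fderiv_apply_subset ℝ v hx'))
    exact image_eq_zero_of_notMem_tsupport (f := fun x => fderiv ℝ (h α) x v) this⟩

theorem const {f : E n → ℝ} (hf : ContDiff ℝ ∞ f) (h0 : ∀ x ∉ closedCube n r, f x = 0) :
    IsCut r fun _ : ι => f :=
  ⟨UnifBdd.of_contDiff_hasCompactSupport hf (HasCompactSupport.intro (isCompact_closedCube n r) h0),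
    fun _ => h0⟩

end IsCut

namespace SBGStructure

variable {n : ℕ} {M : Type*} [TopologicalSpace M] [ChartedSpace (E n) M] {ι : Type*}
  {B : SBGStructure n M ι} {α β γ : ι} {x : E n} {p : M} {r : ℝ}

section Transfer

/-- Distributions and their transformation law, for complex valued test functions. -/
theorem cev_transfer [IsManifold (𝓡 n) ∞ M] {u : B.LocalFamily} (hu : u ∈ B.Distrib) {f q : E n → ℂ} (hf : IsTest f)
    (hq : IsTest q) (hqs : tsupport q ⊆ B.dom β α)
    (h1 : ∀ x ∈ B.dom α β, f x = |(fderiv ℝ (B.tr α β) x).det| * q (B.tr α β x))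
    (h0 : ∀ x ∉ B.dom α β, f x = 0) : cev (u α) f = cev (u β) q := by
  have key : ∀ L : ℂ →L[ℝ] ℝ, u α (hf.clm L) = u β (hq.clm L) := fun L =>
    hu α β (hf.clm L) (hq.clm L) ((tsupport_comp_subset (map_zero L) q).trans hqs)
      (fun x hx => by
        change L (f x) = _ * L (q _)
        rw [h1 x hx, ← Complex.real_smul, map_smul]
        rfl)
      (fun x hx => by
        change L (f x) = 0
        rw [h0 x hx, map_zero])
  rw [cev_eq hf, cev_eq hq, key, key]

/-- The family `h_α (g_β ∘ τ_{βα})`. -/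
def cross (B : SBGStructure n M ι) (g h : ι → E n → ℝ) (p : ι × ι) : E n → ℝ :=
  (B.dom p.1 p.2).indicator fun x => h p.1 x * g p.2 (B.tr p.1 p.2 x)

variable [T2Space M]

theorem adm_cross (hr : r < 2) {g h : ι → E n → ℝ} (hg : IsCut r g) (hh : IsCut r h) :
    B.Adm (B.cross g h) := by
  have hK : ∀ p : ι × ι, IsCompact (B.overlap r p.1 p.2) := fun p => isCompact_overlap hr
  have hKD : ∀ p : ι × ι, B.overlap r p.1 p.2 ⊆ B.dom p.1 p.2 := fun p x hx =>
    ((mem_overlap hr).1 hx).2.1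
  have h0 : ∀ p : ι × ι, ∀ x ∈ B.dom p.1 p.2, x ∉ B.overlap r p.1 p.2 →
      h p.1 x * g p.2 (B.tr p.1 p.2 x) = 0 := by
    intro p x hx hxK
    rw [mem_overlap hr] at hxK
    by_cases h1 : x ∈ closedCube n r
    · rw [hg.supp p.2 _ fun h2 => hxK ⟨h1, hx, h2⟩, mul_zero]
    · rw [hh.supp p.1 x h1, zero_mul]
  have h1 : UnifBdd (fun p : ι × ι => B.dom p.1 p.2) fun p x =>
      h p.1 x * g p.2 (B.tr p.1 p.2 x) :=
    UnifBdd.mul (fun _ => isOpen_dom)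
      ((hh.unif.reindex (fun p : ι × ι => p.1)).mono fun _ => subset_univ _)
      (UnifBdd.comp (fun _ => isOpen_dom) (fun _ => isOpen_univ)
        (hg.unif.reindex (fun p : ι × ι => p.2)) unifBdd_tr fun _ _ _ => mem_univ _)
  have hs : ∀ p, tsupport (B.cross g h p) ⊆ B.overlap r p.1 p.2 := fun p => by
    refine closure_minimal (fun x hx => ?_) (hK p).isClosed
    by_contra hxK
    exact hx (indicator_apply_eq_zero.2 fun hxD => h0 p x hxD hxK)
  exact ⟨h1.indicator (fun _ => isOpen_dom) (fun p => (hK p).isClosed) hKD h0,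
    fun p => (hK p).of_isClosed_subset (isClosed_tsupport _) (hs p), fun p => (hs p).trans (hKD p)⟩

variable [IsManifold (𝓡 n) ∞ M]

variable (B) in
/-- The finite set of the indices `β` for which the cells of `α` and `β` overlap. -/
def nbr (hr : r < 2) (α : ι) : Finset ι := (B.finite_cells hr α).toFinset

theorem mem_nbr {hr : r < 2} : β ∈ B.nbr hr α ↔ (B.cell r α ∩ B.cell r β).Nonempty := by
  simp [nbr]

theorem mem_nbr_comm {hr : r < 2} : β ∈ B.nbr hr α ↔ α ∈ B.nbr hr β := by
  rw [mem_nbr, mem_nbr, inter_comm]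

/-- The functions `g_γ ∘ φ_γ` form a partition of unity on `M`, with supports in the cells. -/
def IsPou (B : SBGStructure n M ι) (r : ℝ) (θ : ι → E n → ℝ) : Prop :=
  IsCut r θ ∧ ∀ p : M, ∀ s : Finset ι, (∀ γ, p ∈ B.cell r γ → γ ∈ s) →
    ∑ γ ∈ s, (B.chart γ).source.indicator (fun q => θ γ (B.chart γ q)) p = 1

theorem IsPou.sum_eq_one {θ : ι → E n → ℝ} (hθ : B.IsPou r θ) (hr : r < 2) (hx : x ∈ closedCube n r) :
    ∑ γ ∈ B.nbr hr α, (B.dom α γ).indicator (fun y => θ γ (B.tr α γ y)) x = 1 := by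
  have hx2 := closedCube_subset_cube hr hx
  rw [← hθ.2 ((B.chart α).symm x) (B.nbr hr α) fun γ hγ => mem_nbr.2 ⟨_, ⟨x, hx, rfl⟩, hγ⟩]
  refine Finset.sum_congr rfl fun γ _ => ?_
  by_cases h : (B.chart α).symm x ∈ (B.chart γ).source
  · rw [indicator_of_mem h, indicator_of_mem (mem_dom.2 ⟨hx2, h⟩)]
    rfl
  · rw [indicator_of_notMem h, indicator_of_notMem fun h' => h (mem_dom.1 h').2]

theorem cev_decompose {u : B.LocalFamily} (hu : u ∈ B.Distrib) (hr : r < 2) {g χ h : ι → E n → ℝ}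
    (hg : IsCut r g) (hχ : IsCut r χ) (hh : IsCut r h) (hθ : B.IsPou r fun γ x => g γ x * χ γ x)
    (α : ι) {f : E n → ℂ} (hf : ContDiff ℝ ∞ f) :
    cev (u α) (fun x => (h α x : ℂ) * f x) =
      ∑ γ ∈ B.nbr hr α, cev (u γ) fun x => (χ γ x : ℂ) * B.trOp (B.adj (B.cross g h)) (γ, α) f x := by
  have hG := adm_cross (B := B) hr hθ.1 hh
  have hG' := adm_cross (B := B) hr hg hh
  have htest : ∀ γ, IsTest fun x => (B.cross (fun γ x => g γ x * χ γ x) h (α, γ) x : ℂ) * f x :=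
    fun γ => ⟨(Complex.ofRealCLM.contDiff.comp (hG.unif.contDiff _)).mul hf,
      ((hG.compact (α, γ)).comp_left Complex.ofReal_zero).mul_right, tsupport_mul_subset_left.trans
      ((tsupport_comp_subset Complex.ofReal_zero _).trans ((hG.sub _).trans dom_subset_cube))⟩
  have hsum : (fun x => (h α x : ℂ) * f x) = fun x => ∑ γ ∈ B.nbr hr α,
      (B.cross (fun γ x => g γ x * χ γ x) h (α, γ) x : ℂ) * f x := by
    ext x
    rw [← Finset.sum_mul]
    congr 1
    by_cases hx : x ∈ closedCube n r
    · have h1 := hθ.sum_eq_one (α := α) hr hx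
      rw [← Complex.ofReal_sum]
      congr 1
      calc h α x = h α x * 1 := (mul_one _).symm
        _ = _ := by
          rw [← h1, Finset.mul_sum]
          refine Finset.sum_congr rfl fun γ _ => ?_
          by_cases hx' : x ∈ B.dom α γ
          · simp [cross, hx']
          · simp [cross, hx']
    · rw [hh.supp α x hx, Complex.ofReal_zero]
      symm
      refine Finset.sum_eq_zero fun γ _ => ?_
      have h0 : B.cross (fun γ x => g γ x * χ γ x) h (α, γ) x = 0 :=
        indicator_apply_eq_zero.2 fun _ => by simp only [hh.supp α x hx, zero_mul]
      rw [h0, Complex.ofReal_zero]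
  rw [hsum, cev_sum _ fun γ _ => htest γ]
  refine Finset.sum_congr rfl fun γ _ => ?_
  have hs : tsupport (fun x => (χ γ x : ℂ) * B.trOp (B.adj (B.cross g h)) (γ, α) f x) ⊆ B.dom γ α := by
    refine tsupport_mul_subset_right.trans (subset_trans (closure_mono fun y hy => ?_) (hG'.adj.sub (γ, α)))
    simp only [trOp, Function.mem_support] at hy ⊢
    intro h; simp [h] at hy
  refine cev_transfer hu (htest γ) ⟨(hχ.isTest hr γ).smooth.mul (hG'.adj.contDiff_trOp (γ, α) hf.contDiffOn),
    (hχ.isTest hr γ).compact.mul_right, hs.trans dom_subset_cube⟩ hs (fun x hx => ?_) fun x hx => ?_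
  · have h1 := det_tr_mul hx
    have h2 : |(fderiv ℝ (B.tr α γ) x).det| * |(fderiv ℝ (B.tr γ α) (B.tr α γ x)).det| = 1 := by
      rw [← abs_mul, mul_comm, h1, abs_one]
    have hx' := tr_mem_dom hx
    simp only [trOp, adj, cross, Prod.swap_prod_mk, indicator_of_mem hx, indicator_of_mem hx',
      tr_tr hx, Complex.ofReal_mul]
    have h3 : ((|(fderiv ℝ (B.tr α γ) x).det| : ℝ) : ℂ) *
        ((|(fderiv ℝ (B.tr γ α) (B.tr α γ x)).det| : ℝ) : ℂ) = 1 := by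
      rw [← Complex.ofReal_mul, h2, Complex.ofReal_one]
    linear_combination (-(h α x * (g γ (B.tr α γ x) * χ γ (B.tr α γ x)) * f x) : ℂ) * h3
  · simp only [cross, indicator_of_notMem hx, Complex.ofReal_zero, zero_mul]

/-- The local Fourier transforms of `u`, cut off by `h`, are determined by the functions `F`. -/
def Rep (hr : r < 2) {g h : ι → E n → ℝ} (hg : IsCut r g) (hh : IsCut r h) (u : B.LocalFamily)
    (F : ι → E n → ℂ) : Prop :=
  ∀ α, ∀ f : 𝓢(E n, ℂ), (∀ γ, Integrable fun ζ => F γ ζ * f ζ) ∧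
    cev (u α) (fun x => (h α x : ℂ) * f x) = ∑ γ ∈ B.nbr hr α,
      ∫ ζ, F γ ζ * (𝓕⁻ ((adm_cross (B := B) hr hg hh).adj.trS (γ, α) f) : 𝓢(E n, ℂ)) ζ

theorem rep_flc {u : B.LocalFamily} (hu : u ∈ B.Distrib) (hr : r < 2) {g χ h : ι → E n → ℝ}
    (hg : IsCut r g) (hχ : IsCut r χ) (hh : IsCut r h) (hθ : B.IsPou r fun γ x => g γ x * χ γ x) :
    Rep hr hg hh u fun γ => flc (u γ) (χ γ) := by
  refine fun α f => ⟨fun γ => ((exists_flc (u γ) (hχ.isTest hr γ)).2.2 f).1, ?_⟩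
  rw [cev_decompose hu hr hg hχ hh hθ α (f.smooth ⊤)]
  refine Finset.sum_congr rfl fun γ _ => ?_
  rw [((exists_flc (u γ) (hχ.isTest hr γ)).2.2 _).2, FourierTransform.fourier_fourierInv_eq]
  rfl

theorem Rep.sub {hr : r < 2} {g h : ι → E n → ℝ} {hg : IsCut r g} {hh : IsCut r h}
    {u v : B.LocalFamily} {F G : ι → E n → ℂ} (hu : Rep hr hg hh u F) (hv : Rep hr hg hh v G) :
    Rep hr hg hh (u - v) fun γ ζ => F γ ζ - G γ ζ := by
  intro α f
  have h1 := hu α f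
  have h2 := hv α f
  have hint : ∀ γ, ∀ f : 𝓢(E n, ℂ), Integrable fun ζ => (F γ ζ - G γ ζ) * f ζ := fun γ f => by
    simp only [sub_mul]
    exact ((hu α f).1 γ).sub ((hv α f).1 γ)
  refine ⟨fun γ => hint γ f, ?_⟩
  have h3 : IsTest fun x => (h α x : ℂ) * f x := (hh.isTest hr α).mul_right (f.smooth ⊤)
  have h4 : cev ((u - v) α) (fun x => (h α x : ℂ) * f x) =
      cev (u α) (fun x => (h α x : ℂ) * f x) - cev (v α) (fun x => (h α x : ℂ) * f x) := by
    rw [cev_eq h3, cev_eq h3, cev_eq h3]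
    change (u α _ - v α _) + Complex.I * (u α _ - v α _) = _
    ring
  rw [h4, h1.2, h2.2, ← Finset.sum_sub_distrib]
  refine Finset.sum_congr rfl fun γ _ => ?_
  simp only [sub_mul]
  rw [integral_sub ((hu α _).1 γ) ((hv α _).1 γ)]

theorem exists_qn_flc_le [Countable ι] (hr : r < 2) {g h : ι → E n → ℝ} (hg : IsCut r g) (hh : IsCut r h) (s : ℝ)
    (k : ℕ) : ∃ C : ℝ≥0∞, C ≠ ⊤ ∧ ∀ (u : B.LocalFamily) (F : ι → E n → ℂ),
    (∀ γ, AEMeasurable (F γ)) → Rep hr hg hh u F → ∀ α, qn (wt (B.scale α) s k) (flc (u α) (h α)) ≤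
      C * ∑ γ ∈ B.nbr hr α, qn (wt (B.scale γ) s k) (F γ) := by
  obtain ⟨C, hC, hb⟩ := (B.bound s k).neg _ (adm_cross (B := B) hr hg hh).adj
  obtain ⟨J, hJ⟩ := B.exists_card_le hr
  refine ⟨J * C, ENNReal.mul_ne_top (by simp) hC, fun u F hF hrep α => ?_⟩
  have hcard : (B.nbr hr α).card ≤ J := hJ α _ fun β hβ => mem_nbr.1 hβ
  refine qn_le_of_duality (fun f => ((exists_flc (u α) (hh.isTest hr α)).2.2 f).1) fun f => ?_
  rw [((exists_flc (u α) (hh.isTest hr α)).2.2 f).2, (hrep α (𝓕 f)).2]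
  have h1 : ∀ γ, ‖∫ ζ, F γ ζ * (𝓕⁻ ((adm_cross (B := B) hr hg hh).adj.trS (γ, α) (𝓕 f)) : 𝓢(E n, ℂ)) ζ‖ₑ ^ 2 ≤
      qn (wt (B.scale γ) s k) (F γ) * (C * qn (wt (B.scale α) (-s) (-k)) f) := by
    intro γ
    set w := (adm_cross (B := B) hr hg hh).adj.trS (γ, α) (𝓕 f) with hw
    have h2 := enorm_integral_mul_le (φ := wt (B.scale γ) (-s) (-k)) continuous_wt.measurable
      (fun ξ => wt_pos ξ) (hF γ) (𝓕⁻ w : 𝓢(E n, ℂ)).continuous.aemeasurable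
    simp only [wt_inv, neg_neg] at h2
    refine h2.trans ?_
    gcongr
    have h3 : qn (wt (B.scale γ) (-s) (-k)) (𝓕⁻ w : 𝓢(E n, ℂ)) = sn (B.scale γ) (-s) (-k) w := by
      rw [sn_coe, ← qn_comp_neg (fun ξ => wt_neg ξ) (𝓕 w : 𝓢(E n, ℂ))]
      refine qn_congr fun ξ => ?_
      rw [SchwartzMap.fourierInv_coe, SchwartzMap.fourier_coe, Real.fourierInv_eq_fourier_neg]
    have h4 : sn (B.scale α) (-s) (-k) (𝓕 f : 𝓢(E n, ℂ)) = qn (wt (B.scale α) (-s) (-k)) f := by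
      rw [sn_coe, ← qn_comp_neg (fun ξ => wt_neg ξ) f]
      refine qn_congr fun ξ => ?_
      have h5 : (𝓕⁻ (𝓕 f) : 𝓢(E n, ℂ)) (-ξ) = f (-ξ) := by
        rw [FourierTransform.fourierInv_fourier_eq]
      rw [← h5, SchwartzMap.fourierInv_coe, SchwartzMap.fourier_coe, Real.fourierInv_eq_fourier_neg,
        neg_neg]
    rw [h3, ← h4]
    exact hb (γ, α) (𝓕 f)
  calc _ ≤ ((B.nbr hr α).card : ℝ≥0∞) * ∑ γ ∈ B.nbr hr α,
        ‖∫ ζ, F γ ζ * (𝓕⁻ ((adm_cross (B := B) hr hg hh).adj.trS (γ, α) (𝓕 f)) : 𝓢(E n, ℂ)) ζ‖ₑ ^ 2 :=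
        enorm_sum_sq_le _ _
    _ ≤ J * ∑ γ ∈ B.nbr hr α, qn (wt (B.scale γ) s k) (F γ) * (C * qn (wt (B.scale α) (-s) (-k)) f) := by
        gcongr with γ _
        exact h1 γ
    _ = _ := by rw [← Finset.sum_mul]; ring

end Transfer

end SBGStructure

/-! ### Sobolev norms -/

theorem exists_cube_bump (n : ℕ) {r r' : ℝ} (h : r < r') : ∃ κ : E n → ℝ, ContDiff ℝ ∞ κ ∧
    (∀ x ∉ closedCube n r', κ x = 0) ∧ ∀ x ∈ closedCube n r, κ x = 1 := by
  obtain ⟨θ, h0, h1, -⟩ := exists_contMDiffMap_zero_one_nhds_of_isClosed 𝓘(ℝ, E n) (n := (⊤ : ℕ∞))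
    (s := (cube n r')ᶜ) (t := closedCube n r) (isOpen_cube n r').isClosed_compl
    (isClosed_closedCube n r) (Set.disjoint_left.2 fun x hx hx' => hx (closedCube_subset_cube h hx'))
  exact ⟨θ, θ.contMDiff.contDiff, fun x hx => h0.self_of_nhdsSet x fun hx' =>
    hx (cube_subset_closedCube hx'), fun x hx => h1.self_of_nhdsSet x hx⟩

theorem exists_closedCube {n : ℕ} {K : Set (E n)} (hK : IsCompact K) (hK2 : K ⊆ cube n 2) :
    ∃ r : ℝ, 3 / 2 ≤ r ∧ r < 2 ∧ K ⊆ closedCube n r := by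
  have h1 : ∀ i : Fin n, ∃ a < 2, ∀ x ∈ K, |x i| ≤ a := by
    intro i
    rcases K.eq_empty_or_nonempty with rfl | hne
    · exact ⟨0, by norm_num, by simp⟩
    · obtain ⟨x, hx, hmax⟩ := hK.exists_isMaxOn hne
        (f := fun x : E n => |x i|) (by fun_prop)
      exact ⟨|x i|, hK2 hx i, fun y hy => hmax hy⟩
  choose a ha1 ha2 using h1
  let b : Fin n → ℝ := fun i => max (3 / 2) (a i)
  by_cases hn : Nonempty (Fin n)
  · refine ⟨Finset.univ.sup' Finset.univ_nonempty b, ?_, ?_, fun x hx i => ?_⟩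
    · obtain ⟨i⟩ := hn
      exact (le_max_left _ _).trans (Finset.le_sup' b (Finset.mem_univ i))
    · exact (Finset.sup'_lt_iff _).2 fun i _ => max_lt (by norm_num) (ha1 i)
    · exact (ha2 i x hx).trans ((le_max_right _ _).trans (Finset.le_sup' b (Finset.mem_univ i)))
  · exact ⟨3 / 2, le_rfl, by norm_num, fun x hx i => (hn ⟨i⟩).elim⟩

theorem UnifBdd.sum_finset {I K V F : Type*} [NormedAddCommGroup V] [NormedSpace ℝ V]
    [NormedAddCommGroup F] [NormedSpace ℝ F] {f : I × K → V → F}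
    (hf : UnifBdd (fun _ => univ) f) (S : I → Finset K) {J : ℕ} (hJ : ∀ i, (S i).card ≤ J) :
    UnifBdd (fun _ => univ) fun i x => ∑ j ∈ S i, f (i, j) x := by
  refine ⟨fun i => ContDiffOn.sum fun j _ => hf.1 (i, j), fun k => ?_⟩
  obtain ⟨C, hC0, hC⟩ := hf.exists_bound k
  refine ⟨J * C, fun i x hx => ?_⟩
  have h1 := iteratedFDeriv_fun_sum_apply (𝕜 := ℝ) (n := k) (f := fun j => f (i, j)) (u := S i) (x := x)
    fun j _ => ((hf.contDiff (i, j)).of_le (by exact_mod_cast le_top)).contDiffAt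
  rw [h1]
  refine (norm_sum_le _ _).trans ((Finset.sum_le_card_nsmul _ _ C fun j _ =>
    hC (i, j) x (mem_univ _) k le_rfl).trans ?_)
  rw [nsmul_eq_mul]
  gcongr
  exact hJ i

/-- The weighted sum of weighted `L²` norms. -/
def SBGStructure.NN {n : ℕ} {M : Type*} [TopologicalSpace M] [ChartedSpace (E n) M] {ι : Type*}
    (B : SBGStructure n M ι) (om : ι → ℝ≥0∞) (s k : ℝ) (F : ι → E n → ℂ) : ℝ≥0∞ :=
  ∑' α, om α * qn (wt (B.scale α) s k) (F α)

namespace SBGStructure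

variable {n : ℕ} {M : Type*} [TopologicalSpace M] [ChartedSpace (E n) M] {ι : Type*}
  {B : SBGStructure n M ι} {α β γ : ι} {x : E n} {p : M} {r : ℝ}

/-- The function on `M` which is `f ∘ φ_γ` on `U_γ` and vanishes elsewhere. -/
def pull {F : Type*} [Zero F] (B : SBGStructure n M ι) (γ : ι) (f : E n → F) : M → F :=
  (B.chart γ).source.indicator fun q => f (B.chart γ q)

theorem pull_of_mem {F : Type*} [Zero F] {f : E n → F} (hp : p ∈ (B.chart γ).source) :
    B.pull γ f p = f (B.chart γ p) := indicator_of_mem hp _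

theorem pull_of_notMem {F : Type*} [Zero F] {f : E n → F} (hp : p ∉ (B.chart γ).source) :
    B.pull γ f p = 0 := indicator_of_notMem hp _

theorem pull_symm {F : Type*} [Zero F] {f : E n → F} (hx : x ∈ B.dom α γ) :
    B.pull γ f ((B.chart α).symm x) = f (B.tr α γ x) := pull_of_mem (mem_dom.1 hx).2

theorem pull_symm_of_notMem {F : Type*} [Zero F] {f : E n → F} (hx2 : x ∈ cube n 2) (hx : x ∉ B.dom α γ) :
    B.pull γ f ((B.chart α).symm x) = 0 := pull_of_notMem fun h => hx (mem_dom.2 ⟨hx2, h⟩)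

theorem pull_eq_zero {F : Type*} [Zero F] {f : E n → F} (hr : r < 2)
    (hf : ∀ x ∉ closedCube n r, f x = 0) (hp : p ∉ B.cell r γ) : B.pull γ f p = 0 :=
  indicator_apply_eq_zero.2 fun h => hf _ fun h' => hp ((mem_cell hr).2 ⟨h, h'⟩)

/-- The sum of the functions `q ∘ φ_γ`. -/
def tot (B : SBGStructure n M ι) (q : E n → ℝ) (p : M) : ℝ := ∑ᶠ γ, B.pull γ q p

theorem tot_eq_sum {q : E n → ℝ} (hr : r < 2) (hq : ∀ x ∉ closedCube n r, q x = 0) {s : Finset ι}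
    (hs : ∀ γ, p ∈ B.cell r γ → γ ∈ s) : B.tot q p = ∑ γ ∈ s, B.pull γ q p :=
  finsum_eq_sum_of_support_subset _ fun γ hγ => hs γ (by_contra fun h => hγ (pull_eq_zero hr hq h))

/-- The weight `om_α`, with comparable values on overlapping cells. -/
def Slow (B : SBGStructure n M ι) (r : ℝ) (om : ι → ℝ≥0∞) : Prop :=
  ∃ C : ℝ≥0∞, C ≠ ⊤ ∧ ∀ α β, (B.cell r α ∩ B.cell r β).Nonempty → om α ≤ C * om β

/-- The coefficients in the definition of the Sobolev norms. -/
def coef (B : SBGStructure n M ι) (w : M → ℝ) (α : ι) : ℝ≥0∞ :=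
  ENNReal.ofReal ((B.weightFamily w α)⁻¹ ^ 2 * (B.scaleProd α)⁻¹)

variable [IsManifold (𝓡 n) ∞ M] [T2Space M]

theorem exists_mem_nbr (hr1 : 1 ≤ r) (hr : r < 2) (p : M) : ∃ s : Finset ι, ∀ γ, p ∈ B.cell r γ → γ ∈ s := by
  obtain ⟨α, hα, hα1⟩ := B.cover p
  exact ⟨B.nbr hr α, fun γ hγ => mem_nbr.2 ⟨p, (mem_cell hr).2
    ⟨hα, closedCube_mono hr1 (cube_subset_closedCube hα1)⟩, hγ⟩⟩

theorem one_le_tot {q : E n → ℝ} (hr1 : 1 ≤ r) (hr : r < 2) (hq : ∀ x ∉ closedCube n r, q x = 0)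
    (hq0 : ∀ x, 0 ≤ q x) (hq1 : ∀ x ∈ closedCube n 1, 1 ≤ q x) (p : M) : 1 ≤ B.tot q p := by
  obtain ⟨s, hs⟩ := exists_mem_nbr (B := B) hr1 hr p
  obtain ⟨α, hα, hα1⟩ := B.cover p
  rw [tot_eq_sum hr hq hs]
  have h1 : 1 ≤ B.pull α q p := by
    rw [pull_of_mem hα]; exact hq1 _ (cube_subset_closedCube hα1)
  refine h1.trans (Finset.single_le_sum (f := fun γ => B.pull γ q p) (fun γ _ => ?_) (hs α ?_))
  · exact indicator_nonneg (fun _ _ => hq0 _) _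
  · exact (mem_cell hr).2 ⟨hα, closedCube_mono hr1 (cube_subset_closedCube hα1)⟩

theorem unifBdd_tot {q : E n → ℝ} (hr : r < 2) (hqs : ContDiff ℝ ∞ q)
    (hq : ∀ x ∉ closedCube n r, q x = 0) {r' : ℝ} (hr' : r' < 2) (hrr' : r ≤ r') :
    UnifBdd (fun _ : ι => cube n r') fun α x => B.tot q ((B.chart α).symm x) := by
  set r₁ := (r' + 2) / 2 with hr₁
  have h1 : r₁ < 2 := by linarith
  have h2 : r' < r₁ := by linarith
  obtain ⟨κ, hκ, hκ0, hκ1⟩ := exists_cube_bump n h2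
  obtain ⟨J, hJ⟩ := B.exists_card_le h1
  have hq' : ∀ x ∉ closedCube n r₁, q x = 0 := fun x hx => hq x fun hx' =>
    hx (closedCube_mono (hrr'.trans h2.le) hx')
  have hA := adm_cross (B := B) h1 (IsCut.const hqs hq') (IsCut.const hκ hκ0)
  have hS := hA.unif.sum_finset (fun α => B.nbr h1 α) (J := J) fun α => hJ α _ fun β hβ => mem_nbr.1 hβ
  refine (hS.mono (D' := fun _ => cube n r') fun _ => subset_univ _).congr (fun _ => isOpen_cube n r')
    fun α x hx => ?_
  have hx2 := cube_mono hr'.le hx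
  have hxc := cube_subset_closedCube hx
  simp only
  rw [tot_eq_sum (s := B.nbr h1 α) hr hq fun γ hγ => mem_nbr.2 ⟨_, ⟨x, closedCube_mono h2.le hxc, rfl⟩,
    cell_mono (hrr'.trans h2.le) hγ⟩]
  refine Finset.sum_congr rfl fun γ _ => ?_
  by_cases hd : x ∈ B.dom α γ
  · rw [pull_symm hd, cross, indicator_of_mem hd, hκ1 x hxc, one_mul]
  · rw [pull_symm_of_notMem hx2 hd, cross, indicator_of_notMem hd]

theorem unifBdd_inv_tot {q : E n → ℝ} (hr1 : 1 ≤ r) (hr : r < 2) (hqs : ContDiff ℝ ∞ q)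
    (hq : ∀ x ∉ closedCube n r, q x = 0) (hq0 : ∀ x, 0 ≤ q x) (hq1 : ∀ x ∈ closedCube n 1, 1 ≤ q x)
    {r' : ℝ} (hr' : r' < 2) (hrr' : r ≤ r') :
    UnifBdd (fun _ : ι => cube n r') fun α x => (B.tot q ((B.chart α).symm x))⁻¹ :=
  (unifBdd_tot hr hqs hq hr' hrr').inv one_pos (fun _ => isOpen_cube n r') fun _ _ _ =>
    one_le_tot hr1 hr hq hq0 hq1 _

theorem exists_isPou {χ : E n → ℝ} (hr1 : 1 ≤ r) (hr : r < 2) (hχs : ContDiff ℝ ∞ χ)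
    (hχ : ∀ x ∉ closedCube n r, χ x = 0) (hχ1 : ∀ x ∈ closedCube n 1, χ x = 1) :
    ∃ g : ι → E n → ℝ, IsCut r g ∧ B.IsPou r fun γ x => g γ x * χ x := by
  have hq : ∀ x ∉ closedCube n r, χ x * χ x = 0 := fun x hx => by rw [hχ x hx, zero_mul]
  have hq1 : ∀ x ∈ closedCube n 1, 1 ≤ χ x * χ x := fun x hx => by rw [hχ1 x hx, one_mul]
  have hq0 : ∀ x, 0 ≤ χ x * χ x := fun x => mul_self_nonneg _
  have h1 : r < (r + 2) / 2 := by linarith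
  have h2 : (r + 2) / 2 < 2 := by linarith
  have hg : IsCut r fun γ x => χ x * (B.tot (fun x => χ x * χ x) ((B.chart γ).symm x))⁻¹ :=
    (IsCut.const hχs hχ).mul_cube h1 (unifBdd_inv_tot hr1 hr (hχs.mul hχs) hq hq0 hq1 h2 h1.le)
  refine ⟨_, hg, hg.mul_cube h1 (((IsCut.const (ι := ι) hχs hχ).unif).mono fun _ => subset_univ _),
    fun p s hs => ?_⟩
  have h3 := tot_eq_sum hr hq hs
  have h4 := one_le_tot (B := B) hr1 hr hq hq0 hq1 p
  rw [← mul_inv_cancel₀ (zero_lt_one.trans_le h4).ne']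
  nth_rewrite 1 [h3]
  rw [Finset.sum_mul]
  refine Finset.sum_congr rfl fun γ _ => ?_
  by_cases hp : p ∈ (B.chart γ).source
  · rw [indicator_of_mem hp, pull_of_mem hp]
    simp only [symm_chart hp]
    ring
  · rw [indicator_of_notMem hp, pull_of_notMem hp, zero_mul]

theorem Slow.tsum_nbr_le {om : ι → ℝ≥0∞} {hr : r < 2} (hom : B.Slow r om) :
    ∃ C : ℝ≥0∞, C ≠ ⊤ ∧ ∀ a : ι → ℝ≥0∞,
      ∑' α, om α * ∑ γ ∈ B.nbr hr α, a γ ≤ C * ∑' γ, om γ * a γ := by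
  classical
  obtain ⟨C, hC, hom⟩ := hom
  obtain ⟨J, hJ⟩ := B.exists_card_le hr
  refine ⟨C * J, ENNReal.mul_ne_top hC (by simp), fun a => ?_⟩
  calc _ ≤ ∑' α, ∑' γ, if γ ∈ B.nbr hr α then C * (om γ * a γ) else 0 := by
        refine ENNReal.tsum_le_tsum fun α => ?_
        rw [Finset.mul_sum, tsum_eq_sum (s := B.nbr hr α) fun γ hγ => if_neg hγ]
        refine Finset.sum_le_sum fun γ hγ => ?_
        rw [if_pos hγ, ← mul_assoc]
        gcongr
        exact hom α γ (mem_nbr.1 hγ)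
    _ = ∑' γ, ∑' α, if γ ∈ B.nbr hr α then C * (om γ * a γ) else 0 := ENNReal.tsum_comm
    _ ≤ ∑' γ, C * J * (om γ * a γ) := by
        refine ENNReal.tsum_le_tsum fun γ => ?_
        simp only [mem_nbr_comm (α := _) (β := γ)]
        rw [tsum_eq_sum (s := B.nbr hr γ) fun α hα => if_neg hα, Finset.sum_ite_mem, Finset.inter_self,
          Finset.sum_const, nsmul_eq_mul, mul_left_comm, mul_assoc C]
        gcongr
        exact hJ γ _ fun β hβ => (mem_nbr (hr := hr)).1 hβ
    _ = _ := ENNReal.tsum_mul_left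

theorem exists_NN_flc_le [Countable ι] {om : ι → ℝ≥0∞} (hr : r < 2) (hom : B.Slow r om)
    {g h : ι → E n → ℝ} (hg : IsCut r g) (hh : IsCut r h) (s : ℝ) (k : ℕ) :
    ∃ C : ℝ≥0∞, C ≠ ⊤ ∧ ∀ (u : B.LocalFamily) (F : ι → E n → ℂ), (∀ γ, AEMeasurable (F γ)) →
      Rep hr hg hh u F → B.NN om s k (fun α => flc (u α) (h α)) ≤ C * B.NN om s k F := by
  obtain ⟨C₁, hC₁, h₁⟩ := exists_qn_flc_le (B := B) hr hg hh s k
  obtain ⟨C₂, hC₂, h₂⟩ := hom.tsum_nbr_le (hr := hr)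
  refine ⟨C₁ * C₂, ENNReal.mul_ne_top hC₁ hC₂, fun u F hF hrep => ?_⟩
  calc _ ≤ ∑' α, C₁ * (om α * ∑ γ ∈ B.nbr hr α, qn (wt (B.scale γ) s k) (F γ)) := by
        refine ENNReal.tsum_le_tsum fun α => ?_
        rw [mul_left_comm]
        gcongr
        exact h₁ u F hF hrep α
    _ ≤ C₁ * (C₂ * B.NN om s k F) := by
        rw [ENNReal.tsum_mul_left]
        gcongr
        exact h₂ _
    _ = _ := (mul_assoc _ _ _).symm

theorem IsWeight.slow_coef [Countable ι] {w : M → ℝ} (hw : B.IsWeight w) (hr : r < 2) : B.Slow r (B.coef w) := by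
  obtain ⟨C₁, hC₁, h₁⟩ := hw.exists_weightFamily_le hr
  obtain ⟨C₂, hC₂, h₂⟩ := B.exists_scaleProd_le
  refine ⟨ENNReal.ofReal (C₁ ^ 2 * C₂), ENNReal.ofReal_ne_top, fun α β hαβ => ?_⟩
  have h3 := h₁ β α (by rwa [inter_comm])
  obtain ⟨p, hp1, hp2⟩ := hαβ
  rw [mem_cell hr] at hp1 hp2
  have h4 := h₂ β α ⟨_, chart_mem_dom hp2.1 hp1.1⟩
  have hα := hw.weightFamily_pos (α := α)
  have hβ := hw.weightFamily_pos (α := β)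
  have hα' := scaleProd_pos (B := B) (α := α)
  have hβ' := scaleProd_pos (B := B) (α := β)
  unfold coef
  rw [← ENNReal.ofReal_mul (by positivity)]
  refine ENNReal.ofReal_le_ofReal ?_
  have h5 : (B.weightFamily w α)⁻¹ ≤ C₁ * (B.weightFamily w β)⁻¹ := by
    rw [← div_eq_mul_inv, le_div_iff₀ hβ, ← div_eq_inv_mul, div_le_iff₀ hα]; exact h3
  have h6 : (B.scaleProd α)⁻¹ ≤ C₂ * (B.scaleProd β)⁻¹ := by
    rw [← div_eq_mul_inv, le_div_iff₀ hβ', ← div_eq_inv_mul, div_le_iff₀ hα']; exact h4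
  calc _ ≤ (C₁ * (B.weightFamily w β)⁻¹) ^ 2 * (C₂ * (B.scaleProd β)⁻¹) := by gcongr
    _ = _ := by ring

theorem coef_ne_top {w : M → ℝ} : B.coef w α ≠ ⊤ := ENNReal.ofReal_ne_top

theorem coef_ne_zero [Countable ι] {w : M → ℝ} (hw : B.IsWeight w) : B.coef w α ≠ 0 := by
  have hα := hw.weightFamily_pos (α := α)
  have hα' := scaleProd_pos (B := B) (α := α)
  exact (ENNReal.ofReal_pos.2 (by positivity)).ne'

namespace Choices

variable [MeasurableSpace M] (c : B.Choices)

theorem isTest_chiH : IsTest fun x => (c.chiH x : ℂ) :=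
  ⟨Complex.ofRealCLM.contDiff.comp c.chiH_smooth, c.chiH_compact.comp_left Complex.ofReal_zero,
    (tsupport_comp_subset Complex.ofReal_zero _).trans c.chiH_supp⟩

theorem exists_radius : ∃ r : ℝ, 3 / 2 ≤ r ∧ r < 2 ∧ IsCut r fun _ : ι => c.chiH := by
  obtain ⟨r, hr1, hr2, hr⟩ := exists_closedCube c.chiH_compact.isCompact c.chiH_supp
  exact ⟨r, hr1, hr2, IsCut.const c.chiH_smooth fun x hx =>
    image_eq_zero_of_notMem_tsupport fun h => hx (hr h)⟩

theorem fourierLoc_scl (u : B.LocalFamily) (α : ι) (ζ : E n) :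
    c.fourierLoc u α (scl (B.scale α) ζ) = ((B.scaleProd α)⁻¹ : ℂ) * flc (u α) c.chiH ζ := by
  have hphase : ∀ x, phase B α (scl (B.scale α) ζ) x = 2 * Real.pi * inner ℝ x ζ := fun x => by
    unfold phase
    rw [PiLp.inner_apply, Finset.mul_sum]
    refine Finset.sum_congr rfl fun i _ => ?_
    have := B.scale_pos α i
    rw [scl_apply]
    simp
    field_simp
  have ht : IsTest fun x => (c.chiH x : ℂ) * ex x (-ζ) := isTest_mul_ex c.isTest_chiH _
  unfold fourierLoc flc
  rw [cev_eq ht]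
  have h1 : ht.clm Complex.reCLM = c.cutTest (fun x => Real.cos (phase B α (scl (B.scale α) ζ) x))
      (contDiff_phase α _).cos := by
    ext x
    change ((c.chiH x : ℂ) * ex x (-ζ)).re = c.chiH x * Real.cos _
    rw [hphase, Complex.re_ofReal_mul, ex, Complex.exp_ofReal_mul_I_re]
    simp
  have h2 : ht.clm Complex.imCLM = -c.cutTest (fun x => Real.sin (phase B α (scl (B.scale α) ζ) x))
      (contDiff_phase α _).sin := by
    ext x
    change ((c.chiH x : ℂ) * ex x (-ζ)).im = -(c.chiH x * Real.sin _)
    rw [hphase, Complex.im_ofReal_mul, ex, Complex.exp_ofReal_mul_I_im]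
    simp
  rw [h1, h2, map_neg]
  ring

theorem injOn_scl {ρ : Fin n → ℝ} (hρ : ∀ i, 0 < ρ i) : InjOn (scl ρ : E n → E n) univ := fun x _ y _ h => by
  ext i
  have h1 := congrArg (fun v : E n => v i) h
  simp only [scl_apply] at h1
  have := hρ i
  exact mul_left_cancel₀ (by positivity) h1

theorem image_scl {ρ : Fin n → ℝ} (hρ : ∀ i, 0 < ρ i) : (scl ρ : E n → E n) '' univ = univ := by
  rw [image_univ]
  refine Function.Surjective.range_eq fun y => ⟨WithLp.toLp 2 fun i => y i / (2 * Real.pi * ρ i), ?_⟩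
  ext i
  have := hρ i
  rw [scl_apply]
  simp
  field_simp

theorem abs_det_scl {ρ : Fin n → ℝ} (hρ : ∀ i, 0 < ρ i) :
    |(scl ρ).det| = (2 * Real.pi) ^ n * ∏ i, ρ i := by
  rw [det_scl, abs_of_pos]
  have := Finset.prod_pos fun i (_ : i ∈ Finset.univ) => hρ i
  positivity

theorem integral_scl {ρ : Fin n → ℝ} (hρ : ∀ i, 0 < ρ i) (f : E n → ℂ) :
    ∫ ξ, f ξ = (((2 * Real.pi) ^ n * ∏ i, ρ i : ℝ) : ℂ) * ∫ ζ, f (scl ρ ζ) := by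
  have h1 := integral_image_eq_integral_abs_det_fderiv_smul volume MeasurableSet.univ
    (fun x _ => (scl ρ : E n →L[ℝ] E n).hasFDerivAt.hasFDerivWithinAt) (injOn_scl hρ) f
  rw [image_scl hρ] at h1
  simp only [Measure.restrict_univ, abs_det_scl hρ] at h1
  rw [h1, integral_smul]
  rfl

theorem lintegral_scl {ρ : Fin n → ℝ} (hρ : ∀ i, 0 < ρ i) (f : E n → ℝ≥0∞) :
    ∫⁻ ξ, f ξ = ENNReal.ofReal ((2 * Real.pi) ^ n * ∏ i, ρ i) * ∫⁻ ζ, f (scl ρ ζ) := by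
  have h1 := lintegral_image_eq_lintegral_abs_det_fderiv_mul volume MeasurableSet.univ
    (fun x _ => (scl ρ : E n →L[ℝ] E n).hasFDerivAt.hasFDerivWithinAt) (injOn_scl hρ) f
  rw [image_scl hρ] at h1
  simp only [Measure.restrict_univ, abs_det_scl hρ] at h1
  rw [h1, lintegral_const_mul' _ _ ENNReal.ofReal_ne_top]

/-- The constant in the comparison of the Sobolev norms. -/
def norCst (n : ℕ) : ℝ≥0∞ := ENNReal.ofReal ((2 * Real.pi) ^ n)

theorem norCst_ne_top : norCst n ≠ ⊤ := ENNReal.ofReal_ne_top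

theorem norCst_ne_zero : norCst n ≠ 0 := (ENNReal.ofReal_pos.2 (by positivity)).ne'

theorem sobNorm_sq [Countable ι] {w : M → ℝ} (hw : B.IsWeight w) (s : ℝ) (u : B.LocalFamily) :
    c.sobNorm w s u ^ 2 = norCst n * B.NN (B.coef w) s 0 fun α => flc (u α) c.chiH := by
  unfold sobNorm NN
  rw [← ENNReal.rpow_natCast, ← ENNReal.rpow_mul]
  norm_num
  rw [← ENNReal.tsum_mul_left]
  refine tsum_congr fun α => ?_
  have hsp := scaleProd_pos (B := B) (α := α)
  rw [mul_pow, eLpNorm_eq_lintegral_rpow_enorm_toReal (by norm_num) (by norm_num)]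
  simp only [ENNReal.toReal_ofNat, ENNReal.rpow_ofNat]
  rw [← ENNReal.rpow_natCast (_ ^ _), ← ENNReal.rpow_mul]
  norm_num
  rw [lintegral_scl (B.scale_pos α)]
  have h1 : ∀ ζ, ‖c.weightedFourier s u α (scl (B.scale α) ζ)‖ₑ ^ 2 =
      ENNReal.ofReal ((B.scaleProd α)⁻¹ ^ 2) * (ENNReal.ofReal (wt (B.scale α) s 0 ζ ^ 2) *
        ‖flc (u α) c.chiH ζ‖ₑ ^ 2) := fun ζ => by
    have hb : 0 < bracket (scl (B.scale α) ζ) ^ s := Real.rpow_pos_of_pos (bracket_pos _) _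
    have hw : wt (B.scale α) s 0 ζ = bracket (scl (B.scale α) ζ) ^ s := by simp [wt]
    unfold weightedFourier
    rw [fourierLoc_scl, hw, ← Complex.ofReal_inv, enorm_mul, enorm_mul, ← ofReal_norm ((_ : ℝ) : ℂ),
      ← ofReal_norm (((B.scaleProd α)⁻¹ : ℝ) : ℂ), Complex.norm_real, Complex.norm_real,
      Real.norm_of_nonneg hb.le, Real.norm_of_nonneg (by positivity), mul_pow, mul_pow,
      ← ENNReal.ofReal_pow hb.le, ← ENNReal.ofReal_pow (by positivity)]
    ring
  simp only [h1]
  rw [lintegral_const_mul' _ _ ENNReal.ofReal_ne_top]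
  unfold qn coef norCst
  have hwp := hw.weightFamily_pos (α := α)
  rw [← ENNReal.ofReal_pow (by positivity), ← mul_assoc, ← mul_assoc, ← mul_assoc,
    ← ENNReal.ofReal_mul (by positivity), ← ENNReal.ofReal_mul (by positivity),
    ← ENNReal.ofReal_mul (by positivity)]
  congr 2
  have : ∏ i, B.scale α i = B.scaleProd α := rfl
  rw [this]
  field_simp

end Choices

end SBGStructure

/-! ### Smooth functions as distributions -/

section

variable {n : ℕ} {f v : E n → ℂ}

theorem IsTest.mul_contDiffOn (hf : IsTest f) (hv : ContDiffOn ℝ ∞ v (cube n 2)) :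
    IsTest fun x => f x * v x :=
  ⟨contDiff_of_contDiffAt_tsupport fun x hx => hf.smooth.contDiffAt.mul (hv.contDiffAt
      ((isOpen_cube n 2).mem_nhds (hf.sub (tsupport_mul_subset_left hx)))),
    hf.compact.mul_right, tsupport_mul_subset_left.trans hf.sub⟩

theorem IsTest.integrable (hf : IsTest f) : Integrable f :=
  hf.smooth.continuous.integrable_of_hasCompactSupport hf.compact

end

namespace SBGStructure

variable {n : ℕ} {M : Type*} [TopologicalSpace M] [ChartedSpace (E n) M] {ι : Type*}
  {B : SBGStructure n M ι} {α β γ : ι} {x : E n} {p : M} {r : ℝ} {u : M → ℂ}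

/-- The locally finite sum of the functions `f_γ ∘ φ_γ`. -/
def syn (B : SBGStructure n M ι) (f : ι → E n → ℂ) (p : M) : ℂ := ∑ᶠ γ, B.pull γ (f γ) p

theorem syn_eq_sum {f : ι → E n → ℂ} (hr : r < 2) (hf : ∀ γ, ∀ x ∉ closedCube n r, f γ x = 0)
    {s : Finset ι} (hs : ∀ γ, p ∈ B.cell r γ → γ ∈ s) : B.syn f p = ∑ γ ∈ s, B.pull γ (f γ) p :=
  finsum_eq_sum_of_support_subset _ fun γ hγ =>
    hs γ (by_contra fun h => hγ (pull_eq_zero hr (hf γ) h))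

variable [IsManifold (𝓡 n) ∞ M]

theorem contDiffOn_comp_symm (hu : u ∈ Smooth n M) :
    ContDiffOn ℝ ∞ (fun x => u ((B.chart α).symm x)) (cube n 2) := fun x hx =>
  (contDiffAt_symm hx (hu ((B.chart α).symm x))).contDiffWithinAt

theorem ofFun_apply (hu : u ∈ Smooth n M) (f : 𝓓(box n, ℝ)) :
    B.ofFun u α f = ∫ x, (f x : ℂ) * u ((B.chart α).symm x) := by
  have h : LocallyIntegrableOn (fun x => u ((B.chart α).symm x)) (box n) volume :=
    (contDiffOn_comp_symm hu).continuousOn.locallyIntegrableOn (isOpen_cube n 2).measurableSet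
  refine (TestFunction.integralAgainstBilinCLM_eq_integral h).trans ?_
  simp

theorem cev_ofFun (hu : u ∈ Smooth n M) {f : E n → ℂ} (hf : IsTest f) :
    cev (B.ofFun u α) f = ∫ x, f x * u ((B.chart α).symm x) := by
  rw [cev_eq hf, ofFun_apply hu, ofFun_apply hu, ← integral_const_mul, ← integral_add
    ((IsTest.ofReal _).mul_contDiffOn (contDiffOn_comp_symm hu)).integrable
    (((IsTest.ofReal _).mul_contDiffOn (contDiffOn_comp_symm hu)).integrable.const_mul _)]
  congr 1
  ext x
  rw [← mul_assoc, ← add_mul]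
  congr 1
  change ((f x).re : ℂ) + Complex.I * ((f x).im : ℂ) = f x
  rw [mul_comm, Complex.re_add_im]

theorem ofFun_mem_distrib (hu : u ∈ Smooth n M) : B.ofFun u ∈ B.Distrib := by
  intro α β f g hg hf hf0
  rw [ofFun_apply hu, ofFun_apply hu]
  have h1 : ∫ x, (f x : ℂ) * u ((B.chart α).symm x) = ∫ x in B.dom α β, (f x : ℂ) * u ((B.chart α).symm x) :=
    (setIntegral_eq_integral_of_forall_compl_eq_zero fun x hx => by
      rw [hf0 x hx, Complex.ofReal_zero, zero_mul]).symm
  have h2 : ∫ x, (g x : ℂ) * u ((B.chart β).symm x) = ∫ x in B.dom β α, (g x : ℂ) * u ((B.chart β).symm x) :=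
    (setIntegral_eq_integral_of_forall_compl_eq_zero fun x hx => by
      rw [image_eq_zero_of_notMem_tsupport fun h => hx (hg h), Complex.ofReal_zero, zero_mul]).symm
  rw [h1, h2, setIntegral_tr α β]
  refine setIntegral_congr_fun isOpen_dom.measurableSet fun x hx => ?_
  rw [hf x hx, symm_tr hx, Complex.real_smul]
  push_cast
  rw [mul_assoc]
  rfl

theorem ofFun_add {v : M → ℂ} (hu : u ∈ Smooth n M) (hv : v ∈ Smooth n M) :
    B.ofFun (u + v) = B.ofFun u + B.ofFun v := by
  funext α
  ext f
  change B.ofFun (u + v) α f = B.ofFun u α f + B.ofFun v α f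
  rw [ofFun_apply hu, ofFun_apply hv, ofFun_apply (add_mem hu hv), ← integral_add
    ((IsTest.ofReal _).mul_contDiffOn (contDiffOn_comp_symm hu)).integrable
    ((IsTest.ofReal _).mul_contDiffOn (contDiffOn_comp_symm hv)).integrable]
  simp only [Pi.add_apply, mul_add]

theorem ofFun_smul (c : ℂ) (hu : u ∈ Smooth n M) : B.ofFun (c • u) = c • B.ofFun u := by
  funext α
  ext f
  change B.ofFun (c • u) α f = c * B.ofFun u α f
  rw [ofFun_apply hu, ofFun_apply (Submodule.smul_mem _ c hu), ← integral_const_mul]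
  congr 1
  ext x
  simp only [Pi.smul_apply, smul_eq_mul]
  ring

theorem ofFun_sub {v : M → ℂ} (hu : u ∈ Smooth n M) (hv : v ∈ Smooth n M) :
    B.ofFun (u - v) = B.ofFun u - B.ofFun v := by
  have h1 : u - v = u + (-1 : ℂ) • v := by rw [neg_one_smul, sub_eq_add_neg]
  rw [h1, ofFun_add hu (Submodule.smul_mem _ _ hv), ofFun_smul _ hv, neg_one_smul ℂ (B.ofFun v), sub_eq_add_neg]

variable [T2Space M]

theorem contMDiff_pull {F : Type*} [NormedAddCommGroup F] [NormedSpace ℝ F] {f : E n → F} (hr : r < 2)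
    (hf : ContDiff ℝ ∞ f) (h0 : ∀ x ∉ closedCube n r, f x = 0) :
    ContMDiff (𝓡 n) 𝓘(ℝ, F) ∞ (B.pull γ f) := by
  intro p
  by_cases hp : p ∈ (B.chart γ).source
  · have h1 : ContMDiffAt (𝓡 n) 𝓘(ℝ, F) ∞ (fun q => f (B.chart γ q)) p :=
      ContMDiffAt.comp (I' := 𝓘(ℝ, E n)) p hf.contMDiff.contMDiffAt (contMDiffAt_chart hp)
    refine h1.congr_of_eventuallyEq ?_
    filter_upwards [(B.chart γ).open_source.mem_nhds hp] with q hq using pull_of_mem hq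
  · have hp' : p ∉ B.cell r γ := fun h => hp ((mem_cell hr).1 h).1
    refine (contMDiffAt_const (c := (0 : F))).congr_of_eventuallyEq ?_
    filter_upwards [(isClosed_cell hr).isOpen_compl.mem_nhds hp'] with q hq
      using pull_eq_zero hr h0 hq

theorem syn_mem_smooth {f : ι → E n → ℂ} (hr1 : 1 ≤ r) (hr : r < 2)
    (hf : ∀ γ, ContDiff ℝ ∞ (f γ)) (h0 : ∀ γ, ∀ x ∉ closedCube n r, f γ x = 0) :
    B.syn f ∈ Smooth n M := by
  intro p
  obtain ⟨s, hs⟩ := exists_mem_nbr (B := B) hr1 hr p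
  have h1 : ContMDiffAt (𝓡 n) 𝓘(ℝ, ℂ) ∞ (fun q => ∑ γ ∈ s, B.pull γ (f γ) q) p :=
    ContMDiffAt.sum fun γ _ => (contMDiff_pull hr (hf γ) (h0 γ)) p
  refine h1.congr_of_eventuallyEq ?_
  filter_upwards [B.eventually_mem_cell hr1 hr p] with q hq
    using syn_eq_sum hr h0 fun γ hγ => hs γ (hq γ hγ)

theorem hasCompactSupport_syn {f : ι → E n → ℂ} {S : Set M} (hS : IsCompact S)
    (hfS : ∀ γ, ∀ p ∉ S, B.pull γ (f γ) p = 0) : HasCompactSupport (B.syn f) :=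
  HasCompactSupport.intro hS fun p hp => by
    unfold syn
    simp only [hfS _ p hp, finsum_zero]

theorem rep_syn (hr : r < 2) {g h : ι → E n → ℝ} (hg : IsCut r g) (hh : IsCut r h)
    (hu : u ∈ Smooth n M) (k : ι → 𝓢(E n, ℂ))
    (hk : ∀ α, ∀ x ∈ closedCube n r, u ((B.chart α).symm x) =
      ∑ γ ∈ B.nbr hr α, B.pull γ (fun y => (g γ y : ℂ) * k γ y) ((B.chart α).symm x)) :
    Rep hr hg hh (B.ofFun u) fun γ => (𝓕 (k γ) : 𝓢(E n, ℂ)) := by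
  have hG := adm_cross (B := B) hr hg hh
  refine fun α f => ⟨fun γ => ?_, ?_⟩
  · have h1 := (SchwartzMap.pairing (ContinuousLinearMap.mul ℝ ℂ) (𝓕 (k γ)) f).integrable (μ := volume)
    exact h1.congr (ae_of_all _ fun ζ => rfl)
  · rw [cev_ofFun hu ((hh.isTest hr α).mul_right (f.smooth ⊤))]
    have h1 : ∀ x, (h α x : ℂ) * f x * u ((B.chart α).symm x) =
        ∑ γ ∈ B.nbr hr α, B.trOp (B.cross g h) (α, γ) (k γ) x * f x := by
      intro x
      by_cases hx : x ∈ closedCube n r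
      · rw [hk α x hx, Finset.mul_sum]
        refine Finset.sum_congr rfl fun γ _ => ?_
        by_cases hd : x ∈ B.dom α γ
        · simp only [pull_symm hd, trOp, cross, indicator_of_mem hd]
          push_cast
          ring
        · simp only [pull_symm_of_notMem (closedCube_subset_cube hr hx) hd, trOp, cross,
            indicator_of_notMem hd]
          simp
      · rw [hh.supp α x hx]
        symm
        simp only [Complex.ofReal_zero, zero_mul]
        refine Finset.sum_eq_zero fun γ _ => ?_
        have : B.cross g h (α, γ) x = 0 := indicator_apply_eq_zero.2 fun _ => by
          simp only [hh.supp α x hx, zero_mul]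
        simp [trOp, this]
    simp only [h1]
    rw [integral_finsetSum]
    · refine Finset.sum_congr rfl fun γ _ => ?_
      rw [hG.integral_trOp_mul (α, γ) (k γ) f]
      have h2 := SchwartzMap.integral_fourier_mul_eq (k γ) (𝓕⁻ (hG.adj.trS (γ, α) f))
      rw [h2]
      simp only [FourierTransform.fourier_fourierInv_eq]
      rfl
    · intro γ _
      exact ((hG.contDiff_trOp (α, γ) ((k γ).smooth ⊤).contDiffOn).continuous.mul
        f.continuous).integrable_of_hasCompactSupport ((hG.hasCompactSupport_trOp _ _).mul_right)

/-- The Schwartz function `χ (u ∘ φ_γ⁻¹)`. -/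
def locS (B : SBGStructure n M ι) {χ : E n → ℝ} (hχ : IsTest fun x => (χ x : ℂ)) (hu : u ∈ Smooth n M)
    (γ : ι) : 𝓢(E n, ℂ) :=
  (hχ.mul_contDiffOn (contDiffOn_comp_symm (B := B) (α := γ) hu)).compact.toSchwartzMap
    (hχ.mul_contDiffOn (contDiffOn_comp_symm hu)).smooth

theorem locS_apply {χ : E n → ℝ} (hχ : IsTest fun x => (χ x : ℂ)) (hu : u ∈ Smooth n M) :
    B.locS hχ hu γ x = χ x * u ((B.chart γ).symm x) := rfl

theorem fourier_locS {χ : E n → ℝ} (hχ : IsTest fun x => (χ x : ℂ)) (hu : u ∈ Smooth n M) (ζ : E n) :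
    (𝓕 (B.locS hχ hu γ) : 𝓢(E n, ℂ)) ζ = flc (B.ofFun u γ) χ ζ := by
  unfold flc
  rw [cev_ofFun hu (isTest_mul_ex hχ _), SchwartzMap.fourier_coe, fourier_eq_ex]
  congr 1
  ext x
  rw [locS_apply]
  ring

namespace Choices

variable [MeasurableSpace M] (c : B.Choices)


theorem measurable_fourierLoc (u : B.LocalFamily) (α : ι) : Measurable (c.fourierLoc u α) := by
  have h1 := (exists_flc (u α) c.isTest_chiH).1
  let L : E n → E n := fun ξ => WithLp.toLp 2 fun i => ξ i / (2 * Real.pi * B.scale α i)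
  have hL : Continuous L := by
    refine (PiLp.continuous_toLp 2 _).comp (continuous_pi fun i => ?_)
    fun_prop
  have h2 : c.fourierLoc u α = fun ξ => ((B.scaleProd α)⁻¹ : ℂ) * flc (u α) c.chiH (L ξ) := by
    funext ξ
    rw [← c.fourierLoc_scl]
    congr 1
    ext i
    have := B.scale_pos α i
    rw [scl_apply]
    simp only [L]
    field_simp
  rw [h2]
  exact (h1.comp hL.measurable).const_mul _

theorem mem_H_iff [Countable ι] {w : M → ℝ} (hw : B.IsWeight w) {s : ℝ} {u : B.LocalFamily} :
    u ∈ c.H w s ↔ u ∈ B.Distrib ∧ B.NN (B.coef w) s 0 (fun α => flc (u α) c.chiH) < ⊤ := by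
  have hsq := c.sobNorm_sq hw s u
  have hiff : c.sobNorm w s u < ⊤ ↔ B.NN (B.coef w) s 0 (fun α => flc (u α) c.chiH) < ⊤ := by
    have h0 : c.sobNorm w s u < ⊤ ↔ c.sobNorm w s u ^ 2 < ⊤ := by simp [ENNReal.pow_lt_top_iff]
    rw [h0, hsq]
    constructor
    · intro h
      exact ENNReal.lt_top_of_mul_ne_top_right h.ne norCst_ne_zero
    · exact ENNReal.mul_lt_top norCst_ne_top.lt_top
  refine ⟨fun h => ⟨h.1, hiff.1 h.2.2⟩, fun h => ⟨h.1, fun α => ?_, hiff.2 h.2⟩⟩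
  have hm : Measurable (c.weightedFourier s u α) :=
    (Complex.measurable_ofReal.comp (continuous_bracket_rpow s).measurable).mul (c.measurable_fourierLoc u α)
  refine ⟨hm.aestronglyMeasurable, ?_⟩
  have h1 := (c.sobNorm_lt_top_iff w s u).1 (hiff.2 h.2)
  have h2 := ENNReal.ne_top_of_tsum_ne_top h1.ne α
  by_contra hcon
  rw [not_lt, top_le_iff] at hcon
  rw [hcon, ENNReal.mul_top (ENNReal.ofReal_pos.2 (inv_pos.2 hw.weightFamily_pos)).ne'] at h2
  simp at h2

end Choices

end SBGStructure

/-! ### Vector fields acting on distributions -/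

section Div

variable {n : ℕ} {X : E n → E n}

/-- The divergence `∑ ∂_i (f X^i)`. -/
def divT (hX : ∀ i, ContDiffOn ℝ ∞ (fun x => X x i) (cube n 2)) (f : 𝓓(box n, ℝ)) : 𝓓(box n, ℝ) :=
  ∑ i, TestFunction.lineDerivCLM ℝ (e i) (SBGStructure.mulTest (fun x => X x i) (hX i) f)

theorem lineDerivCLM_apply' (f : 𝓓(box n, ℝ)) (v x : E n) :
    (TestFunction.lineDerivCLM ℝ v f : 𝓓(box n, ℝ)) x = fderiv ℝ f x v := by
  rw [TestFunction.lineDerivCLM_apply_of_le (by simp),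
    ((f.contDiff.differentiable (by simp)).differentiableAt).lineDeriv_eq_fderiv]

theorem divT_apply (hX : ∀ i, ContDiffOn ℝ ∞ (fun x => X x i) (cube n 2)) (f : 𝓓(box n, ℝ)) (x : E n) :
    divT hX f x = ∑ i, fderiv ℝ (fun y => f y * X y i) x (e i) := by
  unfold divT
  have h : ∀ s : Finset (Fin n), (∑ i ∈ s, (TestFunction.lineDerivCLM ℝ (e i)
      (SBGStructure.mulTest (fun x => X x i) (hX i) f) : 𝓓(box n, ℝ))) x =
      ∑ i ∈ s, fderiv ℝ (fun y => f y * X y i) x (e i) := by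
    classical
    intro s
    induction s using Finset.induction_on with
    | empty => rfl
    | insert i s hi ih =>
      rw [Finset.sum_insert hi, Finset.sum_insert hi, ← ih]
      change (TestFunction.lineDerivCLM ℝ (e i) (SBGStructure.mulTest (fun x => X x i) (hX i) f) : 𝓓(box n, ℝ)) x + _ = _
      rw [lineDerivCLM_apply']
      rfl
  exact h _

theorem tsupport_divT_subset (hX : ∀ i, ContDiffOn ℝ ∞ (fun x => X x i) (cube n 2)) (f : 𝓓(box n, ℝ)) :
    tsupport (divT hX f) ⊆ tsupport f := by
  refine closure_minimal (fun x hx => ?_) (isClosed_tsupport _)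
  by_contra hx'
  refine hx ?_
  rw [divT_apply]
  refine Finset.sum_eq_zero fun i _ => ?_
  have h0 : (fun y => f y * X y i) =ᶠ[𝓝 x] fun _ => 0 := by
    filter_upwards [(isClosed_tsupport f).isOpen_compl.mem_nhds hx'] with y hy
    rw [image_eq_zero_of_notMem_tsupport hy, zero_mul]
  rw [h0.fderiv_eq]
  simp

theorem integral_divT_mul (hX : ∀ i, ContDiffOn ℝ ∞ (fun x => X x i) (cube n 2)) (f : 𝓓(box n, ℝ))
    {ψ : E n → ℝ} (hψ : ContDiff ℝ ∞ ψ) :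
    ∫ x, divT hX f x * ψ x = -∫ x, f x * fderiv ℝ ψ x (X x) := by
  have hd : ∀ i, Continuous fun x => fderiv ℝ ψ x (e i) := fun i =>
    (hψ.continuous_fderiv (by simp)).clm_apply continuous_const
  let F : Fin n → 𝓓(box n, ℝ) := fun i => SBGStructure.mulTest (fun x => X x i) (hX i) f
  have hF : ∀ i, (F i : E n → ℝ) = fun y => f y * X y i := fun i => rfl
  have hFd : ∀ i, Continuous fun x => fderiv ℝ (F i) x (e i) := fun i =>
    ((F i).contDiff.continuous_fderiv (by simp)).clm_apply continuous_const
  have hc : ∀ i, HasCompactSupport fun x => fderiv ℝ (F i) x (e i) := fun i =>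
    (F i).hasCompactSupport.fderiv_apply (𝕜 := ℝ) (e i)
  have h1 : ∀ i, ∫ x, fderiv ℝ (F i) x (e i) * ψ x = -∫ x, F i x * fderiv ℝ ψ x (e i) := fun i => by
    rw [integral_mul_fderiv_eq_neg_fderiv_mul_of_integrable (f := F i) (g := ψ), neg_neg]
    · exact ((hFd i).mul hψ.continuous).integrable_of_hasCompactSupport (hc i).mul_right
    · exact ((F i).continuous.mul (hd i)).integrable_of_hasCompactSupport (F i).hasCompactSupport.mul_right
    · exact ((F i).continuous.mul hψ.continuous).integrable_of_hasCompactSupport (F i).hasCompactSupport.mul_right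
    · exact fun x _ => ((F i).contDiff.differentiable (by simp)).differentiableAt
    · exact fun x _ => (hψ.differentiable (by simp)).differentiableAt
  have h2 : ∀ x, fderiv ℝ ψ x (X x) = ∑ i, X x i * fderiv ℝ ψ x (e i) := fun x => by
    conv_lhs => rw [clm_eq_sum (fderiv ℝ ψ x)]
    simp
  simp only [divT_apply, Finset.sum_mul, h2, Finset.mul_sum]
  rw [integral_finsetSum _ fun i _ => ?_, integral_finsetSum _ fun i _ => ?_, ← Finset.sum_neg_distrib]
  · refine Finset.sum_congr rfl fun i _ => (h1 i).trans ?_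
    congr 2
    ext x
    rw [hF, mul_assoc]
  · have := ((F i).continuous.mul (hd i)).integrable_of_hasCompactSupport (μ := volume) (F i).hasCompactSupport.mul_right
    exact this.congr (ae_of_all _ fun x => mul_assoc _ _ _)
  · exact ((hFd i).mul hψ.continuous).integrable_of_hasCompactSupport (hc i).mul_right

end Div

namespace SBGStructure

variable {n : ℕ} {M : Type*} [TopologicalSpace M] [ChartedSpace (E n) M] {ι : Type*}
  {B : SBGStructure n M ι} {α β γ : ι} {x : E n} {p : M} {r : ℝ}
  [IsManifold (𝓡 n) ∞ M] {W : VField n M}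

theorem MemW.contDiffOn (hW : B.MemW W) (α : ι) (i : Fin n) :
    ContDiffOn ℝ ∞ (fun x => B.locVF W α x i) (cube n 2) :=
  (EuclideanSpace.proj i : E n →L[ℝ] ℝ).contDiff.comp_contDiffOn (hW.2.1 α)

theorem MemW.unifBdd (hW : B.MemW W) : UnifBdd (fun _ : ι => cube n 2) (B.locVF W) := hW.2

theorem vfAct_apply (hW : B.MemW W) (u : B.LocalFamily) (f : 𝓓(box n, ℝ)) :
    B.vfAct W u α f = -u α (divT (hW.contDiffOn α) f) := by
  unfold vfAct
  rw [dif_pos (hW.contDiffOn α)]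
  unfold divT
  rw [map_sum, ← Finset.sum_neg_distrib]
  have h : ∀ s : Finset (Fin n), (∑ i ∈ s, (mulCLM (fun x => B.locVF W α x i) (hW.contDiffOn α i)).precompCompactConvergenceCLM ℂ
      (Distribution.lineDerivCLM (e i) (u α) : 𝓓'(box n, ℂ))) f = ∑ i ∈ s, -u α (TestFunction.lineDerivCLM ℝ (e i)
        (mulTest (fun x => B.locVF W α x i) (hW.contDiffOn α i) f)) := by
    classical
    intro s
    induction s using Finset.induction_on with
    | empty => rfl
    | insert i s hi ih =>
      rw [Finset.sum_insert hi, Finset.sum_insert hi, ← ih]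
      rfl
  exact h _

theorem locVF_tr (W : VField n M) (hx : x ∈ B.dom α β) :
    B.locVF W β (B.tr α β x) = fderiv ℝ (B.tr α β) x (B.locVF W α x) := by
  have h1 := (mem_dom.1 hx).1
  have h2 := (mem_dom.1 hx).2
  unfold locVF
  rw [symm_tr hx, mfderiv_chart (symm_mem_source h1) h2, chart_symm h1]
  rfl

theorem image_tr_subset {K : Set (E n)} (hK : IsCompact K) (hKD : K ⊆ B.dom β α) :
    IsCompact (B.tr β α '' K) ∧ B.tr β α '' K ⊆ B.dom α β :=
  ⟨hK.image_of_continuousOn (contDiffOn_tr.continuousOn.mono hKD), by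
    rintro _ ⟨y, hy, rfl⟩
    exact tr_mem_dom (hKD hy)⟩

/-- Smooth functions with compact support in an overlap can be transported to the other chart. -/
theorem exists_transport {ψ : E n → ℝ} (hψ : ContDiff ℝ ∞ ψ) (hc : HasCompactSupport ψ)
    (hs : tsupport ψ ⊆ B.dom α β) : ∃ φ : E n → ℝ, ContDiff ℝ ∞ φ ∧ HasCompactSupport φ ∧
      tsupport φ ⊆ B.dom β α ∧ ∀ x ∈ B.dom α β, φ (B.tr α β x) = ψ x := by
  have hK := image_tr_subset hc.isCompact hs
  have h0 : ∀ y ∉ B.tr α β '' tsupport ψ, (B.dom β α).indicator (fun y => ψ (B.tr β α y)) y = 0 :=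
    fun y hy => indicator_apply_eq_zero.2 fun hyD => by
      by_contra hne
      exact hy ⟨B.tr β α y, subset_tsupport _ hne, tr_tr hyD⟩
  have hs' : tsupport ((B.dom β α).indicator fun y => ψ (B.tr β α y)) ⊆ B.tr α β '' tsupport ψ :=
    closure_minimal (fun y hy => by_contra fun h => hy (h0 y h)) hK.1.isClosed
  refine ⟨(B.dom β α).indicator fun y => ψ (B.tr β α y), contDiff_of_contDiffAt_tsupport fun y hy => ?_,
    HasCompactSupport.intro hK.1 h0, hs'.trans hK.2, fun x hx => ?_⟩
  · have hyD := hK.2 (hs' hy)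
    refine (hψ.contDiffAt.comp y (contDiffOn_tr.contDiffAt (isOpen_dom.mem_nhds hyD))).congr_of_eventuallyEq ?_
    filter_upwards [isOpen_dom.mem_nhds hyD] with z hz using indicator_of_mem hz _
  · rw [indicator_of_mem (tr_mem_dom hx), tr_tr hx]

variable [T2Space M]

theorem divT_tr (hW : B.MemW W) {f g : 𝓓(box n, ℝ)} (hg : tsupport g ⊆ B.dom β α)
    (hf : ∀ x ∈ B.dom α β, f x = |(fderiv ℝ (B.tr α β) x).det| * g (B.tr α β x))
    (hf0 : ∀ x ∉ B.dom α β, f x = 0) (hx : x ∈ B.dom α β) :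
    divT (hW.contDiffOn α) f x =
      |(fderiv ℝ (B.tr α β) x).det| * divT (hW.contDiffOn β) g (B.tr α β x) := by
  have hdet : ContinuousOn (fun x => |(fderiv ℝ (B.tr α β) x).det|) (B.dom α β) :=
    (unifBdd_abs_det.1 (α, β)).continuousOn
  have hcont : ContinuousOn (fun x => |(fderiv ℝ (B.tr α β) x).det| *
      divT (hW.contDiffOn β) g (B.tr α β x)) (B.dom α β) :=
    hdet.mul ((divT (hW.contDiffOn β) g).continuous.comp_continuousOn contDiffOn_tr.continuousOn)
  have hcont2 : ContinuousOn (divT (hW.contDiffOn α) f) (B.dom α β) :=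
    (divT (hW.contDiffOn α) f).continuous.continuousOn
  have key := isOpen_dom.ae_eq_zero_of_integral_contDiff_smul_eq_zero (μ := (volume : Measure (E n)))
    (f := fun x => divT (hW.contDiffOn α) f x - |(fderiv ℝ (B.tr α β) x).det| *
      divT (hW.contDiffOn β) g (B.tr α β x)) ((hcont2.sub hcont).locallyIntegrableOn isOpen_dom.measurableSet)
    fun ψ hψ hψc hψs => by
      obtain ⟨φ, hφ, hφc, hφs, hφψ⟩ := exists_transport hψ hψc hψs
      have hψ0 : ∀ x ∉ B.dom α β, ψ x = 0 := fun x hx =>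
        image_eq_zero_of_notMem_tsupport fun h => hx (hψs h)
      have h1 : ∫ x, divT (hW.contDiffOn α) f x * ψ x = ∫ y, divT (hW.contDiffOn β) g y * φ y := by
        rw [integral_divT_mul _ _ hψ, integral_divT_mul _ _ hφ]
        congr 1
        have hl : ∫ x, f x * fderiv ℝ ψ x (B.locVF W α x) =
            ∫ x in B.dom α β, f x * fderiv ℝ ψ x (B.locVF W α x) :=
          (setIntegral_eq_integral_of_forall_compl_eq_zero fun x hx => by rw [hf0 x hx, zero_mul]).symm
        have hl' : ∫ x, g x * fderiv ℝ φ x (B.locVF W β x) =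
            ∫ x in B.dom β α, g x * fderiv ℝ φ x (B.locVF W β x) :=
          (setIntegral_eq_integral_of_forall_compl_eq_zero fun x hx => by
            rw [image_eq_zero_of_notMem_tsupport fun h => hx (hg h), zero_mul]).symm
        rw [hl, hl', setIntegral_tr α β]
        refine setIntegral_congr_fun isOpen_dom.measurableSet fun x hx => ?_
        rw [hf x hx, smul_eq_mul, mul_assoc, locVF_tr W hx]
        congr 2
        have h2 : ψ =ᶠ[𝓝 x] φ ∘ B.tr α β := by
          filter_upwards [isOpen_dom.mem_nhds hx] with z hz using (hφψ z hz).symm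
        rw [h2.fderiv_eq, fderiv_comp x (hφ.differentiable (by simp)).differentiableAt
          (hasFDerivAt_tr hx).differentiableAt]
        rfl
      have h2 : ∫ y, divT (hW.contDiffOn β) g y * φ y = ∫ x in B.dom α β,
          ψ x * (|(fderiv ℝ (B.tr α β) x).det| * divT (hW.contDiffOn β) g (B.tr α β x)) := by
        have hl : ∫ y, divT (hW.contDiffOn β) g y * φ y =
            ∫ y in B.dom β α, divT (hW.contDiffOn β) g y * φ y :=
          (setIntegral_eq_integral_of_forall_compl_eq_zero fun x hx => by
            rw [image_eq_zero_of_notMem_tsupport fun h => hx (hφs h), mul_zero]).symm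
        rw [hl, setIntegral_tr α β]
        refine setIntegral_congr_fun isOpen_dom.measurableSet fun x hx => ?_
        rw [hφψ x hx, smul_eq_mul]
        ring
      have h3 : ∫ x in B.dom α β, ψ x * divT (hW.contDiffOn α) f x =
          ∫ x, divT (hW.contDiffOn α) f x * ψ x := by
        rw [setIntegral_eq_integral_of_forall_compl_eq_zero fun x hx => by rw [hψ0 x hx, zero_mul]]
        simp only [mul_comm]
      rw [← setIntegral_eq_integral_of_forall_compl_eq_zero (s := B.dom α β) fun x hx => by
        rw [hψ0 x hx, zero_smul]]
      simp only [smul_eq_mul, mul_sub]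
      have hcs : ∀ q : E n → ℝ, ContinuousOn q (B.dom α β) → IntegrableOn (fun x => ψ x * q x) (B.dom α β) := by
        intro q hq
        have h4 : IntegrableOn (fun x => ψ x * q x) (tsupport ψ) :=
          (hψ.continuous.continuousOn.mul (hq.mono hψs)).integrableOn_compact hψc
        exact ((integrableOn_iff_integrable_of_support_subset
          ((Function.support_mul_subset_left _ _).trans (subset_tsupport _))).1 h4).integrableOn
      rw [integral_sub (hcs _ hcont2) (hcs _ hcont), h3, h1, h2, sub_self]
  have h5 : EqOn (divT (hW.contDiffOn α) f) (fun x => |(fderiv ℝ (B.tr α β) x).det| *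
      divT (hW.contDiffOn β) g (B.tr α β x)) (B.dom α β) :=
    Measure.eqOn_open_of_ae_eq (μ := (volume : Measure (E n)))
      ((ae_restrict_iff' isOpen_dom.measurableSet).2 (key.mono fun x h hx => sub_eq_zero.1 (h hx)))
      isOpen_dom hcont2 hcont
  exact h5 hx

theorem vfAct_mem_distrib (hW : B.MemW W) {u : B.LocalFamily} (hu : u ∈ B.Distrib) :
    B.vfAct W u ∈ B.Distrib := by
  intro α β f g hg hf hf0
  have hK := image_tr_subset (B := B) g.hasCompactSupport.isCompact hg
  have hfs : tsupport f ⊆ B.dom α β := by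
    refine subset_trans (closure_minimal (fun x hx => ?_) hK.1.isClosed) hK.2
    by_cases hxD : x ∈ B.dom α β
    · have h1 := hf x hxD
      refine ⟨B.tr α β x, subset_tsupport _ fun h => hx ?_, tr_tr hxD⟩
      change f x = _ * g (B.tr α β x) at h1
      rw [h1, h, mul_zero]
    · exact (hx (hf0 x hxD)).elim
  rw [vfAct_apply hW, vfAct_apply hW, hu α β (divT (hW.contDiffOn α) f) (divT (hW.contDiffOn β) g)
    ((tsupport_divT_subset _ _).trans hg) (fun x hx => divT_tr hW hg hf hf0 hx) fun x hx => ?_]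
  exact image_eq_zero_of_notMem_tsupport fun h => hx (hfs (tsupport_divT_subset _ _ h))

end SBGStructure

/-! ### Mixed norms -/

theorem UnifBdd.of_finite {I K V F : Type*} [Finite K] [NormedAddCommGroup V] [NormedSpace ℝ V]
    [NormedAddCommGroup F] [NormedSpace ℝ F] {D : I → Set V} {f : K → I → V → F}
    (hf : ∀ c, UnifBdd D (f c)) (col : I → K) : UnifBdd D fun i => f (col i) i := by
  cases nonempty_fintype K
  refine ⟨fun i => (hf (col i)).1 i, fun k => ?_⟩
  choose C hC using fun c => (hf c).2 k
  refine ⟨∑ c, |C c|, fun i x hx => (hC (col i) i x hx).trans ((le_abs_self _).trans ?_)⟩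
  exact Finset.single_le_sum (f := fun c => |C c|) (fun _ _ => abs_nonneg _) (Finset.mem_univ _)

section

variable {n : ℕ} {v : 𝓓'(box n, ℂ)} {h : E n → ℝ}

theorem hasFDerivAt_ex_left (x ζ : E n) (v : E n) :
    fderiv ℝ (fun y => ex y (-ζ)) x v = -(2 * Real.pi * Complex.I * (inner ℝ v ζ : ℝ)) * ex x (-ζ) := by
  have h1 : HasFDerivAt (fun y : E n => ((2 * Real.pi * inner ℝ y (-ζ) : ℝ) : ℂ) * Complex.I)
      ((ContinuousLinearMap.smulRight (Complex.ofRealCLM.comp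
        ((2 * Real.pi) • (innerSL ℝ (-ζ) : E n →L[ℝ] ℝ))) Complex.I)) x := by
    have h2 : (fun y : E n => ((2 * Real.pi * inner ℝ y (-ζ) : ℝ) : ℂ) * Complex.I) =
        ⇑((ContinuousLinearMap.smulRight (Complex.ofRealCLM.comp
        ((2 * Real.pi) • (innerSL ℝ (-ζ) : E n →L[ℝ] ℝ))) Complex.I)) := by
      ext y
      simp [real_inner_comm]
    rw [h2]
    exact ContinuousLinearMap.hasFDerivAt _
  have h3 := h1.cexp
  have h4 : fderiv ℝ (fun y => ex y (-ζ)) x = _ := h3.fderiv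
  rw [h4]
  simp [ex, real_inner_comm]
  ring

theorem IsTest.fderiv_apply {f : E n → ℂ} (hf : IsTest f) (v : E n) : IsTest fun x => fderiv ℝ f x v :=
  ⟨(hf.smooth.fderiv_right (m := ∞) (by simp)).clm_apply contDiff_const, hf.compact.fderiv_apply (𝕜 := ℝ) v,
    (tsupport_fderiv_apply_subset ℝ v).trans hf.sub⟩

theorem flc_zero : flc v (fun _ => 0) = 0 := by
  funext ζ
  simp [flc, cev_zero]

theorem cev_fderiv_mul_ex (hh : IsTest fun x => (h x : ℂ)) (i : Fin n) (ζ : E n) :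
    cev v (fun x => fderiv ℝ (fun y => (h y : ℂ) * ex y (-ζ)) x (e i)) =
      flc v (fun x => fderiv ℝ h x (e i)) ζ - 2 * Real.pi * Complex.I * ζ i * flc v h ζ := by
  have hr : ContDiff ℝ ∞ h := by
    have := Complex.reCLM.contDiff.comp hh.smooth
    simpa [Function.comp_def] using this
  have h1 : (fun x => fderiv ℝ (fun y => (h y : ℂ) * ex y (-ζ)) x (e i)) = fun x =>
      ((fderiv ℝ h x (e i) : ℝ) : ℂ) * ex x (-ζ) +
        (-(2 * Real.pi * Complex.I * ζ i)) * ((h x : ℂ) * ex x (-ζ)) := by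
    ext x
    have h2 : HasFDerivAt (fun y => (h y : ℂ)) (Complex.ofRealCLM.comp (fderiv ℝ h x)) x :=
      Complex.ofRealCLM.hasFDerivAt.comp x ((hr.differentiable (by simp)) x).hasFDerivAt
    have h3 : DifferentiableAt ℝ (fun y => ex y (-ζ)) x :=
      ((contDiff_ex_left (-ζ)).differentiable (by simp)) x
    rw [fderiv_fun_mul h2.differentiableAt h3, h2.fderiv]
    simp only [add_apply, smul_apply, hasFDerivAt_ex_left]
    have h4 : inner ℝ (e i : E n) ζ = ζ i := by simp [e, EuclideanSpace.inner_single_left]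
    rw [h4]
    simp
    ring
  have hd : IsTest fun x => ((fderiv ℝ h x (e i) : ℝ) : ℂ) := by
    have := hh.fderiv_apply (e i)
    refine cast (congrArg IsTest ?_) this
    ext x
    have h2 : HasFDerivAt (fun y => (h y : ℂ)) (Complex.ofRealCLM.comp (fderiv ℝ h x)) x :=
      Complex.ofRealCLM.hasFDerivAt.comp x ((hr.differentiable (by simp)) x).hasFDerivAt
    rw [h2.fderiv]
    rfl
  rw [h1, cev_add (isTest_mul_ex hd _) ((isTest_mul_ex hh _).mul_left contDiff_const),
    cev_const_mul _ (isTest_mul_ex hh _)]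
  unfold flc
  ring

end

namespace SBGStructure

variable {n : ℕ} {M : Type*} [TopologicalSpace M] [ChartedSpace (E n) M] {ι : Type*}
  {B : SBGStructure n M ι} {α β γ : ι} {x : E n} {p : M} {r : ℝ}

theorem NN_sum_le {om : ι → ℝ≥0∞} {s k : ℝ} {J : Type*} (S : Finset J) {F : J → ι → E n → ℂ}
    (hF : ∀ j α, Measurable (F j α)) :
    B.NN om s k (fun α ζ => ∑ j ∈ S, F j α ζ) ≤ S.card * ∑ j ∈ S, B.NN om s k (F j) := by
  unfold NN
  rw [← Summable.tsum_finsetSum fun _ _ => ENNReal.summable, ← ENNReal.tsum_mul_left]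
  refine ENNReal.tsum_le_tsum fun α => ?_
  rw [← Finset.mul_sum, mul_left_comm]
  gcongr
  exact qn_sum_le S continuous_wt.measurable fun j _ => (hF j α).aemeasurable

theorem NN_add_le {om : ι → ℝ≥0∞} {s k : ℝ} {F G : ι → E n → ℂ} (hF : ∀ α, Measurable (F α)) :
    B.NN om s k (fun α ζ => F α ζ + G α ζ) ≤ 2 * (B.NN om s k F + B.NN om s k G) := by
  unfold NN
  rw [← ENNReal.tsum_add, ← ENNReal.tsum_mul_left]
  refine ENNReal.tsum_le_tsum fun α => ?_
  rw [← mul_add, mul_left_comm]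
  gcongr
  rw [mul_add]
  exact qn_add_le continuous_wt.measurable (hF α).aemeasurable

variable [IsManifold (𝓡 n) ∞ M] {W : VField n M}

theorem cev_vfAct (hW : B.MemW W) (u : B.LocalFamily) {f : E n → ℂ} (hf : IsTest f) :
    cev (B.vfAct W u α) f =
      -∑ i, cev (u α) fun x => fderiv ℝ (fun y => f y * (B.locVF W α y i : ℂ)) x (e i) := by
  have h1 : ∀ i, IsTest fun y => f y * (B.locVF W α y i : ℂ) := fun i =>
    hf.mul_contDiffOn (Complex.ofRealCLM.contDiff.comp_contDiffOn (hW.contDiffOn α i))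
  have h2 : ∀ i, IsTest fun x => fderiv ℝ (fun y => f y * (B.locVF W α y i : ℂ)) x (e i) := fun i =>
    (h1 i).fderiv_apply _
  rw [← cev_sum _ fun i _ => h2 i, cev_eq hf, cev_eq (IsTest.sum _ fun i _ => h2 i), vfAct_apply hW,
    vfAct_apply hW]
  have h3 : ∀ L : ℂ →L[ℝ] ℝ, divT (hW.contDiffOn α) (hf.clm L) =
      (IsTest.sum Finset.univ fun i _ => h2 i).clm L := by
    intro L
    ext x
    rw [divT_apply]
    change _ = L (∑ i, fderiv ℝ (fun y => f y * (B.locVF W α y i : ℂ)) x (e i))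
    rw [map_sum]
    refine Finset.sum_congr rfl fun i _ => ?_
    have h4 : (fun y => hf.clm L y * B.locVF W α y i) = fun y => L (f y * (B.locVF W α y i : ℂ)) := by
      ext y
      change L (f y) * _ = _
      rw [mul_comm (f y), ← Complex.real_smul, map_smul, smul_eq_mul, mul_comm]
    rw [h4]
    have h5 := (L.hasFDerivAt.comp x (((h1 i).smooth.differentiable (by simp)) x).hasFDerivAt).fderiv
    change fderiv ℝ (L ∘ fun y => f y * (B.locVF W α y i : ℂ)) x (e i) = _
    rw [h5]
    rfl
  rw [h3, h3]
  ring

theorem flc_vfAct (hW : B.MemW W) (u : B.LocalFamily) {h : E n → ℝ} (hh : IsTest fun x => (h x : ℂ))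
    (ζ : E n) : flc (B.vfAct W u α) h ζ = ∑ i, (2 * Real.pi * Complex.I * ζ i *
      flc (u α) (fun x => h x * B.locVF W α x i) ζ -
        flc (u α) (fun x => fderiv ℝ (fun y => h y * B.locVF W α y i) x (e i)) ζ) := by
  have h1 : ∀ i, IsTest fun y => ((h y * B.locVF W α y i : ℝ) : ℂ) := fun i => by
    simp only [Complex.ofReal_mul]
    exact hh.mul_contDiffOn (Complex.ofRealCLM.contDiff.comp_contDiffOn (hW.contDiffOn α i))
  have h0 : flc (B.vfAct W u α) h ζ = cev (B.vfAct W u α) fun x => (h x : ℂ) * ex x (-ζ) := rfl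
  rw [h0, cev_vfAct hW u (isTest_mul_ex hh _), ← Finset.sum_neg_distrib]
  refine Finset.sum_congr rfl fun i _ => ?_
  have h2 := cev_fderiv_mul_ex (v := u α) (h1 i) i ζ
  have h3 : (fun y => (h y : ℂ) * ex y (-ζ) * (B.locVF W α y i : ℂ)) =
      fun y => ((h y * B.locVF W α y i : ℝ) : ℂ) * ex y (-ζ) := by
    ext y
    push_cast
    ring
  rw [h3, h2]
  ring

theorem flc_vfAct_sum {J : ℕ} {S : Fin J → VField n M} {f : Fin J → M → ℝ} (hW : B.MemW W)
    (hS : ∀ j, B.MemW (S j)) (hf : ∀ j, B.UnifSmooth (f j)) (hWS : ∀ p, W p = ∑ j, f j p • S j p)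
    (u : B.LocalFamily) {h : E n → ℝ} (hh : IsTest fun x => (h x : ℂ)) (ζ : E n) :
    flc (B.vfAct W u α) h ζ =
      ∑ j, flc (B.vfAct (S j) u α) (fun x => h x * f j ((B.chart α).symm x)) ζ := by
  have hfc : ∀ j, ContDiffOn ℝ ∞ (fun x => (f j ((B.chart α).symm x) : ℂ)) (cube n 2) := fun j =>
    Complex.ofRealCLM.contDiff.comp_contDiffOn ((hf j).2.1 α)
  have h1 : ∀ j, IsTest fun x => (h x : ℂ) * ex x (-ζ) * (f j ((B.chart α).symm x) : ℂ) := fun j =>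
    (isTest_mul_ex hh _).mul_contDiffOn (hfc j)
  have h2 : ∀ j i, IsTest fun y => (h y : ℂ) * ex y (-ζ) * (f j ((B.chart α).symm y) : ℂ) *
      (B.locVF (S j) α y i : ℂ) := fun j i =>
    (h1 j).mul_contDiffOn (Complex.ofRealCLM.contDiff.comp_contDiffOn ((hS j).contDiffOn α i))
  have h3 : ∀ j, flc (B.vfAct (S j) u α) (fun x => h x * f j ((B.chart α).symm x)) ζ =
      -∑ i, cev (u α) fun x => fderiv ℝ (fun y => (h y : ℂ) * ex y (-ζ) *
        (f j ((B.chart α).symm y) : ℂ) * (B.locVF (S j) α y i : ℂ)) x (e i) := fun j => by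
    rw [← cev_vfAct (hS j) u (h1 j)]
    unfold flc
    congr 1
    ext x
    push_cast
    ring
  have h0 : flc (B.vfAct W u α) h ζ = cev (B.vfAct W u α) fun x => (h x : ℂ) * ex x (-ζ) := rfl
  rw [h0, cev_vfAct hW u (isTest_mul_ex hh _)]
  simp only [h3]
  rw [Finset.sum_neg_distrib, Finset.sum_comm]
  congr 1
  refine Finset.sum_congr rfl fun i _ => ?_
  rw [← cev_sum _ fun j _ => (h2 j i).fderiv_apply (e i)]
  congr 1
  ext x
  have h4 : (fun y => (h y : ℂ) * ex y (-ζ) * (B.locVF W α y i : ℂ)) = fun y =>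
      ∑ j, (h y : ℂ) * ex y (-ζ) * (f j ((B.chart α).symm y) : ℂ) * (B.locVF (S j) α y i : ℂ) := by
    ext y
    have h5 : B.locVF W α y = ∑ j, f j ((B.chart α).symm y) • B.locVF (S j) α y := by
      unfold locVF
      rw [hWS, map_sum]
      simp only [map_smul]
      rfl
    rw [h5, sum_apply', Complex.ofReal_sum, Finset.mul_sum]
    refine Finset.sum_congr rfl fun j _ => ?_
    rw [PiLp.smul_apply, smul_eq_mul]
    push_cast
    ring
  rw [h4, fderiv_fun_sum fun j _ => ((h2 j i).smooth.differentiable (by simp)) x]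
  simp

end SBGStructure

namespace SBGStructure

variable {n : ℕ} {M : Type*} [TopologicalSpace M] [ChartedSpace (E n) M] {ι : Type*}
  {B : SBGStructure n M ι} {α β γ : ι} {x : E n} {p : M} {r : ℝ}
  [IsManifold (𝓡 n) ∞ M] [T2Space M] [MeasurableSpace M]

namespace Choices

variable (c : B.Choices) {w : M → ℝ} {s : ℝ} {k : ℕ} {u : B.LocalFamily} {W : VField n M}

/-- The squared norm with `s` derivatives along `𝒱` and `k` derivatives along `𝒲`, on the Fourier
side. -/
def nn (w : M → ℝ) (s k : ℝ) (u : B.LocalFamily) : ℝ≥0∞ :=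
  B.NN (B.coef w) s k fun α => flc (u α) c.chiH

theorem measurable_flc_cut {h : ι → E n → ℝ} (hh : IsCut r h) (hr : r < 2) (u : B.LocalFamily) (α : ι) :
    Measurable (flc (u α) (h α)) := (exists_flc (u α) (hh.isTest hr α)).1

variable [Countable ι]

theorem exists_NN_cut_le (hw : B.IsWeight w) (s : ℝ) (k : ℕ) {h : ι → E n → ℝ} (hr : r < 2)
    (hh : IsCut r h) : ∃ C : ℝ≥0∞, C ≠ ⊤ ∧ ∀ u ∈ B.Distrib,
      B.NN (B.coef w) s k (fun α => flc (u α) (h α)) ≤ C * c.nn w s k u := by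
  obtain ⟨r₀, hr₀, hr₀', hcut⟩ := c.exists_radius
  have h1 : max r r₀ < 2 := max_lt hr hr₀'
  have hh' := hh.mono (le_max_left r r₀)
  have hχ := hcut.mono (le_max_right r r₀)
  have h2 : 1 ≤ max r r₀ := le_max_of_le_right (by linarith)
  rcases isEmpty_or_nonempty ι with hι | ⟨⟨i₀⟩⟩
  · exact ⟨0, by simp, fun u _ => by simp [NN]⟩
  obtain ⟨g, hg, hθ⟩ := exists_isPou (B := B) h2 h1 c.chiH_smooth (hχ.supp i₀) c.chiH_one
  obtain ⟨C, hC, hle⟩ := exists_NN_flc_le h1 (hw.slow_coef h1) hg hh' s k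
  exact ⟨C, hC, fun u hu => hle u _ (fun γ => (measurable_flc_cut hχ h1 u γ).aemeasurable)
    (rep_flc hu h1 hg hχ hh' hθ)⟩

theorem exists_nn_vfAct_le (hw : B.IsWeight w) (hW : B.MemW W) (s : ℝ) (k : ℕ) :
    ∃ C : ℝ≥0∞, C ≠ ⊤ ∧ ∀ u ∈ B.Distrib, c.nn w s k (B.vfAct W u) ≤ C * c.nn w s (k + 1) u := by
  obtain ⟨r, hr1, hr, hχ⟩ := c.exists_radius
  have hh : ∀ i, IsCut r fun α x => c.chiH x * B.locVF W α x i := fun i =>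
    hχ.mul_cube hr (hW.unifBdd.apply (fun _ => isOpen_cube n 2) i)
  have hd : ∀ i, IsCut r fun α x => fderiv ℝ (fun y => c.chiH y * B.locVF W α y i) x (e i) := fun i =>
    (hh i).fderiv_apply _
  choose C₁ hC₁ h₁ using fun i => c.exists_NN_cut_le hw s (k + 1) hr (hh i)
  choose C₂ hC₂ h₂ using fun i => c.exists_NN_cut_le hw s (k + 1) hr (hd i)
  simp only [Nat.cast_add, Nat.cast_one] at h₁ h₂
  refine ⟨n * ∑ i, 2 * (C₁ i + C₂ i), ENNReal.mul_ne_top (by simp) (ENNReal.sum_ne_top.2 fun i _ =>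
    ENNReal.mul_ne_top (by simp) (ENNReal.add_ne_top.2 ⟨hC₁ i, hC₂ i⟩)), fun u hu => ?_⟩
  have hm1 : ∀ i α, Measurable fun ζ : E n => 2 * Real.pi * Complex.I * ζ i *
      flc (u α) (fun x => c.chiH x * B.locVF W α x i) ζ := fun i α =>
    Measurable.mul (by fun_prop) (measurable_flc_cut (hh i) hr u α)
  have hm2 : ∀ i α, Measurable fun ζ : E n =>
      -flc (u α) (fun x => fderiv ℝ (fun y => c.chiH y * B.locVF W α y i) x (e i)) ζ := fun i α =>
    (measurable_flc_cut (hd i) hr u α).neg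
  have h3 : (fun α => flc (B.vfAct W u α) c.chiH) = fun α ζ => ∑ i, (2 * Real.pi * Complex.I * ζ i *
      flc (u α) (fun x => c.chiH x * B.locVF W α x i) ζ +
        -flc (u α) (fun x => fderiv ℝ (fun y => c.chiH y * B.locVF W α y i) x (e i)) ζ) := by
    funext α ζ
    rw [flc_vfAct hW u c.isTest_chiH]
    simp only [sub_eq_add_neg]
  unfold nn
  rw [h3]
  refine (NN_sum_le _ fun i α => (hm1 i α).add (hm2 i α)).trans ?_
  rw [Finset.card_univ, Fintype.card_fin, mul_assoc (n : ℝ≥0∞), Finset.sum_mul]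
  gcongr with i _
  refine (NN_add_le (hm1 i)).trans ?_
  rw [mul_assoc (2 : ℝ≥0∞), add_mul]
  gcongr
  · refine le_trans (ENNReal.tsum_le_tsum fun α => ?_) (h₁ i u hu)
    gcongr
    refine (qn_mono (C := 1) fun ζ => ?_).trans_eq (by rw [one_pow, ENNReal.ofReal_one, one_mul])
    rw [abs_of_pos (wt_pos ζ), abs_of_pos (wt_pos ζ), norm_mul, one_mul, ← mul_assoc]
    gcongr
    refine abs_le_of_sq_le_sq' ?_ (wt_pos ζ).le |>.2
    have h4 := wt_succ_right_sq (B.scale α) s k ζ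
    have h5 := Finset.single_le_sum (f := fun i => (wt (B.scale α) s k ζ * (2 * Real.pi * ζ i)) ^ 2)
      (fun _ _ => sq_nonneg _) (Finset.mem_univ i)
    push_cast
    rw [h4]
    have h6 : ‖2 * (Real.pi : ℂ) * Complex.I * (ζ i : ℂ)‖ ^ 2 = (2 * Real.pi * ζ i) ^ 2 := by
      rw [norm_mul, norm_mul, Complex.norm_I, Complex.norm_real, norm_mul, Complex.norm_real]
      simp [mul_pow]
    rw [mul_pow, h6, ← mul_pow]
    nlinarith [sq_nonneg (wt (B.scale α) s k ζ)]
  · refine le_trans (ENNReal.tsum_le_tsum fun α => ?_) (h₂ i u hu)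
    gcongr
    refine (qn_mono (C := 1) fun ζ => ?_).trans_eq (by rw [one_pow, ENNReal.ofReal_one, one_mul])
    rw [abs_of_pos (wt_pos ζ), abs_of_pos (wt_pos ζ), norm_neg, one_mul]
    gcongr
    exact wt_le_wt le_rfl (by simp) ζ

theorem exists_nn_succ_le (hw : B.IsWeight w) (s : ℝ) (k : ℕ) :
    ∃ C : ℝ≥0∞, C ≠ ⊤ ∧ ∀ u ∈ B.Distrib, c.nn w s (k + 1) u ≤
      C * (c.nn w s k u + ∑ j, c.nn w s k (B.vfAct (c.span j) u)) := by
  obtain ⟨r, hr1, hr, hχ⟩ := c.exists_radius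
  obtain ⟨N, V, col, hV, hVe⟩ := exists_coordinate_fields B (by linarith : 1 ≤ r) hr
  choose f hf hVf using fun (a : Fin N) (i : Fin n) => c.span_spanning.2 (V a i) (hV a i)
  have hh : ∀ i j, IsCut r fun α x => c.chiH x * f (col α) i j ((B.chart α).symm x) := fun i j =>
    hχ.mul_cube hr (UnifBdd.of_finite (f := fun a (α : ι) x => f a i j ((B.chart α).symm x))
      (fun a => (hf a i j).2) col)
  have hd : ∀ i, IsCut r fun (_ : ι) x => fderiv ℝ c.chiH x (e i) := fun i => hχ.fderiv_apply _
  choose C₁ hC₁ h₁ using fun i j => c.exists_NN_cut_le hw s k hr (hh i j)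
  choose C₂ hC₂ h₂ using fun i => c.exists_NN_cut_le hw s k hr (hd i)
  set C₀ : ℝ≥0∞ := 1 + ∑ i, (2 * c.num * ∑ j, C₁ i j + 2 * C₂ i) with hC₀
  refine ⟨C₀, ?_, fun u hu => ?_⟩
  · refine ENNReal.add_ne_top.2 ⟨by simp, ENNReal.sum_ne_top.2 fun i _ => ENNReal.add_ne_top.2
      ⟨ENNReal.mul_ne_top (ENNReal.mul_ne_top (by simp) (by simp)) (ENNReal.sum_ne_top.2 fun j _ => hC₁ i j),
        ENNReal.mul_ne_top (by simp) (hC₂ i)⟩⟩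
  set T := c.nn w s k u + ∑ j, c.nn w s k (B.vfAct (c.span j) u) with hT
  have hmS : ∀ i j α, Measurable fun ζ => flc (B.vfAct (c.span j) u α)
      (fun x => c.chiH x * f (col α) i j ((B.chart α).symm x)) ζ := fun i j α =>
    measurable_flc_cut (hh i j) hr _ α
  have h3 : ∀ i α ζ, 2 * Real.pi * Complex.I * ζ i * flc (u α) c.chiH ζ =
      (∑ j, flc (B.vfAct (c.span j) u α) (fun x => c.chiH x * f (col α) i j ((B.chart α).symm x)) ζ) +
        flc (u α) (fun x => fderiv ℝ c.chiH x (e i)) ζ := by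
    intro i α ζ
    rw [← flc_vfAct_sum (hV (col α) i) (fun j => c.span_spanning.1 j) (hf (col α) i)
      (hVf (col α) i) u c.isTest_chiH, flc_vfAct (hV (col α) i) u c.isTest_chiH]
    have h4 : ∀ l, (fun x => c.chiH x * B.locVF (V (col α) i) α x l) =
        fun x => if l = i then c.chiH x else 0 := by
      intro l
      ext x
      by_cases hx : x ∈ closedCube n r
      · rw [hVe α i x hx, e_apply]
        simp
      · rw [hχ.supp α x hx]
        simp
    simp only [h4]
    rw [Finset.sum_eq_single i]
    · simp only [if_true]
      ring
    · intro l _ hl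
      simp only [if_neg hl]
      rw [flc_zero]
      simp [flc_zero]
    · simp
  have h5 : ∀ i, B.NN (B.coef w) s k (fun α ζ => 2 * Real.pi * Complex.I * ζ i * flc (u α) c.chiH ζ) ≤
      (2 * c.num * ∑ j, C₁ i j + 2 * C₂ i) * T := by
    intro i
    simp only [h3]
    refine (NN_add_le fun α => Finset.measurable_fun_sum _ fun j _ => hmS i j α).trans ?_
    rw [mul_add, add_mul]
    refine add_le_add ?_ ?_
    · rw [mul_assoc, mul_assoc]
      refine mul_le_mul_right ?_ _
      refine (NN_sum_le _ fun j α => hmS i j α).trans ?_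
      rw [Finset.card_univ, Fintype.card_fin, Finset.sum_mul]
      gcongr with j _
      refine (h₁ i j _ (vfAct_mem_distrib (c.span_spanning.1 j) hu)).trans ?_
      gcongr
      exact (Finset.single_le_sum (f := fun j => c.nn w s k (B.vfAct (c.span j) u))
        (fun _ _ => zero_le) (Finset.mem_univ j)).trans le_add_self
    · rw [mul_assoc]
      gcongr
      refine (h₂ i u hu).trans ?_
      gcongr
      exact le_self_add
  have h6 : c.nn w s (k + 1) u = c.nn w s k u +
      ∑ i, B.NN (B.coef w) s k (fun α ζ => 2 * Real.pi * Complex.I * ζ i * flc (u α) c.chiH ζ) := by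
    unfold nn NN
    rw [← Summable.tsum_finsetSum fun _ _ => ENNReal.summable, ← ENNReal.tsum_add]
    refine tsum_congr fun α => ?_
    rw [← Finset.mul_sum, ← mul_add]
    congr 1
    rw [qn_eq_add_sum (φ₁ := wt (B.scale α) s k) (v := fun i ζ => 2 * Real.pi * ζ i)
      continuous_wt.measurable (fun i => by fun_prop)
      (exists_flc (u α) c.isTest_chiH).1.aemeasurable (wt_succ_right_sq _ _ _)]
    congr 1
    refine Finset.sum_congr rfl fun i _ => qn_congr fun ζ => ?_
    simp
  rw [h6, hC₀, add_mul, one_mul, Finset.sum_mul]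
  exact add_le_add le_self_add (Finset.sum_le_sum fun i _ => h5 i)

theorem nn_mono_order {s' k k' : ℝ} (hs : s ≤ s') (hk : k ≤ k') : c.nn w s k u ≤ c.nn w s' k' u := by
  refine ENNReal.tsum_le_tsum fun α => ?_
  gcongr
  refine qn_mono_weight fun ζ => ?_
  rw [abs_of_pos (wt_pos ζ), abs_of_pos (wt_pos ζ)]
  exact wt_le_wt hs hk ζ

theorem foldr_mem_distrib (l : List (VField n M)) (hl : ∀ W ∈ l, B.MemW W) (hu : u ∈ B.Distrib) :
    l.foldr B.vfAct u ∈ B.Distrib := by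
  induction l with
  | nil => exact hu
  | cons W l ih =>
    exact vfAct_mem_distrib (hl W (by simp)) (ih fun W hW => hl W (by simp [hW]))

theorem exists_nn_foldr_le (hw : B.IsWeight w) (s : ℝ) (l : List (VField n M))
    (hl : ∀ W ∈ l, B.MemW W) (k : ℕ) : ∃ C : ℝ≥0∞, C ≠ ⊤ ∧ ∀ u ∈ B.Distrib,
      c.nn w s k (l.foldr B.vfAct u) ≤ C * c.nn w s ((k + l.length : ℕ) : ℝ) u := by
  induction l generalizing k with
  | nil => exact ⟨1, by simp, fun u _ => by simp⟩
  | cons W l ih =>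
    obtain ⟨C₁, hC₁, h₁⟩ := c.exists_nn_vfAct_le hw (hl W (by simp)) s k
    obtain ⟨C₂, hC₂, h₂⟩ := ih (fun W hW => hl W (by simp [hW])) (k + 1)
    refine ⟨C₁ * C₂, ENNReal.mul_ne_top hC₁ hC₂, fun u hu => ?_⟩
    rw [mul_assoc]
    refine (h₁ _ (foldr_mem_distrib l (fun W hW => hl W (by simp [hW])) hu)).trans ?_
    gcongr
    have h3 := h₂ u hu
    have h4 : k + (W :: l).length = k + 1 + l.length := by simp; ring
    rw [h4]
    exact_mod_cast h3

/-- The sum over all words of length `≤ k` in the fixed vector fields. -/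
def words (w : M → ℝ) (s : ℝ) (k : ℕ) (u : B.LocalFamily) : ℝ≥0∞ :=
  ∑ j ∈ Finset.range (k + 1), ∑ f : Fin j → Fin c.num,
    c.nn w s 0 ((List.ofFn fun i => c.span (f i)).foldr B.vfAct u)

theorem le_words {j : ℕ} (hj : j ≤ k) (f : Fin j → Fin c.num) :
    c.nn w s 0 ((List.ofFn fun i => c.span (f i)).foldr B.vfAct u) ≤ c.words w s k u :=
  (Finset.single_le_sum (f := fun f : Fin j → Fin c.num =>
    c.nn w s 0 ((List.ofFn fun i => c.span (f i)).foldr B.vfAct u)) (fun _ _ => zero_le)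
    (Finset.mem_univ f)).trans (Finset.single_le_sum (f := fun j => ∑ f : Fin j → Fin c.num,
    c.nn w s 0 ((List.ofFn fun i => c.span (f i)).foldr B.vfAct u)) (fun _ _ => zero_le)
    (Finset.mem_range.2 (Nat.lt_succ_of_le hj)))

theorem exists_nn_le_words (hw : B.IsWeight w) (s : ℝ) (k : ℕ) : ∃ C : ℝ≥0∞, C ≠ ⊤ ∧
    ∀ u ∈ B.Distrib, c.nn w s k u ≤ C * c.words w s k u := by
  induction k with
  | zero => exact ⟨1, by simp, fun u _ => by simp [words]⟩
  | succ k ih =>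
    obtain ⟨C₁, hC₁, h₁⟩ := ih
    obtain ⟨C₂, hC₂, h₂⟩ := c.exists_nn_succ_le hw s k
    set D : ℝ≥0∞ := ∑ j ∈ Finset.range (k + 1), ∑ _f : Fin j → Fin c.num, 1 with hD
    have hDt : D ≠ ⊤ := ENNReal.sum_ne_top.2 fun j _ => ENNReal.sum_ne_top.2 fun _ _ => by simp
    have h3 : ∀ u, c.words w s k u ≤ c.words w s (k + 1) u := fun u => by
      unfold words
      exact Finset.sum_le_sum_of_subset (Finset.range_subset_range.2 (by omega))
    have h4 : ∀ u j, c.words w s k (B.vfAct (c.span j) u) ≤ D * c.words w s (k + 1) u := fun u j => by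
      rw [hD, Finset.sum_mul]
      unfold words
      refine Finset.sum_le_sum fun i hi => ?_
      rw [Finset.sum_mul]
      refine Finset.sum_le_sum fun f _ => ?_
      rw [one_mul]
      have h5 := c.le_words (w := w) (s := s) (u := u) (k := k + 1)
        (Finset.mem_range.1 hi : i + 1 ≤ k + 1) (Fin.snoc (α := fun _ => Fin c.num) f j)
      refine le_of_eq_of_le ?_ h5
      rw [List.ofFn_succ']
      simp
    refine ⟨C₂ * (C₁ + c.num * (C₁ * D)), ENNReal.mul_ne_top hC₂ (ENNReal.add_ne_top.2 ⟨hC₁,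
      ENNReal.mul_ne_top (by simp) (ENNReal.mul_ne_top hC₁ hDt)⟩), fun u hu => ?_⟩
    push_cast
    refine (h₂ u hu).trans ?_
    rw [mul_assoc]
    gcongr
    rw [add_mul]
    gcongr
    · exact (h₁ u hu).trans (by gcongr; exact h3 u)
    · refine (Finset.sum_le_card_nsmul _ _ (C₁ * D * c.words w s (k + 1) u) fun j _ => ?_).trans_eq ?_
      · refine (h₁ _ (vfAct_mem_distrib (c.span_spanning.1 j) hu)).trans ?_
        rw [mul_assoc]
        gcongr
        exact h4 u j
      · simp [mul_assoc]

theorem exists_words_le_nn (hw : B.IsWeight w) (s : ℝ) (k : ℕ) : ∃ C : ℝ≥0∞, C ≠ ⊤ ∧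
    ∀ u ∈ B.Distrib, c.words w s k u ≤ C * c.nn w s k u := by
  choose C hC h using fun (j : ℕ) (f : Fin j → Fin c.num) => c.exists_nn_foldr_le hw s
    (List.ofFn fun i => c.span (f i)) (fun W hW => by
      obtain ⟨i, rfl⟩ := (List.mem_ofFn' _ _).1 hW
      exact c.span_spanning.1 _) 0
  refine ⟨∑ j ∈ Finset.range (k + 1), ∑ f, C j f, ENNReal.sum_ne_top.2 fun j _ =>
    ENNReal.sum_ne_top.2 fun f _ => hC j f, fun u hu => ?_⟩
  unfold words
  rw [Finset.sum_mul]
  refine Finset.sum_le_sum fun j hj => ?_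
  rw [Finset.sum_mul]
  refine Finset.sum_le_sum fun f _ => ?_
  have h1 := h j f u hu
  simp only [Nat.cast_zero] at h1
  refine h1.trans ?_
  gcongr
  refine c.nn_mono_order le_rfl ?_
  have : j ≤ k := Nat.lt_succ_iff.1 (Finset.mem_range.1 hj)
  simpa using this

theorem mixedNorm_sq (hw : B.IsWeight w) (s : ℝ) (k : ℕ) (u : B.LocalFamily) :
    c.mixedNorm w s k u ^ 2 = norCst n * c.words w s k u := by
  unfold mixedNorm words
  rw [← ENNReal.rpow_natCast, ← ENNReal.rpow_mul]
  norm_num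
  rw [Finset.mul_sum]
  refine Finset.sum_congr rfl fun j _ => ?_
  rw [Finset.mul_sum]
  exact Finset.sum_congr rfl fun f _ => c.sobNorm_sq hw s _

theorem memMixed_iff (hw : B.IsWeight w) {s : ℝ} {k : ℕ} {u : B.LocalFamily} :
    c.MemMixed w s k u ↔ u ∈ B.Distrib ∧ c.nn w s k u < ⊤ := by
  constructor
  · intro h
    have hu : u ∈ B.Distrib := (h [] (by simp) (by simp)).1
    obtain ⟨C, hC, hle⟩ := c.exists_nn_le_words hw s k
    refine ⟨hu, (hle u hu).trans_lt (ENNReal.mul_lt_top hC.lt_top ?_)⟩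
    refine ENNReal.sum_lt_top.2 fun j hj => ENNReal.sum_lt_top.2 fun f _ => ?_
    refine ((c.mem_H_iff hw).1 (h _ ?_ fun W hW => ?_)).2
    · simpa using Nat.lt_succ_iff.1 (Finset.mem_range.1 hj)
    · obtain ⟨i, rfl⟩ := (List.mem_ofFn' _ _).1 hW
      exact c.span_spanning.1 _
  · rintro ⟨hu, hlt⟩ l hlk hl
    obtain ⟨C, hC, hle⟩ := c.exists_nn_foldr_le hw s l hl 0
    refine (c.mem_H_iff hw).2 ⟨foldr_mem_distrib l hl hu, ?_⟩
    have h1 := hle u hu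
    simp only [Nat.cast_zero] at h1
    refine h1.trans_lt (ENNReal.mul_lt_top hC.lt_top (lt_of_le_of_lt (c.nn_mono_order le_rfl ?_) hlt))
    simpa using hlk

end Choices

end SBGStructure

/-! ### Completeness -/

section

variable {n : ℕ}

theorem qn_fourierInv {ρ : Fin n → ℝ} {s k : ℝ} (f : 𝓢(E n, ℂ)) :
    qn (wt ρ s k) (𝓕⁻ f : 𝓢(E n, ℂ)) = qn (wt ρ s k) (𝓕 f : 𝓢(E n, ℂ)) := by
  rw [← qn_comp_neg wt_neg]
  refine qn_congr fun ξ => ?_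
  rw [SchwartzMap.fourierInv_coe, Real.fourierInv_eq_fourier_neg, neg_neg]
  rfl

theorem exists_qn_fourier_le {K : Set (E n)} (hK : IsCompact K) (s : ℝ) : ∃ (C : ℝ) (N : ℕ), 0 ≤ C ∧
    ∀ ρ : Fin n → ℝ, (∀ i, 0 ≤ ρ i) → (∀ i, ρ i ≤ 1) → ∀ f : 𝓢(E n, ℂ), (∀ x ∉ K, f x = 0) →
      ∀ A : ℝ, (∀ i ≤ N, ∀ x, ‖iteratedFDeriv ℝ i f x‖ ≤ A) →
        qn (wt ρ s 0) (𝓕 f : 𝓢(E n, ℂ)) ≤ ENNReal.ofReal (C * A ^ 2) := by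
  set N : ℕ := ⌈|s| + (n + 1)⌉₊ with hN
  have hN' : |s| + (n + 1) ≤ N := Nat.le_ceil _
  have hI : qn (fun _ : E n => 1) (fun ξ => ((bracket ξ ^ (-((n : ℝ) + 1)) : ℝ) : ℂ)) < ⊤ := by
    refine lt_of_le_of_lt (lintegral_mono fun ξ => ?_) (lintegral_bracket_lt_top (n := n))
    have h0 : 0 < bracket ξ ^ (-((n : ℝ) + 1)) := Real.rpow_pos_of_pos (bracket_pos _) _
    have h1 : bracket ξ ^ (-((n : ℝ) + 1)) ≤ 1 :=
      Real.rpow_le_one_of_one_le_of_nonpos (one_le_bracket _) (by linarith [(Nat.cast_nonneg n : (0 : ℝ) ≤ n)])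
    rw [← ofReal_norm, Complex.norm_real, Real.norm_of_nonneg h0.le, one_pow, ENNReal.ofReal_one, one_mul,
      ← ENNReal.ofReal_pow h0.le]
    exact ENNReal.ofReal_le_ofReal (by nlinarith)
  set I := (qn (fun _ : E n => 1) (fun ξ => ((bracket ξ ^ (-((n : ℝ) + 1)) : ℝ) : ℂ))).toReal with hIdef
  set D : ℝ := (2 * Real.pi) ^ |s| * (2 ^ N * volume.real K * (1 + 2 ^ N * (N + 1))) with hD
  refine ⟨D ^ 2 * I, N, by positivity, fun ρ h0 h1 f hfK A hA => ?_⟩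
  have hA0 : 0 ≤ A := (norm_nonneg _).trans (hA 0 (Nat.zero_le _) 0)
  have hfc : HasCompactSupport f := HasCompactSupport.intro hK hfK
  have hbd : ∀ j : ℕ, ∃ a : ℝ, ∀ x, ‖iteratedFDeriv ℝ j f x‖ ≤ a := fun j => by
    obtain ⟨a, ha⟩ := (hfc.iteratedFDeriv (𝕜 := ℝ) j).exists_bound_of_continuous
      (((f.smooth ⊤).continuous_iteratedFDeriv (by exact_mod_cast le_top)))
    exact ⟨a, ha⟩
  choose a ha using hbd
  have hb : SymBd K 0 (fun j => if j ≤ N then A else a j) fun x _ => f x := by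
    refine ⟨(f.smooth ⊤).comp contDiff_fst, fun x hx _ => hfK x hx, fun j x ξ => ?_⟩
    rw [Real.rpow_zero, mul_one]
    split_ifs with hj
    · exact hA j hj x
    · exact ha j x
  have h2 : ∀ θ, ‖(𝓕 f : 𝓢(E n, ℂ)) θ‖ ≤ 2 ^ N * volume.real K * (1 + 2 ^ N * (N + 1)) * A *
      bracket θ ^ (-(N : ℝ)) := fun θ => by
    have h3 := hb.norm_fourier_le hK N θ 0
    rw [Real.rpow_zero, mul_one] at h3
    rw [Finset.sum_congr rfl fun j hj => if_pos (Nat.lt_succ_iff.1 (Finset.mem_range.1 hj))] at h3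
    simp only [Nat.zero_le, if_true, Finset.sum_const, Finset.card_range, nsmul_eq_mul] at h3
    refine h3.trans_eq ?_
    push_cast
    ring
  have h4 : qn (wt ρ s 0) (𝓕 f : 𝓢(E n, ℂ)) ≤ ENNReal.ofReal ((D * A) ^ 2) *
      qn (fun _ : E n => 1) (fun ξ => ((bracket ξ ^ (-((n : ℝ) + 1)) : ℝ) : ℂ)) := by
    refine qn_mono fun θ => ?_
    have hb1 := bracket_pos θ
    have hb2 := bracket_pos (scl ρ θ)
    have h5 : wt ρ s 0 θ ≤ (2 * Real.pi) ^ |s| * bracket θ ^ |s| := by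
      unfold wt
      rw [Real.rpow_zero, mul_one, ← Real.mul_rpow (by positivity) hb1.le]
      exact (Real.rpow_le_rpow_of_exponent_le (one_le_bracket _) (le_abs_self s)).trans
        (Real.rpow_le_rpow hb2.le (bracket_scl_le h0 h1 θ) (abs_nonneg s))
    rw [abs_of_pos (wt_pos θ), abs_one, one_mul, Complex.norm_real,
      Real.norm_of_nonneg (Real.rpow_nonneg hb1.le _)]
    calc _ ≤ ((2 * Real.pi) ^ |s| * bracket θ ^ |s|) * (2 ^ N * volume.real K * (1 + 2 ^ N * (N + 1)) * A *
          bracket θ ^ (-(N : ℝ))) := by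
          gcongr
          exact h2 θ
      _ = D * A * bracket θ ^ (|s| + -(N : ℝ)) := by rw [Real.rpow_add hb1, hD]; ring
      _ ≤ _ := by
          gcongr
          · exact one_le_bracket θ
          · linarith
  refine h4.trans_eq ?_
  rw [← ENNReal.ofReal_toReal hI.ne, ← hIdef, ← ENNReal.ofReal_mul (by positivity)]
  congr 1
  ring

theorem cev_sub_left (v v' : 𝓓'(box n, ℂ)) (f : E n → ℂ) : cev (v - v') f = cev v f - cev v' f := by
  by_cases hf : IsTest f
  · rw [cev_eq hf, cev_eq hf, cev_eq hf]
    change (v _ - v' _) + Complex.I * (v _ - v' _) = _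
    ring
  · simp [cev, hf]

theorem cev_add_left (v v' : 𝓓'(box n, ℂ)) (f : E n → ℂ) : cev (v + v') f = cev v f + cev v' f := by
  by_cases hf : IsTest f
  · rw [cev_eq hf, cev_eq hf, cev_eq hf]
    change (v _ + v' _) + Complex.I * (v _ + v' _) = _
    ring
  · simp [cev, hf]

theorem cev_smul_left (z : ℂ) (v : 𝓓'(box n, ℂ)) (f : E n → ℂ) : cev (z • v) f = z * cev v f := by
  by_cases hf : IsTest f
  · rw [cev_eq hf, cev_eq hf]
    change (z * v _) + Complex.I * (z * v _) = _
    ring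
  · simp [cev, hf]

/-- Schwartz functions are dense in weighted `L²` spaces. -/
theorem exists_qn_sub_le {ρ : Fin n → ℝ} {s k : ℝ} {F : E n → ℂ} (hF : Measurable F)
    (hq : qn (wt ρ s k) F < ⊤) {ε : ℝ≥0∞} (hε : 0 < ε) :
    ∃ κ : 𝓢(E n, ℂ), qn (wt ρ s k) (fun ζ => F ζ - (𝓕 κ : 𝓢(E n, ℂ)) ζ) ≤ ε := by
  have hwm : Measurable fun ζ : E n => (wt ρ s k ζ : ℂ) :=
    (Complex.continuous_ofReal.comp continuous_wt).measurable
  have hm : MemLp (fun ζ => (wt ρ s k ζ : ℂ) * F ζ) 2 volume := by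
    refine ⟨(hwm.mul hF).aestronglyMeasurable, ?_⟩
    rw [eLpNorm_lt_top_iff_lintegral_rpow_enorm_lt_top (by norm_num) (by norm_num)]
    simp only [ENNReal.toReal_ofNat, ENNReal.rpow_ofNat]
    refine lt_of_eq_of_lt (lintegral_congr fun ζ => ?_) hq
    rw [enorm_mul, mul_pow, ← ofReal_norm (wt ρ s k ζ : ℂ), Complex.norm_real,
      Real.norm_of_nonneg (wt_pos _).le, ENNReal.ofReal_pow (wt_pos _).le]
  obtain ⟨δ, hδ0, hδ⟩ : ∃ δ : ℝ≥0, 0 < δ ∧ (δ : ℝ≥0∞) ^ 2 ≤ ε := by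
    rcases eq_or_ne ε ⊤ with rfl | hε'
    · exact ⟨1, one_pos, le_top⟩
    · have h1 : 0 < ε.toReal := ENNReal.toReal_pos hε.ne' hε'
      refine ⟨Real.toNNReal √ε.toReal, Real.toNNReal_pos.2 (Real.sqrt_pos.2 h1), le_of_eq ?_⟩
      change ENNReal.ofReal √ε.toReal ^ 2 = ε
      rw [← ENNReal.ofReal_pow (Real.sqrt_nonneg _), Real.sq_sqrt h1.le, ENNReal.ofReal_toReal hε']
  have hde : DenseRange (SchwartzMap.toLpCLM ℂ ℂ 2 (volume : Measure (E n))) :=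
    SchwartzMap.denseRange_toLpCLM (by norm_num)
  obtain ⟨G, hG⟩ := hde.exists_dist_lt (hm.toLp _) (NNReal.coe_pos.2 hδ0)
  let κ₀ : 𝓢(E n, ℂ) := SchwartzMap.smulLeftCLM ℂ (wt (n := n) ρ (-s) (-k)) G
  have hκ₀ : ∀ ζ, κ₀ ζ = (wt ρ (-s) (-k) ζ : ℂ) * G ζ := fun ζ => smulLeft_apply hasTemperateGrowth_wt G ζ
  refine ⟨𝓕⁻ κ₀, ?_⟩
  rw [FourierTransform.fourier_fourierInv_eq]
  have h1 : qn (wt ρ s k) (fun ζ => F ζ - κ₀ ζ) =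
      ‖hm.toLp _ - SchwartzMap.toLpCLM ℂ ℂ 2 (volume : Measure (E n)) G‖ₑ ^ 2 := by
    rw [← lintegral_enorm_sq_Lp]
    refine lintegral_congr_ae ?_
    filter_upwards [SchwartzMap.coeFn_toLp G 2 volume, hm.coeFn_toLp,
      Lp.coeFn_sub (hm.toLp _) (SchwartzMap.toLpCLM ℂ ℂ 2 (volume : Measure (E n)) G)] with ζ h2 h3 h4
    rw [h4, Pi.sub_apply, h3]
    change _ = ‖_ - SchwartzMap.toLp G 2 volume ζ‖ₑ ^ 2
    have h5 : (wt ρ s k ζ : ℂ) * (wt ρ (-s) (-k) ζ : ℂ) = 1 := by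
      rw [← Complex.ofReal_mul, wt_mul]; simp [wt_zero_zero]
    rw [h2, hκ₀]
    have h6 : (wt ρ s k ζ : ℂ) * F ζ - G ζ = (wt ρ s k ζ : ℂ) * (F ζ - (wt ρ (-s) (-k) ζ : ℂ) * G ζ) := by
      linear_combination G ζ * h5
    rw [h6, enorm_mul, mul_pow, ← ofReal_norm (wt ρ s k ζ : ℂ), Complex.norm_real,
      Real.norm_of_nonneg (wt_pos _).le, ENNReal.ofReal_pow (wt_pos _).le]
  rw [h1]
  refine le_trans ?_ hδ
  gcongr
  rw [dist_eq_norm] at hG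
  rw [← ofReal_norm, ENNReal.ofReal_le_iff_le_toReal (by simp)]
  exact hG.le

end

namespace SBGStructure

variable {n : ℕ} {M : Type*} [TopologicalSpace M] [ChartedSpace (E n) M] {ι : Type*}
  {B : SBGStructure n M ι} {α β γ : ι} {x : E n} {p : M} {r : ℝ}
  [IsManifold (𝓡 n) ∞ M] [T2Space M] [MeasurableSpace M]

namespace Choices

variable (c : B.Choices) {w : M → ℝ} {s : ℝ} {k : ℕ} {u v : B.LocalFamily}

theorem measurable_flc_chiH (u : B.LocalFamily) (α : ι) : Measurable (flc (u α) c.chiH) :=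
  (exists_flc (u α) c.isTest_chiH).1

theorem nn_add_le (w : M → ℝ) (s k : ℝ) (u v : B.LocalFamily) :
    c.nn w s k (u + v) ≤ 2 * (c.nn w s k u + c.nn w s k v) := by
  have h : (fun α => flc ((u + v) α) c.chiH) = fun α ζ => flc (u α) c.chiH ζ + flc (v α) c.chiH ζ := by
    funext α ζ
    exact cev_add_left _ _ _
  unfold nn
  rw [h]
  exact NN_add_le fun α => c.measurable_flc_chiH u α

theorem nn_smul (w : M → ℝ) (s k : ℝ) (z : ℂ) (u : B.LocalFamily) :
    c.nn w s k (z • u) = ‖z‖ₑ ^ 2 * c.nn w s k u := by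
  have h : (fun α => flc ((z • u) α) c.chiH) = fun α ζ => z * flc (u α) c.chiH ζ := by
    funext α ζ
    exact cev_smul_left _ _ _
  unfold nn NN
  rw [← ENNReal.tsum_mul_left]
  refine tsum_congr fun α => ?_
  have h1 : flc ((z • u) α) c.chiH = fun ζ => z * flc (u α) c.chiH ζ := congrFun h α
  change B.coef w α * qn (wt (B.scale α) s k) (flc ((z • u) α) c.chiH) =
    ‖z‖ₑ ^ 2 * (B.coef w α * qn (wt (B.scale α) s k) (flc (u α) c.chiH))
  rw [h1, qn_const_mul, mul_left_comm]

theorem nn_sub_comm (w : M → ℝ) (s k : ℝ) (u v : B.LocalFamily) :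
    c.nn w s k (u - v) = c.nn w s k (v - u) := by
  have h : u - v = (-1 : ℂ) • (v - u) := by rw [neg_one_smul ℂ (v - u), neg_sub]
  rw [h, nn_smul]
  simp

variable [Countable ι]

theorem exists_cev_le (hw : B.IsWeight w) (s : ℝ) (α : ι) {K : Set (E n)} (hK : IsCompact K)
    (hK2 : K ⊆ cube n 2) : ∃ (C : ℝ≥0∞) (N : ℕ), C ≠ ⊤ ∧ ∀ u ∈ B.Distrib, ∀ f : E n → ℂ,
      ContDiff ℝ ∞ f → tsupport f ⊆ K → ∀ A : ℝ, (∀ i ≤ N, ∀ x, ‖iteratedFDeriv ℝ i f x‖ ≤ A) →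
        ‖cev (u α) f‖ₑ ^ 2 ≤ C * ENNReal.ofReal (A ^ 2) * c.nn w s 0 u := by
  obtain ⟨r, hr1, hr2, hr⟩ := exists_closedCube hK hK2
  have h1 : r < (r + 2) / 2 := by linarith
  have h2 : (r + 2) / 2 < 2 := by linarith
  obtain ⟨κ, hκ, hκ0, hκ1⟩ := exists_cube_bump n h1
  have hcut : IsCut ((r + 2) / 2) fun _ : ι => κ := IsCut.const hκ hκ0
  obtain ⟨C₁, hC₁, h₁⟩ := c.exists_NN_cut_le hw s 0 h2 hcut
  obtain ⟨C₂, N, hC₂, h₂⟩ := exists_qn_fourier_le hK (-s)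
  have hcoef := coef_ne_zero (α := α) hw
  refine ⟨(B.coef w α)⁻¹ * C₁ * ENNReal.ofReal C₂, N, ENNReal.mul_ne_top (ENNReal.mul_ne_top
    (ENNReal.inv_ne_top.2 hcoef) hC₁) ENNReal.ofReal_ne_top, fun u hu f hf hfK A hA => ?_⟩
  have hfc : HasCompactSupport f := hK.of_isClosed_subset (isClosed_tsupport _) hfK
  let fS : 𝓢(E n, ℂ) := hfc.toSchwartzMap hf
  have hfS : ∀ x, fS x = f x := fun x => rfl
  have hf0 : ∀ x ∉ K, f x = 0 := fun x hx => image_eq_zero_of_notMem_tsupport fun h => hx (hfK h)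
  have h3 : cev (u α) f = ∫ ζ, flc (u α) κ ζ * (𝓕⁻ fS : 𝓢(E n, ℂ)) ζ := by
    rw [((exists_flc (u α) (hcut.isTest h2 α)).2.2 _).2, FourierTransform.fourier_fourierInv_eq]
    congr 1
    ext x
    by_cases hx : x ∈ K
    · rw [hκ1 x (hr hx), hfS]
      simp
    · rw [hfS, hf0 x hx, mul_zero]
  rw [h3]
  refine (enorm_integral_mul_le (φ := wt (B.scale α) (-s) 0) continuous_wt.measurable (fun ξ => wt_pos ξ)
    (exists_flc (u α) (hcut.isTest h2 α)).1.aemeasurable (𝓕⁻ fS).continuous.aemeasurable).trans ?_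
  rw [qn_fourierInv]
  have h4 := h₂ (B.scale α) (fun i => (B.scale_pos α i).le) (B.scale_le_one α) fS
    (fun x hx => hf0 x hx) A hA
  have h5 : qn (fun ξ => (wt (B.scale α) (-s) 0 ξ)⁻¹) (flc (u α) κ) ≤
      (B.coef w α)⁻¹ * (C₁ * c.nn w s 0 u) := by
    simp_rw [wt_inv, neg_neg, neg_zero]
    have h6 := h₁ u hu
    simp only [Nat.cast_zero] at h6
    have h7 : B.coef w α * qn (wt (B.scale α) s 0) (flc (u α) κ) ≤ C₁ * c.nn w s 0 u :=
      (ENNReal.le_tsum (f := fun α => B.coef w α * qn (wt (B.scale α) s 0) (flc (u α) κ)) α).trans h6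
    calc _ = (B.coef w α)⁻¹ * (B.coef w α * qn (wt (B.scale α) s 0) (flc (u α) κ)) := by
          rw [← mul_assoc, ENNReal.inv_mul_cancel hcoef coef_ne_top, one_mul]
      _ ≤ _ := by gcongr
  refine (mul_le_mul' h5 h4).trans_eq ?_
  rw [ENNReal.ofReal_mul hC₂]
  ring

theorem exists_cev_le_of_isTest (hw : B.IsWeight w) (s : ℝ) (α : ι) {f : E n → ℂ} (hf : IsTest f) :
    ∃ C : ℝ≥0∞, C ≠ ⊤ ∧ ∀ u ∈ B.Distrib, ‖cev (u α) f‖ₑ ^ 2 ≤ C * c.nn w s 0 u := by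
  obtain ⟨C, N, hC, h⟩ := c.exists_cev_le hw s α hf.compact.isCompact hf.sub
  obtain ⟨A, -, hA⟩ := (UnifBdd.of_contDiff_hasCompactSupport (I := Unit) hf.smooth
    hf.compact).exists_bound N
  exact ⟨C * ENNReal.ofReal (A ^ 2), ENNReal.mul_ne_top hC ENNReal.ofReal_ne_top, fun u hu =>
    h u hu f hf.smooth subset_rfl A fun i hi x => hA () x (mem_univ _) i hi⟩

theorem exists_limit (hw : B.IsWeight w) {s : ℝ} {u : ℕ → B.LocalFamily} (hu : ∀ j, u j ∈ B.Distrib)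
    {ε : ℕ → ℝ≥0∞} (hε : Tendsto ε atTop (𝓝 0)) (h0 : c.nn w s 0 (u 0) < ⊤)
    (hε0 : ε 0 < ⊤) (h : ∀ i j, i ≤ j → c.nn w s 0 (u j - u i) ≤ ε i) :
    ∃ v ∈ B.Distrib, ∀ α, ∀ f : E n → ℂ, IsTest f →
      Tendsto (fun j => cev (u j α) f) atTop (𝓝 (cev (v α) f)) := by
  have hlim : ∀ α, ∀ f : E n → ℂ, IsTest f → ∃ z, Tendsto (fun j => cev (u j α) f) atTop (𝓝 z) := by
    intro α f hf
    obtain ⟨C, hC, hb⟩ := c.exists_cev_le_of_isTest hw s α hf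
    refine cauchySeq_tendsto_of_complete (Metric.cauchySeq_iff'.2 fun δ hδ => ?_)
    have h2 := ENNReal.Tendsto.const_mul hε (Or.inr hC)
    rw [mul_zero] at h2
    obtain ⟨N, hN⟩ := (h2.eventually_lt_const (ENNReal.ofReal_pos.2 (pow_pos hδ 2))).exists
    refine ⟨N, fun j hj => ?_⟩
    have h3 := ((hb _ (sub_mem (hu j) (hu N))).trans (mul_le_mul' le_rfl (h N j hj))).trans_lt hN
    have h4 : cev ((u j - u N) α) f = cev (u j α) f - cev (u N α) f := cev_sub_left _ _ _
    rw [h4, ← ofReal_norm, ← ENNReal.ofReal_pow (norm_nonneg _),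
      ENNReal.ofReal_lt_ofReal_iff (pow_pos hδ 2)] at h3
    rw [dist_eq_norm]
    exact lt_of_pow_lt_pow_left₀ 2 hδ.le h3
  have hlim' : ∀ α (f : 𝓓(box n, ℝ)), ∃ z, Tendsto (fun j => u j α f) atTop (𝓝 z) := fun α f => by
    obtain ⟨z, hz⟩ := hlim α _ (IsTest.ofReal f)
    exact ⟨z, hz.congr fun j => cev_ofReal f⟩
  choose L hL using hlim'
  have hadd : ∀ α f g, L α (f + g) = L α f + L α g := fun α f g => by
    refine tendsto_nhds_unique (hL α (f + g)) (((hL α f).add (hL α g)).congr fun j => ?_)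
    rw [map_add]
  have hsmul : ∀ α (a : ℝ) f, L α (a • f) = a • L α f := fun α a f => by
    refine tendsto_nhds_unique (hL α (a • f)) (((hL α f).const_smul a).congr fun j => ?_)
    rw [map_smul]
  have hbd : ∀ j, c.nn w s 0 (u j) ≤ 2 * (ε 0 + c.nn w s 0 (u 0)) := fun j => by
    have h1 := c.nn_add_le w s 0 (u j - u 0) (u 0)
    rw [sub_add_cancel] at h1
    exact h1.trans (by gcongr; exact h 0 j (Nat.zero_le _))
  have hD : 2 * (ε 0 + c.nn w s 0 (u 0)) ≠ ⊤ :=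
    ENNReal.mul_ne_top (by norm_num) (ENNReal.add_ne_top.2 ⟨hε0.ne, h0.ne⟩)
  set D := 2 * (ε 0 + c.nn w s 0 (u 0)) with hDdef
  have hcont : ∀ α (K : TopologicalSpace.Compacts (E n)) (hK : (K : Set (E n)) ⊆ box n),
      Continuous (L α ∘ TestFunction.ofSupportedIn (n := ⊤) hK) := by
    intro α K hK
    obtain ⟨C, N, hC, hb⟩ := c.exists_cev_le hw s α K.isCompact hK
    refine (ContDiffMapSupportedIn.mkCLMtoNormedSpace ℝ
      (L α ∘ TestFunction.ofSupportedIn (n := ⊤) hK) (fun f g => hadd α (TestFunction.ofSupportedIn hK f) (TestFunction.ofSupportedIn hK g))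
      (fun a f => hsmul α a (TestFunction.ofSupportedIn hK f)) ⟨Finset.Iic N, √(C * D).toReal, Real.sqrt_nonneg _, fun f => ?_⟩).continuous
    set A := ((Finset.Iic N).sup fun i => ContDiffMapSupportedIn.seminorm ℝ (E n) ℝ ⊤ K i) f with hA
    have hA0 : 0 ≤ A := apply_nonneg _ _
    refine le_of_tendsto (hL α _).norm (Eventually.of_forall fun j => ?_)
    have h1 := hb (u j) (hu j) (fun x => ((f x : ℝ) : ℂ)) (Complex.ofRealCLM.contDiff.comp f.contDiff)
      ((tsupport_comp_subset (g := fun t : ℝ => (t : ℂ)) Complex.ofReal_zero f).trans f.tsupport_subset)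
      A fun i hi x => by
        have h2 := Complex.ofRealLI.norm_iteratedFDeriv_comp_left (f := f)
          (f.contDiff.contDiffAt (x := x)) (i := i) (by exact_mod_cast le_top)
        change ‖iteratedFDeriv ℝ i (Complex.ofRealLI ∘ f) x‖ ≤ A
        rw [h2]
        refine (ContDiffMapSupportedIn.norm_iteratedFDeriv_apply_le_seminorm_top ℝ).trans ?_
        exact Seminorm.le_finset_sup_apply (Finset.mem_Iic.2 hi)
    have h3 : cev (u j α) (fun x => ((f x : ℝ) : ℂ)) = u j α (TestFunction.ofSupportedIn (n := ⊤) hK f) :=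
      cev_ofReal (TestFunction.ofSupportedIn (n := ⊤) hK f)
    rw [h3] at h1
    have h4 : ‖u j α (TestFunction.ofSupportedIn (n := ⊤) hK f)‖ₑ ^ 2 ≤
        ENNReal.ofReal ((√(C * D).toReal * A) ^ 2) := by
      refine (h1.trans (mul_le_mul' le_rfl (hbd j))).trans_eq ?_
      rw [mul_pow, Real.sq_sqrt ENNReal.toReal_nonneg, ENNReal.ofReal_mul ENNReal.toReal_nonneg,
        ENNReal.ofReal_toReal (ENNReal.mul_ne_top hC hD)]
      ring
    rw [← ofReal_norm, ← ENNReal.ofReal_pow (norm_nonneg _),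
      ENNReal.ofReal_le_ofReal_iff (by positivity)] at h4
    exact le_of_sq_le_sq h4 (by positivity)
  let v : B.LocalFamily := fun α => (ContinuousLinearMap.toUniformConvergenceCLM _ _ _
    (TestFunction.mkCLM ℝ (n := ⊤) (L α) (hadd α) (hsmul α) (hcont α)) : 𝓓'(box n, ℂ))
  have hv : ∀ α f, v α f = L α f := fun α f => rfl
  refine ⟨v, fun α β f g h1 h2 h3 => ?_, fun α f hf => ?_⟩
  · rw [hv, hv]
    exact tendsto_nhds_unique (hL α f) ((hL β g).congr fun j => (hu j α β f g h1 h2 h3).symm)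
  · rw [cev_eq hf, hv, hv]
    refine ((hL α _).add ((hL α _).const_mul _)).congr fun j => ?_
    rw [cev_eq hf]

theorem nn_le_of_tendsto {w : M → ℝ} {s k : ℝ} {u : ℕ → B.LocalFamily}
    (h : ∀ α, ∀ f : E n → ℂ, IsTest f → Tendsto (fun j => cev (u j α) f) atTop (𝓝 (cev (v α) f)))
    {D : ℕ → ℝ≥0∞} {D' : ℝ≥0∞} (hD : ∀ j, c.nn w s k (u j) ≤ D j) (hD' : Tendsto D atTop (𝓝 D')) :
    c.nn w s k v ≤ D' := by
  let : MeasurableSpace ι := ⊤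
  have h1 : ∀ u : B.LocalFamily, c.nn w s k u = ∫⁻ α, (∫⁻ ζ, B.coef w α *
      (ENNReal.ofReal (wt (B.scale α) s k ζ ^ 2) * ‖flc (u α) c.chiH ζ‖ₑ ^ 2)) ∂Measure.count := by
    intro u
    rw [lintegral_count]
    refine tsum_congr fun α => ?_
    rw [lintegral_const_mul' _ _ coef_ne_top]
    rfl
  have hm : ∀ (u : B.LocalFamily) α, Measurable fun ζ => B.coef w α *
      (ENNReal.ofReal (wt (B.scale α) s k ζ ^ 2) * ‖flc (u α) c.chiH ζ‖ₑ ^ 2) := fun u α =>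
    ((continuous_wt.measurable.pow_const 2).ennreal_ofReal.mul
      ((c.measurable_flc_chiH u α).enorm.pow_const 2)).const_mul _
  refine le_trans ?_ (hD'.liminf_eq.symm ▸ liminf_le_liminf (Eventually.of_forall hD))
  simp only [h1]
  refine le_trans (lintegral_mono fun α => ?_) (lintegral_liminf_le fun j => measurable_from_top)
  refine le_trans (lintegral_mono fun ζ => ?_) (lintegral_liminf_le fun j => hm (u j) α)
  have h2 : Tendsto (fun j => flc (u j α) c.chiH ζ) atTop (𝓝 (flc (v α) c.chiH ζ)) :=
    h α _ (isTest_mul_ex c.isTest_chiH _)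
  have h3 := ENNReal.Tendsto.const_mul (ENNReal.Tendsto.const_mul (((ENNReal.continuous_pow 2).tendsto _).comp h2.enorm)
    (Or.inr (ENNReal.ofReal_ne_top (r := wt (B.scale α) s k ζ ^ 2)))) (Or.inr (coef_ne_top (B := B) (w := w) (α := α)))
  exact h3.liminf_eq.ge

end Choices

end SBGStructure

/-! ### Density of test functions and extension of operators -/

namespace SBGStructure

variable {n : ℕ} {M : Type*} [TopologicalSpace M] [ChartedSpace (E n) M] {ι : Type*}
  {B : SBGStructure n M ι} {α β γ : ι} {x : E n} {p : M} {r : ℝ}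
  [IsManifold (𝓡 n) ∞ M] [T2Space M]

theorem finite_cells_of_isCompact (hr1 : 1 ≤ r) (hr : r < 2) {K : Set M} (hK : IsCompact K) :
    {γ | (B.cell r γ ∩ K).Nonempty}.Finite := by
  choose s hs using fun p : M => exists_mem_nbr (B := B) hr1 hr p
  obtain ⟨t, -, ht⟩ := hK.elim_nhds_subcover (fun p => {q | ∀ β, q ∈ B.cell r β → p ∈ B.cell r β})
    fun p _ => B.eventually_mem_cell hr1 hr p
  refine (t.finite_toSet.biUnion fun p _ => (s p).finite_toSet).subset ?_
  rintro γ ⟨q, hq, hqK⟩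
  obtain ⟨p, hp, hpq⟩ := mem_iUnion₂.1 (ht hqK)
  exact mem_iUnion₂.2 ⟨p, hp, hs p γ (hpq γ hq)⟩

theorem syn_symm_eq_sum (hr : r < 2) {f : ι → E n → ℂ} (hf : ∀ γ, ∀ x ∉ closedCube n r, f γ x = 0)
    (hx : x ∈ closedCube n r) :
    B.syn f ((B.chart α).symm x) = ∑ γ ∈ B.nbr hr α, B.pull γ (f γ) ((B.chart α).symm x) :=
  syn_eq_sum hr hf fun _ hγ => mem_nbr.2 ⟨_, ⟨x, hx, rfl⟩, hγ⟩

namespace Choices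

variable [MeasurableSpace M] (c : B.Choices) {w w₁ w₂ : M → ℝ} {s s₁ s₂ : ℝ} {u v : B.LocalFamily}

theorem nn_zero (w : M → ℝ) (s k : ℝ) : c.nn w s k 0 = 0 := by
  have h := c.nn_smul w s k 0 0
  rwa [zero_smul ℂ (0 : B.LocalFamily), enorm_zero, zero_pow two_ne_zero, zero_mul] at h

theorem nn_sub_le (w : M → ℝ) (s k : ℝ) (u v : B.LocalFamily) :
    c.nn w s k (u - v) ≤ 2 * (c.nn w s k u + c.nn w s k v) := by
  have h1 := c.nn_add_le w s k u (0 - v)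
  rwa [nn_sub_comm c w s k 0 v, sub_zero, zero_sub, ← sub_eq_add_neg] at h1

theorem nn_ofFun_lt_top (w : M → ℝ) (s k : ℝ) {x : M → ℂ} (hx : x ∈ SmoothC n M) :
    c.nn w s k (B.ofFun x) < ⊤ := by
  obtain ⟨r, hr1, hr, hcut⟩ := c.exists_radius
  have hfin := finite_cells_of_isCompact (B := B) (by linarith) hr hx.2.isCompact
  have h1 : ∀ α, flc (B.ofFun x α) c.chiH = (𝓕 (B.locS c.isTest_chiH hx.1 α) : 𝓢(E n, ℂ)) := fun α => by
    funext ζ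
    rw [fourier_locS]
  unfold nn NN
  simp only [h1]
  rw [tsum_eq_sum (s := hfin.toFinset) fun α hα => ?_]
  · exact ENNReal.sum_lt_top.2 fun α _ => ENNReal.mul_lt_top coef_ne_top.lt_top (qn_wt_lt_top _)
  · have h2 : B.locS c.isTest_chiH hx.1 α = 0 := by
      ext y
      rw [locS_apply]
      by_cases hy : y ∈ closedCube n r
      · rw [image_eq_zero_of_notMem_tsupport (f := x) fun h => hα (hfin.mem_toFinset.2
          ⟨_, ⟨y, hy, rfl⟩, h⟩), mul_zero]
        rfl
      · rw [hcut.supp α y hy, Complex.ofReal_zero, zero_mul]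
        rfl
    rw [h2, FourierTransform.fourier_zero]
    simp [qn]

variable [Countable ι]

theorem exists_smoothC_nn_sub_le (hw : B.IsWeight w) (s : ℝ) (k : ℕ) (hu : u ∈ B.Distrib)
    (hk : c.nn w s k u < ⊤) {ε : ℝ≥0∞} (hε : ε ≠ 0) :
    ∃ x ∈ SmoothC n M, c.nn w s k (u - B.ofFun x) ≤ ε := by
  rcases isEmpty_or_nonempty ι with hι | ⟨⟨i₀⟩⟩
  · exact ⟨0, zero_mem _, by simp [nn, NN]⟩
  obtain ⟨r, hr1, hr, hχ⟩ := c.exists_radius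
  have hr1' : 1 ≤ r := by linarith
  obtain ⟨g, hg, hθ⟩ := exists_isPou (B := B) hr1' hr c.chiH_smooth (hχ.supp i₀) c.chiH_one
  obtain ⟨C, hC, hle⟩ := exists_NN_flc_le hr (hw.slow_coef hr) hg hχ s k
  obtain ⟨δ, hδ, hδC⟩ := ENNReal.exists_nnreal_pos_mul_lt hC hε
  have hδ2 : (δ : ℝ≥0∞) / 2 ≠ 0 := by simpa using hδ.ne'
  obtain ⟨ε', hε', hsum⟩ := ENNReal.exists_pos_sum_of_countable' hδ2 ι
  obtain ⟨Γ, hΓ⟩ := ((ENNReal.tendsto_tsum_compl_atTop_zero hk.ne).eventually_lt_const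
    (pos_iff_ne_zero.2 hδ2)).exists
  have hκ : ∀ α, ∃ κ : 𝓢(E n, ℂ), qn (wt (B.scale α) s k)
      (fun ζ => flc (u α) c.chiH ζ - (𝓕 κ : 𝓢(E n, ℂ)) ζ) ≤ (B.coef w α)⁻¹ * ε' α := fun α => by
    refine exists_qn_sub_le (c.measurable_flc_chiH u α) ?_
      (ENNReal.mul_pos (ENNReal.inv_ne_zero.2 coef_ne_top) (hε' α).ne')
    refine lt_of_not_ge fun h => ?_
    have h1 : B.coef w α * qn (wt (B.scale α) s k) (flc (u α) c.chiH) ≤ c.nn w s k u :=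
      ENNReal.le_tsum (f := fun α => B.coef w α * qn (wt (B.scale α) s k) (flc (u α) c.chiH)) α
    rw [top_le_iff.1 h, ENNReal.mul_top (coef_ne_zero hw)] at h1
    exact hk.not_ge h1
  choose κ₀ hκ₀ using hκ
  classical
  let κ : ι → 𝓢(E n, ℂ) := fun α => if α ∈ Γ then κ₀ α else 0
  have h0 : ∀ γ, ∀ x ∉ closedCube n r, (g γ x : ℂ) * κ γ x = 0 := fun γ x hx => by
    rw [hg.supp γ x hx, Complex.ofReal_zero, zero_mul]
  set x := B.syn fun γ y => (g γ y : ℂ) * κ γ y with hxdef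
  have hx : x ∈ Smooth n M := syn_mem_smooth hr1' hr (fun γ =>
    (Complex.ofRealCLM.contDiff.comp (hg.unif.contDiff γ)).mul ((κ γ).smooth ⊤)) h0
  have hxc : HasCompactSupport x := hasCompactSupport_syn
    (Γ.isCompact_biUnion fun γ _ => isCompact_cell (B := B) (α := γ) hr) fun γ p hp => by
      by_cases hγ : γ ∈ Γ
      · exact pull_eq_zero hr (h0 γ) fun h => hp (mem_iUnion₂.2 ⟨γ, hγ, h⟩)
      · simp [pull, κ, hγ, indicator]
  refine ⟨x, ⟨hx, hxc⟩, (hle _ _ (fun γ => ((c.measurable_flc_chiH u γ).sub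
    (𝓕 (κ γ) : 𝓢(E n, ℂ)).continuous.measurable).aemeasurable)
    ((rep_flc hu hr hg hχ hχ hθ).sub (rep_syn hr hg hχ hx κ fun α y hy =>
      syn_symm_eq_sum hr h0 hy))).trans ?_⟩
  have h3 : B.NN (B.coef w) s k (fun γ ζ => flc (u γ) c.chiH ζ - (𝓕 (κ γ) : 𝓢(E n, ℂ)) ζ) ≤ δ := by
    calc _ ≤ ∑' α, (ε' α + {α | α ∉ Γ}.indicator (fun α => B.coef w α *
          qn (wt (B.scale α) s k) (flc (u α) c.chiH)) α) := by
          refine ENNReal.tsum_le_tsum fun α => ?_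
          by_cases hα : α ∈ Γ
          · refine le_trans ?_ le_self_add
            simp only [κ, if_pos hα]
            refine (mul_le_mul' le_rfl (hκ₀ α)).trans_eq ?_
            rw [← mul_assoc, ENNReal.mul_inv_cancel (coef_ne_zero hw) coef_ne_top, one_mul]
          · refine le_trans ?_ le_add_self
            simp only [κ, if_neg hα, FourierTransform.fourier_zero]
            rw [indicator_of_mem (by exact hα)]
            simp
      _ = ∑' α, ε' α + ∑' b : {α // α ∉ Γ}, B.coef w b *
          qn (wt (B.scale b) s k) (flc (u b) c.chiH) := by
          rw [ENNReal.tsum_add]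
          congr 1
          exact (tsum_subtype {α | α ∉ Γ} _).symm
      _ ≤ δ / 2 + δ / 2 := add_le_add hsum.le hΓ.le
      _ = δ := ENNReal.add_halves _
  refine (mul_le_mul' le_rfl h3).trans (le_of_eq_of_le (mul_comm _ _) hδC.le)

theorem eq_zero_of_nn (hw : B.IsWeight w) (hu : u ∈ B.Distrib) (h : c.nn w s 0 u = 0) : u = 0 := by
  funext α
  ext f
  obtain ⟨C, -, hC⟩ := c.exists_cev_le_of_isTest hw s α (IsTest.ofReal f)
  have h1 := hC u hu
  rw [h, mul_zero, cev_ofReal, nonpos_iff_eq_zero] at h1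
  exact enorm_eq_zero.1 (pow_eq_zero_iff two_ne_zero |>.1 h1)

/-- The pair `(u, v)` is a limit of pairs `(x, A x)` with test functions `x`. -/
def Approx (w₁ w₂ : M → ℝ) (s₁ s₂ : ℝ) (A : SmoothC n M →ₗ[ℂ] SmoothC n M) (u v : B.LocalFamily) : Prop :=
  ∀ ε : ℝ≥0∞, ε ≠ 0 → ∃ x : SmoothC n M, c.nn w₁ s₁ 0 (u - B.ofFun x) ≤ ε ∧
    c.nn w₂ s₂ 0 (v - B.ofFun (A x)) ≤ ε

/-- The operator `A` on test functions is bounded, also with `k` additional derivatives along `𝒲`. -/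
def NNBdd (w₁ w₂ : M → ℝ) (s₁ s₂ : ℝ) (A : SmoothC n M → M → ℂ) : Prop :=
  ∀ k : ℕ, ∃ C : ℝ≥0∞, C ≠ ⊤ ∧ ∀ x : SmoothC n M,
    c.nn w₂ s₂ k (B.ofFun (A x)) ≤ C * c.nn w₁ s₁ k (B.ofFun x)

variable {A : SmoothC n M →ₗ[ℂ] SmoothC n M} {c}

theorem Approx.add {u' v' : B.LocalFamily} (h : c.Approx w₁ w₂ s₁ s₂ A u v)
    (h' : c.Approx w₁ w₂ s₁ s₂ A u' v') : c.Approx w₁ w₂ s₁ s₂ A (u + u') (v + v') := by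
  intro ε hε
  have h4 : ε / 4 ≠ 0 := ENNReal.div_ne_zero.2 ⟨hε, by norm_num⟩
  have h5 : 2 * (ε / 4 + ε / 4) = ε := by
    rw [← two_mul, ← mul_assoc (2 : ℝ≥0∞), show (2 : ℝ≥0∞) * 2 = 4 by norm_num]
    exact ENNReal.mul_div_cancel (by norm_num) (by norm_num)
  obtain ⟨x, hx1, hx2⟩ := h _ h4
  obtain ⟨y, hy1, hy2⟩ := h' _ h4
  refine ⟨x + y, ?_, ?_⟩
  · have h6 : u + u' - B.ofFun (x + y : SmoothC n M) = (u - B.ofFun x) + (u' - B.ofFun y) := by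
      rw [Submodule.coe_add, ofFun_add x.2.1 y.2.1]; abel
    rw [h6, ← h5]
    exact (c.nn_add_le _ _ _ _ _).trans (by gcongr)
  · have h6 : v + v' - B.ofFun (A (x + y)) = (v - B.ofFun (A x)) + (v' - B.ofFun (A y)) := by
      rw [map_add, Submodule.coe_add, ofFun_add (A x).2.1 (A y).2.1]; abel
    rw [h6, ← h5]
    exact (c.nn_add_le _ _ _ _ _).trans (by gcongr)

theorem Approx.smul (z : ℂ) (h : c.Approx w₁ w₂ s₁ s₂ A u v) :
    c.Approx w₁ w₂ s₁ s₂ A (z • u) (z • v) := by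
  intro ε hε
  obtain ⟨δ, hδ, hδC⟩ := ENNReal.exists_nnreal_pos_mul_lt (a := ‖z‖ₑ ^ 2) (by simp) hε
  obtain ⟨x, hx1, hx2⟩ := h δ (by simpa using hδ.ne')
  rw [mul_comm] at hδC
  refine ⟨z • x, ?_, ?_⟩
  · have h6 : z • u - B.ofFun (z • x : SmoothC n M) = z • (u - B.ofFun x) := by
      rw [Submodule.coe_smul, ofFun_smul z x.2.1, ← smul_sub z u]
    rw [h6, nn_smul]
    exact (mul_le_mul' le_rfl hx1).trans hδC.le
  · have h6 : z • v - B.ofFun (A (z • x)) = z • (v - B.ofFun (A x)) := by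
      rw [map_smul, Submodule.coe_smul, ofFun_smul z (A x).2.1, ← smul_sub z v]
    rw [h6, nn_smul]
    exact (mul_le_mul' le_rfl hx2).trans hδC.le

theorem approx_ofFun (x : SmoothC n M) : c.Approx w₁ w₂ s₁ s₂ A (B.ofFun x) (B.ofFun (A x)) :=
  fun ε _ => ⟨x, by rw [sub_self, nn_zero]; exact zero_le, by rw [sub_self, nn_zero]; exact zero_le⟩

theorem Approx.unique (hw₂ : B.IsWeight w₂) (hA : c.NNBdd w₁ w₂ s₁ s₂ fun x => A x) {v' : B.LocalFamily}
    (hv : v ∈ B.Distrib) (hv' : v' ∈ B.Distrib)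
    (h : c.Approx w₁ w₂ s₁ s₂ A u v) (h' : c.Approx w₁ w₂ s₁ s₂ A u v') : v = v' := by
  obtain ⟨C, hC, hCA⟩ := hA 0
  simp only [Nat.cast_zero] at hCA
  have h1 := h.add (h'.smul (-1))
  have h2 : u + (-1 : ℂ) • u = 0 := by rw [neg_one_smul ℂ u, add_neg_cancel]
  have h3 : v + (-1 : ℂ) • v' = v - v' := by rw [neg_one_smul ℂ v', sub_eq_add_neg]
  rw [h2, h3] at h1
  refine sub_eq_zero.1 (c.eq_zero_of_nn (s := s₂) hw₂ (sub_mem hv hv') ?_)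
  refine le_antisymm (ENNReal.le_of_forall_pos_le_add fun ε hε _ => ?_) zero_le
  obtain ⟨δ, hδ, hδC⟩ := ENNReal.exists_nnreal_pos_mul_lt (a := 2 * (1 + C))
    (ENNReal.mul_ne_top (by norm_num) (ENNReal.add_ne_top.2 ⟨by norm_num, hC⟩))
    (b := ε) (by simpa using hε.ne')
  obtain ⟨x, hx1, hx2⟩ := h1 δ (by simpa using hδ.ne')
  rw [nn_sub_comm, sub_zero] at hx1
  have h4 := c.nn_add_le w₂ s₂ 0 (v - v' - B.ofFun (A x)) (B.ofFun (A x))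
  rw [sub_add_cancel] at h4
  rw [zero_add]
  refine h4.trans (le_trans ?_ hδC.le)
  calc _ ≤ 2 * ((δ : ℝ≥0∞) + C * δ) := by
        gcongr
        exact (hCA x).trans (by gcongr)
    _ = _ := by ring

theorem exists_approx (hw₁ : B.IsWeight w₁) (hw₂ : B.IsWeight w₂)
    (hA : c.NNBdd w₁ w₂ s₁ s₂ fun x => A x) (k : ℕ) : ∃ C : ℝ≥0∞, C ≠ ⊤ ∧ ∀ u ∈ B.Distrib,
      c.nn w₁ s₁ k u < ⊤ → ∃ v ∈ B.Distrib, c.Approx w₁ w₂ s₁ s₂ A u v ∧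
        c.nn w₂ s₂ k v ≤ C * c.nn w₁ s₁ k u := by
  obtain ⟨C, hC, hCA⟩ := hA k
  refine ⟨4 * C, ENNReal.mul_ne_top (by norm_num) hC, fun u hu huk => ?_⟩
  let ε : ℕ → ℝ≥0∞ := fun j => 2⁻¹ ^ j
  have hε0 : ∀ j, ε j ≠ 0 := fun j => pow_ne_zero _ (by norm_num)
  have hεa : ∀ i j, i ≤ j → ε j ≤ ε i := fun i j hij => pow_le_pow_right_of_le_one' (by norm_num) hij
  have hεt : Tendsto ε atTop (𝓝 0) := ENNReal.tendsto_pow_atTop_nhds_zero_of_lt_one (by norm_num)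
  choose x hxS hx using fun j => c.exists_smoothC_nn_sub_le hw₁ s₁ k hu huk (hε0 j)
  let X : ℕ → SmoothC n M := fun j => ⟨x j, hxS j⟩
  let U : ℕ → B.LocalFamily := fun j => B.ofFun (A (X j))
  have hU : ∀ j, U j ∈ B.Distrib := fun j => ofFun_mem_distrib (A (X j)).2.1
  have hmono : ∀ (w : M → ℝ) s (v : B.LocalFamily), c.nn w s 0 v ≤ c.nn w s k v := fun w s v =>
    c.nn_mono_order le_rfl (Nat.cast_nonneg k)
  have hUU : ∀ i j, i ≤ j → c.nn w₂ s₂ k (U j - U i) ≤ 4 * C * ε i := by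
    intro i j hij
    have h1 : U j - U i = B.ofFun (A (X j - X i)) := by
      rw [map_sub, Submodule.coe_sub, ofFun_sub (A (X j)).2.1 (A (X i)).2.1]
    have h2 : B.ofFun (X j - X i : SmoothC n M) = (u - B.ofFun (x i)) - (u - B.ofFun (x j)) := by
      rw [Submodule.coe_sub, ofFun_sub (X j).2.1 (X i).2.1]
      change B.ofFun (x j) - B.ofFun (x i) = _
      abel
    have h3 := c.nn_sub_le w₁ s₁ k (u - B.ofFun (x i)) (u - B.ofFun (x j))
    rw [← h2] at h3
    rw [h1]
    calc _ ≤ C * (2 * (ε i + ε i)) := (hCA _).trans (by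
          gcongr
          refine h3.trans ?_
          gcongr
          · exact hx i
          · exact (hx j).trans (hεa i j hij))
      _ = _ := by ring
  have hC4 : 4 * C ≠ ⊤ := ENNReal.mul_ne_top (by norm_num) hC
  have hεt' : Tendsto (fun j => 4 * C * ε j) atTop (𝓝 0) := by
    simpa using ENNReal.Tendsto.const_mul hεt (Or.inr hC4)
  obtain ⟨v, hv, hlim⟩ := c.exists_limit hw₂ (s := s₂) hU (ε := fun j => 4 * C * ε j) hεt'
    (c.nn_ofFun_lt_top _ _ _ (A (X 0)).2) (ENNReal.mul_lt_top hC4.lt_top (by simp [ε]))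
    fun i j hij => (hmono _ _ _).trans (hUU i j hij)
  have hvU : ∀ i, c.nn w₂ s₂ k (v - U i) ≤ 4 * C * ε i := fun i => by
    refine c.nn_le_of_tendsto (u := fun j => U (j + i) - U i) (fun α f hf => ?_)
      (fun j => hUU i (j + i) (Nat.le_add_left i j)) tendsto_const_nhds
    have h1 := (((tendsto_add_atTop_iff_nat i).2 (hlim α f hf)).sub_const (cev (U i α) f))
    have h2 : cev ((v - U i) α) f = cev (v α) f - cev (U i α) f := cev_sub_left _ _ _
    rw [h2]
    refine h1.congr fun j => ?_
    exact (cev_sub_left _ _ _).symm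
  refine ⟨v, hv, fun δ hδ => ?_, ?_⟩
  · obtain ⟨j, hj1, hj2⟩ := ((hεt.eventually_lt_const (pos_iff_ne_zero.2 hδ)).and
      (hεt'.eventually_lt_const (pos_iff_ne_zero.2 hδ))).exists
    exact ⟨X j, (hmono _ _ _).trans ((hx j).trans hj1.le), (hmono _ _ _).trans ((hvU j).trans hj2.le)⟩
  · have h5 : ∀ j, c.nn w₂ s₂ k (U j) ≤ C * (2 * (c.nn w₁ s₁ k u + ε j)) := fun j => by
      have h6 := c.nn_sub_le w₁ s₁ k u (u - B.ofFun (x j))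
      rw [sub_sub_cancel] at h6
      exact (hCA (X j)).trans (by gcongr; exact h6.trans (by gcongr; exact hx j))
    have h7 : Tendsto (fun j => C * (2 * (c.nn w₁ s₁ k u + ε j))) atTop
        (𝓝 (C * (2 * (c.nn w₁ s₁ k u + 0)))) :=
      ENNReal.Tendsto.const_mul (ENNReal.Tendsto.const_mul (hεt.const_add _) (Or.inr (by norm_num)))
        (Or.inr hC)
    refine (c.nn_le_of_tendsto hlim h5 h7).trans ?_
    rw [add_zero]
    calc _ = 2 * C * c.nn w₁ s₁ k u := by ring
      _ ≤ _ := by gcongr; norm_num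

theorem exists_le_mul_of_sq {C : ℝ≥0∞} (hC : C ≠ ⊤) :
    ∃ D : ℝ≥0, ∀ a b : ℝ≥0∞, a ^ 2 ≤ C * b ^ 2 → a ≤ D * b := by
  lift C to ℝ≥0 using hC
  refine ⟨C + 1, fun a b h => ?_⟩
  rw [← ENNReal.pow_le_pow_left_iff two_ne_zero, mul_pow]
  refine h.trans ?_
  gcongr
  norm_cast
  nlinarith [zero_le (a := C)]

theorem mem_H_iff_nn (hw : B.IsWeight w) : u ∈ c.H w s ↔ u ∈ B.Distrib ∧ c.nn w s 0 u < ⊤ := mem_H_iff c hw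

theorem sobNorm_sq_nn (hw : B.IsWeight w) (s : ℝ) (u : B.LocalFamily) :
    c.sobNorm w s u ^ 2 = norCst n * c.nn w s 0 u := sobNorm_sq c hw s u

theorem IsBddExt.approx (hw₁ : B.IsWeight w₁) (hw₂ : B.IsWeight w₂) {T : c.H w₁ s₁ →ₗ[ℂ] c.H w₂ s₂}
    (hT : c.IsBddExt A T) (u : c.H w₁ s₁) : c.Approx w₁ w₂ s₁ s₂ A u (T u) := by
  obtain ⟨hT1, D, hD⟩ := hT
  intro ε hε
  obtain ⟨δ, hδ, hδC⟩ := ENNReal.exists_nnreal_pos_mul_lt (a := 1 + (D : ℝ≥0∞) ^ 2) (by finiteness) hε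
  rw [mul_add, mul_one] at hδC
  have hu := (mem_H_iff_nn hw₁).1 u.2
  obtain ⟨x, hxS, hx⟩ := c.exists_smoothC_nn_sub_le hw₁ s₁ 0 hu.1 (by simpa using hu.2)
    (ε := δ) (by simpa using hδ.ne')
  simp only [Nat.cast_zero] at hx
  obtain ⟨y, hy, hTy⟩ := hT1 ⟨x, hxS⟩
  refine ⟨⟨x, hxS⟩, hx.trans (le_self_add.trans hδC.le), ?_⟩
  have h9 : ((T (u - y) : c.H w₂ s₂) : B.LocalFamily) = (T u : B.LocalFamily) - (T y : B.LocalFamily) := by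
    refine eq_sub_of_add_eq ?_
    have h8 : T (u - y + y) = T (u - y) + T y := map_add T (u - y) y
    have h7 : u - y + y = u := Subtype.ext (sub_add_cancel (u : B.LocalFamily) (y : B.LocalFamily))
    rw [h7] at h8
    rw [h8]
    rfl
  have h1 := hD (u - y)
  rw [← ENNReal.pow_le_pow_left_iff two_ne_zero, mul_pow, sobNorm_sq_nn hw₂, sobNorm_sq_nn hw₁,
    mul_left_comm, ENNReal.mul_le_mul_iff_right norCst_ne_zero norCst_ne_top, h9] at h1
  change c.nn w₂ s₂ 0 ((T u : B.LocalFamily) - (T y : B.LocalFamily)) ≤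
    _ * c.nn w₁ s₁ 0 ((u : B.LocalFamily) - (y : B.LocalFamily)) at h1
  rw [hTy, hy] at h1
  refine h1.trans (le_trans ?_ (le_add_self.trans hδC.le))
  rw [mul_comm]
  gcongr

/-- Operators on test functions which are bounded extend uniquely to weighted Sobolev spaces. -/
theorem exists_extension (hw₁ : B.IsWeight w₁) (hw₂ : B.IsWeight w₂)
    (hA : c.NNBdd w₁ w₂ s₁ s₂ fun x => A x) :
    (∃! T : c.H w₁ s₁ →ₗ[ℂ] c.H w₂ s₂, c.IsBddExt A T) ∧
      ∀ T : c.H w₁ s₁ →ₗ[ℂ] c.H w₂ s₂, c.IsBddExt A T → ∀ k : ℕ, c.MapsMixed T k := by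
  obtain ⟨C, hC, hCA⟩ := exists_approx hw₁ hw₂ hA 0
  simp only [Nat.cast_zero] at hCA
  have hex : ∀ u : c.H w₁ s₁, ∃ v : c.H w₂ s₂, c.Approx w₁ w₂ s₁ s₂ A u v ∧
      c.nn w₂ s₂ 0 v ≤ C * c.nn w₁ s₁ 0 u := fun u => by
    have hu := (mem_H_iff_nn hw₁).1 u.2
    obtain ⟨v, hv, h1, h2⟩ := hCA u hu.1 hu.2
    exact ⟨⟨v, (mem_H_iff_nn hw₂).2 ⟨hv, h2.trans_lt (ENNReal.mul_lt_top hC.lt_top hu.2)⟩⟩, h1, h2⟩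
  have huniq : ∀ (u : B.LocalFamily) (v v' : c.H w₂ s₂), c.Approx w₁ w₂ s₁ s₂ A u v →
      c.Approx w₁ w₂ s₁ s₂ A u v' → v = v' := fun u v v' h h' =>
    Subtype.ext (h.unique hw₂ hA v.2.1 v'.2.1 h')
  choose T hT hTn using hex
  let T' : c.H w₁ s₁ →ₗ[ℂ] c.H w₂ s₂ :=
    { toFun := T
      map_add' := fun u v => huniq _ _ _ (hT (u + v)) ((hT u).add (hT v))
      map_smul' := fun z u => huniq _ _ _ (hT (z • u)) ((hT u).smul z) }
  have hext : ∀ T₁ : c.H w₁ s₁ →ₗ[ℂ] c.H w₂ s₂, c.IsBddExt A T₁ → T₁ = T' := fun T₁ h₁ =>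
    LinearMap.ext fun u => huniq _ _ _ (h₁.approx hw₁ hw₂ u) (hT u)
  refine ⟨⟨T', ⟨fun x => ?_, ?_⟩, hext⟩, fun T₁ h₁ k => ?_⟩
  · have h1 : B.ofFun x ∈ c.H w₁ s₁ := (mem_H_iff_nn hw₁).2
      ⟨ofFun_mem_distrib x.2.1, c.nn_ofFun_lt_top _ _ _ x.2⟩
    refine ⟨⟨_, h1⟩, rfl, ?_⟩
    exact (hT ⟨_, h1⟩).unique hw₂ hA (T ⟨_, h1⟩).2.1 (ofFun_mem_distrib (A x).2.1) (approx_ofFun x)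
  · obtain ⟨D, hD⟩ := exists_le_mul_of_sq hC
    refine ⟨D, fun v => hD _ _ ?_⟩
    rw [sobNorm_sq_nn hw₂, sobNorm_sq_nn hw₁, mul_left_comm]
    gcongr
    exact hTn v
  · obtain ⟨C₀, hC₀, h₀⟩ := exists_approx hw₁ hw₂ hA k
    obtain ⟨C₁, hC₁, h₁'⟩ := c.exists_nn_le_words hw₁ s₁ k
    obtain ⟨C₂, hC₂, h₂⟩ := c.exists_words_le_nn hw₂ s₂ k
    obtain ⟨D, hD⟩ := exists_le_mul_of_sq (C := C₂ * (C₀ * C₁))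
      (ENNReal.mul_ne_top hC₂ (ENNReal.mul_ne_top hC₀ hC₁))
    refine ⟨D, fun v hv => ?_⟩
    obtain ⟨hvD, hvk⟩ := (c.memMixed_iff hw₁).1 hv
    obtain ⟨v', hv', hA', hle⟩ := h₀ v hvD hvk
    have h3 : v' = (T₁ v : B.LocalFamily) := hA'.unique hw₂ hA hv' (T₁ v).2.1 (h₁.approx hw₁ hw₂ v)
    rw [h3] at hv' hle
    refine ⟨(c.memMixed_iff hw₂).2 ⟨hv', hle.trans_lt (ENNReal.mul_lt_top hC₀.lt_top hvk)⟩, hD _ _ ?_⟩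
    rw [mixedNorm_sq c hw₂, mixedNorm_sq c hw₁, mul_left_comm]
    refine mul_le_mul' le_rfl ((h₂ _ hv').trans ?_)
    rw [mul_assoc C₂, mul_assoc C₀]
    gcongr
    exact hle.trans (by gcongr; exact h₁' _ hvD)

end Choices

end SBGStructure

/-! ### Quantizations -/

section

variable {n : ℕ} {ρ : Fin n → ℝ} {K : Set (E n)} {m : ℝ} {A : ℕ → ℝ} {b : E n → E n → ℂ} {ψ v : 𝓢(E n, ℂ)}

theorem SymBd.locOp_add (hb : SymBd K m A b) (h0 : ∀ i, 0 ≤ ρ i) (h1 : ∀ i, ρ i ≤ 1)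
    (hψ : HasCompactSupport ψ) (v' : 𝓢(E n, ℂ)) (x : E n) :
    locOp ρ b ψ (v + v' : 𝓢(E n, ℂ)) x = locOp ρ b ψ v x + locOp ρ b ψ v' x := by
  rw [hb.locOp_eq h0 h1 hψ, hb.locOp_eq h0 h1 hψ, hb.locOp_eq h0 h1 hψ,
    ← integral_add (hb.integrable_locKer h0 h1 x) (hb.integrable_locKer h0 h1 x)]
  congr 1
  ext p
  simp only [locKer, FourierTransform.fourier_add, add_apply]
  ring

theorem locOp_const_mul (z : ℂ) (b : E n → E n → ℂ) (ψ v : E n → ℂ) (x : E n) :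
    locOp ρ b ψ (fun y => z * v y) x = z * locOp ρ b ψ v x := by
  unfold locOp
  rw [← integral_const_mul]
  congr 1
  ext η
  rw [mul_left_comm, ← integral_const_mul z]
  congr 2
  ext y
  ring

end

namespace SBGStructure

variable {n : ℕ} {M : Type*} [TopologicalSpace M] [ChartedSpace (E n) M] {ι : Type*}
  {B : SBGStructure n M ι} {α β γ : ι} {x : E n} {p : M} {r : ℝ}
  [IsManifold (𝓡 n) ∞ M]

theorem exists_symBd {g : ι → E n → ℝ} (hg : IsCut r g) (hr : r < 2) {m : ℝ} {b : CotFun n M}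
    (hb : B.IsSymbol m b) : ∃ A : ℕ → ℝ, ∀ α, SymBd (closedCube n r) m A
      fun x ξ => g α x • B.locSymbol b α x ξ := by
  have hc : ∀ α ξ, ContDiffOn ℝ ∞ (fun y => B.locSymbol b α y ξ) (cube n 2) := fun α ξ =>
    (hb.1 α).comp (contDiff_id.prodMk contDiff_const).contDiffOn fun y hy => ⟨hy, mem_univ _⟩
  have h1 : UnifBdd (fun _ : ι × E n => cube n 2)
      fun p y => bracket p.2 ^ (-m) • B.locSymbol b p.1 y p.2 := by
    refine ⟨fun p => (hc p.1 p.2).const_smul _, fun k => ?_⟩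
    obtain ⟨C, hC⟩ := hb.2 k 0
    refine ⟨C, fun p x hx => ?_⟩
    have h2 := hC p.1 x hx p.2
    have h3 : (fun y => iteratedFDeriv ℝ 0 (fun η => B.locSymbol b p.1 y η) p.2) =
        (continuousMultilinearCurryFin0 ℝ (E n) ℂ).symm ∘ fun y => B.locSymbol b p.1 y p.2 := by
      funext y
      rw [iteratedFDeriv_zero_eq_comp]
      rfl
    rw [h3, LinearIsometryEquiv.norm_iteratedFDeriv_comp_left, Nat.cast_zero, sub_zero] at h2
    have hd : ContDiffAt ℝ k (fun y => B.locSymbol b p.1 y p.2) x :=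
      ((hc p.1 p.2).contDiffAt ((isOpen_cube n 2).mem_nhds hx)).of_le (by exact_mod_cast le_top)
    have h4 : iteratedFDeriv ℝ k (bracket p.2 ^ (-m) • fun y => B.locSymbol b p.1 y p.2) x =
        bracket p.2 ^ (-m) • iteratedFDeriv ℝ k (fun y => B.locSymbol b p.1 y p.2) x :=
      iteratedFDeriv_const_smul_apply hd
    have hp := bracket_pos p.2
    change ‖iteratedFDeriv ℝ k (bracket p.2 ^ (-m) • fun y => B.locSymbol b p.1 y p.2) x‖ ≤ C
    rw [h4, norm_smul, Real.norm_of_nonneg (Real.rpow_nonneg hp.le _)]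
    calc _ ≤ bracket p.2 ^ (-m) * (C * bracket p.2 ^ m) := by gcongr
      _ = C := by rw [mul_left_comm, ← Real.rpow_add hp, neg_add_cancel, Real.rpow_zero, mul_one]
  have h2 := UnifBdd.smul_cutoff (D' := fun _ => univ) (fun _ => isOpen_cube n 2) (fun _ => isOpen_univ)
    (hg.unif.reindex (Prod.fst : ι × E n → ι))
    (fun p => inter_subset_right.trans ((hg.tsupport_subset p.1).trans (closedCube_subset_cube hr))) h1
  choose A hA using h2.2
  refine ⟨A, fun α => ⟨contDiff_of_contDiffAt_tsupport fun z hz => ?_, fun x hx ξ => ?_, fun j x ξ => ?_⟩⟩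
  · have h3 : tsupport (fun z : E n × E n => g α z.1 • B.locSymbol b α z.1 z.2) ⊆
        Prod.fst ⁻¹' closedCube n r := by
      refine closure_minimal (fun z hz => ?_) ((isClosed_closedCube n r).preimage continuous_fst)
      by_contra h
      exact hz (by simp only; rw [hg.supp α z.1 h, zero_smul])
    refine ((hg.unif.contDiff α).comp contDiff_fst).contDiffAt.smul ((hb.1 α).contDiffAt ?_)
    exact (((isOpen_cube n 2).prod isOpen_univ).mem_nhds ⟨closedCube_subset_cube hr (h3 hz), mem_univ _⟩)
  · rw [hg.supp α x hx, zero_smul]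
  · have hp := bracket_pos ξ
    have h4 : (fun y => g α y • B.locSymbol b α y ξ) =
        bracket ξ ^ m • fun y => g α y • (bracket ξ ^ (-m) • B.locSymbol b α y ξ) := by
      funext y
      have h5 : ((bracket ξ ^ m : ℝ) : ℂ) * ((bracket ξ ^ (-m) : ℝ) : ℂ) = 1 := by
        rw [← Complex.ofReal_mul, ← Real.rpow_add hp, add_neg_cancel, Real.rpow_zero, Complex.ofReal_one]
      simp only [Pi.smul_apply, Complex.real_smul]
      linear_combination (-(g α y * B.locSymbol b α y ξ)) * h5
    rw [h4, iteratedFDeriv_const_smul_apply (((h2.contDiff (α, ξ)).of_le (by exact_mod_cast le_top)).contDiffAt),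
      norm_smul, Real.norm_of_nonneg (Real.rpow_nonneg hp.le _), mul_comm]
    gcongr
    exact hA j (α, ξ) x (mem_univ _)

variable [T2Space M] {u : M → ℂ}

theorem exists_coef_mul_le [Countable ι] {w w' : M → ℝ} (hw : B.IsWeight w) (hw' : B.IsWeight w') :
    ∃ C : ℝ≥0∞, C ≠ ⊤ ∧ ∀ γ, B.coef (fun p => w p * w' p) γ * ‖(B.weightFamily w γ : ℂ)‖ₑ ^ 2 ≤
      C * B.coef w' γ := by
  obtain ⟨C₁, hC₁, h₁⟩ := hw.exists_wtBd le_rfl (by norm_num)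
  obtain ⟨C₂, hC₂, h₂⟩ := hw'.exists_wtBd le_rfl (by norm_num)
  obtain ⟨C₃, hC₃, h₃⟩ := (hw.mul hw').exists_wtBd le_rfl (by norm_num)
  refine ⟨ENNReal.ofReal ((C₁ * C₂ * C₃) ^ 2), ENNReal.ofReal_ne_top, fun γ => ?_⟩
  have hx : (0 : E n) ∈ cube n (3 / 2) := fun i => by simp
  have hp1 := hw.1 ((B.chart γ).symm 0)
  have hp2 := hw'.1 ((B.chart γ).symm 0)
  have h4 := h₁.pos γ
  have h5 := h₂.pos γ
  have h6 := h₃.pos γ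
  have hs := scaleProd_pos (B := B) (α := γ)
  have h7 : B.weightFamily w γ * B.weightFamily w' γ ≤
      C₁ * C₂ * C₃ * B.weightFamily (fun p => w p * w' p) γ := by
    calc _ ≤ (C₁ * w ((B.chart γ).symm 0)) * (C₂ * w' ((B.chart γ).symm 0)) := by
          gcongr
          · exact h₁.ge γ 0 hx
          · exact h₂.ge γ 0 hx
      _ = C₁ * C₂ * (w ((B.chart γ).symm 0) * w' ((B.chart γ).symm 0)) := by ring
      _ ≤ C₁ * C₂ * (C₃ * B.weightFamily (fun p => w p * w' p) γ) :=
          mul_le_mul_of_nonneg_left (h₃.le γ 0 hx) (by positivity)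
      _ = _ := by ring
  rw [← ofReal_norm, Complex.norm_real, Real.norm_of_nonneg h4.le, ← ENNReal.ofReal_pow h4.le, coef, coef,
    ← ENNReal.ofReal_mul (by positivity), ← ENNReal.ofReal_mul (by positivity)]
  refine ENNReal.ofReal_le_ofReal ?_
  have h8 : (B.weightFamily (fun p => w p * w' p) γ)⁻¹ * B.weightFamily w γ ≤
      C₁ * C₂ * C₃ * (B.weightFamily w' γ)⁻¹ := by
    rw [← div_eq_mul_inv, le_div_iff₀ h5, mul_assoc, inv_mul_le_iff₀ h6, mul_comm]
    rw [mul_comm] at h7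
    linarith
  calc _ = ((B.weightFamily (fun p => w p * w' p) γ)⁻¹ * B.weightFamily w γ) ^ 2 * (B.scaleProd γ)⁻¹ := by
        ring
    _ ≤ (C₁ * C₂ * C₃ * (B.weightFamily w' γ)⁻¹) ^ 2 * (B.scaleProd γ)⁻¹ := by gcongr
    _ = _ := by ring

namespace Choices

variable [MeasurableSpace M] (c : B.Choices) {w w' : M → ℝ} {s m : ℝ}

/-- The cutoff near the diagonal as a Schwartz function. -/
def psiS : 𝓢(E n, ℂ) :=
  HasCompactSupport.toSchwartzMap (f := fun x => (c.psi x : ℂ))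
    (c.psi_compact.comp_left Complex.ofReal_zero) (Complex.ofRealCLM.contDiff.comp c.psi_smooth)

theorem hasCompactSupport_psiS : HasCompactSupport c.psiS :=
  c.psi_compact.comp_left (g := fun t : ℝ => (t : ℂ)) Complex.ofReal_zero

theorem chiQ_eq_zero {x : E n} (hx : x ∉ closedCube n (5 / 4)) : c.chiQ x = 0 :=
  image_eq_zero_of_notMem_tsupport fun h => hx (cube_subset_closedCube (c.chiQ_supp h))

theorem pou_symm (hx : x ∈ cube n 2) :
    c.pou α ((B.chart α).symm x) = c.chiQ x * (B.tot c.chiQ ((B.chart α).symm x))⁻¹ := by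
  have h : ∀ β p, c.cutQ β p = B.pull β c.chiQ p := fun β p => by
    simp [cutQ, pull, indicator]
  unfold pou tot
  simp only [h]
  rw [pull_of_mem (symm_mem_source hx), chart_symm hx, div_eq_mul_inv]

variable {χ : E n → ℝ}

theorem opLocal_eq (hu : u ∈ Smooth n M) (hχ : IsTest fun x => (χ x : ℂ))
    (hχ1 : ∀ y ∈ closedCube n (3 / 2), χ y = 1) (hx : x ∈ closedCube n (5 / 4)) (a : E n → E n → ℂ) :
    c.opLocal α a (fun y => u ((B.chart α).symm y)) x =
      locOp (B.scale α) a c.psiS (B.locS hχ hu α) x := by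
  have hs : (B.scaleProd α : ℂ) ≠ 0 := Complex.ofReal_ne_zero.2 scaleProd_pos.ne'
  have hpi : (((2 * Real.pi) ^ n : ℝ) : ℂ) ≠ 0 := Complex.ofReal_ne_zero.2 (by positivity)
  have hph : ∀ η y, phase B α (scl (B.scale α) η) (x - y) = 2 * Real.pi * inner ℝ (x - y) η := fun η y => by
    rw [phase, PiLp.inner_apply, Finset.mul_sum]
    refine Finset.sum_congr rfl fun i _ => ?_
    have := B.scale_pos α i
    rw [scl_apply]
    simp only [RCLike.inner_apply, conj_trivial]
    field_simp
  unfold opLocal locOp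
  rw [integral_scl (B.scale_pos α)]
  change _ * ((((2 * Real.pi) ^ n * B.scaleProd α : ℝ) : ℂ) * _) = _
  rw [Complex.ofReal_mul, mul_assoc _ (B.scaleProd α : ℂ), inv_mul_cancel_left₀ hpi, ← integral_const_mul]
  congr 1
  ext η
  rw [← integral_const_mul, ← integral_const_mul]
  congr 1
  ext y
  rw [hph, mul_comm Complex.I]
  change _ = a x _ * (ex (x - y) η * (c.psi (x - y) : ℂ) * (χ y * u ((B.chart α).symm y)))
  have h1 : (c.psi (x - y) : ℂ) * u ((B.chart α).symm y) =
      (c.psi (x - y) : ℂ) * (χ y * u ((B.chart α).symm y)) := by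
    by_cases hy : y ∈ closedCube n (3 / 2)
    · rw [hχ1 y hy, Complex.ofReal_one, one_mul]
    · have h2 : c.psi (x - y) = 0 := by
        refine image_eq_zero_of_notMem_tsupport fun h => hy fun i => ?_
        have h3 := abs_lt.1 (c.psi_supp h i)
        have h4 := abs_le.1 (hx i)
        have h5 : (x - y) i = x i - y i := rfl
        rw [h5] at h3
        exact abs_le.2 ⟨by linarith, by linarith⟩
      rw [h2, Complex.ofReal_zero, zero_mul, zero_mul]
  unfold ex
  generalize Complex.exp _ = ex'
  linear_combination (ex' * c.psi (x - y) * a x (scl (B.scale α) η) * u ((B.chart α).symm y)) *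
    mul_inv_cancel₀ hs + ex' * a x (scl (B.scale α) η) * h1

variable [Countable ι]

theorem exists_quant (hw : B.IsWeight w) {a : CotFun n M} (ha : B.IsWSymbol w m a)
    (hχ : IsTest fun x => (χ x : ℂ)) (hχ1 : ∀ y ∈ closedCube n (3 / 2), χ y = 1) :
    ∃ (A : ℕ → ℝ) (q : ι → E n → E n → ℂ), (∀ γ, SymBd (closedCube n (5 / 4)) m A (q γ)) ∧
      ∀ (u : M → ℂ) (hu : u ∈ Smooth n M), c.OpV a u = B.syn fun γ x =>
        (B.weightFamily w γ : ℂ) * locOp (B.scale γ) (q γ) c.psiS (B.locS hχ hu γ) x := by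
  obtain ⟨b, hb, hab⟩ := ha
  have hg : IsCut (5 / 4) fun (α : ι) x => c.chiQ x * ((B.tot c.chiQ ((B.chart α).symm x))⁻¹ *
      (w ((B.chart α).symm x) / B.weightFamily w α)) :=
    (IsCut.const c.chiQ_smooth fun _ => c.chiQ_eq_zero).mul_cube (r' := 3 / 2) (by norm_num)
      ((unifBdd_inv_tot (r := 5 / 4) (by norm_num) (by norm_num) c.chiQ_smooth (fun _ => c.chiQ_eq_zero)
        c.chiQ_nonneg (fun x hx => (c.chiQ_one x hx).ge) (by norm_num) (by norm_num)).mul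
        (fun _ => isOpen_cube n _) (hw.unifBdd_div le_rfl (by norm_num)))
  obtain ⟨A, hA⟩ := exists_symBd hg (by norm_num) hb
  refine ⟨A, _, hA, fun u hu => ?_⟩
  funext p
  refine finsum_congr fun γ => ?_
  by_cases hp : p ∈ (B.chart γ).source
  · rw [if_pos hp, pull_of_mem hp]
    have hx := mem_cube_of_mem_source hp
    set x := B.chart γ p
    have hW : (B.weightFamily w γ : ℂ) ≠ 0 := Complex.ofReal_ne_zero.2 hw.weightFamily_pos.ne'
    change _ = (B.weightFamily w γ : ℂ) * locOp (B.scale γ) _ _ _ x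
    by_cases hx1 : x ∈ closedCube n (5 / 4)
    · rw [c.opLocal_eq hu hχ hχ1 hx1]
      unfold locOp
      rw [← integral_const_mul]
      congr 1
      ext η
      rw [← mul_assoc]
      congr 1
      change (c.pou γ ((B.chart γ).symm x) : ℂ) * a _ _ = _ * ((_ : ℝ) • b _ _)
      rw [c.pou_symm hx, hab, Complex.real_smul]
      change _ * (_ * b ((B.chart γ).symm x) (B.covector γ _ _)) = _
      push_cast
      field_simp
    · rw [(hA γ).locOp_eq_zero hx1, mul_zero]
      unfold opLocal
      simp only [c.pou_symm hx, c.chiQ_eq_zero hx1, zero_mul, Complex.ofReal_zero, mul_zero, integral_zero]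
  · rw [if_neg hp, pull_of_notMem hp]

theorem exists_OpV (hw : B.IsWeight w) {a : CotFun n M} (ha : B.IsWSymbol w m a) :
    (∀ u ∈ Smooth n M, c.OpV a u ∈ Smooth n M) ∧ (∀ u ∈ SmoothC n M, c.OpV a u ∈ SmoothC n M) ∧
    (∀ u ∈ Smooth n M, ∀ v ∈ Smooth n M, c.OpV a (u + v) = c.OpV a u + c.OpV a v) ∧
    (∀ z : ℂ, ∀ u ∈ Smooth n M, c.OpV a (z • u) = z • c.OpV a u) ∧
    ∀ w', B.IsWeight w' → ∀ (s : ℝ) (k : ℕ), ∃ C : ℝ≥0∞, C ≠ ⊤ ∧ ∀ u ∈ Smooth n M,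
      c.nn (fun p => w p * w' p) (s - m) k (B.ofFun (c.OpV a u)) ≤ C * c.nn w' s k (B.ofFun u) := by
  obtain ⟨χ, hχs, hχ0, hχ1⟩ := exists_cube_bump n (r := 3 / 2) (r' := 7 / 4) (by norm_num)
  have hcut : IsCut (7 / 4) fun _ : ι => χ := IsCut.const hχs hχ0
  have hχ : IsTest fun x => (χ x : ℂ) :=
    (IsCut.const (ι := Unit) hχs hχ0).isTest (by norm_num) ()
  obtain ⟨A, q, hq, hop⟩ := c.exists_quant hw ha hχ hχ1
  have h54 : (5 / 4 : ℝ) < 2 := by norm_num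
  have h0 : ∀ γ i, 0 ≤ B.scale γ i := fun γ i => (B.scale_pos γ i).le
  have hψ := c.hasCompactSupport_psiS
  have hK := isCompact_closedCube n (5 / 4)
  have hz : ∀ (v : ι → 𝓢(E n, ℂ)) γ, ∀ x ∉ closedCube n (5 / 4), (B.weightFamily w γ : ℂ) *
      locOp (B.scale γ) (q γ) c.psiS (v γ) x = 0 := fun v γ x hx => by
    rw [(hq γ).locOp_eq_zero hx, mul_zero]
  have hsm : ∀ u ∈ Smooth n M, c.OpV a u ∈ Smooth n M := fun u hu => by
    rw [hop u hu]
    exact syn_mem_smooth (by norm_num) h54 (fun γ => contDiff_const.mul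
      ((hq γ).contDiff_locOp hK (h0 γ) (B.scale_le_one γ) hψ)) (hz _)
  refine ⟨hsm, fun u hu => ⟨hsm u hu.1, ?_⟩, fun u hu v hv => ?_, fun z u hu => ?_, fun w' hw' s k => ?_⟩
  · have hfin := finite_cells_of_isCompact (B := B) (r := 7 / 4) (by norm_num) (by norm_num) hu.2.isCompact
    rw [hop u hu.1]
    refine hasCompactSupport_syn (hfin.isCompact_biUnion fun γ _ => isCompact_cell (B := B) (α := γ) h54)
      fun γ p hp => ?_
    by_cases hγ : γ ∈ {γ | (B.cell (7 / 4) γ ∩ tsupport u).Nonempty}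
    · exact pull_eq_zero h54 (hz _ γ) fun h => hp (mem_iUnion₂.2 ⟨γ, hγ, h⟩)
    · have h1 : B.locS hχ hu.1 γ = 0 := by
        ext y
        rw [locS_apply]
        by_cases hy : y ∈ closedCube n (7 / 4)
        · rw [image_eq_zero_of_notMem_tsupport (f := u) fun h => hγ ⟨_, ⟨y, hy, rfl⟩, h⟩, mul_zero]
          rfl
        · rw [hχ0 y hy, Complex.ofReal_zero, zero_mul]
          rfl
      simp [pull, indicator, h1, locOp]
  · rw [hop _ (add_mem hu hv), hop u hu, hop v hv]
    funext p
    obtain ⟨t, ht⟩ := exists_mem_nbr (B := B) (by norm_num) h54 p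
    rw [Pi.add_apply, syn_eq_sum h54 (hz _) ht, syn_eq_sum h54 (hz _) ht, syn_eq_sum h54 (hz _) ht,
      ← Finset.sum_add_distrib]
    refine Finset.sum_congr rfl fun γ _ => ?_
    have h1 : B.locS hχ (add_mem hu hv) γ = B.locS hχ hu γ + B.locS hχ hv γ := by
      ext y
      exact mul_add _ _ _
    by_cases hp : p ∈ (B.chart γ).source
    · rw [pull_of_mem hp, pull_of_mem hp, pull_of_mem hp, h1,
        (hq γ).locOp_add (h0 γ) (B.scale_le_one γ) hψ, mul_add]
    · rw [pull_of_notMem hp, pull_of_notMem hp, pull_of_notMem hp, add_zero]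
  · rw [hop _ (Submodule.smul_mem _ z hu), hop u hu]
    funext p
    obtain ⟨t, ht⟩ := exists_mem_nbr (B := B) (by norm_num) h54 p
    rw [Pi.smul_apply, syn_eq_sum h54 (hz _) ht, syn_eq_sum h54 (hz _) ht, Finset.smul_sum]
    refine Finset.sum_congr rfl fun γ _ => ?_
    have h1 : (B.locS hχ (Submodule.smul_mem _ z hu) γ : E n → ℂ) = fun y => z * B.locS hχ hu γ y := by
      funext y
      exact mul_left_comm _ _ _
    by_cases hp : p ∈ (B.chart γ).source
    · rw [pull_of_mem hp, pull_of_mem hp, h1, locOp_const_mul, mul_left_comm]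
      rfl
    · rw [pull_of_notMem hp, pull_of_notMem hp, smul_zero]
  · obtain ⟨r, hr1, hr, hrχ⟩ := c.exists_radius
    obtain ⟨κ, hκ, hκ0, hκ1⟩ := exists_cube_bump n (r := 5 / 4) (r' := r) (by linarith)
    have hκc : IsCut r fun _ : ι => κ := IsCut.const hκ hκ0
    obtain ⟨C₁, hC₁, h₁⟩ := exists_NN_flc_le hr ((hw.mul hw').slow_coef hr) hκc hrχ (s - m) k
    obtain ⟨C₂, hC₂, h₂⟩ := SymBd.exists_sn_locOp_le hK m A hψ s k
    obtain ⟨C₃, hC₃, h₃⟩ := c.exists_NN_cut_le hw' s k (by norm_num) hcut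
    obtain ⟨D, hD, hDle⟩ := exists_coef_mul_le hw hw'
    refine ⟨C₁ * (D * C₂ * C₃), by finiteness, fun u hu => ?_⟩
    let F : ι → 𝓢(E n, ℂ) := fun γ => ((hq γ).hasCompactSupport_locOp hK).toSchwartzMap
      ((hq γ).contDiff_locOp (v := B.locS hχ hu γ) hK (h0 γ) (B.scale_le_one γ) hψ)
    let κS : ι → 𝓢(E n, ℂ) := fun γ => (B.weightFamily w γ : ℂ) • F γ
    have hF : ∀ γ y, (κ y : ℂ) * κS γ y = (B.weightFamily w γ : ℂ) *
        locOp (B.scale γ) (q γ) c.psiS (B.locS hχ hu γ) y := fun γ y => by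
      change (κ y : ℂ) * ((B.weightFamily w γ : ℂ) * _) = _
      by_cases hy : y ∈ closedCube n (5 / 4)
      · rw [hκ1 y hy, Complex.ofReal_one, one_mul]
        rfl
      · change (κ y : ℂ) * ((B.weightFamily w γ : ℂ) *
          locOp (B.scale γ) (q γ) c.psiS (B.locS hχ hu γ) y) = _
        rw [hz (B.locS hχ hu) γ y hy, mul_zero]
    have hrep := rep_syn hr hκc hrχ (hsm u hu) κS fun α x hx => by
      simp only [hF]
      rw [hop u hu]
      exact syn_symm_eq_sum hr (fun γ y hy => hz _ γ y fun h => hy (closedCube_mono (by linarith) h)) hx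
    have h4 := h₁ _ _ (fun γ => (𝓕 (κS γ) : 𝓢(E n, ℂ)).continuous.aemeasurable) hrep
    refine h4.trans ?_
    rw [mul_assoc C₁]
    refine mul_le_mul' le_rfl ?_
    calc _ ≤ ∑' γ, D * C₂ * (B.coef w' γ * qn (wt (B.scale γ) s k) (flc (B.ofFun u γ) χ)) := by
          refine ENNReal.tsum_le_tsum fun γ => ?_
          have h5 : qn (wt (B.scale γ) (s - m) k) (𝓕 (κS γ) : 𝓢(E n, ℂ)) =
              ‖(B.weightFamily w γ : ℂ)‖ₑ ^ 2 * sn (B.scale γ) (s - m) k (F γ) := by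
            rw [sn_coe, ← qn_const_mul]
            simp only [κS, FourierTransform.fourier_smul]
            rfl
          have h6 := h₂ (q γ) (hq γ) (B.scale γ) (h0 γ) (B.scale_le_one γ) (B.locS hχ hu γ)
          have h7 : flc (B.ofFun u γ) χ = (𝓕 (B.locS hχ hu γ) : 𝓢(E n, ℂ)) := by
            funext ζ
            rw [fourier_locS]
          rw [h5, h7, ← sn_coe, ← mul_assoc]
          calc _ ≤ (D * B.coef w' γ) * (C₂ * sn (B.scale γ) s k (B.locS hχ hu γ)) :=
                mul_le_mul' (hDle γ) h6
            _ = _ := by ring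
      _ = D * C₂ * B.NN (B.coef w') s k fun γ => flc (B.ofFun u γ) χ := ENNReal.tsum_mul_left
      _ ≤ D * C₂ * (C₃ * c.nn w' s k (B.ofFun u)) := by
          gcongr
          exact h₃ _ (ofFun_mem_distrib hu)
      _ = _ := by ring

end Choices

end SBGStructure

/-! ### Residual operators -/

namespace SBGStructure

variable {n : ℕ} {M : Type*} [TopologicalSpace M] [ChartedSpace (E n) M] {ι : Type*}
  {B : SBGStructure n M ι} {α : ι} [IsManifold (𝓡 n) ∞ M]

theorem vderiv_const (W : VField n M) (a : ℝ) (p : M) : vderiv W (fun _ => a) p = 0 := by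
  unfold vderiv
  rw [mfderiv_const]
  rfl

theorem IsWeight.one : B.IsWeight fun _ => 1 := by
  refine ⟨fun _ => one_pos, contMDiff_const, fun W _ => ?_⟩
  have h : (fun p => vderiv W (fun _ => (1 : ℝ)) p / 1) = fun _ : M => (0 : ℝ) := by
    funext p
    rw [vderiv_const, zero_div]
  rw [h]
  refine ⟨contMDiff_const, fun _ => contDiffOn_const, fun k => ⟨0, fun α x _ => ?_⟩⟩
  rw [iteratedFDeriv_fun_zero]
  simp

theorem IsWeight.pow {w : M → ℝ} (hw : B.IsWeight w) (N : ℕ) : B.IsWeight fun p => w p ^ N := by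
  induction N with
  | zero => simpa using IsWeight.one
  | succ k ih => simpa only [pow_succ] using ih.mul hw

variable [T2Space M] [Countable ι]

theorem exists_coef_le {w w' : M → ℝ} (hw : B.IsWeight w) (hw' : B.IsWeight w') {C : ℝ}
    (hC : ∀ p, w' p ≤ C * w p) : ∃ D : ℝ≥0∞, D ≠ ⊤ ∧ ∀ γ, B.coef w γ ≤ D * B.coef w' γ := by
  obtain ⟨C₁, hC₁, h₁⟩ := hw.exists_wtBd le_rfl (by norm_num)
  obtain ⟨C₂, hC₂, h₂⟩ := hw'.exists_wtBd le_rfl (by norm_num)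
  refine ⟨ENNReal.ofReal ((C₂ * (|C| * C₁)) ^ 2), ENNReal.ofReal_ne_top, fun γ => ?_⟩
  have hx : (0 : E n) ∈ cube n (3 / 2) := fun i => by simp
  have h4 := h₁.pos γ
  have h5 := h₂.pos γ
  have hs := scaleProd_pos (B := B) (α := γ)
  have hp := hw.1 ((B.chart γ).symm 0)
  have h7 : B.weightFamily w' γ ≤ C₂ * (|C| * C₁) * B.weightFamily w γ := by
    calc _ ≤ C₂ * w' ((B.chart γ).symm 0) := h₂.ge γ 0 hx
      _ ≤ C₂ * (|C| * (C₁ * B.weightFamily w γ)) := by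
          gcongr
          exact (hC _).trans (mul_le_mul (le_abs_self C) (h₁.le γ 0 hx) hp.le (abs_nonneg C))
      _ = _ := by ring
  rw [coef, coef, ← ENNReal.ofReal_mul (by positivity)]
  refine ENNReal.ofReal_le_ofReal ?_
  rw [← mul_assoc, ← mul_pow]
  gcongr
  rw [← div_eq_mul_inv, le_div_iff₀ h5, inv_mul_le_iff₀ h4, mul_comm]
  exact h7

namespace Choices

variable [MeasurableSpace M] (c : B.Choices) {w w' : M → ℝ} {s m : ℝ}

theorem exists_nn_weight_le (hw : B.IsWeight w) (hw' : B.IsWeight w') {C : ℝ} (hC : ∀ p, w' p ≤ C * w p) :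
    ∃ D : ℝ≥0∞, D ≠ ⊤ ∧ ∀ s k u, c.nn w s k u ≤ D * c.nn w' s k u := by
  obtain ⟨D, hD, h⟩ := exists_coef_le hw hw' hC
  refine ⟨D, hD, fun s k u => ?_⟩
  unfold nn NN
  rw [← ENNReal.tsum_mul_left]
  refine ENNReal.tsum_le_tsum fun γ => ?_
  rw [← mul_assoc]
  exact mul_le_mul' (h γ) le_rfl

theorem exists_rho_le : ∃ C : ℝ, 0 < C ∧ ∀ p, c.rho p ≤ C := by
  obtain ⟨-, C, hC, h⟩ := c.rho_scaling
  refine ⟨C, hC, fun p => ?_⟩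
  obtain ⟨α, hα, hα1⟩ := B.cover p
  refine ((h α p ⟨_, cube_mono (by norm_num) hα1, (B.chart α).left_inv hα⟩).1).trans ?_
  have h1 : B.scaleMax α ≤ 1 := Real.iSup_le (B.scale_le_one α) zero_le_one
  nlinarith

theorem IsResidual.nnBdd (hw : B.IsWeight w) {R : SmoothC n M →ₗ[ℂ] SmoothC n M} (hR : c.IsResidual w R)
    (hw' : B.IsWeight w') (s₁ s₂ : ℝ) : c.NNBdd w' (fun p => w p * w' p) s₁ s₂ fun u => R u := by
  obtain ⟨Q, hQ0, hQ⟩ := c.exists_rho_le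
  have hρ := c.rho_scaling.1
  obtain ⟨N, hN⟩ := exists_nat_ge (max |s₁| |s₂|)
  have hN1 : -(N : ℝ) ≤ s₁ := by
    linarith [neg_abs_le s₁, (le_max_left |s₁| |s₂|).trans hN]
  have hN2 : s₂ ≤ N := (le_abs_self s₂).trans ((le_max_right |s₁| |s₂|).trans hN)
  have hρN : B.IsWeight fun p => c.rho p ^ N := hρ.pow N
  have hw'' : B.IsWeight fun p => w' p * c.rho p ^ N := hw'.mul hρN
  have e1 : (fun p => w p * (w' p * c.rho p ^ N) * c.rho p ^ (N : ℝ)) =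
      fun p => w p * w' p * (c.rho p ^ N * c.rho p ^ N) := by
    funext p
    rw [Real.rpow_natCast]
    ring
  have e2 : (fun p => w' p * c.rho p ^ N * c.rho p ^ (-(N : ℝ))) = w' := by
    funext p
    rw [Real.rpow_neg (hρ.1 p).le, Real.rpow_natCast]
    have := pow_pos (hρ.1 p) N
    field_simp
  have hW := (hw.mul hw').mul (hρN.mul hρN)
  intro k
  obtain ⟨C, hC⟩ := hR.1 _ hw'' N k
  simp only [e1, e2] at hC
  obtain ⟨D, hD, hDle⟩ := c.exists_nn_weight_le (hw.mul hw') hW (C := Q ^ N * Q ^ N) fun p => by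
    have h1 := hρ.1 p
    have h2 := hw.1 p
    have h3 := hw'.1 p
    have h4 := hQ p
    rw [mul_comm]
    gcongr
  obtain ⟨C₁, hC₁, h₁⟩ := c.exists_nn_le_words hW N k
  obtain ⟨C₂, hC₂, h₂⟩ := c.exists_words_le_nn hw' (-(N : ℝ)) k
  refine ⟨D * (C₁ * ((C : ℝ≥0∞) ^ 2 * C₂)), by finiteness, fun u => ?_⟩
  have h3 := (hC u).2
  rw [← ENNReal.pow_le_pow_left_iff two_ne_zero, mul_pow, mixedNorm_sq c hW, mixedNorm_sq c hw', mul_left_comm,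
    ENNReal.mul_le_mul_iff_right norCst_ne_zero norCst_ne_top] at h3
  calc _ ≤ D * c.nn (fun p => w p * w' p * (c.rho p ^ N * c.rho p ^ N)) N k (B.ofFun (R u)) :=
        (hDle _ _ _).trans' (c.nn_mono_order hN2 le_rfl)
    _ ≤ D * (C₁ * ((C : ℝ≥0∞) ^ 2 * (C₂ * c.nn w' s₁ k (B.ofFun u)))) := by
        gcongr
        refine (h₁ _ (ofFun_mem_distrib (R u).2.1)).trans ?_
        gcongr
        refine h3.trans ?_
        gcongr
        exact (h₂ _ (ofFun_mem_distrib u.2.1)).trans (by gcongr; exact c.nn_mono_order hN1 le_rfl)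
    _ = _ := by ring

end Choices

end SBGStructure

end ScaledBG

end

theorem mainTheorem2 {n : ℕ} [NeZero n] {M : Type*} [TopologicalSpace M] [T2Space M]
    [ChartedSpace (ScaledBG.E n) M] [IsManifold (𝓡 n) ∞ M] [MeasurableSpace M] [BorelSpace M]
    {ι : Type*} [Countable ι] (B : ScaledBG.SBGStructure n M ι) (c : B.Choices)
    (w : M → ℝ) (hw : B.IsWeight w) (m : ℝ) :
    (∀ A ∈ c.Psi w m, ∀ w' : M → ℝ, B.IsWeight w' → ∀ s : ℝ,
      (∃! T : c.H w' s →ₗ[ℂ] c.H (fun p => w p * w' p) (s - m), c.IsBddExt A T) ∧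
      ∀ T : c.H w' s →ₗ[ℂ] c.H (fun p => w p * w' p) (s - m), c.IsBddExt A T →
        ∀ k : ℕ, c.MapsMixed T k) ∧
    (∀ a : ScaledBG.CotFun n M, B.IsWSymbol w m a →
      (∀ u ∈ ScaledBG.Smooth n M, c.OpV a u ∈ ScaledBG.Smooth n M) ∧
      ∃ A : ScaledBG.SmoothC n M →ₗ[ℂ] ScaledBG.SmoothC n M,
        (∀ u : ScaledBG.SmoothC n M, (A u : M → ℂ) = c.OpV a u) ∧
        ∀ w' : M → ℝ, B.IsWeight w' → ∀ s : ℝ,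
          (∃! T : c.H w' s →ₗ[ℂ] c.H (fun p => w p * w' p) (s - m), c.IsBddExt A T) ∧
          ∀ T : c.H w' s →ₗ[ℂ] c.H (fun p => w p * w' p) (s - m), c.IsBddExt A T →
            (∀ u ∈ ScaledBG.Smooth n M, ∀ v : c.H w' s, (v : B.LocalFamily) = B.ofFun u →
              (T v : B.LocalFamily) = B.ofFun (c.OpV a u)) ∧
            ∀ k : ℕ, c.MapsMixed T k) := by
  open ScaledBG SBGStructure Choices in
  refine ⟨fun A hA w' hw' s => ?_, fun a ha => ?_⟩
  · obtain ⟨a, ha, R, hR, hAR⟩ := hA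
    obtain ⟨-, hcpt, -, -, hbd⟩ := c.exists_OpV hw ha
    refine exists_extension hw' (hw.mul hw') fun k => ?_
    obtain ⟨C₁, hC₁, h₁⟩ := hbd w' hw' s k
    obtain ⟨C₂, hC₂, h₂⟩ := IsResidual.nnBdd c hw hR hw' s (s - m) k
    refine ⟨2 * (C₁ + C₂), by finiteness, fun u => ?_⟩
    have h3 : (A u : M → ℂ) = c.OpV a u + (R u : M → ℂ) := funext (hAR u)
    simp only [h3, ofFun_add (B := B) (hcpt u u.2).1 (R u).2.1]
    calc _ ≤ 2 * (C₁ * c.nn w' s k (B.ofFun u) + C₂ * c.nn w' s k (B.ofFun u)) :=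
          (c.nn_add_le _ _ _ _ _).trans (by gcongr; exacts [h₁ u u.2.1, h₂ u])
      _ = _ := by ring
  · obtain ⟨hsm, hcpt, hadd, hsmul, hbd⟩ := c.exists_OpV hw ha
    let A : SmoothC n M →ₗ[ℂ] SmoothC n M :=
      { toFun := fun u => ⟨c.OpV a u, hcpt u u.2⟩
        map_add' := fun u v => Subtype.ext (hadd u u.2.1 v v.2.1)
        map_smul' := fun z u => Subtype.ext (hsmul z u u.2.1) }
    refine ⟨hsm, A, fun _ => rfl, fun w' hw' s => ?_⟩
    have hA : c.NNBdd w' (fun p => w p * w' p) s (s - m) fun u => A u := fun k => by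
      obtain ⟨C, hC, h⟩ := hbd w' hw' s k
      exact ⟨C, hC, fun u => h u u.2.1⟩
    obtain ⟨hex, hmix⟩ := exists_extension hw' (hw.mul hw') hA
    refine ⟨hex, fun T hT => ⟨fun u hu v hv => ?_, hmix T hT⟩⟩
    refine (hT.approx hw' (hw.mul hw') v).unique (hw.mul hw') hA (T v).2.1
      (ofFun_mem_distrib (hsm u hu)) fun ε hε => ?_
    obtain ⟨C, hC, h⟩ := hbd w' hw' s 0
    obtain ⟨δ, hδ, hδC⟩ := ENNReal.exists_nnreal_pos_mul_lt (a := 1 + C) (by finiteness) hε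
    rw [mul_add, mul_one] at hδC
    have hv' := (mem_H_iff_nn hw').1 v.2
    obtain ⟨x, hxS, hx⟩ := c.exists_smoothC_nn_sub_le hw' s 0 hv'.1 (by simpa using hv'.2)
      (ε := δ) (by simpa using hδ.ne')
    simp only [Nat.cast_zero] at hx h
    refine ⟨⟨x, hxS⟩, hx.trans (le_self_add.trans hδC.le), ?_⟩
    have hs := sub_mem hu hxS.1
    have h1 := h (u - x) hs
    have h2 : c.OpV a (u - x) = c.OpV a u - c.OpV a x := by
      refine eq_sub_of_add_eq ?_
      rw [← hadd _ hs _ hxS.1, sub_add_cancel]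
    rw [h2, ofFun_sub (hsm u hu) (hsm x hxS.1), ofFun_sub hu hxS.1, ← hv] at h1
    refine h1.trans (le_trans ?_ (le_add_self.trans hδC.le))
    rw [mul_comm]
    gcongr
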